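/- Notation. For a group $G$ below, with Lie algebra $\mathfrak g=\mathfrak k\oplus\mathfrak p$ (Cartan decomposition), let $\mathfrak a\subseteq\mathfrak p$ be any maximal abelian subspace, $\Sigma=\Sigma(\mathfrak g,\mathfrak a)$ the restricted roots, $\Omega=\{Y\in\mathfrak a:|\alpha(Y)|<\pi/2\ \forall\alpha\in\Sigma\}$, $\partial_e\Omega$ the set of extreme points of $\overline\Omega$, and $$\partial_d\Xi=G\exp(i\,\partial_e\Omega)K_{\mathbb C}/K_{\mathbb C}\subseteq G_{\mathbb C}/K_{\mathbb C}$$ the distinguished boundary of the complex crown $\Xi=G\exp(i\Omega)K_{\mathbb C}/K_{\mathbb C}$. For $G=SO(N,\mathbb C)$ take $K=SO(N,\mathbb R)$, $G_{\mathbb C}=G\times G$ with $G\hookrightarrow G_{\mathbb C}$, $g\mapsto(g,\bar g)$, and $K_{\mathbb C}$ the diagonal. For $G=SO_e(p,q)$ take $K=SO(p)\times SO(q)$, $G_{\mathbb C}=SO(p+q,\mathbb C)$ (the special orthogonal group of the complexified form) and $K_{\mathbb C}=SO(p,\mathbb C)\times SO(q,\mathbb C)$. A $G$-isomorphism is a $G$-equivariant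 homeomorphism, $L_0$ is the identity component of $L$, $SO_e(p,q)=SO(p,q)_0$, and $G/H$ is called symmetric if $(G^\sigma)_0\subseteq H\subseteq G^\sigma$ for an involutive automorphism $\sigma$ of the Lie group $G$. The subgroups named below are embedded in $G$ in the standard way: $SO(r,s)$ in $SO(r+s,\mathbb C)$ by conjugation with $\mathrm{diag}(1_r,i1_s)$; $SO^*(2n)=\{g\in SO(2n,\mathbb C):g^*Jg=J\}$, and $SO^*(2n)\subseteq SO(2n,\mathbb C)\subseteq SO(2n+1,\mathbb C)$; $SO_e(1,p-1)\times SO_e(1,q-1)$ in $SO_e(p,q)$ via the splitting of the $p$ positive and $q$ negative directions into $1$ positive and $q-1$ negative, and $1$ negative and $p-1$ positive ones; $SO(p,\mathbb C)\subseteq SO(p,p)$ as the isometries of $\sum z_j^2$, whose real part has signature $(p,p)$. **Theorem.** There are $G$-isomorphisms as follows. 1. $G=SO(2n,\mathbb C)$, $n\ge 3$: $$\partial_d\Xi\simeq G/SO(2,2n-2)\ \amalg\ G/SO^*(2n)\ \amalg\ G/\kappa(SO^*(2n)),$$ where $\kappa$ is conjugation by $\mathrm{diag}(1,\dots,1,-1)$.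 If $n$ is odd, then also $\partial_d\Xi\simeq G/SO(2,2n-2)\amalg G/SO^*(2n)\amalg G/SO^*(2n)$. 2. $G=SO(2n+1,\mathbb C)$: for $n\ge3$, $\partial_d\Xi\simeq G/SO(2,2n-1)\amalg G/SO^*(2n)$, and $G/SO^*(2n)$ is not a symmetric space. For $n=2$, $\partial_d\Xi\simeq SO(5,\mathbb C)/SO(2,3)$. 3. $G=SO_e(n,n)$, $n\ge3$: $\partial_d\Xi\simeq G/H_1\amalg G/H_2\amalg G/\kappa(H_2)$ for subgroups $H_1,H_2$ with $(H_1)_0=SO_e(1,n-1)\times SO_e(1,n-1)$ and $(H_2)_0=SO(n,\mathbb C)$, where $\kappa$ is conjugation by the reflection in the last positive basis vector. If $n$ is odd, then also $\partial_d\Xi\simeq G/H_1\amalg G/H_2\amalg G/H_2$. 4. $G=SO_e(p,q)$, $1\le p<q$. (i) For $p=1$: $\partial_d\Xi\simeq G/H$ with $H_0=SO_e(1,q-1)$. (ii) For $p=2$: $\partial_d\Xi\simeq G/H$ with $H_0=SO_e(1,q-1)\times\mathbb R$, where $\mathbb R\simeq SO_e(1,1)$ via $t\mapsto\begin{pmatrix}\cosh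 t&\sinh t\\ \sinh t&\cosh t\end{pmatrix}$. (iii) For $p\ge3$: $\partial_d\Xi\simeq G/H_1\amalg G/H_2$ with $(H_1)_0=SO_e(1,p-1)\times SO_e(1,q-1)$ and $(H_2)_0=SO(p,\mathbb C)\times SO(q-p)$, and $G/H_2$ is not a symmetric space. -/

import Mathlib

open scoped Matrix MatrixGroups

attribute [local instance] LieRing.ofAssociativeRing

namespace Crown

/-! ### The distinguished boundary of a complex crown -/

section General

variable {𝔤 : Type} [LieRing 𝔤] [LieAlgebra ℝ 𝔤]

/-- `𝔞` is a maximal abelian subspace of the subspace `𝔭` of the Lie algebra `𝔤`. -/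
def IsMaximalAbelianIn (𝔭 𝔞 : Submodule ℝ 𝔤) : Prop :=
  Maximal (fun 𝔟 : Submodule ℝ 𝔤 => 𝔟 ≤ 𝔭 ∧ ∀ X ∈ 𝔟, ∀ Y ∈ 𝔟, ⁅X, Y⁆ = 0) 𝔞

/-- The restricted roots `Σ(𝔤, 𝔞)`: the nonzero functionals `α` on `𝔞` with
`𝔤^α = {X | ∀ H ∈ 𝔞, [H, X] = α(H) X} ≠ 0`. -/
def restrictedRoots (𝔞 : Submodule ℝ 𝔤) : Set (Module.Dual ℝ 𝔞) :=
  {α | α ≠ 0 ∧ ∃ X : 𝔤, X ≠ 0 ∧ ∀ H : 𝔞, ⁅(H : 𝔤), X⁆ = α H • X}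

/-- `Ω = {Y ∈ 𝔞 | ∀ α ∈ Σ, |α(Y)| < π/2}`. -/
def Omega (𝔞 : Submodule ℝ 𝔤) : Set 𝔞 :=
  {Y | ∀ α ∈ restrictedRoots 𝔞, |α Y| < Real.pi / 2}

/-- The set of extreme points of the closure of `Ω`. -/
def extremeOmega [TopologicalSpace 𝔤] (𝔞 : Submodule ℝ 𝔤) : Set 𝔞 :=
  (closure (Omega 𝔞)).extremePoints ℝ

/-- The distinguished boundary `G exp(i ∂ₑΩ) K_ℂ / K_ℂ ⊆ G_ℂ / K_ℂ`. Here `Γ` is the complexification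
`G_ℂ`, `ι : G → G_ℂ` is the inclusion, and `expI : 𝔤 → G_ℂ` is `X ↦ exp(iX)`. -/
def distinguishedBoundary [TopologicalSpace 𝔤] {G Γ : Type} [Group G] [Group Γ]
    (ι : G →* Γ) (KC : Subgroup Γ) (expI : 𝔤 → Γ) (𝔞 : Submodule ℝ 𝔤) : Set (Γ ⧸ KC) :=
  {x | ∃ g : G, ∃ Y ∈ extremeOmega 𝔞, x = ((ι g * expI (Y : 𝔤) : Γ) : Γ ⧸ KC)}

end General

section Groups

variable {G Γ : Type} [Group G] [TopologicalSpace G] [Group Γ] [TopologicalSpace Γ]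

/-- `S ≃ G/H₀ ⨿ ... ⨿ G/H_{k-1}` as topological `G`-spaces, where `S` is a `G`-invariant subset of
`Γ/K` and `G` acts through `ι : G → Γ`. -/
def IsOrbitDecomposition (ι : G →* Γ) {K : Subgroup Γ} (S : Set (Γ ⧸ K)) {k : ℕ}
    (H : Fin k → Subgroup G) : Prop :=
  ∃ Φ : (Σ j, G ⧸ H j) ≃ₜ S,
    ∀ (g : G) (x : Σ j, G ⧸ H j), ((Φ (g • x) : S) : Γ ⧸ K) = ι g • ((Φ x : S) : Γ ⧸ K)

/-- The identity component `L₀` of a subgroup `L` of a topological group. -/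
def idComp [IsTopologicalGroup G] (L : Subgroup G) : Subgroup G :=
  (Subgroup.connectedComponentOfOne L).map L.subtype

/-- The subgroup `G^σ` of fixed points. -/
def fixedSubgroup (σ : G ≃ₜ* G) : Subgroup G where
  carrier := {g | σ g = g}
  one_mem' := map_one σ
  mul_mem' := fun {a b} ha hb => by
    change σ (a * b) = a * b
    rw [map_mul, show σ a = a from ha, show σ b = b from hb]
  inv_mem' := fun {a} ha => by
    change σ a⁻¹ = a⁻¹
    rw [map_inv, show σ a = a from ha]

/-- `G/H` is a symmetric space: `(G^σ)₀ ⊆ H ⊆ G^σ` for some involutive automorphism `σ` of the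
topological group `G`. -/
def IsSymmetricSubgroup [IsTopologicalGroup G] (H : Subgroup G) : Prop :=
  ∃ σ : G ≃ₜ* G, (∀ g, σ (σ g) = g) ∧ idComp (fixedSubgroup σ) ≤ H ∧ H ≤ fixedSubgroup σ

end Groups

/-! ### Matrix groups -/

section Matrices

variable {m n : Type} [Fintype m] [DecidableEq m] [Fintype n] [DecidableEq n]
variable {R : Type} [CommRing R]

/-- The invertible matrices `g` with `gᵀ B g = B`. -/
def bilinIsometry (B : Matrix m m R) : Subgroup (GL m R) where
  carrier := {g | (g : Matrix m m R)ᵀ * B * (g : Matrix m m R) = B}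
  one_mem' := by simp
  mul_mem' := fun {a b} ha hb => by
    simp only [Set.mem_ofPred_eq, Units.val_mul, Matrix.transpose_mul] at *
    calc _ = (b : Matrix m m R)ᵀ * ((a : Matrix m m R)ᵀ * B * (a : Matrix m m R)) * b := by
          simp only [Matrix.mul_assoc]
      _ = B := by rw [ha, hb]
  inv_mem' := fun {a} ha => by
    simp only [Set.mem_ofPred_eq] at *
    have h1 : (a : Matrix m m R) * ((a⁻¹ : GL m R) : Matrix m m R) = 1 := by
      rw [← Units.val_mul, mul_inv_cancel, Units.val_one]
    have h2 : ((a⁻¹ : GL m R) : Matrix m m R)ᵀ * (a : Matrix m m R)ᵀ = 1 := by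
      rw [← Matrix.transpose_mul, h1, Matrix.transpose_one]
    calc _ = ((a⁻¹ : GL m R) : Matrix m m R)ᵀ *
          ((a : Matrix m m R)ᵀ * B * (a : Matrix m m R)) * ((a⁻¹ : GL m R) : Matrix m m R) := by
          rw [ha]
      _ = (((a⁻¹ : GL m R) : Matrix m m R)ᵀ * (a : Matrix m m R)ᵀ) * B *
          ((a : Matrix m m R) * ((a⁻¹ : GL m R) : Matrix m m R)) := by
          simp only [Matrix.mul_assoc]
      _ = B := by rw [h1, h2, Matrix.one_mul, Matrix.mul_one]

/-- The invertible complex matrices `g` with `gᴴ B g = B`. -/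
def sesqIsometry (B : Matrix m m ℂ) : Subgroup (GL m ℂ) where
  carrier := {g | (g : Matrix m m ℂ)ᴴ * B * (g : Matrix m m ℂ) = B}
  one_mem' := by simp
  mul_mem' := fun {a b} ha hb => by
    simp only [Set.mem_ofPred_eq, Units.val_mul, Matrix.conjTranspose_mul] at *
    calc _ = (b : Matrix m m ℂ)ᴴ * ((a : Matrix m m ℂ)ᴴ * B * (a : Matrix m m ℂ)) * b := by
          simp only [Matrix.mul_assoc]
      _ = B := by rw [ha, hb]
  inv_mem' := fun {a} ha => by
    simp only [Set.mem_ofPred_eq] at *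
    have h1 : (a : Matrix m m ℂ) * ((a⁻¹ : GL m ℂ) : Matrix m m ℂ) = 1 := by
      rw [← Units.val_mul, mul_inv_cancel, Units.val_one]
    have h2 : ((a⁻¹ : GL m ℂ) : Matrix m m ℂ)ᴴ * (a : Matrix m m ℂ)ᴴ = 1 := by
      rw [← Matrix.conjTranspose_mul, h1, Matrix.conjTranspose_one]
    calc _ = ((a⁻¹ : GL m ℂ) : Matrix m m ℂ)ᴴ *
          ((a : Matrix m m ℂ)ᴴ * B * (a : Matrix m m ℂ)) * ((a⁻¹ : GL m ℂ) : Matrix m m ℂ) := by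
          rw [ha]
      _ = (((a⁻¹ : GL m ℂ) : Matrix m m ℂ)ᴴ * (a : Matrix m m ℂ)ᴴ) * B *
          ((a : Matrix m m ℂ) * ((a⁻¹ : GL m ℂ) : Matrix m m ℂ)) := by
          simp only [Matrix.mul_assoc]
      _ = B := by rw [h1, h2, Matrix.one_mul, Matrix.mul_one]

/-- `det g = 1` and `gᵀ B g = B`. -/
def specialIsometry (B : Matrix m m R) : Subgroup (GL m R) :=
  bilinIsometry B ⊓ (Matrix.GeneralLinearGroup.det (n := m) (R := R)).ker

variable (m R) in
/-- The special orthogonal group of the form `∑ xᵢ²` over `R` (used for `R = ℝ` and `R = ℂ`). -/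
def SO : Subgroup (GL m R) := specialIsometry 1

/-- The special isometry group over `R` of the form `∑_{i<p} xᵢ² - ∑_{j<q} yⱼ²`: this is
`SO(p,q)` for `R = ℝ` and its complexification for `R = ℂ`. -/
def SOpq (p q : ℕ) (R : Type) [CommRing R] : Subgroup (GL (Fin p ⊕ Fin q) R) :=
  specialIsometry (LieAlgebra.Orthogonal.indefiniteDiagonal (Fin p) (Fin q) R)

/-- `SO_e(p,q)`, the identity component of `SO(p,q)`. -/
noncomputable def SOe (p q : ℕ) : Subgroup (GL (Fin p ⊕ Fin q) ℝ) := idComp (SOpq p q ℝ)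

/-- `SO*(2n) = {g ∈ SO(2n,ℂ) | gᴴ J g = J}`. -/
noncomputable def SOstar (n : ℕ) : Subgroup (GL (Fin n ⊕ Fin n) ℂ) :=
  SO (Fin n ⊕ Fin n) ℂ ⊓ sesqIsometry (Matrix.J (Fin n) ℂ)

/-- Renumbering of the basis. -/
def reindexGL (e : m ≃ n) : GL m R →* GL n R :=
  Units.map (Matrix.reindexAlgEquiv R R e : Matrix m m R →* Matrix n n R)

/-- `(a, d) ↦ diag(a, d)`, on block matrices. -/
def blockDiag : GL m R × GL n R →* GL (m ⊕ n) R :=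
  (Units.map
    { toFun := fun A : Matrix m m R × Matrix n n R => Matrix.fromBlocks A.1 0 0 A.2
      map_one' := Matrix.fromBlocks_one
      map_mul' := fun A B => by simp [Matrix.fromBlocks_multiply] }).comp
    (MulEquiv.prodUnits (M := Matrix m m R) (N := Matrix n n R)).symm.toMonoidHom

/-- The diagonal matrix with entries `d`. -/
def diagGL (d : m → Rˣ) : GL m R :=
  Units.map (Matrix.diagonalRingHom m R : (m → R) →* Matrix m m R) (MulEquiv.piUnits.symm d)

/-- The entrywise inclusion `GL(m,ℝ) ⊆ GL(m,ℂ)`. -/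
noncomputable def complexifyGL : GL m ℝ →* GL m ℂ := Matrix.GeneralLinearGroup.map Complex.ofRealHom

/-- Entrywise complex conjugation. -/
noncomputable def conjGL : GL m ℂ →* GL m ℂ := Matrix.GeneralLinearGroup.map (starRingEnd ℂ)

/-- The inclusion `GL(m,ℂ) ⊆ GL(2m,ℝ)`, where `ℂᵐ = ℝᵐ ⊕ iℝᵐ`. It carries the isometries of
`∑ zⱼ²` to isometries of its real part `∑ xⱼ² - ∑ yⱼ²`. -/
noncomputable def realifyGL : GL m ℂ →* GL (m ⊕ m) ℝ :=
  Units.map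
    { toFun := fun A : Matrix m m ℂ =>
        Matrix.fromBlocks (A.map Complex.re) (-A.map Complex.im)
          (A.map Complex.im) (A.map Complex.re)
      map_one' := by
        ext (i | i) (j | j) <;> simp [Matrix.one_apply, apply_ite Complex.im]
      map_mul' := fun A B => by
        ext (i | i) (j | j) <;>
          simp [Matrix.mul_apply, Finset.sum_add_distrib, Finset.sum_sub_distrib] <;> ring }

/-- `t ↦ (cosh t, sinh t; sinh t, cosh t)`, a copy of the additive group `ℝ`. -/
noncomputable def boost : Multiplicative ℝ →* GL (Fin 1 ⊕ Fin 1) ℝ :=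
  MonoidHom.toHomUnits
    { toFun := fun t => Matrix.fromBlocks
        (Matrix.of fun _ _ => Real.cosh t.toAdd) (Matrix.of fun _ _ => Real.sinh t.toAdd)
        (Matrix.of fun _ _ => Real.sinh t.toAdd) (Matrix.of fun _ _ => Real.cosh t.toAdd)
      map_one' := by
        ext (i | i) (j | j) <;> simp [Matrix.one_apply, Subsingleton.elim i j]
      map_mul' := fun s t => by
        ext (i | i) (j | j) <;>
          simp [Matrix.mul_apply, Real.cosh_add, Real.sinh_add] <;>
          ring }

/-- Conjugation by `r`, applied to a subgroup. -/
def conjBy {G : Type} [Group G] (r : G) (H : Subgroup G) : Subgroup G :=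
  H.map (MulAut.conj r).toMonoidHom

end Matrices

/-! ### The subgroups occurring in the complex orthogonal groups -/

/-- `SO(r,s)` as a subgroup of `SO(N,ℂ)`, `N = r + s`: the group `E SO(r,s) E⁻¹` with
`E = diag(1,…,1,i,…,i)`. -/
noncomputable def SOpqInC (r s N : ℕ) (h : r + s = N) : Subgroup (GL (Fin N) ℂ) :=
  (conjBy (diagGL (Sum.elim (fun _ => 1) fun _ => Units.mk0 Complex.I Complex.I_ne_zero))
    ((SOpq r s ℝ).map complexifyGL)).map (reindexGL (finSumFinEquiv.trans (finCongr h)))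

/-- `SO*(2n)` as a group of matrices with rows and columns numbered by `Fin (2n)`. -/
noncomputable def SOstarEven (n : ℕ) : Subgroup (GL (Fin (2 * n)) ℂ) :=
  (SOstar n).map (reindexGL (finSumFinEquiv.trans (finCongr (two_mul n).symm)))

/-- `SO*(2n)` as the subgroup `{diag(g, 1)}` of `SO(2n+1,ℂ)`. -/
noncomputable def SOstarOdd (n : ℕ) : Subgroup (GL (Fin (2 * n + 1)) ℂ) :=
  (((SOstarEven n).prod (⊥ : Subgroup (GL (Fin 1) ℂ))).map blockDiag).map
    (reindexGL finSumFinEquiv)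

/-- The reflection `diag(1,…,1,-1)`. -/
def lastReflection (N : ℕ) (R : Type) [CommRing R] : GL (Fin N) R :=
  diagGL fun i => if i.val + 1 = N then -1 else 1

/-! ### The subgroups occurring in the real orthogonal groups -/

/-- The splitting of the `p` positive and `q` negative directions into `1 + (q-1)` and `1 + (p-1)`:
the first part consists of the first positive and the first `q - 1` negative directions, the second
part of the last negative and the last `p - 1` positive directions. -/
def splitEquiv (p q : ℕ) (hp : 1 ≤ p) (hq : 1 ≤ q) :
    (Fin 1 ⊕ Fin (q - 1)) ⊕ (Fin 1 ⊕ Fin (p - 1)) ≃ Fin p ⊕ Fin q :=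
  ((Equiv.sumCongr (Equiv.refl _) (Equiv.sumComm _ _)).trans
    (Equiv.sumSumSumComm _ _ _ _)).trans
    (Equiv.sumCongr (finSumFinEquiv.trans (finCongr (by omega)))
      (finSumFinEquiv.trans (finCongr (by omega))))

/-- The subgroup `A × B` of `SO(p,q)`, for `A ⊆ SO(1,q-1)` and `B ⊆ SO(1,p-1)`. (The form has
signature `(1,q-1)` on the first part of the splitting and `(p-1,1)` on the second one.) -/
def prodInSOpq (p q : ℕ) (hp : 1 ≤ p) (hq : 1 ≤ q) (A : Subgroup (GL (Fin 1 ⊕ Fin (q - 1)) ℝ))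
    (B : Subgroup (GL (Fin 1 ⊕ Fin (p - 1)) ℝ)) : Subgroup (GL (Fin p ⊕ Fin q) ℝ) :=
  ((A.prod B).map blockDiag).map (reindexGL (splitEquiv p q hp hq))

/-- `SO(p,ℂ) × SO(q-p)` as a subgroup of `SO(p,q)`, with `SO(p,ℂ) ⊆ SO(p,p)`. -/
noncomputable def SOCprodSO (p q : ℕ) (h : p ≤ q) : Subgroup (GL (Fin p ⊕ Fin q) ℝ) :=
  ((((SO (Fin p) ℂ).map realifyGL).prod (SO (Fin (q - p)) ℝ)).map blockDiag).map
    (reindexGL ((Equiv.sumAssoc _ _ _).trans (Equiv.sumCongr (Equiv.refl _)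
      (finSumFinEquiv.trans (finCongr (Nat.add_sub_of_le h))))))

/-! ### Exponentials -/

section Exponentials

variable {m : Type} [Fintype m] [DecidableEq m]

/-- `exp A`, as an invertible matrix. -/
noncomputable def expGL (A : Matrix m m ℂ) : GL m ℂ := (Matrix.isUnit_exp A).unit

theorem coe_expGL (A : Matrix m m ℂ) : (expGL A : Matrix m m ℂ) = NormedSpace.exp A := rfl

theorem expGL_mem_bilinIsometry {B A : Matrix m m ℂ} (hB : IsUnit B) (hA : Aᵀ * B = B * -A) :
    expGL A ∈ bilinIsometry B := by
  change (NormedSpace.exp A)ᵀ * B * NormedSpace.exp A = B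
  have hdet := (Matrix.isUnit_iff_isUnit_det B).1 hB
  have h1 : Aᵀ = B * -A * B⁻¹ := by
    rw [← hA, Matrix.mul_assoc, Matrix.mul_nonsing_inv B hdet, Matrix.mul_one]
  have h2 : IsUnit (NormedSpace.exp A).det :=
    (Matrix.isUnit_iff_isUnit_det _).1 (Matrix.isUnit_exp A)
  rw [← Matrix.exp_transpose, h1, Matrix.exp_conj B _ hB, Matrix.exp_neg, Matrix.mul_assoc,
    Matrix.mul_assoc, ← Matrix.mul_assoc B⁻¹, Matrix.nonsing_inv_mul B hdet, Matrix.one_mul,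
    Matrix.mul_assoc, Matrix.nonsing_inv_mul _ h2, Matrix.mul_one]

theorem expGL_mem_specialIsometry {B A : Matrix m m ℂ} (hB : IsUnit B) (hA : Aᵀ * B = B * -A) :
    expGL A ∈ specialIsometry B := by
  refine ⟨expGL_mem_bilinIsometry hB hA, ?_⟩
  have hhalf : ((1 / 2 : ℂ) • A)ᵀ * B = B * -((1 / 2 : ℂ) • A) := by
    rw [Matrix.transpose_smul, Matrix.smul_mul, hA, ← smul_neg, Matrix.mul_smul]
  have h := expGL_mem_bilinIsometry hB hhalf
  change (NormedSpace.exp ((1 / 2 : ℂ) • A))ᵀ * B * NormedSpace.exp ((1 / 2 : ℂ) • A) = B at h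
  have hdet := (Matrix.isUnit_iff_isUnit_det B).1 hB
  have h3 := congrArg Matrix.det h
  rw [Matrix.det_mul, Matrix.det_mul, Matrix.det_transpose] at h3
  have h4 : (NormedSpace.exp ((1 / 2 : ℂ) • A)).det * (NormedSpace.exp ((1 / 2 : ℂ) • A)).det = 1 := by
    apply mul_right_cancel₀ hdet.ne_zero
    linear_combination h3
  have h5 : NormedSpace.exp A =
      NormedSpace.exp ((1 / 2 : ℂ) • A) * NormedSpace.exp ((1 / 2 : ℂ) • A) := by
    rw [← Matrix.exp_add_of_commute _ _ (Commute.refl _), ← add_smul]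
    norm_num
  refine MonoidHom.mem_ker.2 ?_
  ext
  change (NormedSpace.exp A).det = 1
  rw [h5, Matrix.det_mul, h4]

end Exponentials

/-! ### The crown data of `G = SO(N,ℂ)`, with `G_ℂ = G × G`, `K = SO(N,ℝ)` and `K_ℂ = Δ(G)` -/

section ComplexCase

variable (N : ℕ)

/-- `so(N,ℂ)` as a real Lie algebra. -/
noncomputable def soC : LieSubalgebra ℝ (Matrix (Fin N) (Fin N) ℂ) where
  __ := (LieAlgebra.Orthogonal.so (Fin N) ℂ).toSubmodule.restrictScalars ℝ
  lie_mem' := fun hX hY => (LieAlgebra.Orthogonal.so (Fin N) ℂ).lie_mem hX hY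

/-- `𝔭 = i so(N,ℝ)`, the orthogonal complement of `𝔨 = so(N,ℝ)`. -/
noncomputable def pC : Submodule ℝ (soC N) where
  carrier := {X | (X : Matrix (Fin N) (Fin N) ℂ).map (starRingEnd ℂ) = -(X : Matrix (Fin N) (Fin N) ℂ)}
  zero_mem' := by ext; simp
  add_mem' := fun {X Y} hX hY => by
    ext i j
    have h1 := congrFun (congrFun hX i) j
    have h2 := congrFun (congrFun hY i) j
    simp only [Matrix.map_apply, Matrix.neg_apply] at h1 h2
    change (starRingEnd ℂ) ((X : Matrix (Fin N) (Fin N) ℂ) i j + (Y : Matrix (Fin N) (Fin N) ℂ) i j) =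
      -((X : Matrix (Fin N) (Fin N) ℂ) i j + (Y : Matrix (Fin N) (Fin N) ℂ) i j)
    rw [map_add, h1, h2]
    ring
  smul_mem' := fun c X hX => by
    ext i j
    have h1 := congrFun (congrFun hX i) j
    simp only [Matrix.map_apply, Matrix.neg_apply] at h1
    change (starRingEnd ℂ) (c • (X : Matrix (Fin N) (Fin N) ℂ) i j) =
      -(c • (X : Matrix (Fin N) (Fin N) ℂ) i j)
    rw [Complex.real_smul, map_mul, Complex.conj_ofReal, h1]
    ring

theorem conjGL_mem {g : GL (Fin N) ℂ} (hg : g ∈ SO (Fin N) ℂ) : conjGL g ∈ SO (Fin N) ℂ := by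
  obtain ⟨h1, h2⟩ := hg
  refine ⟨?_, ?_⟩
  · change ((g : Matrix (Fin N) (Fin N) ℂ).map (starRingEnd ℂ))ᵀ * 1 *
      (g : Matrix (Fin N) (Fin N) ℂ).map (starRingEnd ℂ) = 1
    change (g : Matrix (Fin N) (Fin N) ℂ)ᵀ * 1 * (g : Matrix (Fin N) (Fin N) ℂ) = 1 at h1
    rw [Matrix.mul_one] at h1 ⊢
    rw [← Matrix.transpose_map, ← Matrix.map_mul, h1, Matrix.map_one _ (map_zero _) (map_one _)]
  · have h3 := congrArg Units.val (MonoidHom.mem_ker.1 h2)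
    refine MonoidHom.mem_ker.2 ?_
    ext
    change ((starRingEnd ℂ).mapMatrix (g : Matrix (Fin N) (Fin N) ℂ)).det = 1
    change (g : Matrix (Fin N) (Fin N) ℂ).det = 1 at h3
    rw [← RingHom.map_det, h3, map_one]

/-- Complex conjugation on `SO(N,ℂ)`. -/
noncomputable def conjSO : SO (Fin N) ℂ →* SO (Fin N) ℂ :=
  (conjGL.comp (SO (Fin N) ℂ).subtype).codRestrict (SO (Fin N) ℂ) fun g => conjGL_mem N g.2

/-- The inclusion of `G = SO(N,ℂ)` into its complexification `G × G`, `g ↦ (g, ḡ)`. -/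
noncomputable def inclC : SO (Fin N) ℂ →* SO (Fin N) ℂ × SO (Fin N) ℂ :=
  (MonoidHom.id _).prod (conjSO N)

/-- `K_ℂ = Δ(G)`, the diagonal of `G × G`. -/
def KCC : Subgroup (SO (Fin N) ℂ × SO (Fin N) ℂ) :=
  ((MonoidHom.id (SO (Fin N) ℂ)).prod (MonoidHom.id (SO (Fin N) ℂ))).range

/-- The inclusion of `𝔤` into `𝔤_ℂ = 𝔤 ⊕ 𝔤` is `X ↦ (X, X̄)`, and the complex structure of
`𝔤 ⊕ 𝔤` is multiplication by `i`; so `X ↦ exp(iX)` is `X ↦ (exp(iX), exp(iX̄))`. -/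
noncomputable def expIC (X : soC N) : SO (Fin N) ℂ × SO (Fin N) ℂ :=
  (⟨expGL (Complex.I • (X : Matrix (Fin N) (Fin N) ℂ)),
      expGL_mem_specialIsometry isUnit_one (by
        have h : (X : Matrix (Fin N) (Fin N) ℂ)ᵀ = -X := (LieAlgebra.Orthogonal.mem_so _ _ _).1 X.2
        rw [Matrix.transpose_smul, h]; simp)⟩,
    ⟨expGL (Complex.I • (X : Matrix (Fin N) (Fin N) ℂ).map (starRingEnd ℂ)),
      expGL_mem_specialIsometry isUnit_one (by
        have h : (X : Matrix (Fin N) (Fin N) ℂ)ᵀ = -X := (LieAlgebra.Orthogonal.mem_so _ _ _).1 X.2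
        rw [Matrix.transpose_smul, ← Matrix.transpose_map, h]
        ext; simp)⟩)

/-- The distinguished boundary for `G = SO(N,ℂ)`. -/
noncomputable def boundaryC (𝔞 : Submodule ℝ (soC N)) :
    Set ((SO (Fin N) ℂ × SO (Fin N) ℂ) ⧸ KCC N) :=
  distinguishedBoundary (inclC N) (KCC N) (expIC N) 𝔞

end ComplexCase

/-! ### The crown data of `G = SO_e(p,q)`, with `G_ℂ = SO(p+q,ℂ)` (realized as the special isometry
group of the complexified form), `K = SO(p) × SO(q)` and `K_ℂ = SO(p,ℂ) × SO(q,ℂ)` -/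

section RealCase

variable (p q : ℕ)

/-- `so(p,q)`. -/
abbrev soR : LieSubalgebra ℝ (Matrix (Fin p ⊕ Fin q) (Fin p ⊕ Fin q) ℝ) :=
  LieAlgebra.Orthogonal.so' (Fin p) (Fin q) ℝ

/-- `𝔭`, the symmetric matrices in `so(p,q)`. -/
def pR : Submodule ℝ (soR p q) where
  carrier := {X | (X : Matrix (Fin p ⊕ Fin q) (Fin p ⊕ Fin q) ℝ)ᵀ = X}
  zero_mem' := by simp
  add_mem' := fun {X Y} hX hY => by
    have h1 : (X : Matrix (Fin p ⊕ Fin q) (Fin p ⊕ Fin q) ℝ)ᵀ = X := hX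
    have h2 : (Y : Matrix (Fin p ⊕ Fin q) (Fin p ⊕ Fin q) ℝ)ᵀ = Y := hY
    change ((X : Matrix (Fin p ⊕ Fin q) (Fin p ⊕ Fin q) ℝ) + (Y : Matrix (Fin p ⊕ Fin q) (Fin p ⊕ Fin q) ℝ))ᵀ = (X : Matrix (Fin p ⊕ Fin q) (Fin p ⊕ Fin q) ℝ) + (Y : Matrix (Fin p ⊕ Fin q) (Fin p ⊕ Fin q) ℝ)
    rw [Matrix.transpose_add, h1, h2]
  smul_mem' := fun c X hX => by
    have h1 : (X : Matrix (Fin p ⊕ Fin q) (Fin p ⊕ Fin q) ℝ)ᵀ = X := hX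
    change (c • (X : Matrix (Fin p ⊕ Fin q) (Fin p ⊕ Fin q) ℝ))ᵀ = c • (X : Matrix (Fin p ⊕ Fin q) (Fin p ⊕ Fin q) ℝ)
    rw [Matrix.transpose_smul, h1]

theorem map_indefiniteDiagonal :
    (LieAlgebra.Orthogonal.indefiniteDiagonal (Fin p) (Fin q) ℝ).map Complex.ofReal =
      LieAlgebra.Orthogonal.indefiniteDiagonal (Fin p) (Fin q) ℂ := by
  rw [LieAlgebra.Orthogonal.indefiniteDiagonal, LieAlgebra.Orthogonal.indefiniteDiagonal,
    Matrix.diagonal_map Complex.ofReal_zero]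
  congr 1
  ext (i | i) <;> simp

theorem isUnit_indefiniteDiagonal :
    IsUnit (LieAlgebra.Orthogonal.indefiniteDiagonal (Fin p) (Fin q) ℂ) := by
  rw [Matrix.isUnit_iff_isUnit_det, LieAlgebra.Orthogonal.indefiniteDiagonal, Matrix.det_diagonal,
    isUnit_iff_ne_zero, Finset.prod_ne_zero_iff]
  rintro (i | i) _ <;> simp

theorem SOe_le : SOe p q ≤ SOpq p q ℝ := by
  rintro _ ⟨g, _, rfl⟩
  exact g.2

theorem complexifyGL_mem {g : GL (Fin p ⊕ Fin q) ℝ} (hg : g ∈ SOpq p q ℝ) :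
    complexifyGL g ∈ SOpq p q ℂ := by
  obtain ⟨h1, h2⟩ := hg
  refine ⟨?_, ?_⟩
  · change (Complex.ofRealHom.mapMatrix (g : Matrix (Fin p ⊕ Fin q) (Fin p ⊕ Fin q) ℝ))ᵀ *
      LieAlgebra.Orthogonal.indefiniteDiagonal (Fin p) (Fin q) ℂ *
      Complex.ofRealHom.mapMatrix (g : Matrix (Fin p ⊕ Fin q) (Fin p ⊕ Fin q) ℝ) =
        LieAlgebra.Orthogonal.indefiniteDiagonal (Fin p) (Fin q) ℂ
    have h3 := congrArg (fun M => Complex.ofRealHom.mapMatrix M) h1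
    simp only [map_mul] at h3
    rw [← map_indefiniteDiagonal]
    exact h3
  · have h3 := congrArg Units.val (MonoidHom.mem_ker.1 h2)
    refine MonoidHom.mem_ker.2 ?_
    ext
    change (Complex.ofRealHom.mapMatrix (g : Matrix (Fin p ⊕ Fin q) (Fin p ⊕ Fin q) ℝ)).det = 1
    change (g : Matrix (Fin p ⊕ Fin q) (Fin p ⊕ Fin q) ℝ).det = 1 at h3
    rw [← RingHom.map_det, h3, map_one]

/-- The inclusion of `G = SO_e(p,q)` into its complexification. -/
noncomputable def inclR : SOe p q →* SOpq p q ℂ :=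
  (complexifyGL.comp (SOe p q).subtype).codRestrict (SOpq p q ℂ) fun g =>
    complexifyGL_mem p q (SOe_le p q g.2)

/-- `K_ℂ = SO(p,ℂ) × SO(q,ℂ)`. -/
def KCR : Subgroup (SOpq p q ℂ) :=
  (((SO (Fin p) ℂ).prod (SO (Fin q) ℂ)).map blockDiag).subgroupOf (SOpq p q ℂ)

/-- `X ↦ exp(iX)`. -/
noncomputable def expIR (X : soR p q) : SOpq p q ℂ :=
  ⟨expGL (Complex.I • (X : Matrix (Fin p ⊕ Fin q) (Fin p ⊕ Fin q) ℝ).map Complex.ofReal),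
    expGL_mem_specialIsometry (isUnit_indefiniteDiagonal p q) (by
      have h : (X : Matrix (Fin p ⊕ Fin q) (Fin p ⊕ Fin q) ℝ)ᵀ *
          LieAlgebra.Orthogonal.indefiniteDiagonal (Fin p) (Fin q) ℝ =
          LieAlgebra.Orthogonal.indefiniteDiagonal (Fin p) (Fin q) ℝ * -X :=
        (mem_skewAdjointMatricesSubmodule _ _).1 X.2
      have h3 := congrArg (fun M => Complex.ofRealHom.mapMatrix M) h
      simp only [map_mul, map_neg] at h3
      rw [← map_indefiniteDiagonal, Matrix.transpose_smul, Matrix.smul_mul, ← smul_neg,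
        Matrix.mul_smul]
      exact congrArg (fun M => Complex.I • M) h3)⟩

/-- The distinguished boundary for `G = SO_e(p,q)`. -/
noncomputable def boundaryR (𝔞 : Submodule ℝ (soR p q)) : Set (SOpq p q ℂ ⧸ KCR p q) :=
  distinguishedBoundary (inclR p q) (KCR p q) (expIR p q) 𝔞

end RealCase

/-- A subgroup `H` of a subgroup `L` of `M`, viewed as a subgroup of `M`. -/
abbrev asSubgroup {M : Type} [Group M] {L : Subgroup M} (H : Subgroup L) : Subgroup M :=
  H.map L.subtype

end Crown

open Crown

namespace Crown

open Topology Filter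

section

variable {G : Type} [Group G] [TopologicalSpace G]

theorem isPreconnected_preimage_val {L : Subgroup G} {C : Set G} (hC : IsPreconnected C)
    (hCL : C ⊆ L) : IsPreconnected ((↑) ⁻¹' C : Set L) := by
  rw [← IsInducing.subtypeVal.isPreconnected_image]
  convert hC
  ext x
  constructor
  · rintro ⟨y, hy, rfl⟩
    exact hy
  · exact fun hx => ⟨⟨x, hCL hx⟩, hx, rfl⟩

end

section IdentityComponent

variable {G G' : Type} [Group G] [TopologicalSpace G] [IsTopologicalGroup G]
  [Group G'] [TopologicalSpace G'] [IsTopologicalGroup G']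

theorem idComp_le (L : Subgroup G) : idComp L ≤ L := by
  rintro _ ⟨g, _, rfl⟩
  exact g.2

theorem isPreconnected_idComp (L : Subgroup G) : IsPreconnected (idComp L : Set G) := by
  have h : (idComp L : Set G) = (fun g : L => (g : G)) '' connectedComponent (1 : L) := rfl
  rw [h]
  exact isPreconnected_connectedComponent.image _ continuous_subtype_val.continuousOn

theorem subset_idComp {L : Subgroup G} {C : Set G} (hC : IsPreconnected C) (h1 : (1 : G) ∈ C)
    (hCL : C ⊆ L) : C ⊆ idComp L := by
  intro g hg
  have h2 : IsPreconnected ((↑) ⁻¹' C : Set L) := by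
    exact isPreconnected_preimage_val hC hCL
  have h3 : (⟨g, hCL hg⟩ : L) ∈ connectedComponent (1 : L) :=
    h2.subset_connectedComponent (show (1 : L) ∈ ((↑) ⁻¹' C : Set L) from h1) hg
  exact ⟨⟨g, hCL hg⟩, h3, rfl⟩

theorem le_idComp {L C : Subgroup G} (hC : IsPreconnected (C : Set G)) (hCL : C ≤ L) :
    C ≤ idComp L :=
  subset_idComp hC C.one_mem hCL

theorem map_idComp_le (φ : G →* G') (hφ : Continuous φ) {L : Subgroup G} {L' : Subgroup G'}
    (h : L.map φ ≤ L') : (idComp L).map φ ≤ idComp L' := by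
  apply le_idComp
  · rw [Subgroup.coe_map]
    exact (isPreconnected_idComp L).image _ hφ.continuousOn
  · exact (Subgroup.map_mono (idComp_le L)).trans h

/-- The identity component of a subgroup of a subgroup does not depend on the ambient group. -/
theorem asSubgroup_idComp {L : Subgroup G} (H : Subgroup L) :
    asSubgroup (idComp H) = idComp (asSubgroup H) := by
  apply le_antisymm
  · exact map_idComp_le L.subtype continuous_subtype_val le_rfl
  · intro g hg
    have hgL : ((idComp (asSubgroup H) : Subgroup G) : Set G) ⊆ L := by
      intro x hx
      obtain ⟨y, _, rfl⟩ := idComp_le _ hx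
      exact y.2
    have h2 : IsPreconnected ((↑) ⁻¹' ((idComp (asSubgroup H) : Subgroup G) : Set G) : Set L) := by
      exact isPreconnected_preimage_val (isPreconnected_idComp _) hgL
    refine ⟨⟨g, hgL hg⟩, subset_idComp h2 (idComp (asSubgroup H)).one_mem ?_ hg, rfl⟩
    intro x hx
    obtain ⟨y, hy, h⟩ := idComp_le _ hx
    rwa [← Subtype.ext (show (y : G) = x from h)]

end IdentityComponent

section

variable {G G' : Type} [Group G] [TopologicalSpace G] [Group G'] [TopologicalSpace G']

theorem isPreconnected_subgroup_map {L : Subgroup G} (hL : IsPreconnected (L : Set G))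
    (φ : G →* G') (hφ : Continuous φ) : IsPreconnected (L.map φ : Set G') := by
  rw [Subgroup.coe_map]
  exact hL.image _ hφ.continuousOn

theorem isPreconnected_subgroup_prod {L : Subgroup G} {L' : Subgroup G'}
    (hL : IsPreconnected (L : Set G)) (hL' : IsPreconnected (L' : Set G')) :
    IsPreconnected (L.prod L' : Set (G × G')) := by
  rw [Subgroup.coe_prod]
  exact hL.prod hL'

end

section Orbits

variable {G Γ : Type} [Group G] [TopologicalSpace G] [IsTopologicalGroup G]
  [Group Γ] [TopologicalSpace Γ] [IsTopologicalGroup Γ]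

/-- Points of `M ⊆ Γ` can be reached, modulo `K`, from nearby points of `M` by elements of `G` that
are close to the identity. -/
def HasLocalSections (ι : G →* Γ) (K : Subgroup Γ) (M : Set Γ) : Prop :=
  ∀ γ₀ ∈ M, ∀ U ∈ 𝓝 (1 : G), ∀ᶠ γ in 𝓝 γ₀, γ ∈ M → ∃ g ∈ U, (γ : Γ ⧸ K) = ((ι g * γ₀ : Γ) : Γ ⧸ K)

theorem isOrbitDecomposition_of_points {ι : G →* Γ} (hι : Continuous ι) {K : Subgroup Γ} {M : Set Γ}
    (hLS : HasLocalSections ι K M) (hM : ∀ g : G, ∀ γ ∈ M, ι g * γ ∈ M)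
    (hMK : ∀ γ ∈ M, ∀ k ∈ K, γ * k ∈ M)
    {k : ℕ} (x : Fin k → Γ) (hx : ∀ j, x j ∈ M) {S : Set (Γ ⧸ K)}
    (hS : ∀ y, y ∈ S ↔ ∃ j, ∃ g : G, y = ((ι g * x j : Γ) : Γ ⧸ K))
    (hdisj : ∀ i j, ∀ g : G, ((ι g * x i : Γ) : Γ ⧸ K) = (x j : Γ ⧸ K) → i = j)
    (H : Fin k → Subgroup G)
    (hH : ∀ j g, g ∈ H j ↔ ((ι g * x j : Γ) : Γ ⧸ K) = (x j : Γ ⧸ K)) :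
    IsOrbitDecomposition ι S H := by
  have key : ∀ (g : G) (a b : Γ), (a : Γ ⧸ K) = (b : Γ ⧸ K) → ((ι g * a : Γ) : Γ ⧸ K) = ((ι g * b :
      Γ) : Γ ⧸ K) := by
    intro g a b h
    have := congrArg (fun z => ι g • z) h
    exact this
  let f0 : (Σ j, G ⧸ H j) → Γ ⧸ K := fun y =>
    Quotient.liftOn' y.2 (fun g => ((ι g * x y.1 : Γ) : Γ ⧸ K)) (by
      intro a b hab
      rw [QuotientGroup.leftRel_apply] at hab
      have h1 := key a _ _ ((hH _ _).1 hab)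
      simpa [mul_assoc] using h1.symm)
  have f0_mk : ∀ j (g : G), f0 ⟨j, (g : G ⧸ H j)⟩ = ((ι g * x j : Γ) : Γ ⧸ K) := fun _ _ => rfl
  have hf0S : ∀ y, f0 y ∈ S := by
    rintro ⟨j, y⟩
    induction y using QuotientGroup.induction_on with
    | _ g => exact (hS _).2 ⟨j, g, rfl⟩
  let f : (Σ j, G ⧸ H j) → S := fun y => ⟨f0 y, hf0S y⟩
  have hcont : Continuous f := by
    refine Continuous.subtype_mk ?_ _
    rw [continuous_sigma_iff]
    intro j
    have h1 : Continuous fun g : G => ((ι g * x j : Γ) : Γ ⧸ K) :=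
      QuotientGroup.continuous_mk.comp (by fun_prop)
    exact (QuotientGroup.isQuotientMap_mk (N := H j)).continuous_iff.2 h1
  have hbij : Function.Bijective f := by
    constructor
    · rintro ⟨i, y⟩ ⟨j, z⟩ h
      induction y using QuotientGroup.induction_on with
      | _ a =>
      induction z using QuotientGroup.induction_on with
      | _ b =>
      have h1 : ((ι a * x i : Γ) : Γ ⧸ K) = ((ι b * x j : Γ) : Γ ⧸ K) := congrArg Subtype.val h
      have h2 := key b⁻¹ _ _ h1
      have h3 : ((ι (b⁻¹ * a) * x i : Γ) : Γ ⧸ K) = (x j : Γ ⧸ K) := by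
        simpa [mul_assoc] using h2
      obtain rfl := hdisj _ _ _ h3
      have h4 : b⁻¹ * a ∈ H i := (hH _ _).2 h3
      congr 1
      exact (QuotientGroup.eq.2 h4).symm
    · rintro ⟨y, hy⟩
      obtain ⟨j, g, rfl⟩ := (hS _).1 hy
      exact ⟨⟨j, (g : G ⧸ H j)⟩, rfl⟩
  have hSM : ∀ γ : Γ, (γ : Γ ⧸ K) ∈ S → γ ∈ M := by
    intro γ hγ
    obtain ⟨j, g, h⟩ := (hS _).1 hγ
    have h2 := hMK _ (hM g _ (hx j)) _ (QuotientGroup.eq.1 h.symm)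
    rwa [mul_inv_cancel_left] at h2
  have hopen : IsOpenMap f := by
    rw [isOpenMap_iff_nhds_le]
    rintro ⟨j, y⟩
    induction y using QuotientGroup.induction_on with
    | _ a =>
    intro V hV
    rw [mem_map] at hV
    have hc : Continuous fun g : G => (⟨j, ((g * a : G) : G ⧸ H j)⟩ : Σ j, G ⧸ H j) :=
      continuous_sigmaMk.comp (continuous_quot_mk.comp (by fun_prop))
    have h1 : (fun g : G => (⟨j, ((g * a : G) : G ⧸ H j)⟩ : Σ j, G ⧸ H j)) ⁻¹' (f ⁻¹' V) ∈ 𝓝 (1 : G) :=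
      hc.continuousAt.preimage_mem_nhds (by simpa using hV)
    have h2 := hLS _ (hM a _ (hx j)) _ h1
    have h3 : ∀ᶠ z in 𝓝 ((ι a * x j : Γ) : Γ ⧸ K), ∀ hz : z ∈ S, (⟨z, hz⟩ : S) ∈ V := by
      rw [QuotientGroup.nhds_eq, eventually_map]
      filter_upwards [h2] with γ hγ hz
      obtain ⟨g, hg, h4⟩ := hγ (hSM _ hz)
      have h5 : f ⟨j, ((g * a : G) : G ⧸ H j)⟩ = ⟨(γ : Γ ⧸ K), hz⟩ := by
        apply Subtype.ext
        change ((ι (g * a) * x j : Γ) : Γ ⧸ K) = γ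
        rw [h4, map_mul, mul_assoc]
      rw [← h5]
      exact hg
    have h6 : ∀ᶠ z : S in 𝓝 (f ⟨j, (a : G ⧸ H j)⟩), ∀ hz : (z : Γ ⧸ K) ∈ S, (⟨z, hz⟩ : S) ∈ V :=
      Tendsto.eventually (f := fun z : S => (z : Γ ⧸ K))
        (p := fun z => ∀ hz : z ∈ S, (⟨z, hz⟩ : S) ∈ V)
        (continuous_subtype_val (p := fun z => z ∈ S)).continuousAt.tendsto h3
    filter_upwards [h6] with z hz
    exact hz z.2
  refine ⟨(Equiv.ofBijective f hbij).toHomeomorphOfContinuousOpen hcont hopen, ?_⟩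
  rintro g ⟨j, y⟩
  induction y using QuotientGroup.induction_on with
  | _ a =>
  change ((ι (g * a) * x j : Γ) : Γ ⧸ K) = ι g • ((ι a * x j : Γ) : Γ ⧸ K)
  rw [map_mul, mul_assoc]
  rfl

end Orbits

section Polytope

/-- The eigenvalues `t₁, …, tₙ, -t₁, …, -tₙ, 0, …, 0`. -/
def eigs {n : ℕ} (r : ℕ) (t : Fin n → ℝ) : Fin n ⊕ Fin n ⊕ Fin r → ℝ :=
  Sum.elim t (Sum.elim (-t) 0)

/-- The set `Ω` in coordinates: all sums of two different eigenvalues are less than `c` in size. -/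
def OmegaModel (n r : ℕ) (c : ℝ) : Set (Fin n → ℝ) :=
  {t | ∀ a b, a ≠ b → |eigs r t a + eigs r t b| < c}

/-- The polytope `closure Ω` in coordinates. -/
def polytope (n r : ℕ) (c : ℝ) : Set (Fin n → ℝ) :=
  {t | ∀ a b, a ≠ b → |eigs r t a + eigs r t b| ≤ c}

theorem eigs_smul {n : ℕ} (r : ℕ) (s : ℝ) (t : Fin n → ℝ) (a) : eigs r (s • t) a = s * eigs r t a := by
  rcases a with a | a | a <;> simp [eigs]

theorem continuous_eigs {n : ℕ} (r : ℕ) (a) : Continuous fun t : Fin n → ℝ => eigs r t a := by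
  rcases a with a | a | a <;> simp only [eigs, Sum.elim_inl, Sum.elim_inr] <;> fun_prop

theorem closure_OmegaModel {n r : ℕ} {c : ℝ} (hc : 0 < c) :
    closure (OmegaModel n r c) = polytope n r c := by
  apply subset_antisymm
  · apply closure_minimal
    · exact fun t ht a b hab => (ht a b hab).le
    · have : polytope n r c = ⋂ a, ⋂ b, ⋂ (_ : a ≠ b), {t | |eigs r t a + eigs r t b| ≤ c} := by
        ext t; simp [polytope]
      rw [this]
      refine isClosed_iInter fun a => isClosed_iInter fun b => isClosed_iInter fun _ => ?_
      exact isClosed_le (((continuous_eigs r a).add (continuous_eigs r b)).abs) continuous_const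
  · intro t ht
    have h1 : Tendsto (fun s : ℝ => s • t) (𝓝[<] 1) (𝓝 ((1 : ℝ) • t)) :=
      ((continuous_id.smul continuous_const).tendsto (1 : ℝ)).mono_left nhdsWithin_le_nhds
    rw [one_smul] at h1
    refine mem_closure_of_tendsto h1 ?_
    have h2 : ∀ᶠ s : ℝ in 𝓝[<] 1, 0 < s :=
      nhdsWithin_le_nhds (lt_mem_nhds one_pos)
    filter_upwards [h2, self_mem_nhdsWithin] with s hs hs1 a b hab
    rw [eigs_smul, eigs_smul, ← mul_add, abs_mul, abs_of_pos hs]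
    have := ht a b hab
    have hs1' : s < 1 := hs1
    nlinarith [abs_nonneg (eigs r t a + eigs r t b)]

theorem abs_add_abs_le_iff {x y c : ℝ} : |x| + |y| ≤ c ↔ |x + y| ≤ c ∧ |x - y| ≤ c := by
  constructor
  · intro h
    exact ⟨(abs_add_le x y).trans h, (abs_sub x y).trans h⟩
  · rintro ⟨h1, h2⟩
    rw [abs_le] at h1 h2
    rcases abs_cases x with ⟨h3, _⟩ | ⟨h3, _⟩ <;> rcases abs_cases y with ⟨h4, _⟩ | ⟨h4, _⟩ <;>
      rw [h3, h4] <;> linarith [h1.1, h1.2, h2.1, h2.2]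

theorem mem_polytope_iff {n r : ℕ} {c : ℝ} (hn : 2 ≤ n) {t : Fin n → ℝ} :
    t ∈ polytope n r c ↔ ∀ j k, j ≠ k → |t j| + |t k| ≤ c := by
  constructor
  · intro h j k hjk
    rw [abs_add_abs_le_iff]
    have h1 := h (Sum.inl j) (Sum.inl k) (by simpa using hjk)
    have h2 := h (Sum.inl j) (Sum.inr (Sum.inl k)) (by simp)
    simp only [eigs, Sum.elim_inl, Sum.elim_inr, Pi.neg_apply, ← sub_eq_add_neg] at h1 h2
    exact ⟨h1, h2⟩
  · intro h
    have h1 : ∀ j, |t j| ≤ c := by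
      intro j
      have : Nontrivial (Fin n) := Fin.nontrivial_iff_two_le.2 hn
      obtain ⟨k, hk⟩ := exists_ne j
      linarith [h j k hk.symm, abs_nonneg (t k)]
    have hc : 0 ≤ c := (abs_nonneg _).trans (h1 ⟨0, by omega⟩)
    have h2 : ∀ j k, j ≠ k → |t j + t k| ≤ c ∧ |t j - t k| ≤ c := fun j k hjk =>
      abs_add_abs_le_iff.1 (h j k hjk)
    rintro (a | a | a) (b | b | b) hab <;>
      simp only [eigs, Sum.elim_inl, Sum.elim_inr, Pi.neg_apply, Pi.zero_apply, add_zero, zero_add,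
        abs_neg]
    · exact (h2 a b (by simpa using hab)).1
    · by_cases e : a = b
      · simpa [e] using hc
      · exact (h2 a b e).2
    · exact h1 a
    · by_cases e : a = b
      · simpa [e] using hc
      · rw [neg_add_eq_sub]; exact (h2 b a (Ne.symm e)).2
    · rw [← neg_add, abs_neg]
      exact (h2 a b (by simpa using hab)).1
    · exact h1 a
    · exact h1 b
    · exact h1 b
    · simpa using hc

theorem mem_polytope_one_iff {r : ℕ} (hr : 1 ≤ r) {c : ℝ} {t : Fin 1 → ℝ} :
    t ∈ polytope 1 r c ↔ |t 0| ≤ c := by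
  constructor
  · intro h
    simpa [eigs] using h (Sum.inl 0) (Sum.inr (Sum.inr ⟨0, hr⟩)) (by simp)
  · intro h
    have hc := (abs_nonneg _).trans h
    rintro (a | a | a) (b | b | b) hab <;>
      (try (obtain rfl := Subsingleton.elim a 0)) <;> (try (obtain rfl := Subsingleton.elim b 0)) <;>
      simp_all [eigs]

/-- A point of a set that can be moved a little in both directions is not extreme. -/
theorem eq_zero_of_mem_extremePoints {E : Type*} [AddCommGroup E] [Module ℝ E] {s : Set E} {x d : E}
    (hx : x ∈ s.extremePoints ℝ) (h1 : x + d ∈ s) (h2 : x - d ∈ s) : d = 0 := by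
  have h3 : x ∈ openSegment ℝ (x + d) (x - d) :=
    ⟨1 / 2, 1 / 2, by norm_num, by norm_num, by norm_num, by module⟩
  have h4 := (mem_extremePoints_iff_left.1 hx).2 _ h1 _ h2 h3
  simpa using h4

theorem extremePoints_polytope_one {r : ℕ} (hr : 1 ≤ r) {c : ℝ} {t : Fin 1 → ℝ} :
    t ∈ (polytope 1 r c).extremePoints ℝ ↔ |t 0| = c := by
  constructor
  · intro h
    have h0 := (mem_polytope_one_iff hr).1 (extremePoints_subset h)
    have h1 := eq_zero_of_mem_extremePoints (d := fun _ => c - |t 0|) h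
      ((mem_polytope_one_iff hr).2 (by
        have := abs_add_le (t 0) (c - |t 0|)
        rw [abs_of_nonneg (sub_nonneg.2 h0)] at this
        simpa using this))
      ((mem_polytope_one_iff hr).2 (by
        have := abs_sub (t 0) (c - |t 0|)
        rw [abs_of_nonneg (sub_nonneg.2 h0)] at this
        simpa using this))
    have := congrFun h1 0
    simp only [Pi.zero_apply] at this
    linarith
  · intro h
    refine mem_extremePoints_iff_left.2 ⟨(mem_polytope_one_iff hr).2 h.le, ?_⟩
    rintro x hx y hy ⟨a, b, ha, hb, hab, rfl⟩
    rw [mem_polytope_one_iff hr] at hx hy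
    simp only [Pi.add_apply, Pi.smul_apply, smul_eq_mul] at h
    have hb' : b = 1 - a := by linarith
    subst hb'
    funext i
    obtain rfl := Subsingleton.elim i 0
    simp only [Pi.add_apply, Pi.smul_apply, smul_eq_mul]
    rw [abs_le] at hx hy
    rcases abs_cases (a * x 0 + (1 - a) * y 0) with ⟨h1, _⟩ | ⟨h1, _⟩ <;> nlinarith

theorem extreme_single {n r : ℕ} (hn : 2 ≤ n) {c : ℝ} (hc : 0 < c) (j : Fin n) {s : ℝ}
    (hs : |s| = c) : (Pi.single j s : Fin n → ℝ) ∈ (polytope n r c).extremePoints ℝ := by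
  refine mem_extremePoints_iff_left.2 ⟨(mem_polytope_iff hn).2 ?_, ?_⟩
  · intro k l hkl
    by_cases h1 : k = j
    · subst h1
      simp [Pi.single_eq_of_ne (Ne.symm hkl), hs]
    · by_cases h2 : l = j
      · subst h2
        simp [Pi.single_eq_of_ne h1, hs]
      · simp [Pi.single_eq_of_ne h1, Pi.single_eq_of_ne h2, hc.le]
  · rintro x hx y hy ⟨a, b, ha, hb, hab, h⟩
    rw [mem_polytope_iff hn] at hx hy
    have : Nontrivial (Fin n) := Fin.nontrivial_iff_two_le.2 hn
    obtain ⟨k0, hk0⟩ := exists_ne j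
    have hb' : b = 1 - a := by linarith
    have hj := congrFun h j
    simp only [Pi.add_apply, Pi.smul_apply, smul_eq_mul, Pi.single_eq_same] at hj
    have h1 := hx j k0 hk0.symm
    have h2 := hy j k0 hk0.symm
    have h3 := abs_le.1 (show |x j| ≤ c by linarith [abs_nonneg (x k0)])
    have h4 := abs_le.1 (show |y j| ≤ c by linarith [abs_nonneg (y k0)])
    have hxj : x j = s := by
      subst hb'
      rcases abs_cases s with ⟨h5, _⟩ | ⟨h5, _⟩ <;> nlinarith
    funext k
    by_cases hk : k = j
    · subst hk; simpa using hxj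
    · have := hx j k (Ne.symm hk)
      rw [hxj, hs] at this
      rw [Pi.single_eq_of_ne hk]
      exact abs_eq_zero.1 (by linarith [abs_nonneg (x k)])

theorem extreme_half {n r : ℕ} (hn : 3 ≤ n) {c : ℝ} {t : Fin n → ℝ}
    (ht : ∀ j, |t j| = c / 2) : t ∈ (polytope n r c).extremePoints ℝ := by
  refine mem_extremePoints_iff_left.2 ⟨(mem_polytope_iff (by omega)).2 ?_, ?_⟩
  · intro k l _
    rw [ht, ht]; linarith
  · rintro x hx y hy ⟨a, b, ha, hb, hab, h⟩
    rw [mem_polytope_iff (by omega)] at hx hy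
    have e1 : ∀ j k, j ≠ k → |x j| + |x k| = c := by
      intro j k hjk
      have hj := congrFun h j
      have hk := congrFun h k
      simp only [Pi.add_apply, Pi.smul_apply, smul_eq_mul] at hj hk
      have h1 := hx j k hjk
      have h2 := hy j k hjk
      have h3 : c / 2 ≤ a * |x j| + b * |y j| := by
        rw [← ht j, ← hj]
        refine (abs_add_le _ _).trans ?_
        rw [abs_mul, abs_mul, abs_of_pos ha, abs_of_pos hb]
      have h4 : c / 2 ≤ a * |x k| + b * |y k| := by
        rw [← ht k, ← hk]
        refine (abs_add_le _ _).trans ?_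
        rw [abs_mul, abs_mul, abs_of_pos ha, abs_of_pos hb]
      have hb' : b = 1 - a := by linarith
      subst hb'
      nlinarith
    have e2 : ∀ j, |x j| = c / 2 := by
      intro j
      obtain ⟨k, hk, -⟩ := Fin.exists_ne_and_ne_of_two_lt j j (by omega)
      obtain ⟨l, hl⟩ := Fin.exists_ne_and_ne_of_two_lt j k (by omega)
      linarith [e1 j k hk.symm, e1 j l (Ne.symm hl.1), e1 k l (Ne.symm hl.2)]
    have hy2 : ∀ j, |y j| ≤ c / 2 + (c / 2 - |y j|) := fun j => by
      obtain ⟨k, hk, -⟩ := Fin.exists_ne_and_ne_of_two_lt j j (by omega)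
      obtain ⟨l, hl⟩ := Fin.exists_ne_and_ne_of_two_lt j k (by omega)
      have g : ∀ i, c / 2 ≤ |y i| := by
        intro i
        have hi := congrFun h i
        simp only [Pi.add_apply, Pi.smul_apply, smul_eq_mul] at hi
        have h3 : c / 2 ≤ a * |x i| + b * |y i| := by
          rw [← ht i, ← hi]
          refine (abs_add_le _ _).trans ?_
          rw [abs_mul, abs_mul, abs_of_pos ha, abs_of_pos hb]
        rw [e2 i] at h3
        have ha' : a = 1 - b := by linarith
        subst ha'
        nlinarith
      linarith [hy j k hk.symm, g k, g j]
    funext j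
    have hj := congrFun h j
    simp only [Pi.add_apply, Pi.smul_apply, smul_eq_mul] at hj
    have hb' : b = 1 - a := by linarith
    subst hb'
    have hx' := abs_le.1 (e2 j).le
    have hy' := abs_le.1 (show |y j| ≤ c / 2 by linarith [hy2 j])
    rcases abs_cases (t j) with ⟨h5, _⟩ | ⟨h5, _⟩ <;> have := ht j <;> nlinarith

theorem extremePoints_polytope {n r : ℕ} (hn : 2 ≤ n) {c : ℝ} (hc : 0 < c) {t : Fin n → ℝ}
    (h : t ∈ (polytope n r c).extremePoints ℝ) :
    (∃ j s, |s| = c ∧ t = Pi.single j s) ∨ (3 ≤ n ∧ ∀ j, |t j| = c / 2) := by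
  have h0 := (mem_polytope_iff hn).1 (extremePoints_subset h)
  have : Nontrivial (Fin n) := Fin.nontrivial_iff_two_le.2 hn
  have hle : ∀ j, |t j| ≤ c := by
    intro j
    obtain ⟨k, hk⟩ := exists_ne j
    linarith [h0 j k hk.symm, abs_nonneg (t k)]
  by_cases hbig : ∃ j, c / 2 < |t j|
  · left
    obtain ⟨j, hj⟩ := hbig
    rcases (hle j).eq_or_lt with hjc | hjc
    · refine ⟨j, t j, hjc, ?_⟩
      funext k
      by_cases hk : k = j
      · subst hk; simp
      · rw [Pi.single_eq_of_ne hk]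
        exact abs_eq_zero.1 (by linarith [h0 j k (Ne.symm hk), abs_nonneg (t k)])
    · exfalso
      set a := |t j| with ha
      have htj : t j ≠ 0 := by
        intro e; rw [e, abs_zero] at ha; linarith
      -- move `|t j|` by `ε` and rescale the other coordinates
      obtain ⟨ε, hε0, hε1, hε2⟩ : ∃ ε, 0 < ε ∧ ε ≤ c - a ∧ ε ≤ a - c / 2 :=
        ⟨min (c - a) (a - c / 2), lt_min (by linarith) (by linarith), min_le_left _ _,
          min_le_right _ _⟩
      have hca : 0 < c - a := by linarith
      let d : Fin n → ℝ := fun k => if k = j then ε / a * t j else -(ε / (c - a)) * t k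
      have ha0 : 0 < a := by linarith
      have key : ∀ σ : ℝ, |σ| = 1 → t + σ • d ∈ polytope n r c := by
        intro σ hσ
        have hσ' := abs_le.1 hσ.le
        have hj1 : |(t + σ • d) j| = a + σ * ε := by
          have : (t + σ • d) j = (1 + σ * (ε / a)) * t j := by
            simp [d]; ring
          rw [this, abs_mul, ← ha, abs_of_nonneg]
          · field_simp
          · have : ε / a ≤ 1 := (div_le_one ha0).2 (by linarith)
            have h3 : 0 ≤ ε / a := by positivity
            nlinarith
        have hk1 : ∀ k, k ≠ j → |(t + σ • d) k| = (1 - σ * (ε / (c - a))) * |t k| := by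
          intro k hk
          have : (t + σ • d) k = (1 - σ * (ε / (c - a))) * t k := by
            simp [d, hk]; ring
          rw [this, abs_mul, abs_of_nonneg]
          have : ε / (c - a) ≤ 1 := (div_le_one hca).2 hε1
          have h3 : 0 ≤ ε / (c - a) := by positivity
          nlinarith
        have hk2 : ∀ k, k ≠ j → |(t + σ • d) k| ≤ c - (a + σ * ε) := by
          intro k hk
          rw [hk1 k hk]
          have h4 : |t k| ≤ c - a := by linarith [h0 j k (Ne.symm hk)]
          have h5 : 0 ≤ 1 - σ * (ε / (c - a)) := by
            have : ε / (c - a) ≤ 1 := (div_le_one hca).2 hε1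
            have h3 : 0 ≤ ε / (c - a) := by positivity
            nlinarith
          calc _ ≤ (1 - σ * (ε / (c - a))) * (c - a) := by gcongr
            _ = _ := by field_simp; ring
        rw [mem_polytope_iff hn]
        intro k l hkl
        by_cases hk : k = j
        · subst hk
          linarith [hk2 l hkl.symm]
        · by_cases hl : l = j
          · subst hl
            linarith [hk2 k hk]
          · have h6 := hk2 k hk
            have h7 := hk2 l hl
            have : -ε ≤ σ * ε := by nlinarith
            linarith
      have h1 := key 1 (by simp)
      have h2 := key (-1) (by simp)
      rw [one_smul] at h1
      rw [neg_one_smul, ← sub_eq_add_neg] at h2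
      have h3 := congrFun (eq_zero_of_mem_extremePoints h h1 h2) j
      simp only [d, if_true, Pi.zero_apply] at h3
      exact absurd h3 (by positivity)
  · push Not at hbig
    have hall : ∀ j, |t j| = c / 2 := by
      intro j
      by_contra hne
      have hlt : |t j| < c / 2 := lt_of_le_of_ne (hbig j) hne
      have key : ∀ σ : ℝ, |σ| = 1 → t + Pi.single j (σ * (c / 2 - |t j|)) ∈ polytope n r c := by
        intro σ hσ
        have h1 : ∀ k, |(t + Pi.single j (σ * (c / 2 - |t j|)) : Fin n → ℝ) k| ≤ c / 2 := by
          intro k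
          by_cases hk : k = j
          · subst hk
            simp only [Pi.add_apply, Pi.single_eq_same]
            refine (abs_add_le _ _).trans ?_
            rw [abs_mul, hσ, one_mul, abs_of_pos (by linarith : (0 : ℝ) < c / 2 - |t k|)]
            linarith
          · simpa [Pi.single_eq_of_ne hk] using hbig k
        rw [mem_polytope_iff hn]
        intro k l _
        linarith [h1 k, h1 l]
      have h1 := key 1 (by simp)
      have h2 := key (-1) (by simp)
      rw [one_mul] at h1
      rw [neg_one_mul, Pi.single_neg, ← sub_eq_add_neg] at h2
      have h3 := congrFun (eq_zero_of_mem_extremePoints h h1 h2) j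
      simp only [Pi.single_eq_same, Pi.zero_apply] at h3
      linarith
    rcases (show n = 2 ∨ 3 ≤ n by omega) with rfl | hn3
    · exfalso
      have e0 := hall 0
      have e1 := hall 1
      have key : ∀ σ : ℝ, |σ| = 1 → t + σ • ![t 0, -t 1] ∈ polytope 2 r c := by
        intro σ hσ
        have h1 : |(t + σ • ![t 0, -t 1]) 0| = (1 + σ) * (c / 2) := by
          have : (t + σ • ![t 0, -t 1]) 0 = (1 + σ) * t 0 := by simp; ring
          rw [this, abs_mul, e0, abs_of_nonneg (by linarith [(abs_le.1 hσ.le).1])]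
        have h2 : |(t + σ • ![t 0, -t 1]) 1| = (1 - σ) * (c / 2) := by
          have : (t + σ • ![t 0, -t 1]) 1 = (1 - σ) * t 1 := by simp; ring
          rw [this, abs_mul, e1, abs_of_nonneg (by linarith [(abs_le.1 hσ.le).2])]
        rw [mem_polytope_iff le_rfl]
        intro k l hkl
        fin_cases k <;> fin_cases l <;>
          simp only [Fin.zero_eta, Fin.mk_one, ne_eq, not_true_eq_false] at hkl ⊢
        · rw [h1, h2]; linarith
        · rw [h1, h2]; linarith
      have h1 := key 1 (by simp)
      have h2 := key (-1) (by simp)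
      rw [one_smul] at h1
      rw [neg_one_smul, ← sub_eq_add_neg] at h2
      have h3 := congrFun (eq_zero_of_mem_extremePoints h h1 h2) 0
      simp only [Matrix.cons_val_zero, Pi.zero_apply] at h3
      rw [h3, abs_zero] at e0
      linarith
    · exact Or.inr ⟨hn3, hall⟩

end Polytope

section Roots

variable {𝕜 m : Type} [RCLike 𝕜] [Fintype m] [DecidableEq m] {n r : ℕ}

/-- A joint eigenbasis for an abelian space of `B`-skew matrices: `φ` parametrizes the space, the
columns of `U` are the eigenvectors, with eigenvalues `± tⱼ` and `0`. -/
structure EigenFrame (B : Matrix m m 𝕜) (𝔤 : LieSubalgebra ℝ (Matrix m m 𝕜)) (𝔞 : Submodule ℝ 𝔤)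
    (n r : ℕ) where
  φ : (Fin n → ℝ) →ₗ[ℝ] 𝔤
  U : Matrix m (Fin n ⊕ Fin n ⊕ Fin r) 𝕜
  V : Matrix (Fin n ⊕ Fin n ⊕ Fin r) m 𝕜
  range_eq : φ.range = 𝔞
  continuous_φ : Continuous fun t => (φ t : Matrix m m 𝕜)
  U_mul_V : U * V = 1
  V_mul_U : V * U = 1
  eigen : ∀ t, (φ t : Matrix m m 𝕜) * U = U * Matrix.diagonal fun a => ((eigs r t a : ℝ) : 𝕜)

namespace EigenFrame

variable {B : Matrix m m 𝕜} {𝔤 : LieSubalgebra ℝ (Matrix m m 𝕜)} {𝔞 : Submodule ℝ 𝔤}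
  (E : EigenFrame B 𝔤 𝔞 n r)

theorem mem (t : Fin n → ℝ) : E.φ t ∈ 𝔞 := by
  exact E.range_eq.le ⟨t, rfl⟩

theorem coord (t : Fin n → ℝ) (j : Fin n) :
    t j = RCLike.re ((E.V * (E.φ t : Matrix m m 𝕜) * E.U) (Sum.inl j) (Sum.inl j)) := by
  rw [Matrix.mul_assoc, E.eigen, ← Matrix.mul_assoc, E.V_mul_U, Matrix.one_mul,
    Matrix.diagonal_apply_eq]
  simp [eigs]

theorem injective_φ : Function.Injective E.φ := fun s t h => by
  funext j
  rw [E.coord s, E.coord t, h]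

/-- The parametrization as a linear equivalence. -/
noncomputable def equiv : (Fin n → ℝ) ≃ₗ[ℝ] 𝔞 :=
  LinearEquiv.ofBijective (E.φ.codRestrict 𝔞 E.mem) ⟨fun s t h =>
    E.injective_φ (congrArg Subtype.val h), fun Y => by
      obtain ⟨t, ht⟩ : (Y : 𝔤) ∈ E.φ.range := E.range_eq.ge Y.2
      exact ⟨t, Subtype.ext ht⟩⟩

theorem coe_equiv (t : Fin n → ℝ) : (E.equiv t : 𝔤) = E.φ t := rfl

/-- The parametrization as a homeomorphism. -/
noncomputable def homeo : (Fin n → ℝ) ≃ₜ 𝔞 where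
  toEquiv := E.equiv.toEquiv
  continuous_toFun := Continuous.subtype_mk (Continuous.subtype_mk E.continuous_φ _) _
  continuous_invFun := by
    refine continuous_pi fun j => ?_
    have h : (fun Y : 𝔞 => E.equiv.symm Y j) = fun Y : 𝔞 =>
        RCLike.re ((E.V * ((Y : 𝔤) : Matrix m m 𝕜) * E.U) (Sum.inl j) (Sum.inl j)) := by
      funext Y
      rw [E.coord (E.equiv.symm Y) j, ← E.coe_equiv, LinearEquiv.apply_symm_apply]
    change Continuous fun Y : 𝔞 => E.equiv.symm Y j
    rw [h]
    fun_prop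

theorem eigen_col (t : Fin n → ℝ) (a) :
    (E.φ t : Matrix m m 𝕜) *ᵥ E.U.col a = ((eigs r t a : ℝ) : 𝕜) • E.U.col a := by
  have h := E.eigen t
  funext i
  have := congrFun (congrFun h i) a
  rw [Matrix.mul_diagonal] at this
  simpa [Matrix.mul_apply, Matrix.mulVec, dotProduct, mul_comm] using this

/-- Every sum of two different eigenvalues has a nonzero root vector. -/
theorem exists_root_vector (h𝔤 : ∀ X, X ∈ 𝔤 ↔ Xᵀ * B = -(B * X)) (hB : Bᵀ = B) (hB' : IsUnit B)
    {a b} (hab : a ≠ b) :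
    ∃ X : 𝔤, X ≠ 0 ∧ ∀ t, ⁅E.φ t, X⁆ = (eigs r t a + eigs r t b) • X := by
  let u := E.U.col a
  let v := E.U.col b
  let X : Matrix m m 𝕜 := (Matrix.vecMulVec u v - Matrix.vecMulVec v u) * B
  have hX : X ∈ 𝔤 := by
    rw [h𝔤]
    simp only [X, Matrix.transpose_mul, Matrix.transpose_sub, Matrix.transpose_vecMulVec, hB]
    noncomm_ring
  have hY : ∀ t, ∀ a', (E.U.col a') ᵥ* B ᵥ* (E.φ t : Matrix m m 𝕜) =
      -((eigs r t a' : ℝ) : 𝕜) • (E.U.col a' ᵥ* B) := by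
    intro t a'
    have h1 : B * (E.φ t : Matrix m m 𝕜) = -((E.φ t : Matrix m m 𝕜)ᵀ * B) := by
      rw [(h𝔤 _).1 (E.φ t).2, neg_neg]
    rw [Matrix.vecMul_vecMul, h1, Matrix.vecMul_neg, ← Matrix.vecMul_vecMul,
        Matrix.vecMul_transpose, E.eigen_col,
      Matrix.smul_vecMul, neg_smul]
  refine ⟨⟨X, hX⟩, ?_, ?_⟩
  · intro h0
    have h1 : X = 0 := congrArg Subtype.val h0
    have h2 : Matrix.vecMulVec u v - Matrix.vecMulVec v u = 0 := by
      have := congrArg (· * B⁻¹) h1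
      simpa [X, Matrix.mul_assoc, Matrix.mul_nonsing_inv B ((Matrix.isUnit_iff_isUnit_det B).1 hB')]
        using this
    have hu : ∀ c, E.V *ᵥ (E.U.col c) = Pi.single c 1 := by
      intro c
      have := E.V_mul_U
      funext i
      have := congrFun (congrFun this i) c
      simp only [Matrix.mul_apply, Matrix.one_apply] at this
      simp only [Matrix.mulVec, dotProduct, Matrix.col_apply, Pi.single_apply]
      rw [this]
    have h3 := congrArg (fun M => E.V * M * E.Vᵀ) h2
    simp only [Matrix.mul_sub, Matrix.sub_mul, Matrix.mul_vecMulVec, Matrix.vecMulVec_mul, u, v,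
      Matrix.vecMul_transpose, hu, Matrix.mul_zero, Matrix.zero_mul] at h3
    have h4 := congrFun (congrFun h3 a) b
    simp [Matrix.vecMulVec_apply, hab] at h4
  · intro t
    apply Subtype.ext
    change (E.φ t : Matrix m m 𝕜) * X - X * (E.φ t : Matrix m m 𝕜) =
      (eigs r t a + eigs r t b) • X
    simp only [X, Matrix.sub_mul, Matrix.mul_sub, Matrix.vecMulVec_mul, Matrix.mul_vecMulVec, u, v,
        E.eigen_col, hY]
    ext i j
    simp only [Matrix.sub_apply, Matrix.vecMulVec_apply, Pi.smul_apply, smul_eq_mul,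
      Matrix.smul_apply, RCLike.real_smul_eq_coe_mul]
    push_cast
    ring

/-- Every restricted root is a sum of two different eigenvalues. -/
theorem root_eq (h𝔤 : ∀ X, X ∈ 𝔤 ↔ Xᵀ * B = -(B * X)) (hB : Bᵀ = B) (hB' : IsUnit B)
    {α : Module.Dual ℝ 𝔞} (hα : α ∈ restrictedRoots 𝔞) :
    ∃ a b, a ≠ b ∧ ∀ t, α ⟨E.φ t, E.mem t⟩ = -(eigs r t a + eigs r t b) := by
  obtain ⟨-, X, hX0, hX⟩ := hα
  let F := E.Uᵀ * B * (X : Matrix m m 𝕜) * E.U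
  have hF : Fᵀ = -F := by
    have h1 := (h𝔤 _).1 X.2
    calc Fᵀ = E.Uᵀ * ((X : Matrix m m 𝕜)ᵀ * B) * E.U := by
          simp only [F, Matrix.transpose_mul, Matrix.transpose_transpose, hB, Matrix.mul_assoc]
      _ = -F := by rw [h1]; simp only [F, Matrix.mul_assoc, Matrix.neg_mul, Matrix.mul_neg]
  have hF0 : F ≠ 0 := by
    intro h0
    apply hX0
    apply Subtype.ext
    have hdet := (Matrix.isUnit_iff_isUnit_det B).1 hB'
    have hVU : E.Vᵀ * E.Uᵀ = 1 := by rw [← Matrix.transpose_mul, E.U_mul_V, Matrix.transpose_one]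
    calc (X : Matrix m m 𝕜) = B⁻¹ * ((E.Vᵀ * E.Uᵀ) * B * (X : Matrix m m 𝕜) * (E.U * E.V)) := by
          rw [hVU, E.U_mul_V, Matrix.one_mul, Matrix.mul_one, ← Matrix.mul_assoc,
            Matrix.nonsing_inv_mul _ hdet, Matrix.one_mul]
      _ = B⁻¹ * (E.Vᵀ * F * E.V) := by simp only [F, Matrix.mul_assoc]
      _ = 0 := by rw [h0]; simp
  obtain ⟨a, b, hab⟩ : ∃ a b, F a b ≠ 0 := by
    by_contra! h
    exact hF0 (Matrix.ext h)
  refine ⟨a, b, ?_, ?_⟩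
  · rintro rfl
    have := congrFun (congrFun hF a) a
    simp only [Matrix.transpose_apply, Matrix.neg_apply] at this
    exact hab (self_eq_neg.1 this)
  · intro t
    have h1 : (E.φ t : Matrix m m 𝕜) * X - X * (E.φ t : Matrix m m 𝕜) =
        (α ⟨E.φ t, E.mem t⟩) • (X : Matrix m m 𝕜) := congrArg Subtype.val (hX ⟨E.φ t, E.mem t⟩)
    set D := Matrix.diagonal fun a => ((eigs r t a : ℝ) : 𝕜)
    have h2 : E.Uᵀ * B * (E.φ t : Matrix m m 𝕜) = -(D * E.Uᵀ * B) := by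
      have e1 : B * (E.φ t : Matrix m m 𝕜) = -((E.φ t : Matrix m m 𝕜)ᵀ * B) := by
        rw [(h𝔤 _).1 (E.φ t).2, neg_neg]
      have e2 := congrArg Matrix.transpose (E.eigen t)
      rw [Matrix.transpose_mul, Matrix.transpose_mul, Matrix.diagonal_transpose] at e2
      rw [Matrix.mul_assoc, e1, Matrix.mul_neg, ← Matrix.mul_assoc, e2]
    have h3 : -(D * F) - F * D = (α ⟨E.φ t, E.mem t⟩) • F := by
      have e3 : (α ⟨E.φ t, E.mem t⟩) • F =
          E.Uᵀ * B * ((α ⟨E.φ t, E.mem t⟩) • (X : Matrix m m 𝕜)) * E.U := by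
        rw [Matrix.mul_smul, Matrix.smul_mul]
      rw [e3, ← h1, Matrix.mul_sub, Matrix.sub_mul, ← Matrix.mul_assoc (E.Uᵀ * B), h2,
        ← Matrix.mul_assoc (E.Uᵀ * B), Matrix.mul_assoc _ (E.φ t : Matrix m m 𝕜) E.U, E.eigen]
      simp only [F, D, Matrix.mul_assoc, Matrix.neg_mul]
    have h4 := congrFun (congrFun h3 a) b
    simp only [Matrix.sub_apply, Matrix.neg_apply, D, Matrix.diagonal_mul, Matrix.mul_diagonal,
      Matrix.smul_apply, RCLike.real_smul_eq_coe_mul] at h4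
    have h5 : ((α ⟨E.φ t, E.mem t⟩ : ℝ) : 𝕜) = ((-(eigs r t a + eigs r t b) : ℝ) : 𝕜) := by
      apply mul_right_cancel₀ hab
      rw [← h4]
      push_cast
      ring
    exact_mod_cast h5

theorem mem_Omega_iff (h𝔤 : ∀ X, X ∈ 𝔤 ↔ Xᵀ * B = -(B * X)) (hB : Bᵀ = B) (hB' : IsUnit B)
    (t : Fin n → ℝ) : E.equiv t ∈ Omega 𝔞 ↔ t ∈ OmegaModel n r (Real.pi / 2) := by
  constructor
  · intro h a b hab
    obtain ⟨X, hX0, hX⟩ := E.exists_root_vector h𝔤 hB hB' hab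
    let α : Module.Dual ℝ 𝔞 :=
      { toFun := fun Y => eigs r (E.equiv.symm Y) a + eigs r (E.equiv.symm Y) b
        map_add' := fun Y Z => by
          rcases a with a | a | a <;> rcases b with b | b | b <;> simp [eigs] <;> ring
        map_smul' := fun c Y => by
          rw [map_smul, eigs_smul, eigs_smul, RingHom.id_apply, smul_eq_mul, mul_add] }
    have hα : ∀ s, α (E.equiv s) = eigs r s a + eigs r s b := fun s => by
      change eigs r (E.equiv.symm (E.equiv s)) a + _ = _
      rw [LinearEquiv.symm_apply_apply]
    by_cases h0 : α = 0
    · rw [← hα, h0]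
      simpa using Real.pi_pos
    · rw [← hα]
      refine h α ⟨h0, X, hX0, fun H => ?_⟩
      obtain ⟨s, rfl⟩ := E.equiv.surjective H
      rw [hα]
      exact hX s
  · intro h α hα
    obtain ⟨a, b, hab, hα'⟩ := E.root_eq h𝔤 hB hB' hα
    have : E.equiv t = ⟨E.φ t, E.mem t⟩ := rfl
    rw [this, hα', abs_neg]
    exact h a b hab

theorem mem_extremeOmega_iff (h𝔤 : ∀ X, X ∈ 𝔤 ↔ Xᵀ * B = -(B * X)) (hB : Bᵀ = B) (hB' : IsUnit B)
    (t : Fin n → ℝ) :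
    E.equiv t ∈ extremeOmega 𝔞 ↔ t ∈ (polytope n r (Real.pi / 2)).extremePoints ℝ := by
  have h1 : Omega 𝔞 = E.equiv '' OmegaModel n r (Real.pi / 2) := by
    ext Y
    obtain ⟨s, rfl⟩ := E.equiv.surjective Y
    rw [E.mem_Omega_iff h𝔤 hB hB', E.equiv.injective.mem_set_image]
  have h2 : closure (Omega 𝔞) = E.equiv '' polytope n r (Real.pi / 2) := by
    rw [h1, ← closure_OmegaModel (by positivity)]
    exact (E.homeo.image_closure _).symm
  rw [extremeOmega, h2, ← image_extremePoints, E.equiv.injective.mem_set_image]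

theorem exists_of_mem (Y : 𝔞) : ∃ t, Y = E.equiv t :=
  ⟨E.equiv.symm Y, (E.equiv.apply_symm_apply Y).symm⟩

end EigenFrame

end Roots

section Sqrt

/-- A local square root near `1` in a Banach algebra. -/
theorem exists_local_sqrt (A : Type*) [NormedRing A] [NormedAlgebra ℝ A] [CompleteSpace A] :
    ∃ s : A → A, s 1 = 1 ∧ (∀ᶠ x in 𝓝 (1 : A), ContinuousAt s x) ∧
      (∀ᶠ x in 𝓝 (1 : A), s x * s x = x) ∧ ∀ᶠ y in 𝓝 (1 : A), s (y * y) = y := by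
  let e : A ≃L[ℝ] A := ContinuousLinearEquiv.smulLeft (Units.mk0 (2 : ℝ) two_ne_zero)
  have hd : HasStrictFDerivAt (fun y : A => y * y) (e : A →L[ℝ] A) 1 := by
    have h := (hasStrictFDerivAt_id (𝕜 := ℝ) (1 : A)).mul' (hasStrictFDerivAt_id (𝕜 := ℝ) (1 : A))
    refine h.congr_fderiv ?_
    ext y
    simp [e, Units.smul_def, two_smul]
  let F := hd.toOpenPartialHomeomorph _
  have h1 : (1 : A) ∈ F.source := hd.mem_toOpenPartialHomeomorph_source
  have hF : ∀ y, F y = y * y := fun _ => rfl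
  have hF1 : F 1 = 1 := by rw [hF, mul_one]
  have h1t : (1 : A) ∈ F.target := by
    have := F.map_source h1
    rwa [hF1] at this
  refine ⟨F.symm, ?_, ?_, ?_, ?_⟩
  · conv_lhs => rw [← hF1]
    exact F.left_inv h1
  · filter_upwards [F.open_target.mem_nhds h1t] with x hx
    exact F.continuousAt_symm hx
  · filter_upwards [F.open_target.mem_nhds h1t] with x hx
    rw [← hF, F.right_inv hx]
  · filter_upwards [F.open_source.mem_nhds h1] with y hy
    rw [← hF, F.left_inv hy]

end Sqrt

section Polar

variable {m : Type} [Fintype m] [DecidableEq m]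

/-- The adjoint with respect to an involutive symmetric form `B`. -/
def dag (B X : Matrix m m ℂ) : Matrix m m ℂ := B * Xᵀ * B

theorem dag_mul {B : Matrix m m ℂ} (hB : B * B = 1) (X Y : Matrix m m ℂ) :
    dag B (X * Y) = dag B Y * dag B X := by
  simp only [dag, Matrix.transpose_mul]
  calc _ = B * Yᵀ * 1 * Xᵀ * B := by simp only [Matrix.mul_one, Matrix.mul_assoc]
    _ = _ := by rw [← hB]; simp only [Matrix.mul_assoc]

theorem dag_one {B : Matrix m m ℂ} (hB : B * B = 1) : dag B 1 = 1 := by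
  simp [dag, hB]

theorem dag_dag {B : Matrix m m ℂ} (hB : B * B = 1) (hBt : Bᵀ = B) (X : Matrix m m ℂ) :
    dag B (dag B X) = X := by
  simp only [dag, Matrix.transpose_mul, Matrix.transpose_transpose, hBt]
  calc _ = (B * B) * X * (B * B) := by simp only [Matrix.mul_assoc]
    _ = X := by rw [hB, Matrix.one_mul, Matrix.mul_one]

omit [DecidableEq m] in
theorem continuous_dag (B : Matrix m m ℂ) : Continuous (dag B) :=
   (continuous_const.matrix_mul continuous_id.matrix_transpose).matrix_mul continuous_const

theorem dag_mul_self_iff {B : Matrix m m ℂ} (hB : B * B = 1) (X : Matrix m m ℂ) :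
    dag B X * X = 1 ↔ Xᵀ * B * X = B := by
  constructor
  · intro h
    calc Xᵀ * B * X = (B * B) * Xᵀ * B * X := by rw [hB, Matrix.one_mul]
      _ = B * (dag B X * X) := by simp only [dag, Matrix.mul_assoc]
      _ = B := by rw [h, Matrix.mul_one]
  · intro h
    calc dag B X * X = B * (Xᵀ * B * X) := by simp only [dag, Matrix.mul_assoc]
      _ = 1 := by rw [h, hB]

attribute [local instance] Matrix.linftyOpNormedRing Matrix.linftyOpNormedAlgebra

/-- A `B`-orthogonal projection near `1`, compatible with automorphisms: the factor `P A` of the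
polar decomposition of `A`. -/
theorem exists_polar {B : Matrix m m ℂ} (hB : B * B = 1) (hBt : Bᵀ = B) :
    ∃ P : Matrix m m ℂ → Matrix m m ℂ, P 1 = 1 ∧ (∀ᶠ A in 𝓝 1, ContinuousAt P A) ∧
      (∀ᶠ A in 𝓝 1, (P A)ᵀ * B * P A = B) ∧ (∀ g, gᵀ * B * g = B → P g = g) ∧
      ∀ ψ : Matrix m m ℂ →* Matrix m m ℂ, Continuous ψ → (∀ X, ψ (dag B X) = dag B (ψ X)) →
        ∀ z₀ w₀, dag B z₀ * z₀ = 1 → w₀ * z₀ = 1 →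
        ∀ᶠ A in 𝓝 1, ∀ z, dag B z * z = 1 → z * ψ A * w₀ = A → z * ψ (P A) * w₀ = P A := by
  obtain ⟨s, hs1, hsc, hs2, hs3⟩ := exists_local_sqrt (Matrix m m ℂ)
  let q : Matrix m m ℂ → Matrix m m ℂ := fun A => dag B A * A
  have hq : Continuous q := (continuous_dag B).mul continuous_id
  have hq1 : q 1 = 1 := by simp [q, dag_one hB]
  have hqt : Tendsto q (𝓝 1) (𝓝 1) := by
    have := hq.tendsto 1
    rwa [hq1] at this
  have hst : Tendsto s (𝓝 1) (𝓝 1) := by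
    have := hsc.self_of_nhds.tendsto
    rwa [hs1] at this
  have hsq : Tendsto (fun A => s (q A)) (𝓝 1) (𝓝 1) := hst.comp hqt
  have hunit : ∀ᶠ x in 𝓝 (1 : Matrix m m ℂ), IsUnit x :=
    (Units.isOpen (R := Matrix m m ℂ)).mem_nhds isUnit_one
  -- compatibility of the square root with continuous multiplicative maps
  have hcompat : ∀ φ : Matrix m m ℂ → Matrix m m ℂ, Continuous φ → φ 1 = 1 →
      (∀ x, φ (x * x) = φ x * φ x) → ∀ᶠ x in 𝓝 (1 : Matrix m m ℂ), φ x = x → φ (s x) = s x := by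
    intro φ hφ hφ1 hφm
    have h1 : Tendsto (fun x => φ (s x)) (𝓝 1) (𝓝 1) := by
      have := (hφ.tendsto 1).comp hst
      rwa [hφ1] at this
    filter_upwards [h1.eventually hs3, hs2] with x hx hx2 hx3
    rw [← hφm, hx2, hx3] at hx
    exact hx.symm
  refine ⟨fun A => A * Ring.inverse (s (q A)), ?_, ?_, ?_, ?_, ?_⟩
  · simp [hq1, hs1]
  · filter_upwards [hqt.eventually hsc, hsq.eventually hunit] with A hA hA2
    have h1 : ContinuousAt (fun A => s (q A)) A := ContinuousAt.comp (g := s) hA hq.continuousAt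
    have h2 : ContinuousAt Ring.inverse (s (q A)) := by
      obtain ⟨u, hu⟩ := hA2
      rw [← hu]
      exact NormedRing.inverse_continuousAt u
    exact continuousAt_id.mul (ContinuousAt.comp (f := fun A => s (q A)) h2 h1)
  · have hd := hcompat (dag B) (continuous_dag B) (dag_one hB) (fun x => dag_mul hB x x)
    filter_upwards [hqt.eventually hd, hqt.eventually hs2, hsq.eventually hunit] with A h1 h2 h3
    rw [← dag_mul_self_iff hB]
    have h4 : dag B (q A) = q A := by
      simp only [q]
      rw [dag_mul hB, dag_dag hB hBt]
    have h5 := h1 h4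
    set S := s (q A)
    have e1 : S * Ring.inverse S = 1 := Ring.mul_inverse_cancel _ h3
    have e2 : dag B (Ring.inverse S) * S = 1 := by
      have := congrArg (dag B) e1
      rwa [dag_mul hB, h5, dag_one hB] at this
    rw [dag_mul hB]
    calc _ = dag B (Ring.inverse S) * q A * Ring.inverse S := by simp only [q, Matrix.mul_assoc]
      _ = (dag B (Ring.inverse S) * S) * (S * Ring.inverse S) := by
          rw [← h2]; simp only [Matrix.mul_assoc]
      _ = 1 := by rw [e1, e2, Matrix.mul_one]
  · intro g hg
    rw [← dag_mul_self_iff hB] at hg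
    change g * Ring.inverse (s (dag B g * g)) = g
    rw [hg, hs1, Ring.inverse_one, Matrix.mul_one]
  · intro ψ hψ hψd z₀ w₀ hz₀ hw₀
    have hzw : z₀ * w₀ = 1 := mul_eq_one_comm.1 hw₀
    have hdw : dag B w₀ = z₀ := by
      have h1 : dag B z₀ * dag B w₀ = 1 := by rw [← dag_mul hB, hw₀, dag_one hB]
      calc dag B w₀ = (z₀ * dag B z₀) * dag B w₀ := by rw [mul_eq_one_comm.1 hz₀, Matrix.one_mul]
        _ = z₀ := by rw [Matrix.mul_assoc, h1, Matrix.mul_one]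
    let φ : Matrix m m ℂ → Matrix m m ℂ := fun x => z₀ * ψ x * w₀
    have hφm : ∀ x y, φ (x * y) = φ x * φ y := by
      intro x y
      simp only [φ, map_mul]
      calc _ = z₀ * ψ x * 1 * ψ y * w₀ := by simp only [Matrix.mul_one, Matrix.mul_assoc]
        _ = _ := by rw [← hw₀]; simp only [Matrix.mul_assoc]
    have hφ1 : φ 1 = 1 := by simp [φ, hzw]
    have hφc : Continuous φ := (continuous_const.mul hψ).mul continuous_const
    have hd := hcompat φ hφc hφ1 (fun x => hφm x x)
    filter_upwards [hqt.eventually hd, hsq.eventually hunit] with A h1 h3 z hz hA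
    have h4 : φ (q A) = q A := by
      have e1 : dag B A = z₀ * ψ (dag B A) * dag B z := by
        conv_lhs => rw [← hA]
        rw [dag_mul hB, dag_mul hB, hψd, hdw, Matrix.mul_assoc]
      calc φ (q A) = z₀ * ψ (dag B A) * (dag B z * z) * ψ A * w₀ := by
            simp only [φ, q, map_mul, hz, Matrix.mul_one, Matrix.mul_assoc]
        _ = (z₀ * ψ (dag B A) * dag B z) * (z * ψ A * w₀) := by simp only [Matrix.mul_assoc]
        _ = q A := by rw [← e1, hA]
    have h5 := h1 h4
    set S := s (q A)
    have e1 : S * Ring.inverse S = 1 := Ring.mul_inverse_cancel _ h3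
    have e2 : φ (Ring.inverse S) = Ring.inverse S := by
      have e3 : S * φ (Ring.inverse S) = 1 := by
        have := congrArg φ e1
        rwa [hφm, h5, hφ1] at this
      calc φ (Ring.inverse S) = (Ring.inverse S * S) * φ (Ring.inverse S) := by
            rw [Ring.inverse_mul_cancel _ h3, Matrix.one_mul]
        _ = Ring.inverse S := by rw [Matrix.mul_assoc, e3, Matrix.mul_one]
    calc z * ψ (A * Ring.inverse S) * w₀ = z * ψ A * (w₀ * z₀) * ψ (Ring.inverse S) * w₀ := by
          rw [hw₀, map_mul]; simp only [Matrix.mul_one, Matrix.mul_assoc]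
      _ = (z * ψ A * w₀) * φ (Ring.inverse S) := by simp only [φ, Matrix.mul_assoc]
      _ = A * Ring.inverse S := by rw [hA, e2]

end Polar

section GLTopology

variable {m : Type} [Fintype m] [DecidableEq m] {𝕜 : Type} [RCLike 𝕜]

theorem isOpenEmbedding_GL_val : IsOpenEmbedding (Units.val : GL m 𝕜 → Matrix m m 𝕜) := by
  let _ : NormedRing (Matrix m m 𝕜) := Matrix.linftyOpNormedRing
  let _ : NormedAlgebra ℝ (Matrix m m 𝕜) := Matrix.linftyOpNormedAlgebra
  have : CompleteSpace (Matrix m m 𝕜) := inferInstance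
  exact Units.isOpenEmbedding_val

theorem continuous_GL_val : Continuous (Units.val : GL m 𝕜 → Matrix m m 𝕜) :=
  Units.continuous_val

theorem continuous_into_GL {X : Type*} [TopologicalSpace X] {f : X → GL m 𝕜}
    (hf : Continuous fun x => (f x : Matrix m m 𝕜)) : Continuous f :=
  isOpenEmbedding_GL_val.isInducing.continuous_iff.2 hf

theorem exists_nhds_GL {L : Subgroup (GL m 𝕜)} {U : Set L} (hU : U ∈ 𝓝 (1 : L)) :
    ∃ W ∈ 𝓝 (1 : Matrix m m 𝕜), ∀ g : L, (((g : GL m 𝕜)) : Matrix m m 𝕜) ∈ W → g ∈ U := by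
  have h : IsInducing fun g : L => (((g : GL m 𝕜)) : Matrix m m 𝕜) :=
    isOpenEmbedding_GL_val.isInducing.comp IsInducing.subtypeVal
  rw [h.nhds_eq_comap, mem_comap] at hU
  obtain ⟨W, hW, hWU⟩ := hU
  exact ⟨W, by simpa using hW, fun g hg => hWU hg⟩

theorem isPreconnected_of_val {C : Set (GL m 𝕜)}
    (h : IsPreconnected ((Units.val : GL m 𝕜 → Matrix m m 𝕜) '' C)) : IsPreconnected C :=
  isOpenEmbedding_GL_val.isInducing.isPreconnected_image.1 h

end GLTopology

section Conj

variable {m : Type} [Fintype m] [DecidableEq m]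

/-- Entrywise complex conjugation of matrices. -/
noncomputable abbrev cj : Matrix m m ℂ →+* Matrix m m ℂ := (starRingEnd ℂ).mapMatrix

theorem cj_apply (X : Matrix m m ℂ) (i j : m) : cj X i j = (starRingEnd ℂ) (X i j) := rfl

theorem cj_cj (X : Matrix m m ℂ) : cj (cj X) = X := by
  ext i j; simp

theorem continuous_cj : Continuous (cj : Matrix m m ℂ → Matrix m m ℂ) :=
  continuous_id.matrix_map Complex.continuous_conj

theorem cj_dag {B : Matrix m m ℂ} (hB : cj B = B) (X : Matrix m m ℂ) : cj (dag B X) = dag B (cj X) := by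
  simp only [dag, map_mul, hB]
  rfl

theorem cj_smul_real (c : ℝ) (X : Matrix m m ℂ) : cj (c • X) = c • cj X := by
  ext i j
  simp

/-- The mean of the four quotients of words in `z, z̄` and the corresponding words in `z₀, z̄₀`, for
the twisted action `z ↦ g z ḡ⁻¹`. -/
noncomputable def twistedMean (w₀ z : Matrix m m ℂ) : Matrix m m ℂ :=
  (1 / 4 : ℝ) • (1 + z * w₀ + z * cj z * (cj w₀ * w₀) + z * cj z * z * (w₀ * cj w₀ * w₀))

theorem continuous_twistedMean (w₀ : Matrix m m ℂ) : Continuous (twistedMean w₀) := by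
  have h := continuous_cj (m := m)
  unfold twistedMean
  refine Continuous.const_smul ?_ (1 / 4 : ℝ)
  exact ((continuous_const.add (continuous_id.matrix_mul continuous_const)).add
    ((continuous_id.matrix_mul h).matrix_mul continuous_const)).add
    (((continuous_id.matrix_mul h).matrix_mul continuous_id).matrix_mul continuous_const)

theorem twistedMean_self {w₀ z₀ : Matrix m m ℂ} (h : z₀ * w₀ = 1) : twistedMean w₀ z₀ = 1 := by
  have hc : cj z₀ * cj w₀ = 1 := by rw [← map_mul, h, map_one]
  have e1 : z₀ * cj z₀ * (cj w₀ * w₀) = 1 := by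
    rw [Matrix.mul_assoc, ← Matrix.mul_assoc (cj z₀), hc, Matrix.one_mul, h]
  have e2 : z₀ * cj z₀ * z₀ * (w₀ * cj w₀ * w₀) = 1 := by
    rw [Matrix.mul_assoc _ z₀, Matrix.mul_assoc w₀, ← Matrix.mul_assoc z₀, h, Matrix.one_mul, e1]
  rw [twistedMean, h, e1, e2]
  module

theorem twistedMean_comm {w₀ z₀ z : Matrix m m ℂ} (h : z₀ * w₀ = 1)
    (h₀ : z₀ * cj z₀ * (z₀ * cj z₀) = 1) (hz : z * cj z * (z * cj z) = 1) :
    z * cj (twistedMean w₀ z) * w₀ = twistedMean w₀ z := by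
  have hc : cj z₀ * cj w₀ = 1 := by rw [← map_mul, h, map_one]
  have e1 : z₀ * cj z₀ * (cj w₀ * w₀) = 1 := by
    rw [Matrix.mul_assoc, ← Matrix.mul_assoc (cj z₀), hc, Matrix.one_mul, h]
  have e2 : cj w₀ * w₀ * (cj w₀ * w₀) = 1 := by
    have e3 := mul_eq_one_comm.1 e1
    calc cj w₀ * w₀ * (cj w₀ * w₀) = cj w₀ * w₀ * (cj w₀ * w₀) * (z₀ * cj z₀ * (z₀ * cj z₀)) := by
          rw [h₀, Matrix.mul_one]
      _ = cj w₀ * w₀ * (cj w₀ * w₀ * (z₀ * cj z₀)) * (z₀ * cj z₀) := by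
          simp only [Matrix.mul_assoc]
      _ = 1 := by rw [e3, Matrix.mul_one, e3]
  have e4 : z * (cj z * z * cj z) * ((cj w₀ * w₀ * cj w₀) * w₀) = 1 := by
    calc _ = (z * cj z * (z * cj z)) * (cj w₀ * w₀ * (cj w₀ * w₀)) := by
          simp only [Matrix.mul_assoc]
      _ = 1 := by rw [hz, e2, Matrix.mul_one]
  simp only [twistedMean, cj_smul_real, map_add, map_mul, map_one, cj_cj, Matrix.mul_smul,
    Matrix.smul_mul, Matrix.mul_add, Matrix.add_mul, Matrix.mul_one]
  congr 1
  have e5 : z * (cj z * z * cj z * (cj w₀ * w₀ * cj w₀)) * w₀ = 1 := by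
    rw [← e4]; simp only [Matrix.mul_assoc]
  rw [e5]
  simp only [Matrix.mul_assoc]
  abel

/-- The mean of the four quotients of words in `z, z̄` and the corresponding words in `z₀, z̄₀`, for
commuting involutions `z, z̄`. -/
noncomputable def involutionMean (z₀ z : Matrix m m ℂ) : Matrix m m ℂ :=
  (1 / 4 : ℝ) • (1 + z * z₀ + cj z * cj z₀ + z * cj z * (cj z₀ * z₀))

theorem continuous_involutionMean (z₀ : Matrix m m ℂ) : Continuous (involutionMean z₀) := by
  have h := continuous_cj (m := m)
  unfold involutionMean
  refine Continuous.const_smul ?_ (1 / 4 : ℝ)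
  exact ((continuous_const.add (continuous_id.matrix_mul continuous_const)).add
    (h.matrix_mul continuous_const)).add
    ((continuous_id.matrix_mul h).matrix_mul continuous_const)

variable {z₀ z : Matrix m m ℂ}

theorem involutionMean_self (h₀ : z₀ * z₀ = 1) : involutionMean z₀ z₀ = 1 := by
  have hc : cj z₀ * cj z₀ = 1 := by rw [← map_mul, h₀, map_one]
  have e1 : z₀ * cj z₀ * (cj z₀ * z₀) = 1 := by
    rw [Matrix.mul_assoc, ← Matrix.mul_assoc (cj z₀), hc, Matrix.one_mul, h₀]
  rw [involutionMean, h₀, hc, e1]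
  module

theorem cj_mul_comm (hz : z * z = 1) (hz' : z * cj z * (z * cj z) = 1) : cj z * z = z * cj z := by
  have hc : cj z * cj z = 1 := by rw [← map_mul, hz, map_one]
  calc cj z * z = (z * cj z * (z * cj z)) * (cj z * z) := by rw [hz', Matrix.one_mul]
    _ = z * cj z * (z * (cj z * cj z) * z) := by simp only [Matrix.mul_assoc]
    _ = z * cj z := by rw [hc, Matrix.mul_one, hz, Matrix.mul_one]

theorem involutionMean_comm (h₀ : z₀ * z₀ = 1) (hz : z * z = 1) :
    z * involutionMean z₀ z * z₀ = involutionMean z₀ z := by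
  simp only [involutionMean, Matrix.mul_smul, Matrix.smul_mul, Matrix.mul_add, Matrix.add_mul,
    Matrix.mul_one]
  have e1 : z * (z * z₀) * z₀ = 1 := by
    rw [← Matrix.mul_assoc, hz, Matrix.one_mul, h₀]
  have e2 : z * (z * cj z * (cj z₀ * z₀)) * z₀ = cj z * cj z₀ := by
    calc _ = (z * z) * cj z * cj z₀ * (z₀ * z₀) := by simp only [Matrix.mul_assoc]
      _ = _ := by rw [hz, h₀, Matrix.one_mul, Matrix.mul_one]
  rw [e1, e2]
  simp only [Matrix.mul_assoc]
  congr 1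
  abel

theorem cj_involutionMean (h₀ : z₀ * z₀ = 1) (h₀' : z₀ * cj z₀ * (z₀ * cj z₀) = 1) (hz : z * z = 1)
    (hz' : z * cj z * (z * cj z) = 1) : cj (involutionMean z₀ z) = involutionMean z₀ z := by
  simp only [involutionMean, cj_smul_real, map_add, map_mul, map_one, cj_cj]
  rw [cj_mul_comm hz hz', ← cj_mul_comm h₀ h₀']
  congr 1
  abel

end Conj

section Membership

variable {m : Type} [Fintype m] [DecidableEq m] {R : Type} [CommRing R]

theorem mem_specialIsometry_iff {B : Matrix m m R} {g : GL m R} :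
    g ∈ specialIsometry B ↔
      (g : Matrix m m R)ᵀ * B * (g : Matrix m m R) = B ∧ (g : Matrix m m R).det = 1 := by
  constructor
  · rintro ⟨h1, h2⟩
    exact ⟨h1, congrArg Units.val (MonoidHom.mem_ker.1 h2)⟩
  · rintro ⟨h1, h2⟩
    exact ⟨h1, MonoidHom.mem_ker.2 (Units.ext h2)⟩

theorem mem_SO_iff {g : GL m R} :
    g ∈ SO m R ↔ (g : Matrix m m R)ᵀ * (g : Matrix m m R) = 1 ∧ (g : Matrix m m R).det = 1 := by
  rw [SO, mem_specialIsometry_iff, Matrix.mul_one]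

theorem det_sq_of_isometry [IsDomain R] {B g : Matrix m m R} (hB : IsUnit B) (h : gᵀ * B * g = B) :
    g.det = 1 ∨ g.det = -1 := by
  have h1 := congrArg Matrix.det h
  rw [Matrix.det_mul, Matrix.det_mul, Matrix.det_transpose] at h1
  have hdet := ((Matrix.isUnit_iff_isUnit_det B).1 hB)
  have h2 : g.det * g.det = 1 := hdet.mul_right_cancel (by linear_combination h1)
  exact mul_self_eq_one_iff.1 h2

theorem exists_mem_specialIsometry {B g : Matrix m m R} (h : gᵀ * B * g = B)
    (hdet : g.det = 1) : ∃ g' ∈ specialIsometry B, (g' : Matrix m m R) = g := by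
  have hu : IsUnit g := (Matrix.isUnit_iff_isUnit_det g).2 (by rw [hdet]; exact isUnit_one)
  exact ⟨hu.unit, mem_specialIsometry_iff.2 ⟨h, hdet⟩, rfl⟩

end Membership

section ComplexSections

variable {N : ℕ}

theorem coe_conjSO (g : SO (Fin N) ℂ) :
    (((conjSO N g : SO (Fin N) ℂ) : GL (Fin N) ℂ) : Matrix (Fin N) (Fin N) ℂ) =
      cj (((g : GL (Fin N) ℂ)) : Matrix (Fin N) (Fin N) ℂ) := rfl

/-- The invariant `a b⁻¹` of the coset of `(a, b)`. -/
def quot (γ : SO (Fin N) ℂ × SO (Fin N) ℂ) : Matrix (Fin N) (Fin N) ℂ :=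
  ((γ.1 : GL (Fin N) ℂ) : Matrix (Fin N) (Fin N) ℂ) *
    (((γ.2⁻¹ : SO (Fin N) ℂ) : GL (Fin N) ℂ) : Matrix (Fin N) (Fin N) ℂ)

theorem SO_mul_inv (g : SO (Fin N) ℂ) : ((g : GL (Fin N) ℂ) : Matrix (Fin N) (Fin N) ℂ) *
    (((g⁻¹ : SO (Fin N) ℂ) : GL (Fin N) ℂ) : Matrix (Fin N) (Fin N) ℂ) = 1 := by
  rw [← Units.val_mul, ← Subgroup.coe_mul, mul_inv_cancel]; rfl

theorem SO_inv_mul (g : SO (Fin N) ℂ) :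
    (((g⁻¹ : SO (Fin N) ℂ) : GL (Fin N) ℂ) : Matrix (Fin N) (Fin N) ℂ) *
      ((g : GL (Fin N) ℂ) : Matrix (Fin N) (Fin N) ℂ) = 1 := by
  rw [← Units.val_mul, ← Subgroup.coe_mul, inv_mul_cancel]; rfl

theorem KCC_eq_iff (γ δ : SO (Fin N) ℂ × SO (Fin N) ℂ) :
    (γ : (SO (Fin N) ℂ × SO (Fin N) ℂ) ⧸ KCC N) = δ ↔ quot γ = quot δ := by
  rw [QuotientGroup.eq]
  have h1 : γ⁻¹ * δ ∈ KCC N ↔ γ.1 * γ.2⁻¹ = δ.1 * δ.2⁻¹ := by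
    have : γ⁻¹ * δ ∈ KCC N ↔ γ.1⁻¹ * δ.1 = γ.2⁻¹ * δ.2 := by
      constructor
      · rintro ⟨k, hk⟩
        have e1 := congrArg Prod.fst hk
        have e2 := congrArg Prod.snd hk
        exact (e1.symm.trans e2)
      · intro h
        exact ⟨γ.1⁻¹ * δ.1, Prod.ext rfl h⟩
    rw [this]
    constructor
    · intro h
      calc γ.1 * γ.2⁻¹ = γ.1 * (γ.2⁻¹ * δ.2) * δ.2⁻¹ := by group
        _ = δ.1 * δ.2⁻¹ := by rw [← h]; group
    · intro h
      calc γ.1⁻¹ * δ.1 = γ.1⁻¹ * (δ.1 * δ.2⁻¹) * δ.2 := by group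
        _ = γ.2⁻¹ * δ.2 := by rw [← h]; group
  rw [h1, Subtype.ext_iff, Units.ext_iff]
  rfl

theorem quot_smul (g : SO (Fin N) ℂ) (γ : SO (Fin N) ℂ × SO (Fin N) ℂ) :
    quot (inclC N g * γ) = ((g : GL (Fin N) ℂ) : Matrix (Fin N) (Fin N) ℂ) * quot γ *
      cj (((g⁻¹ : SO (Fin N) ℂ) : GL (Fin N) ℂ) : Matrix (Fin N) (Fin N) ℂ) := by
  have h : (inclC N g * γ).2⁻¹ = γ.2⁻¹ * conjSO N g⁻¹ := by
    rw [map_inv, ← mul_inv_rev]; rfl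
  simp only [quot, h, Subgroup.coe_mul, Units.val_mul, coe_conjSO]
  simp only [← Matrix.mul_assoc]
  rfl

theorem quot_smul_eq_iff (g : SO (Fin N) ℂ) (γ : SO (Fin N) ℂ × SO (Fin N) ℂ)
    (z : Matrix (Fin N) (Fin N) ℂ) : quot (inclC N g * γ) = z ↔
      ((g : GL (Fin N) ℂ) : Matrix (Fin N) (Fin N) ℂ) * quot γ =
        z * cj ((g : GL (Fin N) ℂ) : Matrix (Fin N) (Fin N) ℂ) := by
  have h1 : cj (((g⁻¹ : SO (Fin N) ℂ) : GL (Fin N) ℂ) : Matrix (Fin N) (Fin N) ℂ) *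
      cj ((g : GL (Fin N) ℂ) : Matrix (Fin N) (Fin N) ℂ) = 1 := by
    rw [← map_mul, SO_inv_mul, map_one]
  rw [quot_smul]
  constructor
  · rintro rfl
    rw [Matrix.mul_assoc _ (cj _), h1, Matrix.mul_one]
  · intro h
    rw [h, Matrix.mul_assoc, mul_eq_one_comm.1 h1, Matrix.mul_one]

/-- The points of `Γ` over twisted involutions of order dividing four. -/
def fourthC (N : ℕ) : Set (SO (Fin N) ℂ × SO (Fin N) ℂ) :=
  {γ | quot γ * cj (quot γ) * (quot γ * cj (quot γ)) = 1}

theorem quot_mul_KCC (γ : SO (Fin N) ℂ × SO (Fin N) ℂ) {k} (hk : k ∈ KCC N) :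
    quot (γ * k) = quot γ := by
  rw [← KCC_eq_iff, QuotientGroup.eq]
  simpa using hk

theorem quot_smul_mul_cj (g : SO (Fin N) ℂ) (γ : SO (Fin N) ℂ × SO (Fin N) ℂ) :
    quot (inclC N g * γ) * cj (quot (inclC N g * γ)) =
      ((g : GL (Fin N) ℂ) : Matrix (Fin N) (Fin N) ℂ) * (quot γ * cj (quot γ)) *
        (((g⁻¹ : SO (Fin N) ℂ) : GL (Fin N) ℂ) : Matrix (Fin N) (Fin N) ℂ) := by
  have h1 : cj (((g⁻¹ : SO (Fin N) ℂ) : GL (Fin N) ℂ) : Matrix (Fin N) (Fin N) ℂ) *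
      cj ((g : GL (Fin N) ℂ) : Matrix (Fin N) (Fin N) ℂ) = 1 := by
    rw [← map_mul, SO_inv_mul, map_one]
  rw [quot_smul]
  simp only [map_mul, cj_cj]
  simp only [Matrix.mul_assoc]
  rw [← Matrix.mul_assoc (cj _) (cj _), h1, Matrix.one_mul]

theorem smul_mem_fourthC (g : SO (Fin N) ℂ) {γ} (hγ : γ ∈ fourthC N) :
    inclC N g * γ ∈ fourthC N := by
  change _ = _ at hγ
  change _ = _
  rw [quot_smul_mul_cj]
  set X := quot γ * cj (quot γ)
  set a := ((g : GL (Fin N) ℂ) : Matrix (Fin N) (Fin N) ℂ)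
  set b := (((g⁻¹ : SO (Fin N) ℂ) : GL (Fin N) ℂ) : Matrix (Fin N) (Fin N) ℂ)
  have hba : b * a = 1 := SO_inv_mul g
  calc a * X * b * (a * X * b) = a * (X * (b * a) * X) * b := by simp only [Matrix.mul_assoc]
    _ = 1 := by rw [hba, Matrix.mul_one, hγ, Matrix.mul_one, SO_mul_inv]

theorem quot_transpose_mul (γ : SO (Fin N) ℂ × SO (Fin N) ℂ) : (quot γ)ᵀ * quot γ = 1 := by
  have h := (mem_SO_iff.1 (γ.1 * γ.2⁻¹).2).1
  exact h

theorem continuous_quot : Continuous (quot : SO (Fin N) ℂ × SO (Fin N) ℂ → _) := by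
  refine Continuous.matrix_mul ?_ ?_
  · exact continuous_GL_val.comp (continuous_subtype_val.comp continuous_fst)
  · exact continuous_GL_val.comp (continuous_subtype_val.comp continuous_snd.inv)

theorem hasLocalSections_C (N : ℕ) : HasLocalSections (inclC N) (KCC N) (fourthC N) := by
  intro γ₀ hγ₀ U hU
  obtain ⟨W, hW, hWU⟩ := exists_nhds_GL hU
  obtain ⟨P, hP1, hPc, hPo, -, hPψ⟩ :=
    exists_polar (m := Fin N) (B := 1) (by simp) (by simp)
  set z₀ := quot γ₀
  set w₀ := z₀ᵀ
  have hw₀ : w₀ * z₀ = 1 := quot_transpose_mul γ₀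
  have hzw : z₀ * w₀ = 1 := mul_eq_one_comm.1 hw₀
  have hA : Tendsto (fun γ : SO (Fin N) ℂ × SO (Fin N) ℂ => twistedMean w₀ (quot γ)) (𝓝 γ₀) (𝓝 1) := by
    have := ((continuous_twistedMean w₀).comp continuous_quot).tendsto γ₀
    rwa [Function.comp_apply, twistedMean_self hzw] at this
  have hPt : Tendsto P (𝓝 1) (𝓝 1) := by
    have := hPc.self_of_nhds.tendsto
    rwa [hP1] at this
  have hdag : ∀ z : Matrix (Fin N) (Fin N) ℂ, dag 1 z = zᵀ := fun z => by simp [dag]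
  have hψ := hPψ (cj : Matrix (Fin N) (Fin N) ℂ →+* _).toMonoidHom continuous_cj
    (fun X => cj_dag (map_one _) X) z₀ w₀ (by rw [hdag]; exact hw₀) hw₀
  have hdet : ∀ᶠ X in 𝓝 (1 : Matrix (Fin N) (Fin N) ℂ), X.det ≠ -1 := by
    have h1 : Continuous fun X : Matrix (Fin N) (Fin N) ℂ => X.det := continuous_id.matrix_det
    refine h1.continuousAt.eventually_ne ?_
    rw [Matrix.det_one]
    norm_num
  filter_upwards [hA.eventually hψ, hA.eventually hPo, (hPt.comp hA).eventually hdet,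
    (hPt.comp hA) hW] with γ h1 h2 h3 h4 hγ
  set g := P (twistedMean w₀ (quot γ))
  have h5 := h1 (quot γ) (by rw [hdag]; exact quot_transpose_mul γ)
    (twistedMean_comm hzw hγ₀ hγ)
  have hgdet : g.det = 1 := (det_sq_of_isometry isUnit_one h2).resolve_right h3
  obtain ⟨g', hg', hgg'⟩ := exists_mem_specialIsometry h2 hgdet
  refine ⟨⟨g', hg'⟩, hWU _ (by rw [hgg']; exact h4), ?_⟩
  rw [KCC_eq_iff, eq_comm, quot_smul_eq_iff]
  change (g' : Matrix (Fin N) (Fin N) ℂ) * z₀ = quot γ * cj (g' : Matrix (Fin N) (Fin N) ℂ)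
  rw [hgg']
  calc g * z₀ = (quot γ * cj g * w₀) * z₀ := congrArg (· * z₀) h5.symm
    _ = quot γ * cj g := by rw [Matrix.mul_assoc, hw₀, Matrix.mul_one]

end ComplexSections

theorem eq_zero_of_eq_neg {m n 𝕜 : Type} [RCLike 𝕜] {X : Matrix m n 𝕜} (h : X = -X) : X = 0 := by
  ext i j
  exact self_eq_neg.1 (congrFun (congrFun h i) j)

section RealSections

variable {p q : ℕ}

/-- The form `∑ xᵢ² - ∑ yⱼ²` over `R`. -/
abbrev ID (p q : ℕ) (R : Type) [CommRing R] : Matrix (Fin p ⊕ Fin q) (Fin p ⊕ Fin q) R :=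
  LieAlgebra.Orthogonal.indefiniteDiagonal (Fin p) (Fin q) R

theorem ID_eq_diagonal (R : Type) [CommRing R] :
    ID p q R = Matrix.diagonal (Sum.elim (fun _ => 1) fun _ => -1) := rfl

theorem ID_eq (R : Type) [CommRing R] : ID p q R = Matrix.fromBlocks 1 0 0 (-1) := by
  ext (i | i) (j | j) <;>
    simp [LieAlgebra.Orthogonal.indefiniteDiagonal, Matrix.diagonal_apply, Matrix.one_apply,
      apply_ite (fun x : R => -x)]

theorem ID_mul_self (R : Type) [CommRing R] : ID p q R * ID p q R = 1 := by
  rw [ID_eq, Matrix.fromBlocks_multiply]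
  simp

theorem ID_transpose (R : Type) [CommRing R] : (ID p q R)ᵀ = ID p q R := by
  rw [ID_eq, Matrix.fromBlocks_transpose]
  simp

theorem isUnit_ID (R : Type) [CommRing R] : IsUnit (ID p q R) :=
  IsUnit.of_mul_eq_one _ (ID_mul_self R)

/-- The entrywise inclusion of real matrices into complex matrices. -/
noncomputable abbrev cx {m : Type} [Fintype m] [DecidableEq m] : Matrix m m ℝ →+* Matrix m m ℂ :=
  Complex.ofRealHom.mapMatrix

theorem cx_apply {m : Type} [Fintype m] [DecidableEq m] (X : Matrix m m ℝ) (i j : m) :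
    cx X i j = (X i j : ℂ) := rfl

theorem cx_injective {m : Type} [Fintype m] [DecidableEq m] :
    Function.Injective (cx : Matrix m m ℝ → Matrix m m ℂ) := fun X Y h => by
  ext i j
  have := congrFun (congrFun h i) j
  simpa using this

theorem cx_transpose {m : Type} [Fintype m] [DecidableEq m] (X : Matrix m m ℝ) : cx Xᵀ = (cx X)ᵀ := rfl

theorem continuous_cx {m : Type} [Fintype m] [DecidableEq m] :
    Continuous (cx : Matrix m m ℝ → Matrix m m ℂ) :=
  continuous_id.matrix_map Complex.continuous_ofReal

theorem cj_cx {m : Type} [Fintype m] [DecidableEq m] (X : Matrix m m ℝ) : cj (cx X) = cx X := by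
  ext i j; simp

theorem exists_cx_eq {m : Type} [Fintype m] [DecidableEq m] {X : Matrix m m ℂ} (h : cj X = X) :
    ∃ Y, cx Y = X := by
  refine ⟨X.map Complex.re, ?_⟩
  ext i j
  have h1 : (starRingEnd ℂ) (X i j) = X i j := congrFun (congrFun h i) j
  exact Complex.conj_eq_iff_re.1 h1

theorem cx_ID : cx (ID p q ℝ) = ID p q ℂ := map_indefiniteDiagonal p q

theorem cj_ID : cj (ID p q ℂ) = ID p q ℂ := by rw [← cx_ID, cj_cx]

theorem det_cx {m : Type} [Fintype m] [DecidableEq m] (X : Matrix m m ℝ) : (cx X).det = (X.det : ℂ) :=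
  (RingHom.map_det Complex.ofRealHom X).symm

theorem mem_SOpq_iff {R : Type} [CommRing R] {g : GL (Fin p ⊕ Fin q) R} : g ∈ SOpq p q R ↔
    (g : Matrix (Fin p ⊕ Fin q) (Fin p ⊕ Fin q) R)ᵀ * ID p q R *
      (g : Matrix (Fin p ⊕ Fin q) (Fin p ⊕ Fin q) R) = ID p q R ∧
      (g : Matrix (Fin p ⊕ Fin q) (Fin p ⊕ Fin q) R).det = 1 :=
  mem_specialIsometry_iff

theorem det_ne_neg_one_near {m : Type} [Fintype m] [DecidableEq m] :
    ∀ᶠ X in 𝓝 (1 : Matrix m m ℂ), X.det ≠ -1 := by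
  have h1 : Continuous fun X : Matrix m m ℂ => X.det := continuous_id.matrix_det
  refine h1.continuousAt.eventually_ne ?_
  rw [Matrix.det_one]
  norm_num

/-- A real orthogonal matrix that is the value of a polar projection. -/
theorem exists_real_of_polar {g : Matrix (Fin p ⊕ Fin q) (Fin p ⊕ Fin q) ℂ}
    (h1 : gᵀ * ID p q ℂ * g = ID p q ℂ) (h2 : cj g = g) (h3 : g.det ≠ -1) :
    ∃ g' ∈ SOpq p q ℝ, cx (g' : Matrix (Fin p ⊕ Fin q) (Fin p ⊕ Fin q) ℝ) = g := by
  obtain ⟨Y, rfl⟩ := exists_cx_eq h2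
  have h4 : Yᵀ * ID p q ℝ * Y = ID p q ℝ := by
    apply cx_injective
    rw [map_mul, map_mul, cx_transpose, cx_ID, h1]
  have h5 : Y.det = 1 := by
    refine (det_sq_of_isometry (isUnit_ID ℝ) h4).resolve_right fun h => h3 ?_
    rw [det_cx, h]; simp
  obtain ⟨g', hg', rfl⟩ := exists_mem_specialIsometry h4 h5
  exact ⟨g', hg', rfl⟩

/-- Isometries close to the identity lie in the identity component. -/
theorem exists_nhds_SOe : ∃ W ∈ 𝓝 (1 : Matrix (Fin p ⊕ Fin q) (Fin p ⊕ Fin q) ℂ),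
    ∀ g ∈ SOpq p q ℝ, cx (g : Matrix (Fin p ⊕ Fin q) (Fin p ⊕ Fin q) ℝ) ∈ W → g ∈ SOe p q := by
  obtain ⟨P, hP1, hPc, hPo, hPg, hPψ⟩ :=
    exists_polar (m := Fin p ⊕ Fin q) (ID_mul_self ℂ) (ID_transpose ℂ)
  have hPt : Tendsto P (𝓝 1) (𝓝 1) := by
    have := hPc.self_of_nhds.tendsto
    rwa [hP1] at this
  have hψ := hPψ (cj : Matrix (Fin p ⊕ Fin q) (Fin p ⊕ Fin q) ℂ →+* _).toMonoidHom continuous_cj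
    (fun X => cj_dag cj_ID X) 1 1 (by rw [dag_one (ID_mul_self ℂ), Matrix.one_mul]) (Matrix.one_mul 1)
  have hall := hPc.and (hPo.and (hψ.and (hPt.eventually det_ne_neg_one_near)))
  have : LocallyConvexSpace ℝ (Matrix (Fin p ⊕ Fin q) (Fin p ⊕ Fin q) ℂ) :=
    inferInstanceAs (LocallyConvexSpace ℝ (Fin p ⊕ Fin q → Fin p ⊕ Fin q → ℂ))
  obtain ⟨W, ⟨hW, hWc⟩, h⟩ := (LocallyConvexSpace.convex_basis (𝕜 := ℝ)
    (1 : Matrix (Fin p ⊕ Fin q) (Fin p ⊕ Fin q) ℂ)).eventually_iff.1 hall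
  refine ⟨W, hW, fun g hg hgW => ?_⟩
  obtain ⟨hg1, hg2⟩ := mem_SOpq_iff.1 hg
  set g₀ := cx (g : Matrix (Fin p ⊕ Fin q) (Fin p ⊕ Fin q) ℝ) with hg₀
  let c : ℝ → Matrix (Fin p ⊕ Fin q) (Fin p ⊕ Fin q) ℂ := fun t => (1 - t) • 1 + t • g₀
  have hc : Continuous c := by
    refine Continuous.add ?_ ?_
    · exact (continuous_const.sub continuous_id).smul continuous_const
    · exact continuous_id.smul continuous_const
  have hcW : ∀ t ∈ Set.Icc (0 : ℝ) 1, c t ∈ W := fun t ht =>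
    hWc (mem_of_mem_nhds hW) hgW (by linarith [ht.2]) ht.1 (by ring)
  have hPc' : ContinuousOn (fun t => (P (c t)).map Complex.re) (Set.Icc 0 1) := by
    intro t ht
    have h1 : ContinuousAt (fun t => P (c t)) t :=
      ContinuousAt.comp (g := P) (h (hcW t ht)).1 hc.continuousAt
    exact ((continuous_id.matrix_map Complex.continuous_re).continuousAt.comp h1).continuousWithinAt
  have hcre : ∀ t ∈ Set.Icc (0 : ℝ) 1, ∃ g' ∈ SOpq p q ℝ,
      cx (g' : Matrix (Fin p ⊕ Fin q) (Fin p ⊕ Fin q) ℝ) = P (c t) := by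
    intro t ht
    obtain ⟨-, h1, h2, h3⟩ := h (hcW t ht)
    refine exists_real_of_polar h1 ?_ h3
    have h4 := h2 1 (by rw [dag_one (ID_mul_self ℂ), Matrix.one_mul]) (by
      rw [Matrix.one_mul, Matrix.mul_one]
      change cj (c t) = c t
      simp only [c, map_add, cj_smul_real, map_one, hg₀, cj_cx])
    rw [Matrix.one_mul, Matrix.mul_one] at h4
    exact h4
  have hre : ∀ Y : Matrix (Fin p ⊕ Fin q) (Fin p ⊕ Fin q) ℝ, (cx Y).map Complex.re = Y := by
    intro Y; ext i j; simp
  let C : Set (GL (Fin p ⊕ Fin q) ℝ) := {g' | ∃ t ∈ Set.Icc (0 : ℝ) 1,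
    (g' : Matrix (Fin p ⊕ Fin q) (Fin p ⊕ Fin q) ℝ) = (P (c t)).map Complex.re}
  have hC : IsPreconnected C := by
    apply isPreconnected_of_val
    convert isPreconnected_Icc.image _ hPc' using 1
    ext Y
    constructor
    · rintro ⟨g', ⟨t, ht, h1⟩, rfl⟩
      exact ⟨t, ht, h1.symm⟩
    · rintro ⟨t, ht, rfl⟩
      obtain ⟨g', -, hg''⟩ := hcre t ht
      have e : (P (c t)).map Complex.re = g' := by rw [← hg'', hre]
      exact ⟨g', ⟨t, ht, e.symm⟩, e.symm⟩
  have hCL : C ⊆ SOpq p q ℝ := by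
    rintro g' ⟨t, ht, h1⟩
    obtain ⟨g'', hg''1, hg''2⟩ := hcre t ht
    rw [← hg''2, hre] at h1
    rwa [Units.ext h1]
  have h1 : (1 : GL (Fin p ⊕ Fin q) ℝ) ∈ C := by
    refine ⟨0, ⟨le_rfl, zero_le_one⟩, ?_⟩
    simp only [c, sub_zero, one_smul, zero_smul, add_zero, hP1]
    rw [← map_one cx, hre, Units.val_one]
  refine subset_idComp hC h1 hCL ⟨1, ⟨zero_le_one, le_rfl⟩, ?_⟩
  simp only [c, sub_self, one_smul, zero_smul, zero_add]
  rw [hPg g₀, hg₀, hre]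
  rw [hg₀, ← cx_transpose, ← cx_ID, ← map_mul, ← map_mul, hg1]

/-- The matrix of an element of the complexified group. -/
abbrev mat (γ : SOpq p q ℂ) : Matrix (Fin p ⊕ Fin q) (Fin p ⊕ Fin q) ℂ :=
  ((γ : GL (Fin p ⊕ Fin q) ℂ) : Matrix (Fin p ⊕ Fin q) (Fin p ⊕ Fin q) ℂ)

/-- The real matrix of an element of `SO_e(p,q)`. -/
abbrev matR (g : SOe p q) : Matrix (Fin p ⊕ Fin q) (Fin p ⊕ Fin q) ℝ :=
  ((g : GL (Fin p ⊕ Fin q) ℝ) : Matrix (Fin p ⊕ Fin q) (Fin p ⊕ Fin q) ℝ)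

theorem mat_inclR (g : SOe p q) : mat (inclR p q g) = cx (matR g) := rfl

theorem mat_mul (γ δ : SOpq p q ℂ) : mat (γ * δ) = mat γ * mat δ := rfl

theorem mat_one : mat (1 : SOpq p q ℂ) = 1 := rfl

theorem mat_mul_inv (γ : SOpq p q ℂ) : mat γ * mat γ⁻¹ = 1 := by
  rw [← mat_mul, mul_inv_cancel, mat_one]

theorem mat_inv_mul (γ : SOpq p q ℂ) : mat γ⁻¹ * mat γ = 1 := by
  rw [← mat_mul, inv_mul_cancel, mat_one]

theorem continuous_mat : Continuous (mat : SOpq p q ℂ → _) :=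
  continuous_GL_val.comp continuous_subtype_val

/-- `K_ℂ` consists of the elements that commute with the form and whose first block has
determinant one. -/
theorem mem_KCR_iff (k : SOpq p q ℂ) : k ∈ KCR p q ↔
    mat k * ID p q ℂ = ID p q ℂ * mat k ∧ (mat k).toBlocks₁₁.det = 1 := by
  constructor
  · rintro ⟨⟨a, d⟩, ⟨ha, -⟩, h⟩
    have h1 : mat k = Matrix.fromBlocks (a : Matrix (Fin p) (Fin p) ℂ) 0 0 (d : Matrix (Fin q) (Fin q) ℂ) :=
      congrArg Units.val h.symm
    rw [h1, ID_eq, Matrix.toBlocks_fromBlocks₁₁]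
    refine ⟨?_, (mem_SO_iff.1 ha).2⟩
    simp [Matrix.fromBlocks_multiply]
  · rintro ⟨h1, h2⟩
    obtain ⟨h3, h4⟩ := mem_SOpq_iff.1 k.2
    obtain ⟨a, b, c, d, hk⟩ : ∃ a b c d, mat k = Matrix.fromBlocks a b c d :=
      ⟨_, _, _, _, (Matrix.fromBlocks_toBlocks (mat k)).symm⟩
    change (mat k)ᵀ * ID p q ℂ * mat k = ID p q ℂ at h3
    change (mat k).det = 1 at h4
    rw [hk, ID_eq] at h1 h3
    rw [hk] at h2 h4
    simp only [Matrix.fromBlocks_multiply, Matrix.mul_one, Matrix.mul_zero, add_zero, Matrix.one_mul,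
      Matrix.zero_mul, zero_add, Matrix.mul_neg, Matrix.neg_mul, Matrix.fromBlocks_inj] at h1
    have hb : b = 0 := eq_zero_of_eq_neg h1.2.1.symm
    have hc : c = 0 := eq_zero_of_eq_neg h1.2.2.1
    subst hb hc
    simp only [Matrix.fromBlocks_transpose, Matrix.fromBlocks_multiply, Matrix.transpose_zero,
      Matrix.mul_one, Matrix.mul_zero, add_zero, Matrix.zero_mul, zero_add, Matrix.mul_neg,
      Matrix.neg_mul, Matrix.fromBlocks_inj, neg_zero, neg_inj] at h3
    rw [Matrix.toBlocks_fromBlocks₁₁] at h2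
    rw [Matrix.det_fromBlocks_zero₂₁, h2, one_mul] at h4
    obtain ⟨a', ha', rfl⟩ := exists_mem_specialIsometry (B := 1) (g := a)
      (by rw [Matrix.mul_one]; exact h3.1) h2
    obtain ⟨d', hd', rfl⟩ := exists_mem_specialIsometry (B := 1) (g := d)
      (by rw [Matrix.mul_one]; exact h3.2.2.2) h4
    refine ⟨(a', d'), ⟨ha', hd'⟩, Units.ext ?_⟩
    exact hk.symm

theorem KCR_eq_iff (γ δ : SOpq p q ℂ) : (γ : SOpq p q ℂ ⧸ KCR p q) = δ ↔
    mat (γ⁻¹ * δ) * ID p q ℂ = ID p q ℂ * mat (γ⁻¹ * δ) ∧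
      (mat (γ⁻¹ * δ)).toBlocks₁₁.det = 1 := by
  rw [QuotientGroup.eq, mem_KCR_iff]

/-- The involution `γ D γ⁻¹` attached to a coset. -/
noncomputable def invol (γ : SOpq p q ℂ) : Matrix (Fin p ⊕ Fin q) (Fin p ⊕ Fin q) ℂ :=
  mat γ * ID p q ℂ * mat γ⁻¹

theorem invol_mul_self (γ : SOpq p q ℂ) : invol γ * invol γ = 1 := by
  simp only [invol]
  calc _ = mat γ * ID p q ℂ * (mat γ⁻¹ * mat γ) * ID p q ℂ * mat γ⁻¹ := by
        simp only [Matrix.mul_assoc]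
    _ = mat γ * (ID p q ℂ * ID p q ℂ) * mat γ⁻¹ := by
        rw [mat_inv_mul, Matrix.mul_one, Matrix.mul_assoc (mat γ)]
    _ = 1 := by rw [ID_mul_self, Matrix.mul_one, mat_mul_inv]

theorem mat_inv_eq (γ : SOpq p q ℂ) : mat γ⁻¹ = dag (ID p q ℂ) (mat γ) := by
  have h := (dag_mul_self_iff (ID_mul_self ℂ) (mat γ)).2 (mem_SOpq_iff.1 γ.2).1
  calc mat γ⁻¹ = dag (ID p q ℂ) (mat γ) * mat γ * mat γ⁻¹ := by rw [h, Matrix.one_mul]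
    _ = _ := by rw [Matrix.mul_assoc, mat_mul_inv, Matrix.mul_one]

theorem dag_ID : dag (ID p q ℂ) (ID p q ℂ) = ID p q ℂ := by
  rw [dag, ID_transpose, ID_mul_self, Matrix.one_mul]

theorem dag_invol (γ : SOpq p q ℂ) : dag (ID p q ℂ) (invol γ) = invol γ := by
  have h := ID_mul_self (p := p) (q := q) ℂ
  rw [invol, mat_inv_eq, dag_mul h, dag_mul h, dag_ID, dag_dag h (ID_transpose ℂ), Matrix.mul_assoc]

theorem invol_smul (g γ : SOpq p q ℂ) : invol (g * γ) = mat g * invol γ * mat g⁻¹ := by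
  simp only [invol, mul_inv_rev, mat_mul, Matrix.mul_assoc]

theorem invol_eq_iff (γ δ : SOpq p q ℂ) :
    invol γ = invol δ ↔ mat (γ⁻¹ * δ) * ID p q ℂ = ID p q ℂ * mat (γ⁻¹ * δ) := by
  constructor
  · intro h
    have h1 : mat δ * ID p q ℂ = invol γ * mat δ := by
      rw [h, invol, Matrix.mul_assoc _ _ (mat δ), mat_inv_mul, Matrix.mul_one]
    rw [mat_mul, Matrix.mul_assoc, h1, invol]
    simp only [← Matrix.mul_assoc]
    rw [mat_inv_mul, Matrix.one_mul]
  · intro h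
    have h2 : mat γ * mat (γ⁻¹ * δ) = mat δ := by rw [← mat_mul, mul_inv_cancel_left]
    have h3 : mat (γ⁻¹ * δ) * mat (δ⁻¹) = mat γ⁻¹ := by rw [← mat_mul, mul_assoc, mul_inv_cancel, mul_one]
    rw [invol, invol, ← h3, ← h2]
    simp only [← Matrix.mul_assoc]
    rw [Matrix.mul_assoc (mat γ) (ID p q ℂ), ← h, ← Matrix.mul_assoc (mat γ)]

theorem invol_mul_KCR (γ : SOpq p q ℂ) {k} (hk : k ∈ KCR p q) : invol (γ * k) = invol γ := by
  rw [eq_comm, invol_eq_iff, inv_mul_cancel_left]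
  exact ((mem_KCR_iff k).1 hk).1

theorem continuous_invol : Continuous (invol : SOpq p q ℂ → _) := by
  refine Continuous.matrix_mul ?_ ?_
  · exact continuous_mat.matrix_mul continuous_const
  · exact continuous_mat.comp continuous_inv

/-- The points of `Γ` over involutions that commute with their complex conjugates. -/
def fourthR (p q : ℕ) : Set (SOpq p q ℂ) :=
  {γ | invol γ * cj (invol γ) * (invol γ * cj (invol γ)) = 1}

theorem cj_mat_inclR (g : SOe p q) : cj (mat (inclR p q g)) = mat (inclR p q g) := by
  rw [mat_inclR, cj_cx]

theorem smul_mem_fourthR (g : SOe p q) {γ} (hγ : γ ∈ fourthR p q) :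
    inclR p q g * γ ∈ fourthR p q := by
  change _ = _ at hγ
  change _ = _
  rw [invol_smul, map_mul, map_mul, cj_mat_inclR, ← map_inv, cj_mat_inclR, map_inv]
  set a := mat (inclR p q g)
  set b := mat (inclR p q g)⁻¹
  have hba : b * a = 1 := mat_inv_mul _
  have hab : a * b = 1 := mat_mul_inv _
  set x := invol γ
  set y := cj (invol γ)
  calc a * x * b * (a * y * b) * (a * x * b * (a * y * b))
      = a * x * (b * a) * y * (b * a) * x * (b * a) * y * b := by simp only [Matrix.mul_assoc]
    _ = a * (x * y * (x * y)) * b := by rw [hba]; simp only [Matrix.mul_one, Matrix.mul_assoc]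
    _ = 1 := by rw [hγ, Matrix.mul_one, hab]

theorem hasLocalSections_R (p q : ℕ) : HasLocalSections (inclR p q) (KCR p q) (fourthR p q) := by
  intro γ₀ hγ₀ U hU
  obtain ⟨W, hW, hWU⟩ := exists_nhds_GL hU
  obtain ⟨W', hW', hWe⟩ := exists_nhds_SOe (p := p) (q := q)
  obtain ⟨P, hP1, hPc, hPo, -, hPψ⟩ :=
    exists_polar (m := Fin p ⊕ Fin q) (ID_mul_self ℂ) (ID_transpose ℂ)
  set z₀ := invol γ₀
  have hz₀ : z₀ * z₀ = 1 := invol_mul_self γ₀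
  have hA : Tendsto (fun γ : SOpq p q ℂ => involutionMean z₀ (invol γ)) (𝓝 γ₀) (𝓝 1) := by
    have := ((continuous_involutionMean z₀).comp continuous_invol).tendsto γ₀
    rwa [Function.comp_apply, involutionMean_self hz₀] at this
  have hPt : Tendsto P (𝓝 1) (𝓝 1) := by
    have := hPc.self_of_nhds.tendsto
    rwa [hP1] at this
  have hψ := hPψ (cj : Matrix (Fin p ⊕ Fin q) (Fin p ⊕ Fin q) ℂ →+* _).toMonoidHom continuous_cj
    (fun X => cj_dag cj_ID X) 1 1 (by rw [dag_one (ID_mul_self ℂ), Matrix.one_mul]) (Matrix.one_mul 1)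
  have hψ' := hPψ (MonoidHom.id _) continuous_id (fun _ => rfl) z₀ z₀
    (by rw [dag_invol, hz₀]) hz₀
  have hre : Continuous fun X : Matrix (Fin p ⊕ Fin q) (Fin p ⊕ Fin q) ℂ => X.map Complex.re :=
    continuous_id.matrix_map Complex.continuous_re
  have hWre : ∀ᶠ X in 𝓝 (1 : Matrix (Fin p ⊕ Fin q) (Fin p ⊕ Fin q) ℂ), X.map Complex.re ∈ W := by
    refine hre.continuousAt.eventually_mem ?_
    have : (1 : Matrix (Fin p ⊕ Fin q) (Fin p ⊕ Fin q) ℂ).map Complex.re = 1 :=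
      Matrix.map_one _ Complex.zero_re Complex.one_re
    rwa [this]
  have hPA := hPt.comp hA
  have hk : Tendsto (fun γ : SOpq p q ℂ => mat γ⁻¹ * P (involutionMean z₀ (invol γ)) * mat γ₀)
      (𝓝 γ₀) (𝓝 1) := by
    have h1 := ((continuous_mat.comp continuous_inv).tendsto γ₀)
    have h2 := (h1.mul hPA).mul_const (mat γ₀)
    rw [Matrix.mul_one, Function.comp_apply, mat_inv_mul] at h2
    exact h2
  have hdet : ∀ᶠ X in 𝓝 (1 : Matrix (Fin p ⊕ Fin q) (Fin p ⊕ Fin q) ℂ), X.toBlocks₁₁.det ≠ -1 := by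
    have h1 : Continuous fun X : Matrix (Fin p ⊕ Fin q) (Fin p ⊕ Fin q) ℂ => X.toBlocks₁₁.det :=
      (continuous_id.matrix_submatrix Sum.inl Sum.inl).matrix_det
    refine h1.continuousAt.eventually_ne ?_
    rw [← Matrix.fromBlocks_one, Matrix.toBlocks_fromBlocks₁₁, Matrix.det_one]
    norm_num
  filter_upwards [hA.eventually hψ, hA.eventually hψ', hA.eventually hPo,
    hPA.eventually det_ne_neg_one_near, hPA.eventually hWre, hPA hW', hk.eventually hdet]
    with γ h1 h2 h3 h4 h5 h6 h7 hγ
  set A := involutionMean z₀ (invol γ)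
  have e1 : cj (P A) = P A := by
    have := h1 1 (by rw [dag_one (ID_mul_self ℂ), Matrix.one_mul]) (by
      rw [Matrix.one_mul, Matrix.mul_one]
      exact cj_involutionMean hz₀ hγ₀ (invol_mul_self γ) hγ)
    rw [Matrix.one_mul, Matrix.mul_one] at this
    exact this
  have e2 : invol γ * P A * z₀ = P A :=
    h2 (invol γ) (by rw [dag_invol, invol_mul_self]) (involutionMean_comm hz₀ (invol_mul_self γ))
  obtain ⟨g, hg, hgP⟩ := exists_real_of_polar h3 e1 h4
  have hge : g ∈ SOe p q := hWe g hg (by rw [hgP]; exact h6)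
  refine ⟨⟨g, hge⟩, hWU _ ?_, ?_⟩
  · have : (cx (g : Matrix (Fin p ⊕ Fin q) (Fin p ⊕ Fin q) ℝ)).map Complex.re = g := by
      ext i j; simp
    change (g : Matrix (Fin p ⊕ Fin q) (Fin p ⊕ Fin q) ℝ) ∈ W
    rw [← this, hgP]
    exact h5
  · set k := γ⁻¹ * (inclR p q ⟨g, hge⟩ * γ₀)
    have hkm : mat k = mat γ⁻¹ * P A * mat γ₀ := by
      simp only [k, mat_mul, mat_inclR, Matrix.mul_assoc, ← hgP]
    have hkc : mat k * ID p q ℂ = ID p q ℂ * mat k := by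
      rw [← invol_eq_iff, invol_smul]
      have e3 : invol γ * mat (inclR p q ⟨g, hge⟩) = mat (inclR p q ⟨g, hge⟩) * z₀ := by
        have : mat (inclR p q ⟨g, hge⟩) = P A := hgP
        rw [this]
        conv_rhs => rw [← e2, Matrix.mul_assoc, hz₀, Matrix.mul_one]
      rw [← e3, Matrix.mul_assoc, mat_mul_inv, Matrix.mul_one]
    rw [KCR_eq_iff]
    refine ⟨hkc, ?_⟩
    have h8 := (mem_SOpq_iff.1 k.2).1
    change (mat k)ᵀ * ID p q ℂ * mat k = ID p q ℂ at h8
    obtain ⟨a, b, c, d, hk⟩ : ∃ a b c d, mat k = Matrix.fromBlocks a b c d :=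
      ⟨_, _, _, _, (Matrix.fromBlocks_toBlocks (mat k)).symm⟩
    rw [← hkm] at h7
    change (mat k).toBlocks₁₁.det = 1
    rw [hk, Matrix.toBlocks_fromBlocks₁₁] at h7 ⊢
    rw [hk, ID_eq] at hkc h8
    simp only [Matrix.fromBlocks_multiply, Matrix.mul_one, Matrix.mul_zero, add_zero, Matrix.one_mul,
      Matrix.zero_mul, zero_add, Matrix.mul_neg, Matrix.neg_mul, Matrix.fromBlocks_inj] at hkc
    have hc : c = 0 := eq_zero_of_eq_neg hkc.2.2.1
    subst hc
    simp only [Matrix.fromBlocks_transpose, Matrix.fromBlocks_multiply, Matrix.transpose_zero,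
      Matrix.mul_one, Matrix.mul_zero, add_zero, Matrix.zero_mul,
      Matrix.fromBlocks_inj] at h8
    exact (det_sq_of_isometry (B := 1) isUnit_one (by rw [Matrix.mul_one]; exact h8.1)).resolve_right h7

end RealSections

section OneParameter

open NormedSpace

attribute [-instance] LieRing.ofAssociativeRing

variable {A : Type*} [NormedRing A] [NormedAlgebra ℝ A] [CompleteSpace A]

theorem continuous_exp' : Continuous (exp : A → A) := by
  let _ : NormedAlgebra ℚ A := NormedAlgebra.restrictScalars ℚ ℝ A
  exact exp_continuous

theorem exp_add_smul (s t : ℝ) (X : A) : exp ((s + t) • X) = exp (s • X) * exp (t • X) := by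
  let _ : NormedAlgebra ℚ A := NormedAlgebra.restrictScalars ℚ ℝ A
  rw [add_smul]
  exact exp_add_of_commute (((Commute.refl X).smul_left s).smul_right t)

theorem exp_mul_exp_neg (X : A) : exp X * exp (-X) = 1 := by
  have h := exp_add_smul 1 (-1) X
  simpa using h.symm

theorem exp_neg_mul_exp (X : A) : exp (-X) * exp X = 1 := by
  have h := exp_add_smul (-1) 1 X
  simpa using h.symm

theorem eq_of_exp_smul_eq {X Y : A} (h : ∀ t : ℝ, exp (t • X) = exp (t • Y)) : X = Y := by
  have h1 := hasDerivAt_exp_smul_const (𝕂 := ℝ) X 0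
  have h2 := hasDerivAt_exp_smul_const (𝕂 := ℝ) Y 0
  have h3 : (fun t : ℝ => exp (t • X)) = fun t : ℝ => exp (t • Y) := funext h
  rw [h3] at h1
  simpa using h1.unique h2

/-- If a one-parameter group has an invertible mean, then it is generated by an explicit element. -/
theorem eq_exp_of_isUnit_integral {f : ℝ → A} (hf : Continuous f) (h0 : f 0 = 1)
    (hadd : ∀ s t, f (s + t) = f s * f t) {a : ℝ} (hu : IsUnit (∫ s in (0 : ℝ)..a, f s)) (t : ℝ) :
    f t = exp (t • ((f a - 1) * Ring.inverse (∫ s in (0 : ℝ)..a, f s))) := by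
  set F := ∫ s in (0 : ℝ)..a, f s
  set X := (f a - 1) * Ring.inverse F
  have h1 : ∀ t, f t * F = ∫ s in t..t + a, f s := by
    intro t
    have h := (ContinuousLinearMap.mul ℝ A (f t)).intervalIntegral_comp_comm
      (hf.intervalIntegrable (μ := MeasureTheory.volume) (0 : ℝ) a)
    simp only [ContinuousLinearMap.mul_apply'] at h
    rw [← h]
    simp only [← hadd]
    rw [intervalIntegral.integral_comp_add_left (fun x => f x), add_zero]
  have h2 : ∀ t, f t = (∫ s in t..t + a, f s) * Ring.inverse F := by
    intro t
    rw [← h1, mul_assoc, Ring.mul_inverse_cancel _ hu, mul_one]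
  have hd0 : HasDerivAt f X 0 := by
    have h3 : ∀ t, ∫ s in t..t + a, f s = (∫ s in (0 : ℝ)..t + a, f s) - ∫ s in (0 : ℝ)..t, f s := by
      intro t
      rw [eq_sub_iff_add_eq, add_comm]
      exact intervalIntegral.integral_add_adjacent_intervals (hf.intervalIntegrable _ _)
        (hf.intervalIntegrable _ _)
    have h4 : HasDerivAt (fun t => ∫ s in t..t + a, f s) (f a - 1) 0 := by
      simp only [h3]
      have h5 : HasDerivAt (fun t => ∫ s in (0 : ℝ)..t + a, f s) (f a) 0 := by
        have h6 := intervalIntegral.integral_hasDerivAt_right (hf.intervalIntegrable 0 (0 + a))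
          (hf.stronglyMeasurableAtFilter _ _) hf.continuousAt
        rw [zero_add] at h6
        have h7 := HasDerivAt.comp_add_const (f := fun u => ∫ s in (0 : ℝ)..u, f s) (f' := f a) 0 a
          (by rwa [zero_add])
        exact h7
      have h6 := intervalIntegral.integral_hasDerivAt_right (hf.intervalIntegrable 0 0)
        (hf.stronglyMeasurableAtFilter _ _) hf.continuousAt
      rw [h0] at h6
      exact h5.sub h6
    have h5 : f = fun t => (∫ s in t..t + a, f s) * Ring.inverse F := funext h2
    rw [h5]
    exact h4.mul_const _
  have hd : ∀ t, HasDerivAt f (f t * X) t := by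
    intro t
    have h3 : f = fun s => f t * f (s - t) := by
      funext s
      rw [← hadd]; congr 1; ring
    have h4 : HasDerivAt (fun s => f (s - t)) X t :=
      HasDerivAt.comp_sub_const t t (by rwa [sub_self])
    conv => arg 1; rw [h3]
    exact h4.const_mul (f t)
  have hconst : ∀ t, HasDerivAt (fun s => f s * exp (s • -X)) 0 t := by
    intro t
    have h3 := (hd t).mul (hasDerivAt_exp_smul_const' (𝕂 := ℝ) (-X) t)
    have h4 : f t * X * exp (t • -X) + f t * (-X * exp (t • -X)) = 0 := by noncomm_ring
    rwa [h4] at h3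
  have h3 := is_const_of_deriv_eq_zero (fun t => (hconst t).differentiableAt)
    (fun t => (hconst t).deriv) t 0
  simp only [h0, zero_smul, neg_zero, exp_zero, mul_one, smul_neg] at h3
  calc f t = f t * (exp (-(t • X)) * exp (t • X)) := by rw [exp_neg_mul_exp, mul_one]
    _ = exp (t • X) := by rw [← mul_assoc, h3, one_mul]

theorem exists_isUnit_integral {f : ℝ → A} (hf : Continuous f) (h0 : f 0 = 1) :
    ∃ a, IsUnit (∫ s in (0 : ℝ)..a, f s) := by
  have h1 : Tendsto (fun a : ℝ => a⁻¹ • ∫ s in (0 : ℝ)..a, f s) (𝓝[≠] 0) (𝓝 1) := by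
    have h2 := intervalIntegral.integral_hasDerivAt_right (hf.intervalIntegrable 0 0)
      (hf.stronglyMeasurableAtFilter _ _) hf.continuousAt
    rw [h0, hasDerivAt_iff_tendsto_slope] at h2
    refine h2.congr fun a => ?_
    simp [slope_def_module]
  have h2 : ∀ᶠ a : ℝ in 𝓝[≠] 0, IsUnit (a⁻¹ • ∫ s in (0 : ℝ)..a, f s) :=
    h1.eventually ((Units.isOpen (R := A)).mem_nhds isUnit_one)
  obtain ⟨a, ha, ha0⟩ := (h2.and self_mem_nhdsWithin).exists
  have ha0' : a ≠ 0 := ha0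
  have : (∫ s in (0 : ℝ)..a, f s) = (Units.mk0 a ha0') • (a⁻¹ • ∫ s in (0 : ℝ)..a, f s) := by
    rw [Units.smul_def, Units.val_mk0, smul_smul, mul_inv_cancel₀ ha0', one_smul]
  exact ⟨a, this ▸ ha.smul _⟩

/-- A continuous one-parameter group in a Banach algebra is `t ↦ exp (tX)`. -/
theorem exists_generator {f : ℝ → A} (hf : Continuous f) (h0 : f 0 = 1)
    (hadd : ∀ s t, f (s + t) = f s * f t) : ∃ X, ∀ t : ℝ, f t = exp (t • X) := by
  obtain ⟨a, ha⟩ := exists_isUnit_integral hf h0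
  exact ⟨_, eq_exp_of_isUnit_integral hf h0 hadd ha⟩

end OneParameter

section Differential

open NormedSpace

attribute [-instance] LieRing.ofAssociativeRing

variable {A : Type} [NormedRing A] [NormedAlgebra ℝ A] [CompleteSpace A]

/-- `𝔤` is the Lie algebra of the group `G` of units of `A`. -/
structure IsLieAlgebraOf (𝔤 : Submodule ℝ A) (G : Subgroup Aˣ) : Prop where
  exp_mem : ∀ X ∈ 𝔤, ∃ g ∈ G, (g : A) = exp X
  log_mem : ∀ᶠ Z in 𝓝 (0 : A), (∃ g ∈ G, (g : A) = exp Z) → Z ∈ 𝔤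
  conj_mem : ∀ g ∈ G, ∀ X ∈ 𝔤, (g : A) * X * ((g⁻¹ : Aˣ) : A) ∈ 𝔤

theorem tendsto_exp_smul_slope {V : ℝ → A} {v : A} (hV : Tendsto V (𝓝[≠] 0) (𝓝 v)) :
    Tendsto (fun t : ℝ => t⁻¹ • (exp (t • V t) - 1)) (𝓝[≠] 0) (𝓝 v) := by
  have h1 : HasFDerivAt (exp : A → A) (1 : A →L[ℝ] A) 0 := hasFDerivAt_exp_zero
  have ht : Tendsto (fun t : ℝ => t) (𝓝[≠] 0) (𝓝 0) := tendsto_id.mono_left nhdsWithin_le_nhds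
  have h2 := (hasFDerivWithinAt_univ.2 h1).lim (l := 𝓝[≠] (0 : ℝ)) (c := fun t => t⁻¹)
    (d := fun t => t • V t) (v := v) (by simpa using ht.smul hV) (by simp)
    (hV.congr' (by
      filter_upwards [self_mem_nhdsWithin] with t ht0
      have : t ≠ 0 := ht0
      rw [smul_smul, inv_mul_cancel₀ this, one_smul]))
  simpa using h2

variable {𝔤 : Submodule ℝ A} {G : Subgroup Aˣ}

theorem continuous_subgroup_units {Y : Type*} [TopologicalSpace Y] {f : Y → G} :
    Continuous f ↔ Continuous fun y => ((f y : Aˣ) : A) :=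
  ((Units.isOpenEmbedding_val (R := A)).isInducing.comp IsInducing.subtypeVal).continuous_iff

/-- The exponential map from the Lie algebra of a group. -/
noncomputable def IsLieAlgebraOf.expG (h : IsLieAlgebraOf 𝔤 G) (X : 𝔤) : G :=
  ⟨(h.exp_mem X X.2).choose, (h.exp_mem X X.2).choose_spec.1⟩

namespace IsLieAlgebraOf

theorem coe_expG (h : IsLieAlgebraOf 𝔤 G) (X : 𝔤) : ((h.expG X : Aˣ) : A) = exp (X : A) :=
  (h.exp_mem X X.2).choose_spec.2

theorem continuous_expG (h : IsLieAlgebraOf 𝔤 G) : Continuous h.expG := by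
  rw [continuous_subgroup_units]
  simp only [coe_expG]
  exact continuous_exp'.comp continuous_subtype_val

theorem expG_add_smul (h : IsLieAlgebraOf 𝔤 G) (s t : ℝ) (X : 𝔤) :
    h.expG ((s + t) • X) = h.expG (s • X) * h.expG (t • X) := by
  ext
  simp only [Subgroup.coe_mul, Units.val_mul, coe_expG, Submodule.coe_smul]
  exact exp_add_smul s t _

theorem expG_zero (h : IsLieAlgebraOf 𝔤 G) : h.expG 0 = 1 := by
  ext
  simp [coe_expG]

variable (h : IsLieAlgebraOf 𝔤 G) (σ : G ≃ₜ* G)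

theorem exists_differential (X : 𝔤) :
    ∃ Y, ∀ t : ℝ, ((σ (h.expG (t • X)) : Aˣ) : A) = exp (t • Y) := by
  refine exists_generator (f := fun t : ℝ => ((σ (h.expG (t • X)) : Aˣ) : A)) ?_ ?_ ?_
  · exact continuous_subgroup_units.1 (σ.continuous_toFun.comp
      (h.continuous_expG.comp (continuous_id.smul continuous_const)))
  · simp [expG_zero]
  · intro s t
    rw [expG_add_smul, map_mul]
    rfl

/-- The differential of an automorphism. -/
noncomputable def diff (X : 𝔤) : A := (h.exists_differential σ X).choose

theorem diff_spec (X : 𝔤) (t : ℝ) :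
    ((σ (h.expG (t • X)) : Aˣ) : A) = exp (t • h.diff σ X) :=
  (h.exists_differential σ X).choose_spec t

theorem diff_unique {X : 𝔤} {Y : A} (hY : ∀ t : ℝ, ((σ (h.expG (t • X)) : Aˣ) : A) = exp (t • Y)) :
    h.diff σ X = Y :=
  eq_of_exp_smul_eq fun t => (h.diff_spec σ X t).symm.trans (hY t)

theorem diff_smul (c : ℝ) (X : 𝔤) : h.diff σ (c • X) = c • h.diff σ X :=
  h.diff_unique σ fun t => by rw [smul_smul, diff_spec, smul_smul]

theorem diff_mem (X : 𝔤) : h.diff σ X ∈ 𝔤 := by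
  have h1 : Tendsto (fun t : ℝ => t • h.diff σ X) (𝓝[≠] 0) (𝓝 0) := by
    have : Tendsto (fun t : ℝ => t • h.diff σ X) (𝓝 0) (𝓝 ((0 : ℝ) • h.diff σ X)) :=
      (continuous_id.smul continuous_const).tendsto 0
    rw [zero_smul] at this
    exact this.mono_left nhdsWithin_le_nhds
  obtain ⟨t, ht, ht0⟩ := ((h1.eventually h.log_mem).and self_mem_nhdsWithin).exists
  have ht0' : t ≠ 0 := ht0
  have h2 := 𝔤.smul_mem t⁻¹ (ht ⟨_, (σ (h.expG (t • X))).2, h.diff_spec σ X t⟩)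
  rwa [smul_smul, inv_mul_cancel₀ ht0', one_smul] at h2

theorem continuous_diff : Continuous (h.diff σ) := by
  have hc : Continuous fun x : 𝔤 × ℝ => ((σ (h.expG (x.2 • x.1)) : Aˣ) : A) :=
    continuous_subgroup_units.1 (σ.continuous_toFun.comp
      (h.continuous_expG.comp (continuous_snd.smul continuous_fst)))
  have hf : ∀ X : 𝔤, Continuous fun t : ℝ => ((σ (h.expG (t • X)) : Aˣ) : A) := fun X =>
    hc.comp (continuous_const.prodMk continuous_id)
  rw [continuous_iff_continuousAt]
  intro X
  obtain ⟨a, ha⟩ := exists_isUnit_integral (hf X) (by simp [expG_zero])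
  have hF : Continuous fun X : 𝔤 => ∫ s in (0 : ℝ)..a, ((σ (h.expG (s • X)) : Aˣ) : A) :=
    intervalIntegral.continuous_parametric_intervalIntegral_of_continuous'
      (f := fun (X : 𝔤) (s : ℝ) => ((σ (h.expG (s • X)) : Aˣ) : A)) hc 0 a
  have h1 : ∀ᶠ X' in 𝓝 X, IsUnit (∫ s in (0 : ℝ)..a, ((σ (h.expG (s • X')) : Aˣ) : A)) :=
    hF.continuousAt.eventually ((Units.isOpen (R := A)).mem_nhds ha)
  have h2 : ∀ᶠ X' in 𝓝 X, (((σ (h.expG (a • X')) : Aˣ) : A) - 1) *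
      Ring.inverse (∫ s in (0 : ℝ)..a, ((σ (h.expG (s • X')) : Aˣ) : A)) = h.diff σ X' := by
    filter_upwards [h1] with X' hX'
    refine (h.diff_unique σ fun t => ?_).symm
    refine eq_exp_of_isUnit_integral (f := fun t : ℝ => ((σ (h.expG (t • X')) : Aˣ) : A))
      (hf X') (by simp [expG_zero]) (fun s t => ?_) hX' t
    rw [expG_add_smul, map_mul]
    rfl
  refine ContinuousAt.congr ?_ h2
  refine ContinuousAt.mul ?_ ?_
  · exact ((hc.comp (continuous_id.prodMk continuous_const)).sub continuous_const).continuousAt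
  · obtain ⟨u, hu⟩ := ha
    have := NormedRing.inverse_continuousAt u
    rw [hu] at this
    exact ContinuousAt.comp (f := fun X : 𝔤 => ∫ s in (0 : ℝ)..a, ((σ (h.expG (s • X)) : Aˣ) : A))
      this hF.continuousAt

end IsLieAlgebraOf

/-- `exp (tX) exp (tY) = exp (t W(t))` for small `t`, where `W(t) → X + Y`. -/
theorem exists_exp_mul_exp (X Y : A) : ∃ W : ℝ → A, Tendsto W (𝓝[≠] 0) (𝓝 (X + Y)) ∧
    ∀ᶠ t in 𝓝[≠] (0 : ℝ), exp (t • W t) = exp (t • X) * exp (t • Y) := by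
  have hs : HasStrictFDerivAt (exp : A → A) ((ContinuousLinearEquiv.refl ℝ A : A ≃L[ℝ] A) : A →L[ℝ] A) 0 :=
    hasStrictFDerivAt_exp_zero
  have hl := hs.to_localInverse
  have he := hs.eventually_right_inverse
  set L := hs.localInverse _ _ _
  have hP : HasDerivAt (fun t : ℝ => exp (t • X) * exp (t • Y)) (X + Y) 0 := by
    have h1 := (hasDerivAt_exp_smul_const (𝕂 := ℝ) X 0).mul (hasDerivAt_exp_smul_const (𝕂 := ℝ) Y 0)
    simp only [zero_smul, exp_zero, one_mul, mul_one] at h1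
    exact h1
  rw [exp_zero] at hl he
  have hP0 : (fun t : ℝ => exp (t • X) * exp (t • Y)) 0 = 1 := by simp
  have hL1 : L 1 = 0 := by
    have := hs.localInverse_apply_image
    rwa [exp_zero] at this
  have hLP : HasDerivAt (fun t : ℝ => L (exp (t • X) * exp (t • Y))) (X + Y) 0 := by
    have h2 : HasFDerivAt L (((ContinuousLinearEquiv.refl ℝ A : A ≃L[ℝ] A).symm : A ≃L[ℝ] A) : A →L[ℝ] A)
      ((fun t : ℝ => exp (t • X) * exp (t • Y)) 0) := by rw [hP0]; exact hl.hasFDerivAt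
    exact h2.comp_hasDerivAt 0 hP
  refine ⟨fun t => t⁻¹ • L (exp (t • X) * exp (t • Y)), ?_, ?_⟩
  · rw [hasDerivAt_iff_tendsto_slope] at hLP
    refine hLP.congr fun t => ?_
    simp [slope_def_module, hL1]
  · have h3 : Tendsto (fun t : ℝ => exp (t • X) * exp (t • Y)) (𝓝 0) (𝓝 1) := by
      rw [← hP0]
      exact hP.continuousAt.tendsto
    filter_upwards [(h3.mono_left nhdsWithin_le_nhds).eventually he, self_mem_nhdsWithin] with t ht ht0
    have ht0' : t ≠ 0 := ht0
    rw [smul_smul, mul_inv_cancel₀ ht0', one_smul]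
    exact ht

namespace IsLieAlgebraOf

variable (h : IsLieAlgebraOf 𝔤 G) (σ : G ≃ₜ* G)

theorem add_limit_mem (h : IsLieAlgebraOf 𝔤 G) {W : ℝ → A} {w : A} (hW : Tendsto W (𝓝[≠] 0) (𝓝 w))
    (hG : ∀ᶠ t in 𝓝[≠] (0 : ℝ), ∃ g ∈ G, (g : A) = exp (t • W t)) :
    ∀ᶠ t in 𝓝[≠] (0 : ℝ), W t ∈ 𝔤 := by
  have ht : Tendsto (fun t : ℝ => t) (𝓝[≠] 0) (𝓝 0) := tendsto_id.mono_left nhdsWithin_le_nhds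
  have h1 : Tendsto (fun t => t • W t) (𝓝[≠] (0 : ℝ)) (𝓝 0) := by simpa using ht.smul hW
  filter_upwards [h1.eventually h.log_mem, hG, self_mem_nhdsWithin] with t h2 h3 h4
  have h4' : t ≠ 0 := h4
  have h5 := 𝔤.smul_mem t⁻¹ (h2 h3)
  rwa [smul_smul, inv_mul_cancel₀ h4', one_smul] at h5

theorem diff_add [FiniteDimensional ℝ A] (X Y : 𝔤) :
    h.diff σ (X + Y) = h.diff σ X + h.diff σ Y := by
  obtain ⟨W, hW, hexp⟩ := exists_exp_mul_exp (X : A) (Y : A)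
  have hmem : ∀ᶠ t in 𝓝[≠] (0 : ℝ), W t ∈ 𝔤 := by
    refine h.add_limit_mem hW ?_
    filter_upwards [hexp] with t ht
    refine ⟨(h.expG (t • X) * h.expG (t • Y) : G), Subtype.property _, ?_⟩
    rw [ht]
    simp [coe_expG]
  classical
  let W' : ℝ → 𝔤 := fun t => if ht : W t ∈ 𝔤 then ⟨W t, ht⟩ else X + Y
  have hW' : Tendsto W' (𝓝[≠] 0) (𝓝 (X + Y)) := by
    rw [tendsto_subtype_rng]
    refine hW.congr' ?_
    filter_upwards [hmem] with t ht
    simp [W', ht]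
  have hD : Tendsto (fun t => h.diff σ (W' t)) (𝓝[≠] 0) (𝓝 (h.diff σ (X + Y))) :=
    ((h.continuous_diff σ).tendsto _).comp hW'
  have h1 := tendsto_exp_smul_slope hD
  have h2 : HasDerivAt (fun t : ℝ => exp (t • h.diff σ X) * exp (t • h.diff σ Y))
      (h.diff σ X + h.diff σ Y) 0 := by
    have h1 := (hasDerivAt_exp_smul_const (𝕂 := ℝ) (h.diff σ X) 0).mul
      (hasDerivAt_exp_smul_const (𝕂 := ℝ) (h.diff σ Y) 0)
    simp only [zero_smul, exp_zero, one_mul, mul_one] at h1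
    exact h1
  rw [hasDerivAt_iff_tendsto_slope] at h2
  refine tendsto_nhds_unique h1 (h2.congr' ?_)
  filter_upwards [hmem, hexp] with t ht ht2
  have h3 : (h.expG (t • W' t) : G) = h.expG (t • X) * h.expG (t • Y) := by
    ext
    simp [coe_expG, W', ht, ht2]
  rw [← diff_spec, h3, map_mul, Subgroup.coe_mul, Units.val_mul, diff_spec, diff_spec]
  simp [slope_def_module]

/-- The differential, as an endomorphism of the Lie algebra. -/
noncomputable def diffLin [FiniteDimensional ℝ A] : 𝔤 →ₗ[ℝ] 𝔤 where
  toFun X := ⟨h.diff σ X, h.diff_mem σ X⟩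
  map_add' X Y := Subtype.ext (h.diff_add σ X Y)
  map_smul' c X := Subtype.ext (h.diff_smul σ c X)

variable [FiniteDimensional ℝ A]

theorem diffLin_spec (X : 𝔤) (t : ℝ) : σ (h.expG (t • X)) = h.expG (t • h.diffLin σ X) := by
  ext
  rw [diff_spec, coe_expG]
  rfl

theorem diffLin_unique {X Y : 𝔤} (hY : ∀ t : ℝ, σ (h.expG (t • X)) = h.expG (t • Y)) :
    h.diffLin σ X = Y :=
  Subtype.ext (h.diff_unique σ fun t => by rw [hY, coe_expG]; rfl)

theorem diffLin_diffLin (hσ : ∀ g, σ (σ g) = g) (X : 𝔤) : h.diffLin σ (h.diffLin σ X) = X :=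
  h.diffLin_unique σ fun t => by rw [← diffLin_spec, hσ]

/-- The adjoint action. -/
def Ad (g : G) : 𝔤 →ₗ[ℝ] 𝔤 where
  toFun X := ⟨((g : Aˣ) : A) * X * (((g : Aˣ)⁻¹ : Aˣ) : A), h.conj_mem g g.2 X X.2⟩
  map_add' X Y := Subtype.ext (by simp [mul_add, add_mul])
  map_smul' c X := Subtype.ext (by simp)

theorem expG_Ad (g : G) (X : 𝔤) : h.expG (h.Ad g X) = g * h.expG X * g⁻¹ := by
  let _ : NormedAlgebra ℚ A := NormedAlgebra.restrictScalars ℚ ℝ A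
  ext
  simp only [coe_expG, Subgroup.coe_mul, Units.val_mul, Subgroup.coe_inv]
  exact exp_units_conj (g : Aˣ) (X : A)

theorem diffLin_Ad (g : G) (X : 𝔤) : h.diffLin σ (h.Ad g X) = h.Ad (σ g) (h.diffLin σ X) :=
  h.diffLin_unique σ fun t => by
    rw [← map_smul, ← map_smul, expG_Ad, expG_Ad, map_mul, map_mul, diffLin_spec, map_inv]

theorem hasDerivAt_Ad (X Y : 𝔤) :
    HasDerivAt (fun t : ℝ => ((h.Ad (h.expG (t • X)) Y : 𝔤) : A)) ((X : A) * Y - Y * X) 0 := by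
  have h0 : ∀ t : ℝ, ((h.Ad (h.expG (t • X)) Y : 𝔤) : A) =
      exp (t • (X : A)) * Y * exp (t • -(X : A)) := by
    intro t
    change ((h.expG (t • X) : Aˣ) : A) * Y * (((h.expG (t • X) : Aˣ)⁻¹ : Aˣ) : A) = _
    have h2 : (((h.expG (t • X) : Aˣ)⁻¹ : Aˣ) : A) = exp (t • -(X : A)) := by
      rw [← mul_one (((h.expG (t • X) : Aˣ)⁻¹ : Aˣ) : A), ← exp_mul_exp_neg (t • (X : A)),
        ← mul_assoc, ← Submodule.coe_smul, ← coe_expG h, Units.inv_mul, one_mul, smul_neg,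
        Submodule.coe_smul]
    rw [h2, coe_expG]
    rfl
  have h1 := ((hasDerivAt_exp_smul_const (𝕂 := ℝ) (X : A) 0).mul_const (Y : A)).mul
    (hasDerivAt_exp_smul_const (𝕂 := ℝ) (-(X : A)) 0)
  simp only [h0]
  simp only [zero_smul, exp_zero, one_mul, mul_one, mul_neg, ← sub_eq_add_neg] at h1
  exact h1

theorem lie_mem (h : IsLieAlgebraOf 𝔤 G) (X Y : 𝔤) : (X : A) * Y - Y * X ∈ 𝔤 := by
  have h1 := h.hasDerivAt_Ad X Y
  rw [hasDerivAt_iff_tendsto_slope] at h1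
  refine (Submodule.closed_of_finiteDimensional 𝔤).mem_of_tendsto h1 (Eventually.of_forall fun t => ?_)
  exact 𝔤.smul_mem _ (𝔤.sub_mem (Subtype.property _) (Subtype.property _))

theorem diffLin_lie (X Y : 𝔤) :
    (h.diffLin σ ⟨(X : A) * Y - Y * X, h.lie_mem X Y⟩ : A) =
      (h.diffLin σ X : A) * h.diffLin σ Y - h.diffLin σ Y * h.diffLin σ X := by
  have h1 := h.hasDerivAt_Ad X Y
  have h2 := h.hasDerivAt_Ad (h.diffLin σ X) (h.diffLin σ Y)
  have h3 : HasDerivAt (fun t : ℝ => h.Ad (h.expG (t • X)) Y) ⟨(X : A) * Y - Y * X, h.lie_mem X Y⟩ 0 := by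
    rw [hasDerivAt_iff_tendsto_slope] at h1 ⊢
    rw [tendsto_subtype_rng]
    exact h1
  have h4 := ((𝔤.subtype.comp (h.diffLin σ)).toContinuousLinearMap.hasFDerivAt).comp_hasDerivAt 0 h3
  refine h4.unique (h2.congr_of_eventuallyEq (Eventually.of_forall fun t => ?_))
  change ((h.diffLin σ (h.Ad (h.expG (t • X)) Y) : 𝔤) : A) = _
  rw [diffLin_Ad, diffLin_spec]

end IsLieAlgebraOf

end Differential

section NotSymmetric

open NormedSpace

attribute [-instance] LieRing.ofAssociativeRing

variable {A : Type} [NormedRing A] [NormedAlgebra ℝ A] [CompleteSpace A] [FiniteDimensional ℝ A]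
variable {𝔤 : Submodule ℝ A} {G : Subgroup Aˣ}

/-- A subgroup whose Lie algebra `𝔥` is contained in the even part of a `ℤ/2`-grading of `𝔤` (given
by an element `c`), but does not contain the brackets of odd elements, is not symmetric, provided
that no element of `𝔥` commutes with the odd part, in the weak sense of `hnd`. -/
theorem IsLieAlgebraOf.not_isSymmetricSubgroup (h : IsLieAlgebraOf 𝔤 G) (H : Subgroup G)
    (𝔥 : Submodule ℝ A) (c : A) (hcc : c * c = 1)
    (h𝔥 : ∀ X ∈ 𝔤, (∀ t : ℝ, ∃ g ∈ H, ((g : Aˣ) : A) = exp (t • X)) → X ∈ 𝔥)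
    (heven : ∀ X ∈ 𝔥, c * X = X * c)
    (τ : A →ₗ[ℝ] ℝ) (hτ : ∀ x y, τ (x * y) = τ (y * x))
    (hnd : ∀ Z ∈ 𝔥, Z ∈ 𝔤 → (∀ X ∈ 𝔤, ∀ Y ∈ 𝔤, c * X = -(X * c) → c * Y = -(Y * c) →
      τ ((Z * X - X * Z) * Y) = 0) → Z = 0)
    (hne : ∃ X ∈ 𝔤, ∃ Y ∈ 𝔤, c * X = -(X * c) ∧ c * Y = -(Y * c) ∧ X * Y - Y * X ∉ 𝔥) :
    ¬ IsSymmetricSubgroup H := by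
  rintro ⟨σ, hσ, hle, -⟩
  have hfix : ∀ X : 𝔤, h.diffLin σ X = X → (X : A) ∈ 𝔥 := by
    intro X hX
    refine h𝔥 X X.2 fun t => ⟨h.expG (t • X), hle ?_, h.coe_expG _⟩
    refine subset_idComp (C := Set.range fun s : ℝ => h.expG (s • X))
      (isPreconnected_range (h.continuous_expG.comp (continuous_id.smul continuous_const)))
      ⟨0, by simp [h.expG_zero]⟩ ?_ ⟨t, rfl⟩
    rintro _ ⟨s, rfl⟩
    change σ _ = _
    rw [h.diffLin_spec, hX]
  have hev : ∀ X : 𝔤, (X : A) + h.diffLin σ X ∈ 𝔥 := fun X => hfix (X + h.diffLin σ X) <| by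
    rw [map_add, h.diffLin_diffLin σ hσ, add_comm]
  have hsym : ∀ X Y : 𝔤, c * (X : A) = -(X * c) → c * (Y : A) = -(Y * c) →
      ((X : A) + h.diffLin σ X) * Y - Y * (X + h.diffLin σ X) =
      ((Y : A) + h.diffLin σ Y) * X - X * (Y + h.diffLin σ Y) := by
    intro X Y hX hY
    have h1 := heven _ (hev ⟨(X : A) * Y - Y * X, h.lie_mem X Y⟩)
    rw [h.diffLin_lie σ X Y] at h1
    have hZ := heven _ (hev X)
    have hZ' := heven _ (hev Y)
    obtain ⟨Z, hZe⟩ : ∃ Z, (X : A) + h.diffLin σ X = Z := ⟨_, rfl⟩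
    obtain ⟨Z', hZe'⟩ : ∃ Z', (Y : A) + h.diffLin σ Y = Z' := ⟨_, rfl⟩
    rw [hZe] at hZ ⊢
    rw [hZe'] at hZ' ⊢
    rw [← eq_sub_iff_add_eq'] at hZe hZe'
    rw [hZe, hZe'] at h1
    clear hZe hZe'
    dsimp only at h1
    generalize (X : A) = x at *
    generalize (Y : A) = y at *
    have e1 : c * (Z * y - y * Z - (Z' * x - x * Z')) =
        -((Z * y - y * Z - (Z' * x - x * Z')) * c) := by
      have a1 : c * (Z * y) = -(Z * y * c) := by
        rw [← mul_assoc, hZ, mul_assoc, hY, mul_neg, mul_assoc]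
      have a2 : c * (y * Z) = -(y * Z * c) := by
        rw [← mul_assoc, hY, neg_mul, mul_assoc, hZ, mul_assoc]
      have a3 : c * (Z' * x) = -(Z' * x * c) := by
        rw [← mul_assoc, hZ', mul_assoc, hX, mul_neg, mul_assoc]
      have a4 : c * (x * Z') = -(x * Z' * c) := by
        rw [← mul_assoc, hX, neg_mul, mul_assoc, hZ', mul_assoc]
      simp only [mul_sub, sub_mul, a1, a2, a3, a4]
      abel
    have e2 : c * (Z * y - y * Z - (Z' * x - x * Z')) =
        (Z * y - y * Z - (Z' * x - x * Z')) * c := by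
      have a1 : c * (Z * Z') = Z * Z' * c := by
        rw [← mul_assoc, hZ, mul_assoc, hZ', mul_assoc]
      have a2 : c * (Z' * Z) = Z' * Z * c := by
        rw [← mul_assoc, hZ', mul_assoc, hZ, mul_assoc]
      have a3 : c * (x * y) = x * y * c := by
        rw [← mul_assoc, hX, neg_mul, mul_assoc, hY, mul_neg, neg_neg, mul_assoc]
      have a4 : c * (y * x) = y * x * c := by
        rw [← mul_assoc, hY, neg_mul, mul_assoc, hX, mul_neg, neg_neg, mul_assoc]
      have a5 : Z * y - y * Z - (Z' * x - x * Z') =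
          (2 : ℝ) • (x * y - y * x) + (Z * Z' - Z' * Z) -
            (x * y - y * x + ((Z - x) * (Z' - y) - (Z' - y) * (Z - x))) := by
        rw [two_smul]; noncomm_ring
      rw [a5, mul_sub c ((2 : ℝ) • (x * y - y * x) + (Z * Z' - Z' * Z)), sub_mul _ _ c, h1]
      congr 1
      simp only [mul_add, add_mul, mul_smul_comm, smul_mul_assoc, mul_sub, sub_mul, a1, a2, a3, a4]
    have e3 : (Z * y - y * Z - (Z' * x - x * Z')) * c = 0 := by
      have e4 := e2.symm.trans e1
      have e5 : (2 : ℝ) • ((Z * y - y * Z - (Z' * x - x * Z')) * c) = 0 := by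
        rw [two_smul]
        nth_rewrite 1 [e4]
        exact neg_add_cancel _
      exact (smul_eq_zero.1 e5).resolve_left two_ne_zero
    have e4 := congrArg (· * c) e3
    simp only [mul_assoc, hcc, mul_one, zero_mul] at e4
    exact sub_eq_zero.1 e4
  have hskew : ∀ Z X Y : A, τ ((Z * X - X * Z) * Y) = -τ ((Z * Y - Y * Z) * X) := by
    intro Z X Y
    have h1 := hτ X (Z * Y)
    have h2 := hτ (X * Z) Y
    have h3 := hτ (Z * X) Y
    simp only [sub_mul, map_sub, mul_assoc] at *
    linarith
  have hzero : ∀ X : 𝔤, c * (X : A) = -(X * c) → (X : A) + h.diffLin σ X = 0 := by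
    intro X hX
    refine hnd _ (hev X) (𝔤.add_mem X.2 (Subtype.property _)) fun Y' hY' W' hW' hY hW => ?_
    obtain ⟨Y, rfl⟩ : ∃ Y : 𝔤, (Y : A) = Y' := ⟨⟨Y', hY'⟩, rfl⟩
    obtain ⟨W, rfl⟩ : ∃ W : 𝔤, (W : A) = W' := ⟨⟨W', hW'⟩, rfl⟩
    have s1 : τ _ = τ _ := congrArg (fun E => τ (E * (W : A))) (hsym X Y hX hY)
    have s2 := hskew ((Y : A) + h.diffLin σ Y) X W
    have s3 : τ _ = τ _ := congrArg (fun E => τ (E * (X : A))) (hsym Y W hY hW)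
    have s4 := hskew ((W : A) + h.diffLin σ W) Y X
    have s5 : τ _ = τ _ := congrArg (fun E => τ (E * (Y : A))) (hsym W X hW hX)
    have s6 := hskew ((X : A) + h.diffLin σ X) W Y
    linarith
  obtain ⟨X, hX, Y, hY, hcX, hcY, hnot⟩ := hne
  have h1 := hzero ⟨X, hX⟩ hcX
  have h2 := hzero ⟨Y, hY⟩ hcY
  rw [← eq_neg_iff_add_eq_zero, eq_comm, neg_eq_iff_eq_neg] at h1 h2
  refine hnot (hfix ⟨X * Y - Y * X, h.lie_mem ⟨X, hX⟩ ⟨Y, hY⟩⟩ (Subtype.ext ?_))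
  have h3 := h.diffLin_lie σ ⟨X, hX⟩ ⟨Y, hY⟩
  rw [h1, h2] at h3
  rw [h3]
  simp

end NotSymmetric

section Curves

variable {m : Type} [Fintype m] [DecidableEq m] {𝕜 : Type} [RCLike 𝕜]

theorem isUnit_of_isometry {B g : Matrix m m 𝕜} (hB : IsUnit B) (h : gᵀ * B * g = B) : IsUnit g := by
  rw [Matrix.isUnit_iff_isUnit_det]
  rcases det_sq_of_isometry hB h with h1 | h1 <;> rw [h1]
  · exact isUnit_one
  · exact isUnit_one.neg

/-- A connected set of isometries containing `1` consists of isometries of determinant one. -/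
theorem det_eq_one_of_isPreconnected {B : Matrix m m 𝕜} (hB : IsUnit B) {C : Set (Matrix m m 𝕜)}
    (hC : IsPreconnected C) (h1 : 1 ∈ C) (h : ∀ g ∈ C, gᵀ * B * g = B) {g : Matrix m m 𝕜}
    (hg : g ∈ C) : g.det = 1 := by
  have h2 : IsPreconnected (Matrix.det '' C) := hC.image _ (continuous_id.matrix_det).continuousOn
  have h3 : Matrix.det '' C ⊆ ({1, -1} : Set 𝕜) := by
    rintro _ ⟨g, hg, rfl⟩
    exact det_sq_of_isometry hB (h g hg)
  have h4 : IsTotallyDisconnected ({1, -1} : Set 𝕜) :=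
    (Set.toFinite _).countable.isTotallyDisconnected
  have h5 := h4 _ h3 h2 ⟨g, hg, rfl⟩ ⟨1, h1, rfl⟩
  rwa [Matrix.det_one] at h5

theorem mem_idComp_of_curve {B : Matrix m m 𝕜} (hB : IsUnit B) {T : Type*} [TopologicalSpace T]
    {S : Set T} (hS : IsPreconnected S) {f : T → Matrix m m 𝕜} (hf : ContinuousOn f S)
    (hiso : ∀ t ∈ S, (f t)ᵀ * B * f t = B) {t₀ t₁ : T} (h₀ : t₀ ∈ S) (h₁ : t₁ ∈ S)
    (hf₀ : f t₀ = 1) {g : GL m 𝕜} (hf₁ : f t₁ = g) : g ∈ idComp (specialIsometry B) := by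
  have hC : IsPreconnected (f '' S) := hS.image _ hf
  have hiso' : ∀ g ∈ f '' S, gᵀ * B * g = B := by
    rintro _ ⟨t, ht, rfl⟩
    exact hiso t ht
  have h1 : (Units.val : GL m 𝕜 → Matrix m m 𝕜) '' {γ | (γ : Matrix m m 𝕜) ∈ f '' S} = f '' S := by
    ext M
    constructor
    · rintro ⟨γ, hγ, rfl⟩
      exact hγ
    · intro hM
      exact ⟨(isUnit_of_isometry hB (hiso' M hM)).unit, hM, rfl⟩
  refine subset_idComp (G := GL m 𝕜) (C := {γ | (γ : Matrix m m 𝕜) ∈ f '' S})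
      (isPreconnected_of_val (by rwa [h1]))
    ⟨t₀, h₀, hf₀⟩ ?_ ⟨t₁, h₁, hf₁⟩
  intro γ hγ
  exact mem_specialIsometry_iff.2 ⟨hiso' _ hγ, det_eq_one_of_isPreconnected hB hC ⟨t₀, h₀, hf₀⟩ hiso' hγ⟩

theorem idComp_bilinIsometry {B : Matrix m m 𝕜} (hB : IsUnit B) :
    idComp (bilinIsometry B) = idComp (specialIsometry B) := by
  apply le_antisymm
  · refine le_idComp (isPreconnected_idComp _) fun g hg => ?_
    have h1 : ∀ g ∈ Units.val '' ((idComp (bilinIsometry B) : Subgroup (GL m 𝕜)) : Set (GL m 𝕜)),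
        gᵀ * B * g = B := by
      rintro _ ⟨γ, hγ, rfl⟩
      exact idComp_le _ hγ
    have h2 := det_eq_one_of_isPreconnected hB
      ((isPreconnected_idComp (bilinIsometry B)).image _ continuous_GL_val.continuousOn)
      ⟨1, Subgroup.one_mem _, rfl⟩ h1 ⟨g, hg, rfl⟩
    exact mem_specialIsometry_iff.2 ⟨idComp_le _ hg, h2⟩
  · exact le_idComp (isPreconnected_idComp _) ((idComp_le _).trans inf_le_left)

end Curves

section Cayley

variable {m : Type} [Fintype m] [DecidableEq m] {𝕜 : Type} [RCLike 𝕜]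

theorem one_add_mul_one_sub_comm {R : Type*} [Ring R] (y : R) :
    (1 + y) * (1 - y) = (1 - y) * (1 + y) := by
  noncomm_ring

theorem cayley_isometry {Y : Matrix m m 𝕜} (hY : Yᵀ = -Y) (hu : IsUnit (1 + Y).det) :
    ((1 - Y) * (1 + Y)⁻¹)ᵀ * ((1 - Y) * (1 + Y)⁻¹) = 1 := by
  have h2 : (1 + Y)ᵀ = 1 - Y := by
    rw [Matrix.transpose_add, Matrix.transpose_one, hY, sub_eq_add_neg]
  have h3 : (1 - Y)ᵀ = 1 + Y := by rw [← h2, Matrix.transpose_transpose]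
  have hu' : IsUnit (1 - Y).det := by rwa [← h2, Matrix.det_transpose]
  rw [Matrix.transpose_mul, Matrix.transpose_nonsing_inv, h2, h3, Matrix.mul_assoc,
    ← Matrix.mul_assoc (1 + Y), one_add_mul_one_sub_comm, Matrix.mul_assoc,
    Matrix.mul_nonsing_inv _ hu, Matrix.mul_one, Matrix.nonsing_inv_mul _ hu']

theorem mem_idComp_SO_of_cayley {g : GL m 𝕜} (hg : (g : Matrix m m 𝕜)ᵀ * (g : Matrix m m 𝕜) = 1)
    (hu : IsUnit (1 + (g : Matrix m m 𝕜)).det)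
    (hpath : ∀ X : Matrix m m 𝕜, Xᵀ = -X → IsUnit (1 + X).det →
      ∃ S : Set 𝕜, IsPreconnected S ∧ 0 ∈ S ∧ 1 ∈ S ∧ ∀ t ∈ S, (1 + t • X).det ≠ 0) :
    g ∈ idComp (SO m 𝕜) := by
  obtain ⟨a, ha⟩ : ∃ a, (g : Matrix m m 𝕜) = a := ⟨_, rfl⟩
  rw [ha] at hg hu
  have hg' : a * aᵀ = 1 := mul_eq_one_comm.1 hg
  set b := (1 + a)⁻¹
  have hb1 : (1 + a) * b = 1 := Matrix.mul_nonsing_inv _ hu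
  have hb2 : b * (1 + a) = 1 := Matrix.nonsing_inv_mul _ hu
  set X := (1 - a) * b
  have hX1 : (1 + X) * (1 + a) = (2 : 𝕜) • 1 := by
    simp only [X, add_mul, Matrix.mul_assoc, hb2]
    rw [two_smul]; noncomm_ring
  have hX2 : 1 - X = a * (1 + X) := by
    have h2 : (1 - X) * (1 + a) = a * (1 + X) * (1 + a) := by
      rw [Matrix.mul_assoc, hX1]
      simp only [X, sub_mul, Matrix.mul_assoc, hb2]
      rw [two_smul]; noncomm_ring
    calc 1 - X = (1 - X) * (1 + a) * b := by rw [Matrix.mul_assoc, hb1, Matrix.mul_one]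
      _ = _ := by rw [h2, Matrix.mul_assoc, hb1, Matrix.mul_one]
  have hbT : bᵀ * (1 + aᵀ) = 1 := by
    have := congrArg Matrix.transpose hb1
    simpa [Matrix.transpose_mul] using this
  have hXT : Xᵀ = -X := by
    have hbT' : (1 + aᵀ) * bᵀ = 1 := by
      have := congrArg Matrix.transpose hb2
      simpa [Matrix.transpose_mul] using this
    have h2 : (1 + aᵀ) * Xᵀ = (1 + aᵀ) * -X := by
      have e1 : (1 - aᵀ) * (1 + a) = -((1 + aᵀ) * (1 - a)) := by
        simp only [mul_add, sub_mul, mul_sub, add_mul, mul_one, one_mul, hg]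
        abel
      rw [Matrix.transpose_mul, ← Matrix.mul_assoc, hbT', Matrix.one_mul, mul_neg,
        ← Matrix.mul_assoc, ← neg_mul, ← e1, Matrix.mul_assoc, hb1, Matrix.mul_one,
        Matrix.transpose_sub, Matrix.transpose_one]
    calc Xᵀ = bᵀ * (1 + aᵀ) * Xᵀ := by rw [hbT, Matrix.one_mul]
      _ = bᵀ * (1 + aᵀ) * -X := by rw [Matrix.mul_assoc, h2, Matrix.mul_assoc]
      _ = -X := by rw [hbT, Matrix.one_mul]
  have hXu : IsUnit (1 + X).det := by
    have h2 : (1 + X) * ((2 : 𝕜)⁻¹ • (1 + a)) = 1 := by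
      rw [Matrix.mul_smul, hX1, smul_smul, inv_mul_cancel₀ two_ne_zero, one_smul]
    exact (Matrix.isUnit_iff_isUnit_det _).1 (IsUnit.of_mul_eq_one _ h2)
  obtain ⟨S, hS, hS0, hS1, hSdet⟩ := hpath X hXT hXu
  refine mem_idComp_of_curve (B := 1) isUnit_one hS (f := fun t => (1 - t • X) * (1 + t • X)⁻¹)
    ?_ ?_ hS0 hS1 (by simp) ?_
  · have h1 : Continuous fun t : 𝕜 => 1 - t • X := by
      exact continuous_const.sub (continuous_id.smul continuous_const)
    have h2 : Continuous fun t : 𝕜 => 1 + t • X := by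
      exact continuous_const.add (continuous_id.smul continuous_const)
    have h3 : ContinuousOn (fun t : 𝕜 => (1 + t • X)⁻¹) S := by
      simp only [Matrix.inv_def, Ring.inverse_eq_inv']
      exact (h2.matrix_det.continuousOn.inv₀ hSdet).smul h2.matrix_adjugate.continuousOn
    have h4 : Continuous fun x : Matrix m m 𝕜 × Matrix m m 𝕜 => x.1 * x.2 :=
      continuous_fst.matrix_mul continuous_snd
    exact h4.comp_continuousOn (f := fun t : 𝕜 => (1 - t • X, (1 + t • X)⁻¹))
      (h1.continuousOn.prodMk h3)
  · intro t ht
    rw [Matrix.mul_one]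
    refine cayley_isometry (Y := t • X) ?_ (isUnit_iff_ne_zero.2 (hSdet t ht))
    rw [Matrix.transpose_smul, hXT, smul_neg]
  · rw [ha, one_smul, hX2, Matrix.mul_assoc, Matrix.mul_nonsing_inv _ hXu, Matrix.mul_one]

theorem exists_cayley_path_real (X : Matrix m m ℝ) (hX : Xᵀ = -X) :
    ∃ S : Set ℝ, IsPreconnected S ∧ 0 ∈ S ∧ 1 ∈ S ∧ ∀ t ∈ S, (1 + t • X).det ≠ 0 := by
  refine ⟨Set.univ, isPreconnected_univ, trivial, trivial, fun t _ h => ?_⟩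
  obtain ⟨v, hv, hv0⟩ := Matrix.exists_mulVec_eq_zero_iff.2 h
  have h1 : v ⬝ᵥ (X *ᵥ v) = 0 := by
    have h2 : v ⬝ᵥ (X *ᵥ v) = (Xᵀ *ᵥ v) ⬝ᵥ v := by
      rw [Matrix.dotProduct_mulVec, Matrix.mulVec_transpose]
    rw [hX, Matrix.neg_mulVec, neg_dotProduct, dotProduct_comm (X *ᵥ v)] at h2
    linarith
  have h2 := congrArg (fun w => v ⬝ᵥ w) hv0
  simp only [Matrix.add_mulVec, Matrix.one_mulVec, Matrix.smul_mulVec, dotProduct_add,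
    dotProduct_smul, h1, smul_zero, add_zero, dotProduct_zero] at h2
  exact hv (dotProduct_self_eq_zero.1 h2)

theorem exists_cayley_path_complex (X : Matrix m m ℂ) (hX : IsUnit (1 + X).det) :
    ∃ S : Set ℂ, IsPreconnected S ∧ 0 ∈ S ∧ 1 ∈ S ∧ ∀ t ∈ S, (1 + t • X).det ≠ 0 := by
  let P : Polynomial ℂ := (1 + (Polynomial.X : Polynomial ℂ) • X.map Polynomial.C).det
  have hP : ∀ t, P.eval t = (1 + t • X).det := by
    intro t
    change Polynomial.evalRingHom t _ = _
    rw [RingHom.map_det]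
    congr 1
    ext i j
    simp only [RingHom.mapMatrix_apply, Matrix.map_apply, Matrix.add_apply, Matrix.smul_apply,
      smul_eq_mul, map_add, Polynomial.coe_evalRingHom, Polynomial.eval_mul, Polynomial.eval_X,
      Polynomial.eval_C, Matrix.one_apply]
    split_ifs <;> simp only [Polynomial.eval_one, Polynomial.eval_zero]
  have hP0 : P ≠ 0 := by
    intro h
    have := hP 0
    rw [h] at this
    simp at this
  have hfin : Set.Finite {t | P.IsRoot t} := Polynomial.finite_setOfPred_isRoot hP0
  refine ⟨{t | P.IsRoot t}ᶜ, ?_, ?_, ?_, ?_⟩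
  · have hr : 1 < Module.rank ℝ ℂ := by rw [Complex.rank_real_complex]; exact Cardinal.one_lt_two
    exact (hfin.countable.isPathConnected_compl_of_one_lt_rank hr).isConnected.isPreconnected
  · simp [hP]
  · simp only [Set.mem_compl_iff, Set.mem_ofPred_eq, Polynomial.IsRoot, hP, one_smul]
    exact hX.ne_zero
  · intro t ht h
    exact ht ((hP t).trans h)

end Cayley

section SignMatrices

theorem exists_sign_det_ne_zero {𝕜 : Type} [Field 𝕜] [CharZero 𝕜] : ∀ {n : ℕ}
    (g : Matrix (Fin n) (Fin n) 𝕜), ∃ e : Fin n → 𝕜, (∀ i, e i = 1 ∨ e i = -1) ∧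
      (Matrix.diagonal e + g).det ≠ 0
  | 0, g => ⟨0, fun i => i.elim0, by simp⟩
  | n + 1, g => by
    obtain ⟨e, he, hdet⟩ := exists_sign_det_ne_zero (g.submatrix Fin.succ Fin.succ)
    have h1 : ∀ s : 𝕜, (Matrix.diagonal (Fin.cons s e) + g).det =
        s * (Matrix.diagonal e + g.submatrix Fin.succ Fin.succ).det +
          (Matrix.diagonal (Fin.cons 0 e) + g).det := by
      intro s
      have h2 : ∀ s : 𝕜, (Matrix.diagonal (Fin.cons s e : Fin (n + 1) → 𝕜) + g).submatrix Fin.succ Fin.succ =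
          Matrix.diagonal e + g.submatrix Fin.succ Fin.succ := by
        intro s
        ext i j
        by_cases hij : i = j
        · subst hij; simp
        · simp [hij]
      have h3 : ∀ (s : 𝕜) (j : Fin n), (Matrix.diagonal (Fin.cons s e : Fin (n + 1) → 𝕜) + g).submatrix Fin.succ
          (Fin.succAbove (Fin.succ j)) = (Matrix.diagonal (Fin.cons 0 e : Fin (n + 1) → 𝕜) +
              g).submatrix Fin.succ
          (Fin.succAbove (Fin.succ j)) := by
        intro s j
        ext a b
        simp only [Matrix.submatrix_apply, Matrix.add_apply, Matrix.diagonal_apply]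
        split_ifs <;> simp
      rw [Matrix.det_succ_row_zero, Matrix.det_succ_row_zero (Matrix.diagonal (Fin.cons 0 e) + g),
        Fin.sum_univ_succ, Fin.sum_univ_succ]
      have h4 : ∀ (s : 𝕜) (j : Fin n),
          Matrix.diagonal (Fin.cons s e : Fin (n + 1) → 𝕜) 0 j.succ = 0 := fun s j =>
        Matrix.diagonal_apply_ne _ (Fin.succ_ne_zero j).symm
      simp only [h3 s, Fin.succAbove_zero, h2, Matrix.add_apply, h4, Matrix.diagonal_apply_eq,
        Fin.cons_zero]
      simp only [Fin.val_zero, pow_zero]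
      ring
    by_cases hs : (Matrix.diagonal (Fin.cons 1 e) + g).det ≠ 0
    · exact ⟨Fin.cons 1 e, Fin.cases (by simp) (by simpa using he), hs⟩
    · refine ⟨Fin.cons (-1) e, Fin.cases (by simp) (by simpa using he), fun h => hdet ?_⟩
      push Not at hs
      rw [h1] at h hs
      have h2 : (2 : 𝕜) * (Matrix.diagonal e + g.submatrix Fin.succ Fin.succ).det = 0 := by
        linear_combination hs - h
      exact (mul_eq_zero.1 h2).resolve_left two_ne_zero

variable {m : Type} [Fintype m] [DecidableEq m] {𝕜 : Type} [RCLike 𝕜]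

theorem mem_idComp_SO_of_pair {i j : m} (hij : i ≠ j) {g : GL m 𝕜}
    (hg : (g : Matrix m m 𝕜) = 1 - (2 : 𝕜) • (Matrix.single i i 1 + Matrix.single j j 1)) :
    g ∈ idComp (SO m 𝕜) := by
  obtain ⟨A, hA⟩ : ∃ A : Matrix m m 𝕜, A = Matrix.single i i 1 + Matrix.single j j 1 := ⟨_, rfl⟩
  obtain ⟨J, hJ⟩ : ∃ J : Matrix m m 𝕜, J = Matrix.single i j 1 - Matrix.single j i 1 := ⟨_, rfl⟩
  have hAA : A * A = A := by simp [hA, add_mul, mul_add, hij, hij.symm]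
  have hAJ : A * J = J := by
    simp [hA, hJ, add_mul, mul_sub, hij, hij.symm]
    try abel
  have hJA : J * A = J := by
    simp [hA, hJ, mul_add, sub_mul, hij, hij.symm]
    try abel
  have hJJ : J * J = -A := by
    simp [hA, hJ, mul_sub, sub_mul, hij, hij.symm]
    try abel
  have hAT : Aᵀ = A := by simp [hA]
  have hJT : Jᵀ = -J := by simp [hJ]
  rw [← hA] at hg
  refine mem_idComp_of_curve (B := 1) isUnit_one (isPreconnected_univ (α := ℝ))
    (f := fun t => 1 + ((Real.cos t - 1 : ℝ) : 𝕜) • A + ((Real.sin t : ℝ) : 𝕜) • J) ?_ ?_ (t₀ := 0)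
    (t₁ := Real.pi) trivial trivial (by simp) ?_
  · have h1 : Continuous fun t : ℝ => ((Real.cos t - 1 : ℝ) : 𝕜) :=
      RCLike.continuous_ofReal.comp (Real.continuous_cos.sub continuous_const)
    have h2 : Continuous fun t : ℝ => ((Real.sin t : ℝ) : 𝕜) :=
      RCLike.continuous_ofReal.comp Real.continuous_sin
    exact ((continuous_const.add (h1.smul continuous_const)).add
      (h2.smul continuous_const)).continuousOn
  · intro t _
    have h1 : (((Real.cos t - 1 : ℝ) : 𝕜) * 2 + ((Real.cos t - 1 : ℝ) : 𝕜) * ((Real.cos t - 1 : ℝ) : 𝕜) +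
        ((Real.sin t : ℝ) : 𝕜) * ((Real.sin t : ℝ) : 𝕜)) = 0 := by
      have h := Real.sin_sq_add_cos_sq t
      have : (Real.cos t - 1) * 2 + (Real.cos t - 1) * (Real.cos t - 1) + Real.sin t * Real.sin t = 0 := by
        nlinarith
      exact_mod_cast congrArg (fun x : ℝ => (x : 𝕜)) this
    generalize ((Real.cos t - 1 : ℝ) : 𝕜) = c at *
    generalize ((Real.sin t : ℝ) : 𝕜) = s at *
    simp only [Matrix.transpose_add, Matrix.transpose_one, Matrix.transpose_smul, hAT, hJT,
      Matrix.mul_one]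
    have h2 : (1 + c • A + s • -J) * (1 + c • A + s • J) = 1 + (c * 2 + c * c + s * s) • A := by
      simp only [add_mul, mul_add, Matrix.one_mul, Matrix.mul_one, Matrix.smul_mul, Matrix.mul_smul,
        hAA, hAJ, hJA, hJJ, Matrix.neg_mul, smul_neg, neg_neg]
      module
    rw [h2, h1, zero_smul, add_zero]
  · rw [hg]
    simp only [Real.cos_pi, Real.sin_pi]
    push_cast
    module

theorem mem_idComp_SO_of_sign {e : m → 𝕜} (he : ∀ i, e i = 1 ∨ e i = -1) (hprod : ∏ i, e i = 1)
    {g : GL m 𝕜} (hg : (g : Matrix m m 𝕜) = Matrix.diagonal e) : g ∈ idComp (SO m 𝕜) := by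
  rcases isEmpty_or_nonempty m with hm | ⟨⟨i₀⟩⟩
  · rw [show g = 1 from Units.ext (Subsingleton.elim _ _)]
    exact Subgroup.one_mem _
  let u : m → 𝕜ˣ := fun i => if e i = 1 then 1 else -1
  have hu : ∀ i, (u i : 𝕜) = e i := by
    intro i
    rcases he i with h | h <;> simp [u, h]
    intro h
    have : (2 : 𝕜) = 0 := by linear_combination -h
    exact absurd this two_ne_zero
  let D : (m → 𝕜ˣ) →* GL m 𝕜 :=
    (Units.map (Matrix.diagonalRingHom m 𝕜 : (m → 𝕜) →* Matrix m m 𝕜)).comp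
      MulEquiv.piUnits.symm.toMonoidHom
  have hD : ∀ v : m → 𝕜ˣ, (D v : Matrix m m 𝕜) = Matrix.diagonal fun i => (v i : 𝕜) := fun v => rfl
  have huprod : ∏ i, u i = 1 := by
    ext
    rw [Units.coe_prod]
    simp only [hu, hprod, Units.val_one]
  have h1 : u = ∏ i, (Pi.mulSingle i (u i) * Pi.mulSingle i₀ (u i)) := by
    rw [Finset.prod_mul_distrib, Finset.univ_prod_mulSingle]
    have : ∏ i, (Pi.mulSingle i₀ (u i) : m → 𝕜ˣ) = Pi.mulSingle i₀ (∏ i, u i) :=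
      (map_prod (MonoidHom.mulSingle (fun _ : m => 𝕜ˣ) i₀) u Finset.univ).symm
    rw [this, huprod, Pi.mulSingle_one, mul_one]
  have h2 : g = D u := by
    ext : 1
    rw [hg, hD]
    simp only [hu]
  suffices h3 : u ∈ (idComp (SO m 𝕜)).comap D by
    rw [h2]
    exact h3
  rw [h1]
  refine Subgroup.prod_mem _ fun i _ => ?_
  rw [Subgroup.mem_comap]
  by_cases hi : u i = 1
  · simp only [hi, Pi.mulSingle_one, mul_one, map_one]
    exact Subgroup.one_mem _
  have hi' : u i = -1 := by
    have : u i = if e i = 1 then 1 else -1 := rfl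
    split_ifs at this with h
    · exact absurd this hi
    · exact this
  rw [hi']
  by_cases hii : i = i₀
  · subst hii
    rw [← Pi.mulSingle_mul]
    simp only [mul_neg, mul_one, neg_neg, Pi.mulSingle_one, map_one]
    exact Subgroup.one_mem _
  · refine mem_idComp_SO_of_pair hii ?_
    rw [hD]
    ext a b
    by_cases hab : a = b
    · subst hab
      by_cases ha : a = i
      · subst ha
        simp [hii, Pi.mulSingle_apply, Ne.symm hii]
        norm_num
      · by_cases ha' : a = i₀
        · subst ha'
          simp [ha, Pi.mulSingle_apply, Ne.symm ha]
          norm_num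
        · simp [ha, ha', Pi.mulSingle_apply, Ne.symm ha, Ne.symm ha']
    · have h3 : ∀ k, ¬ (k = a ∧ k = b) := fun k hk => hab (hk.1.symm.trans hk.2)
      simp [hab, h3]

theorem SO_le_idComp {n : ℕ} (hpath : ∀ X : Matrix (Fin n) (Fin n) 𝕜, Xᵀ = -X → IsUnit (1 + X).det →
      ∃ S : Set 𝕜, IsPreconnected S ∧ 0 ∈ S ∧ 1 ∈ S ∧ ∀ t ∈ S, (1 + t • X).det ≠ 0) :
    SO (Fin n) 𝕜 ≤ idComp (SO (Fin n) 𝕜) := by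
  intro g hg
  obtain ⟨hg1, hg2⟩ := mem_SO_iff.1 hg
  obtain ⟨e, he, hdet⟩ := exists_sign_det_ne_zero (g : Matrix (Fin n) (Fin n) 𝕜)
  have hee : Matrix.diagonal e * Matrix.diagonal e = 1 := by
    rw [Matrix.diagonal_mul_diagonal, ← Matrix.diagonal_one]
    congr 1
    funext i
    rcases he i with h | h <;> simp [h]
  let E : GL (Fin n) 𝕜 := ⟨Matrix.diagonal e, Matrix.diagonal e, hee, hee⟩
  have hEg : ((E * g : GL (Fin n) 𝕜) : Matrix (Fin n) (Fin n) 𝕜)ᵀ *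
      ((E * g : GL (Fin n) 𝕜) : Matrix (Fin n) (Fin n) 𝕜) = 1 := by
    rw [Units.val_mul, Matrix.transpose_mul]
    change (g : Matrix (Fin n) (Fin n) 𝕜)ᵀ * (Matrix.diagonal e)ᵀ * (Matrix.diagonal e * g) = 1
    rw [Matrix.diagonal_transpose, Matrix.mul_assoc, ← Matrix.mul_assoc (Matrix.diagonal e), hee,
      Matrix.one_mul, hg1]
  have hEg2 : Matrix.diagonal e * (Matrix.diagonal e + (g : Matrix (Fin n) (Fin n) 𝕜)) =
      1 + ((E * g : GL (Fin n) 𝕜) : Matrix (Fin n) (Fin n) 𝕜) := by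
    rw [mul_add, hee]
    rfl
  have hdetE2 : (Matrix.diagonal e).det * (Matrix.diagonal e).det = 1 := by
    rw [← Matrix.det_mul, hee, Matrix.det_one]
  have hu : (1 + ((E * g : GL (Fin n) 𝕜) : Matrix (Fin n) (Fin n) 𝕜)).det ≠ 0 := by
    rw [← hEg2, Matrix.det_mul]
    exact mul_ne_zero (left_ne_zero_of_mul_eq_one hdetE2) hdet
  have hdetE : (Matrix.diagonal e).det = 1 := by
    rcases mul_self_eq_one_iff.1 hdetE2 with h | h
    · exact h
    · exfalso
      set a := ((E * g : GL (Fin n) 𝕜) : Matrix (Fin n) (Fin n) 𝕜)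
      have ha : a.det = -1 := by
        change (Matrix.diagonal e * (g : Matrix (Fin n) (Fin n) 𝕜)).det = -1
        rw [Matrix.det_mul, h, hg2, mul_one]
      have h1 : (1 + a).det = aᵀ.det * (1 + a).det := by
        conv_lhs => rw [← Matrix.det_transpose]
        rw [← Matrix.det_mul, mul_add, hEg]
        simp [add_comm]
      rw [Matrix.det_transpose, ha] at h1
      have h2 : (2 : 𝕜) * (1 + a).det = 0 := by linear_combination h1
      exact hu ((mul_eq_zero.1 h2).resolve_left two_ne_zero)
  have hE : E ∈ idComp (SO (Fin n) 𝕜) :=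
    mem_idComp_SO_of_sign he (by rwa [Matrix.det_diagonal] at hdetE) rfl
  have h2 := mem_idComp_SO_of_cayley hEg (isUnit_iff_ne_zero.2 hu) hpath
  have h3 := Subgroup.mul_mem _ hE h2
  rwa [← mul_assoc, show E * E = 1 from Units.ext hee, one_mul] at h3

theorem isPreconnected_SO_real (n : ℕ) : IsPreconnected (SO (Fin n) ℝ : Set (GL (Fin n) ℝ)) := by
  rw [le_antisymm (SO_le_idComp fun X hX _ => exists_cayley_path_real X hX) (idComp_le _)]
  exact isPreconnected_idComp _

theorem isPreconnected_SO_complex (n : ℕ) : IsPreconnected (SO (Fin n) ℂ : Set (GL (Fin n) ℂ)) := by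
  rw [le_antisymm (SO_le_idComp fun X _ hX => exists_cayley_path_complex X hX) (idComp_le _)]
  exact isPreconnected_idComp _

end SignMatrices

section SmallGroups

theorem SOe_one_zero : SOe 1 0 = ⊥ := by
  rw [eq_bot_iff]
  intro g hg
  obtain ⟨-, h2⟩ := mem_specialIsometry_iff.1 (SOe_le 1 0 hg)
  rw [Subgroup.mem_bot]
  ext i j
  have hs : Subsingleton (Fin 1 ⊕ Fin 0) := by
    constructor
    rintro (i | i) (j | j)
    · rw [Subsingleton.elim i j]
    · exact j.elim0
    · exact i.elim0
    · exact i.elim0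
  rw [Matrix.det_eq_elem_of_subsingleton _ i] at h2
  rw [Subsingleton.elim j i, h2]
  simp

theorem coe_boost (t : ℝ) : ((boost (Multiplicative.ofAdd t) : GL (Fin 1 ⊕ Fin 1) ℝ) :
    Matrix (Fin 1 ⊕ Fin 1) (Fin 1 ⊕ Fin 1) ℝ) =
      Matrix.fromBlocks (Matrix.of fun _ _ => Real.cosh t) (Matrix.of fun _ _ => Real.sinh t)
        (Matrix.of fun _ _ => Real.sinh t) (Matrix.of fun _ _ => Real.cosh t) := rfl

theorem boost_range_le : boost.range ≤ SOe 1 1 := by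
  rintro _ ⟨t, rfl⟩
  refine mem_idComp_of_curve (B := ID 1 1 ℝ) (isUnit_ID ℝ) (isPreconnected_univ (α := ℝ))
    (f := fun t => (boost (Multiplicative.ofAdd t) : Matrix (Fin 1 ⊕ Fin 1) (Fin 1 ⊕ Fin 1) ℝ))
    (t₀ := 0) (t₁ := t.toAdd) ?_ ?_ trivial trivial ?_ rfl
  · refine Continuous.continuousOn ?_
    simp only [coe_boost]
    have h1 : Continuous fun t : ℝ => (Matrix.of fun _ _ => Real.cosh t : Matrix (Fin 1) (Fin 1) ℝ) :=
      continuous_matrix fun _ _ => Real.continuous_cosh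
    have h2 : Continuous fun t : ℝ => (Matrix.of fun _ _ => Real.sinh t : Matrix (Fin 1) (Fin 1) ℝ) :=
      continuous_matrix fun _ _ => Real.continuous_sinh
    exact h1.matrix_fromBlocks h2 h2 h1
  · intro t _
    rw [coe_boost, ID_eq, Matrix.fromBlocks_transpose]
    simp only [Matrix.fromBlocks_multiply]
    have h := Real.cosh_sq t
    ext (i | i) (j | j) <;>
      simp [Matrix.mul_apply, Subsingleton.elim i j] <;> nlinarith
  · simp

theorem SOe_one_one : SOe 1 1 = boost.range := by
  refine le_antisymm ?_ boost_range_le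
  have hentries : ∀ g ∈ SOpq 1 1 ℝ, ∃ a b : ℝ, a * a - b * b = 1 ∧
      (g : Matrix (Fin 1 ⊕ Fin 1) (Fin 1 ⊕ Fin 1) ℝ) =
        Matrix.fromBlocks (Matrix.of fun _ _ => a) (Matrix.of fun _ _ => b)
          (Matrix.of fun _ _ => b) (Matrix.of fun _ _ => a) := by
    intro g hg
    obtain ⟨h1, h2⟩ := mem_specialIsometry_iff.1 hg
    set M := (g : Matrix (Fin 1 ⊕ Fin 1) (Fin 1 ⊕ Fin 1) ℝ)
    change Mᵀ * ID 1 1 ℝ * M = ID 1 1 ℝ at h1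
    rw [ID_eq] at h1
    have e1 := congrFun (congrFun h1 (Sum.inl 0)) (Sum.inl 0)
    have e2 := congrFun (congrFun h1 (Sum.inl 0)) (Sum.inr 0)
    simp [Matrix.mul_apply, Matrix.fromBlocks] at e1 e2
    have h3 : M.det = M (Sum.inl 0) (Sum.inl 0) * M (Sum.inr 0) (Sum.inr 0) -
        M (Sum.inl 0) (Sum.inr 0) * M (Sum.inr 0) (Sum.inl 0) := by
      rw [← Matrix.det_submatrix_equiv_self (finSumFinEquiv (m := 1) (n := 1)).symm,
        Matrix.det_fin_two]
      rfl
    rw [h3] at h2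
    have h4 : M (Sum.inr 0) (Sum.inr 0) = M (Sum.inl 0) (Sum.inl 0) := by
      linear_combination M (Sum.inl 0) (Sum.inl 0) * h2 - M (Sum.inr 0) (Sum.inr 0) * e1 +
        M (Sum.inr 0) (Sum.inl 0) * e2
    have h5 : M (Sum.inr 0) (Sum.inl 0) = M (Sum.inl 0) (Sum.inr 0) := by
      linear_combination M (Sum.inl 0) (Sum.inr 0) * e1 - M (Sum.inr 0) (Sum.inl 0) * h2 -
        M (Sum.inl 0) (Sum.inl 0) * e2
    refine ⟨M (Sum.inl 0) (Sum.inl 0), M (Sum.inl 0) (Sum.inr 0), ?_, ?_⟩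
    · rw [h5] at e1
      linarith
    · ext (i | i) (j | j) <;> simp [Subsingleton.elim i 0, Subsingleton.elim j 0, h4, h5]
  intro g hg
  obtain ⟨a, b, hab, hg'⟩ := hentries g (SOe_le 1 1 hg)
  have hpos : 0 < a := by
    let f : GL (Fin 1 ⊕ Fin 1) ℝ → ℝ := fun g =>
      (g : Matrix (Fin 1 ⊕ Fin 1) (Fin 1 ⊕ Fin 1) ℝ) (Sum.inl 0) (Sum.inl 0)
    have hf : Continuous f := continuous_GL_val.matrix_elem _ _
    have h1 : IsPreconnected (f '' (SOe 1 1 : Set (GL (Fin 1 ⊕ Fin 1) ℝ))) :=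
      (isPreconnected_idComp _).image _ hf.continuousOn
    have h2 : f g = a := by simp [f, hg']
    have h3 : f 1 = 1 := by simp [f]
    by_contra hle
    obtain ⟨g', hg'', h0⟩ := h1.ordConnected.out ⟨g, hg, rfl⟩ ⟨1, Subgroup.one_mem _, rfl⟩
      (show (0 : ℝ) ∈ Set.Icc (f g) (f 1) by
        rw [h2, h3]
        exact ⟨not_lt.1 hle, zero_le_one⟩)
    obtain ⟨a', b', hab', hg3⟩ := hentries g' (SOe_le 1 1 hg'')
    have h4 : a' = 0 := by rw [← h0]; simp [f, hg3]
    rw [h4] at hab'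
    nlinarith [mul_self_nonneg b']
  have hcosh : Real.cosh (Real.arsinh b) = a := by
    rw [Real.cosh_arsinh, show 1 + b ^ 2 = a ^ 2 by linarith [hab, sq a, sq b], Real.sqrt_sq hpos.le]
  refine ⟨Multiplicative.ofAdd (Real.arsinh b), ?_⟩
  ext : 1
  rw [coe_boost, hg', hcosh, Real.sinh_arsinh]

end SmallGroups

section QuaternionicDeterminant

variable {n : ℕ}

open scoped ComplexOrder in
theorem det_eq_one_of_split_isometry {A B C D : Matrix (Fin n) (Fin n) ℂ}
    (h1 : (Matrix.fromBlocks A B C D)ᵀ * Matrix.fromBlocks 0 1 1 0 * Matrix.fromBlocks A B C D =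
      Matrix.fromBlocks 0 1 1 0)
    (h2 : (Matrix.fromBlocks A B C D)ᴴ * Matrix.fromBlocks 1 0 0 (-1) * Matrix.fromBlocks A B C D =
      Matrix.fromBlocks 1 0 0 (-1)) :
    (Matrix.fromBlocks A B C D).det = 1 := by
  simp only [Matrix.fromBlocks_transpose, Matrix.fromBlocks_conjTranspose,
    Matrix.fromBlocks_multiply, Matrix.fromBlocks_inj, mul_zero, mul_one, zero_add, add_zero,
    mul_neg, neg_mul] at h1 h2
  obtain ⟨e1, e2, -, -⟩ := h1
  obtain ⟨e3, -, -, -⟩ := h2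
  have hA : IsUnit A.det := by
    rw [isUnit_iff_ne_zero]
    intro h
    obtain ⟨v, hv, hv0⟩ := Matrix.exists_mulVec_eq_zero_iff.2 h
    have h3 := congrArg (fun M => star v ⬝ᵥ (M *ᵥ v)) e3
    simp only [Matrix.add_mulVec, Matrix.neg_mulVec, ← Matrix.mulVec_mulVec, hv0, Matrix.mulVec_zero,
      Matrix.one_mulVec, dotProduct_neg, zero_add] at h3
    rw [Matrix.dotProduct_mulVec, Matrix.vecMul_conjTranspose, star_star] at h3
    have h4 := dotProduct_star_self_nonneg v
    have h5 := dotProduct_star_self_nonneg (C *ᵥ v)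
    have h6 : star v ⬝ᵥ v = 0 := le_antisymm (by rw [← h3]; exact neg_nonpos.2 h5) h4
    exact hv (dotProduct_star_self_eq_zero.1 h6)
  have hu := (Matrix.isUnit_iff_isUnit_det A).2 hA
  let _ : Invertible A := hu.invertible
  rw [Matrix.det_fromBlocks₁₁]
  have h3 : Aᵀ * (D - C * ⅟A * B) = 1 := by
    have h4 : Aᵀ * C = -(Cᵀ * A) := by
      rw [eq_neg_iff_add_eq_zero, add_comm]; exact e1
    calc Aᵀ * (D - C * ⅟A * B) = Aᵀ * D - Aᵀ * C * ⅟A * B := by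
          simp only [mul_sub, Matrix.mul_assoc]
      _ = Aᵀ * D + Cᵀ * B := by
          rw [h4]
          simp only [neg_mul, sub_neg_eq_add, Matrix.mul_assoc]
          rw [Matrix.mul_invOf_cancel_left]
      _ = 1 := by rw [add_comm]; exact e2
  have h4 := congrArg Matrix.det h3
  rwa [Matrix.det_mul, Matrix.det_transpose, Matrix.det_one] at h4

/-- `O(n, ℍ)` consists of matrices of determinant one. -/
theorem det_eq_one_of_star {g : Matrix (Fin n ⊕ Fin n) (Fin n ⊕ Fin n) ℂ} (h1 : gᵀ * g = 1)
    (h2 : gᴴ * Matrix.J (Fin n) ℂ * g = Matrix.J (Fin n) ℂ) : g.det = 1 := by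
  let U : Matrix (Fin n ⊕ Fin n) (Fin n ⊕ Fin n) ℂ :=
    Matrix.fromBlocks 1 1 (-Complex.I • 1) (Complex.I • 1)
  let V : Matrix (Fin n ⊕ Fin n) (Fin n ⊕ Fin n) ℂ :=
    Matrix.fromBlocks ((1 / 2 : ℂ) • 1) ((Complex.I / 2) • 1) ((1 / 2 : ℂ) • 1) ((-Complex.I / 2) • 1)
  have hUV : U * V = 1 := by
    simp only [U, V, Matrix.fromBlocks_multiply, Matrix.mul_smul, mul_one,
      smul_smul, ← add_smul]
    rw [← Matrix.fromBlocks_one]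
    congr 1 <;> ring_nf <;> simp
  have hVU : V * U = 1 := mul_eq_one_comm.1 hUV
  have hU1 : Uᵀ * U = (2 : ℂ) • Matrix.fromBlocks 0 1 1 0 := by
    simp only [U, Matrix.fromBlocks_transpose, Matrix.transpose_smul, Matrix.transpose_one,
      Matrix.fromBlocks_multiply, Matrix.mul_smul, mul_one,
      smul_smul, Matrix.fromBlocks_smul]
    congr 1 <;> ring_nf <;> simp <;> module
  have hU2 : Uᴴ * Matrix.J (Fin n) ℂ * U = (2 * Complex.I : ℂ) • Matrix.fromBlocks 1 0 0 (-1) := by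
    simp only [U, Matrix.J, Matrix.fromBlocks_conjTranspose, Matrix.conjTranspose_smul,
      Matrix.conjTranspose_one,
      Matrix.fromBlocks_multiply, Matrix.mul_smul, mul_one, mul_neg, mul_zero,
      Matrix.fromBlocks_smul]
    congr 1 <;> ring_nf <;> simp <;> module
  have h3 : (V * g * U).det = g.det := by
    rw [Matrix.det_mul, Matrix.det_mul, mul_right_comm, ← Matrix.det_mul, hVU, Matrix.det_one, one_mul]
  have hgU : U * (V * g * U) = g * U := by
    simp only [← Matrix.mul_assoc, hUV, Matrix.one_mul]
  rw [← h3, ← Matrix.fromBlocks_toBlocks (V * g * U)]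
  apply det_eq_one_of_split_isometry
  · rw [Matrix.fromBlocks_toBlocks]
    apply smul_right_injective _ (two_ne_zero (α := ℂ))
    simp only
    rw [← hU1, ← Matrix.smul_mul, ← Matrix.mul_smul, ← hU1]
    calc (V * g * U)ᵀ * (Uᵀ * U) * (V * g * U) = (U * (V * g * U))ᵀ * (U * (V * g * U)) := by
          rw [Matrix.transpose_mul U]; simp only [Matrix.mul_assoc]
      _ = Uᵀ * (gᵀ * g) * U := by rw [hgU, Matrix.transpose_mul]; simp only [Matrix.mul_assoc]
      _ = Uᵀ * U := by rw [h1, Matrix.mul_one]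
  · rw [Matrix.fromBlocks_toBlocks]
    apply smul_right_injective _ (mul_ne_zero (two_ne_zero (α := ℂ)) Complex.I_ne_zero)
    simp only
    rw [← hU2, ← Matrix.smul_mul, ← Matrix.mul_smul, ← hU2]
    calc (V * g * U)ᴴ * (Uᴴ * Matrix.J (Fin n) ℂ * U) * (V * g * U) =
          (U * (V * g * U))ᴴ * Matrix.J (Fin n) ℂ * (U * (V * g * U)) := by
          rw [Matrix.conjTranspose_mul U]; simp only [Matrix.mul_assoc]
      _ = Uᴴ * (gᴴ * Matrix.J (Fin n) ℂ * g) * U := by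
          rw [hgU, Matrix.conjTranspose_mul]; simp only [Matrix.mul_assoc]
      _ = _ := by rw [h2]

end QuaternionicDeterminant

section SkewFamilies

open scoped InnerProductSpace

variable {E : Type} [NormedAddCommGroup E] [InnerProductSpace ℝ E]

/-- Orthonormal pairs `(vⱼ, wⱼ)` of eigenvectors of `D` spanning planes in which the operators of
`𝒯` act by infinitesimal rotations. -/
structure IsPairFamily (D : E →ₗ[ℝ] E) (𝒯 : Set (E →ₗ[ℝ] E)) {m : ℕ} (v w : Fin m → E) : Prop where
  vv : ∀ i j, ⟪v i, v j⟫_ℝ = if i = j then 1 else 0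
  ww : ∀ i j, ⟪w i, w j⟫_ℝ = if i = j then 1 else 0
  vw : ∀ i j, ⟪v i, w j⟫_ℝ = 0
  eig : ∀ i, ∃ d : ℝ, D (v i) = d • v i ∧ D (w i) = -d • w i
  rot : ∀ T ∈ 𝒯, ∃ t : Fin m → ℝ, ∀ j, T (v j) = t j • w j ∧ T (w j) = -t j • v j

theorem IsPairFamily.card_le [FiniteDimensional ℝ E] {D : E →ₗ[ℝ] E} {𝒯 : Set (E →ₗ[ℝ] E)} {m : ℕ}
    {v w : Fin m → E} (h : IsPairFamily D 𝒯 v w) : m ≤ Module.finrank ℝ E := by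
  have h1 : Orthonormal ℝ v := orthonormal_iff_ite.2 h.vv
  simpa using h1.linearIndependent.fintype_card_le_finrank

theorem IsPairFamily.extend {D : E →ₗ[ℝ] E} {𝒯 : Set (E →ₗ[ℝ] E)} {m : ℕ}
    {v w : Fin m → E} (h : IsPairFamily D 𝒯 v w) {a b : E} (haa : ⟪a, a⟫_ℝ = 1) (hbb : ⟪b, b⟫_ℝ = 1)
    (hab : ⟪a, b⟫_ℝ = 0) (hav : ∀ i, ⟪v i, a⟫_ℝ = 0) (haw : ∀ i, ⟪w i, a⟫_ℝ = 0)
    (hbv : ∀ i, ⟪v i, b⟫_ℝ = 0) (hbw : ∀ i, ⟪w i, b⟫_ℝ = 0)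
    (heig : ∃ d : ℝ, D a = d • a ∧ D b = -d • b)
    (hrot : ∀ T ∈ 𝒯, ∃ t : ℝ, T a = t • b ∧ T b = -t • a) :
    IsPairFamily D 𝒯 (Fin.cons a v : Fin (m + 1) → E) (Fin.cons b w : Fin (m + 1) → E) where
  vv := by
    intro i j
    refine Fin.cases ?_ (fun i => ?_) i <;> refine Fin.cases ?_ (fun j => ?_) j
    · simpa using haa
    · simpa [(Fin.succ_ne_zero j).symm, real_inner_comm] using hav j
    · simpa using hav i
    · simpa using h.vv i j
  ww := by
    intro i j
    refine Fin.cases ?_ (fun i => ?_) i <;> refine Fin.cases ?_ (fun j => ?_) j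
    · simpa using hbb
    · simpa [(Fin.succ_ne_zero j).symm, real_inner_comm] using hbw j
    · simpa using hbw i
    · simpa using h.ww i j
  vw := by
    intro i j
    refine Fin.cases ?_ (fun i => ?_) i <;> refine Fin.cases ?_ (fun j => ?_) j
    · simpa using hab
    · simpa [real_inner_comm] using haw j
    · simpa using hbv i
    · simpa using h.vw i j
  eig := by
    intro i
    refine Fin.cases ?_ (fun i => ?_) i
    · simpa using heig
    · simpa using h.eig i
  rot := by
    intro T hT
    obtain ⟨t, ht⟩ := h.rot T hT
    obtain ⟨t₀, ht₀⟩ := hrot T hT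
    refine ⟨Fin.cons t₀ t, fun j => ?_⟩
    refine Fin.cases ?_ (fun j => ?_) j
    · simpa using ht₀
    · simpa using ht j

/-- Commuting skew operators are simultaneously infinitesimal rotations in orthogonal planes. -/
theorem exists_pairFamily [FiniteDimensional ℝ E] {D : E →ₗ[ℝ] E} {𝒯 : Set (E →ₗ[ℝ] E)}
    (hD : ∀ x y, ⟪D x, y⟫_ℝ = ⟪x, D y⟫_ℝ) (hskew : ∀ T ∈ 𝒯, ∀ x y, ⟪T x, y⟫_ℝ = -⟪x, T y⟫_ℝ)
    (hcomm : ∀ S ∈ 𝒯, ∀ T ∈ 𝒯, ∀ x, S (T x) = T (S x)) (hDT : ∀ T ∈ 𝒯, ∀ x, D (T x) = -T (D x)) :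
    ∃ (m : ℕ) (v w : Fin m → E), IsPairFamily D 𝒯 v w ∧
      ∀ u, (∀ i, ⟪v i, u⟫_ℝ = 0) → (∀ i, ⟪w i, u⟫_ℝ = 0) → ∀ T ∈ 𝒯, T u = 0 := by
  classical
  let P : ℕ → Prop := fun m => ∃ v w : Fin m → E, IsPairFamily D 𝒯 v w
  have hP0 : P 0 := ⟨Fin.elim0, Fin.elim0, ⟨fun i => i.elim0, fun i => i.elim0, fun i => i.elim0,
    fun i => i.elim0, fun T _ => ⟨Fin.elim0, fun i => i.elim0⟩⟩⟩
  have hmax := Nat.findGreatest_spec (P := P) (Nat.zero_le (Module.finrank ℝ E)) hP0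
  set m := Nat.findGreatest P (Module.finrank ℝ E)
  obtain ⟨v, w, h⟩ := hmax
  refine ⟨m, v, w, h, ?_⟩
  by_contra hcon
  push Not at hcon
  obtain ⟨u, huv, huw, T₀, hT₀, hTu⟩ := hcon
  -- the invariant complement
  let F : Submodule ℝ E :=
    { carrier := {u | (∀ i, ⟪v i, u⟫_ℝ = 0) ∧ ∀ i, ⟪w i, u⟫_ℝ = 0}
      zero_mem' := by simp
      add_mem' := fun hx hy => ⟨fun i => by rw [inner_add_right, hx.1, hy.1, add_zero],
        fun i => by rw [inner_add_right, hx.2, hy.2, add_zero]⟩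
      smul_mem' := fun c x hx => ⟨fun i => by rw [inner_smul_right, hx.1, mul_zero],
        fun i => by rw [inner_smul_right, hx.2, mul_zero]⟩ }
  have hTF : ∀ T ∈ 𝒯, ∀ x ∈ F, T x ∈ F := by
    intro T hT x hx
    obtain ⟨t, ht⟩ := h.rot T hT
    refine ⟨fun i => ?_, fun i => ?_⟩
    · have := hskew T hT (v i) x
      rw [(ht i).1, inner_smul_left, hx.2, mul_zero] at this
      linarith
    · have := hskew T hT (w i) x
      rw [(ht i).2, inner_smul_left, hx.1, mul_zero] at this
      linarith
  have hDF : ∀ x ∈ F, D x ∈ F := by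
    intro x hx
    refine ⟨fun i => ?_, fun i => ?_⟩
    · obtain ⟨d, hd, -⟩ := h.eig i
      rw [← hD, hd, inner_smul_left, hx.1, mul_zero]
    · obtain ⟨d, -, hd⟩ := h.eig i
      rw [← hD, hd, inner_smul_left, hx.2, mul_zero]
  let op : Option (𝒯 × 𝒯) → F →ₗ[ℝ] F := fun o => match o with
    | none => D.restrict hDF
    | some (S, T) => ((S : E →ₗ[ℝ] E).restrict (hTF S S.2)) ∘ₗ ((T : E →ₗ[ℝ] E).restrict (hTF T T.2))
  have hop : ∀ o, (op o).IsSymmetric := by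
    rintro (_ | ⟨S, T⟩) x y
    · exact hD x y
    · change ⟪(S : E →ₗ[ℝ] E) ((T : E →ₗ[ℝ] E) x), (y : E)⟫_ℝ =
        ⟪(x : E), (S : E →ₗ[ℝ] E) ((T : E →ₗ[ℝ] E) y)⟫_ℝ
      rw [hskew S S.2, hskew T T.2, neg_neg, hcomm T T.2 S S.2]
  have hopc : Pairwise (Function.onFun Commute op) := by
    have key : ∀ o o', ∀ x, op o (op o' x) = op o' (op o x) := by
      rintro (_ | ⟨S, T⟩) (_ | ⟨S', T'⟩) x <;> apply Subtype.ext
      · rfl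
      · change D ((S' : E →ₗ[ℝ] E) ((T' : E →ₗ[ℝ] E) x)) = (S' : E →ₗ[ℝ] E) ((T' : E →ₗ[ℝ] E) (D x))
        rw [hDT S' S'.2, hDT T' T'.2, map_neg, neg_neg]
      · change (S : E →ₗ[ℝ] E) ((T : E →ₗ[ℝ] E) (D x)) = D ((S : E →ₗ[ℝ] E) ((T : E →ₗ[ℝ] E) x))
        rw [hDT S S.2, hDT T T.2, map_neg, neg_neg]
      · change (S : E →ₗ[ℝ] E) ((T : E →ₗ[ℝ] E) ((S' : E →ₗ[ℝ] E) ((T' : E →ₗ[ℝ] E) x))) =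
          (S' : E →ₗ[ℝ] E) ((T' : E →ₗ[ℝ] E) ((S : E →ₗ[ℝ] E) ((T : E →ₗ[ℝ] E) x)))
        rw [hcomm T T.2 S' S'.2, hcomm S S.2 S' S'.2, hcomm T T.2 T' T'.2, hcomm S S.2 T' T'.2]
    exact fun o o' _ => LinearMap.ext (key o o')
  have htop := LinearMap.IsSymmetric.iSup_iInf_eq_top_of_commute hop hopc
  obtain ⟨χ, a', ha', haT⟩ : ∃ χ : Option (𝒯 × 𝒯) → ℝ, ∃ a ∈ ⨅ o, Module.End.eigenspace (op o) (χ o),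
      T₀ (a : E) ≠ 0 := by
    by_contra! hno
    have h1 : (⊤ : Submodule ℝ F) ≤ LinearMap.ker (T₀.restrict (hTF T₀ hT₀)) := by
      rw [← htop]
      refine iSup_le fun χ a ha => ?_
      rw [LinearMap.mem_ker]
      exact Subtype.ext (hno χ a ha)
    have h2 := h1 (show (⟨u, huv, huw⟩ : F) ∈ ⊤ from trivial)
    exact hTu (congrArg Subtype.val (LinearMap.mem_ker.1 h2))
  simp only [Submodule.mem_iInf, Module.End.mem_eigenspace_iff] at ha'
  obtain ⟨a, haF⟩ := a'
  change T₀ a ≠ 0 at haT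
  have haD : D a = χ none • a := congrArg Subtype.val (ha' none)
  have haST : ∀ S T : 𝒯, (S : E →ₗ[ℝ] E) ((T : E →ₗ[ℝ] E) a) = χ (some (S, T)) • a := fun S T =>
    congrArg Subtype.val (ha' (some (S, T)))
  set l := χ (some (⟨T₀, hT₀⟩, ⟨T₀, hT₀⟩))
  have hl : T₀ (T₀ a) = l • a := haST ⟨T₀, hT₀⟩ ⟨T₀, hT₀⟩
  have ha0 : a ≠ 0 := fun h0 => haT (by rw [h0, map_zero])
  have hl0 : l ≠ 0 := by
    intro h0
    rw [h0, zero_smul] at hl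
    have := hskew T₀ hT₀ a (T₀ a)
    rw [hl, inner_zero_right, neg_zero] at this
    exact haT (inner_self_eq_zero.1 this)
  -- all images of `a` are proportional
  have hline : ∀ S ∈ 𝒯, ∃ c : ℝ, S a = c • T₀ a := by
    intro S hS
    have e1 : T₀ (S a) = χ (some (⟨T₀, hT₀⟩, ⟨S, hS⟩)) • a := haST ⟨T₀, hT₀⟩ ⟨S, hS⟩
    have e2 : l • S a = χ (some (⟨T₀, hT₀⟩, ⟨S, hS⟩)) • T₀ a := by
      rw [← map_smul, ← hl, hcomm S hS T₀ hT₀, hcomm S hS T₀ hT₀, e1, map_smul]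
    refine ⟨l⁻¹ * χ (some (⟨T₀, hT₀⟩, ⟨S, hS⟩)), ?_⟩
    rw [mul_smul, ← e2, smul_smul, inv_mul_cancel₀ hl0, one_smul]
  set α := ‖a‖
  set β := ‖T₀ a‖
  have hα : α ≠ 0 := norm_ne_zero_iff.2 ha0
  have hβ : β ≠ 0 := norm_ne_zero_iff.2 haT
  have hlβ : l * α ^ 2 = -β ^ 2 := by
    have := hskew T₀ hT₀ a (T₀ a)
    rw [hl, inner_smul_right, real_inner_self_eq_norm_sq, real_inner_self_eq_norm_sq] at this
    linarith
  have hTaF : T₀ a ∈ F := hTF T₀ hT₀ a haF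
  have haTa : ⟪a, T₀ a⟫_ℝ = 0 := by
    have := hskew T₀ hT₀ a a
    rw [real_inner_comm] at this
    linarith
  have hnew : P (m + 1) := by
    refine ⟨_, _, h.extend (a := α⁻¹ • a) (b := β⁻¹ • T₀ a) ?_ ?_ ?_ ?_ ?_ ?_ ?_ ?_ ?_⟩
    · rw [inner_smul_left, inner_smul_right, real_inner_self_eq_norm_sq]
      change α⁻¹ * (α⁻¹ * α ^ 2) = 1
      field_simp
    · rw [inner_smul_left, inner_smul_right, real_inner_self_eq_norm_sq]
      change β⁻¹ * (β⁻¹ * β ^ 2) = 1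
      field_simp
    · rw [inner_smul_left, inner_smul_right, haTa, mul_zero, mul_zero]
    · intro i; rw [inner_smul_right, haF.1, mul_zero]
    · intro i; rw [inner_smul_right, haF.2, mul_zero]
    · intro i; rw [inner_smul_right, hTaF.1, mul_zero]
    · intro i; rw [inner_smul_right, hTaF.2, mul_zero]
    · refine ⟨χ none, ?_, ?_⟩
      · rw [map_smul, haD, smul_comm]
      · rw [map_smul, hDT T₀ hT₀, haD, map_smul, neg_smul, smul_neg, smul_comm]
    · intro S hS
      obtain ⟨c, hc⟩ := hline S hS
      refine ⟨α⁻¹ * c * β, ?_, ?_⟩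
      · rw [map_smul, hc, smul_smul, smul_smul, mul_assoc _ β, mul_inv_cancel₀ hβ, mul_one]
      · rw [map_smul, hcomm S hS T₀ hT₀, hc, map_smul, hl, smul_smul, smul_smul, smul_smul]
        congr 1
        field_simp
        linear_combination c * hlβ
  have := Nat.le_findGreatest (P := P) (hnew.elim fun _ h => h.elim fun _ h => h.card_le) hnew
  exact absurd this (by simp [m])

end SkewFamilies

section GradedNotSymmetric

attribute [-instance] LieRing.ofAssociativeRing

open NormedSpace

variable {m : Type} [Fintype m] [DecidableEq m] {𝕜 : Type} [RCLike 𝕜]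

/-- The matrices `X` with `Xᵀ B + B X = 0`, as a real vector space. -/
def skewFor (B : Matrix m m 𝕜) : Submodule ℝ (Matrix m m 𝕜) where
  carrier := {X | Xᵀ * B = -(B * X)}
  zero_mem' := by simp
  add_mem' := fun {X Y} hX hY => by
    change _ = _ at hX hY ⊢
    rw [Matrix.transpose_add, add_mul, hX, hY, mul_add, neg_add]
  smul_mem' := fun r X hX => by
    change _ = _ at hX ⊢
    rw [Matrix.transpose_smul, Matrix.smul_mul, hX, Matrix.mul_smul, smul_neg]

theorem mem_skewFor {B X : Matrix m m 𝕜} : X ∈ skewFor B ↔ Xᵀ * B = -(B * X) := Iff.rfl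

theorem transpose_exp_conj {B : Matrix m m 𝕜} (hB : B * B = 1) (X : Matrix m m 𝕜) :
    exp (-(B * Xᵀ * B)) = B * (exp (-X))ᵀ * B := by
  have hu : IsUnit B := IsUnit.of_mul_eq_one _ hB
  have hinv : B⁻¹ = B := Matrix.inv_eq_right_inv hB
  have h := Matrix.exp_conj B ((-X)ᵀ) hu
  rw [hinv, Matrix.exp_transpose, Matrix.transpose_neg, Matrix.mul_neg, Matrix.neg_mul] at h
  exact h

theorem exp_isometry {B X : Matrix m m 𝕜} (hB : B * B = 1) (hX : X ∈ skewFor B) :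
    (exp X)ᵀ * B * exp X = B := by
  have h1 : -(B * Xᵀ * B) = X := by
    rw [Matrix.mul_assoc, mem_skewFor.1 hX, Matrix.mul_neg, neg_neg, ← Matrix.mul_assoc, hB,
      Matrix.one_mul]
  have h2 := transpose_exp_conj hB X
  have h3 : exp (-X) = (exp X)⁻¹ := Matrix.exp_neg X
  have hu := (Matrix.isUnit_iff_isUnit_det _).1 (Matrix.isUnit_exp X)
  rw [h1] at h2
  conv_lhs => rw [h2]
  have h4 : (exp X)ᵀ * (exp (-X))ᵀ = 1 := by
    rw [← Matrix.transpose_mul, h3, Matrix.nonsing_inv_mul _ hu, Matrix.transpose_one]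
  have h5 : B * (B * (exp (-X))ᵀ * B) = (exp (-X))ᵀ * B := by
    rw [← Matrix.mul_assoc, ← Matrix.mul_assoc, hB, Matrix.one_mul]
  rw [Matrix.mul_assoc, h5, ← Matrix.mul_assoc, ← h2, h4, Matrix.one_mul]

theorem isLieAlgebraOf_skewFor {B : Matrix m m 𝕜} (hB : B * B = 1)
    {G : Subgroup (GL m 𝕜)} (hG₁ : idComp (specialIsometry B) ≤ G) (hG₂ : G ≤ bilinIsometry B) :
    let _ : NormedRing (Matrix m m 𝕜) := Matrix.linftyOpNormedRing
    let _ : NormedAlgebra ℝ (Matrix m m 𝕜) := Matrix.linftyOpNormedAlgebra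
    IsLieAlgebraOf (skewFor B) G := by
  intro i1 i2
  have hcomplete : CompleteSpace (Matrix m m 𝕜) := inferInstance
  have hu : IsUnit B := IsUnit.of_mul_eq_one _ hB
  constructor
  · intro X hX
    refine ⟨(Matrix.isUnit_exp X).unit, hG₁ ?_, rfl⟩
    refine mem_idComp_of_curve hu (isPreconnected_univ (α := ℝ)) (f := fun t => exp (t • X))
      ?_ ?_ (t₀ := 0) (t₁ := 1) trivial trivial (by simp) (by simp)
    · exact (continuous_exp'.comp (continuous_id.smul continuous_const)).continuousOn
    · intro t _
      exact exp_isometry hB ((skewFor B).smul_mem t hX)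
  · have hs : HasStrictFDerivAt (exp : Matrix m m 𝕜 → Matrix m m 𝕜)
        ((ContinuousLinearEquiv.refl ℝ (Matrix m m 𝕜) : Matrix m m 𝕜 ≃L[ℝ] Matrix m m 𝕜) :
          Matrix m m 𝕜 →L[ℝ] Matrix m m 𝕜) 0 := hasStrictFDerivAt_exp_zero
    have h1 := hs.eventually_left_inverse
    have hc : Continuous fun Z : Matrix m m 𝕜 => -(B * Zᵀ * B) :=
      ((continuous_const.matrix_mul continuous_id.matrix_transpose).matrix_mul continuous_const).neg
    have h2 : Tendsto (fun Z : Matrix m m 𝕜 => -(B * Zᵀ * B)) (𝓝 0) (𝓝 0) := by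
      have := hc.tendsto 0
      simpa using this
    filter_upwards [h1, h2.eventually h1] with Z hZ1 hZ2
    rintro ⟨g, hg, hgZ⟩
    have hiso : (exp Z)ᵀ * B * exp Z = B := by
      have h : (g : Matrix m m 𝕜)ᵀ * B * (g : Matrix m m 𝕜) = B := hG₂ hg
      rw [hgZ] at h
      exact h
    have hdet := (Matrix.isUnit_iff_isUnit_det _).1 (Matrix.isUnit_exp Z)
    have h3 : exp (-(B * Zᵀ * B)) = exp Z := by
      rw [transpose_exp_conj hB, Matrix.exp_neg, Matrix.transpose_nonsing_inv]
      have h4 : B * exp Z = ((exp Z)ᵀ)⁻¹ * B := by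
        have hdet' : IsUnit ((exp Z)ᵀ).det := by rwa [Matrix.det_transpose]
        calc B * exp Z = ((exp Z)ᵀ)⁻¹ * ((exp Z)ᵀ * B * exp Z) := by
              rw [Matrix.mul_assoc, ← Matrix.mul_assoc ((exp Z)ᵀ)⁻¹, Matrix.nonsing_inv_mul _ hdet',
                Matrix.one_mul]
          _ = _ := by rw [hiso]
      rw [Matrix.mul_assoc, ← h4, ← Matrix.mul_assoc, hB, Matrix.one_mul]
    have hZ3 : -(B * Zᵀ * B) = Z := hZ2.symm.trans ((congrArg _ h3).trans hZ1)
    rw [mem_skewFor]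
    calc Zᵀ * B = B * (B * Zᵀ * B) := by
          rw [← Matrix.mul_assoc, ← Matrix.mul_assoc, hB, Matrix.one_mul]
      _ = B * -Z := by rw [← hZ3, neg_neg, hZ3]
      _ = _ := Matrix.mul_neg _ _
  · intro g hg X hX
    have h1 : (g : Matrix m m 𝕜)ᵀ * B * g = B := hG₂ hg
    have h2 : ((g⁻¹ : GL m 𝕜) : Matrix m m 𝕜)ᵀ * B * ((g⁻¹ : GL m 𝕜) : Matrix m m 𝕜) = B :=
      hG₂ (G.inv_mem hg)
    have h3 : (g : Matrix m m 𝕜) * ((g⁻¹ : GL m 𝕜) : Matrix m m 𝕜) = 1 := g.mul_inv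
    have h4 : ((g⁻¹ : GL m 𝕜) : Matrix m m 𝕜) * (g : Matrix m m 𝕜) = 1 := g.inv_mul
    obtain ⟨a, ha⟩ : ∃ a, (g : Matrix m m 𝕜) = a := ⟨_, rfl⟩
    obtain ⟨b, hb⟩ : ∃ b, ((g⁻¹ : GL m 𝕜) : Matrix m m 𝕜) = b := ⟨_, rfl⟩
    rw [ha, hb] at h3 h4 ⊢
    rw [ha] at h1
    rw [hb] at h2
    have h5 : aᵀ * B = B * b := by
      calc aᵀ * B = aᵀ * B * (a * b) := by rw [h3, Matrix.mul_one]
        _ = _ := by rw [← Matrix.mul_assoc, h1]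
    have h6 : bᵀ * B = B * a := by
      calc bᵀ * B = bᵀ * B * (b * a) := by rw [h4, Matrix.mul_one]
        _ = _ := by rw [← Matrix.mul_assoc, h2]
    rw [mem_skewFor] at hX ⊢
    rw [Matrix.transpose_mul, Matrix.transpose_mul]
    calc bᵀ * (Xᵀ * aᵀ) * B = bᵀ * (Xᵀ * (aᵀ * B)) := by simp only [Matrix.mul_assoc]
      _ = bᵀ * ((Xᵀ * B) * b) := by rw [h5]; simp only [Matrix.mul_assoc]
      _ = -((bᵀ * B) * X * b) := by
          rw [hX]; simp only [Matrix.mul_assoc, Matrix.mul_neg, Matrix.neg_mul]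
      _ = _ := by rw [h6]; simp only [Matrix.mul_assoc]

theorem single_mul_diag (i j : m) (x : 𝕜) (d : m → 𝕜) :
    Matrix.single i j x * Matrix.diagonal d = Matrix.single i j (x * d j) := by
  ext k l
  rw [Matrix.mul_diagonal, Matrix.single_apply, Matrix.single_apply]
  split_ifs with h
  · rw [h.2]
  · rw [zero_mul]

theorem diag_mul_single (i j : m) (x : 𝕜) (d : m → 𝕜) :
    Matrix.diagonal d * Matrix.single i j x = Matrix.single i j (d i * x) := by
  ext k l
  rw [Matrix.diagonal_mul, Matrix.single_apply, Matrix.single_apply]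
  split_ifs with h
  · rw [h.1]
  · rw [mul_zero]

theorem single_sub_mem_skewFor {β : m → 𝕜} (hβ : ∀ i, β i * β i = 1) (a b : m) :
    Matrix.single a b (1 : 𝕜) - Matrix.single b a (β a * β b) ∈ skewFor (Matrix.diagonal β) := by
  rw [mem_skewFor, Matrix.transpose_sub, Matrix.transpose_single, Matrix.transpose_single, sub_mul,
    mul_sub, single_mul_diag, single_mul_diag, diag_mul_single, diag_mul_single, mul_one, one_mul,
    mul_assoc, hβ, mul_one, mul_left_comm, hβ, mul_one, neg_sub]

theorem conjTranspose_mem_skewFor {β : m → 𝕜} (hβ : Matrix.diagonal β * Matrix.diagonal β = 1)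
    (hs : (Matrix.diagonal β)ᴴ = Matrix.diagonal β) {W : Matrix m m 𝕜}
    (hW : W ∈ skewFor (Matrix.diagonal β)) : Wᴴ ∈ skewFor (Matrix.diagonal β) := by
  have h1 := congrArg Matrix.conjTranspose (mem_skewFor.1 hW)
  rw [Matrix.conjTranspose_mul, Matrix.conjTranspose_neg, Matrix.conjTranspose_mul, hs] at h1
  have h2 : Wᵀᴴ = Wᴴᵀ := rfl
  rw [h2] at h1
  rw [mem_skewFor]
  calc Wᴴᵀ * Matrix.diagonal β =
        Matrix.diagonal β * (Matrix.diagonal β * Wᴴᵀ) * Matrix.diagonal β := by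
        rw [← Matrix.mul_assoc (Matrix.diagonal β), hβ, Matrix.one_mul]
    _ = _ := by
        rw [h1, Matrix.mul_neg, Matrix.neg_mul, Matrix.mul_assoc, Matrix.mul_assoc, hβ, Matrix.mul_one]

theorem single_bracket {a a' b : m} (haa : a ≠ a') (hab : a ≠ b) (hab' : a' ≠ b) (s s' : 𝕜) :
    (Matrix.single a b (1 : 𝕜) - Matrix.single b a s) *
        (Matrix.single a' b (1 : 𝕜) - Matrix.single b a' s') -
        (Matrix.single a' b (1 : 𝕜) - Matrix.single b a' s') *
        (Matrix.single a b (1 : 𝕜) - Matrix.single b a s) =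
        Matrix.single a a' (-s') + Matrix.single a' a s := by
  simp only [mul_sub, sub_mul, ne_eq, hab.symm, hab'.symm, haa, haa.symm, not_false_eq_true,
    Matrix.single_mul_single_of_ne, Matrix.single_mul_single_same, one_mul, hab, hab']
  ext k l
  simp only [Matrix.sub_apply, Matrix.add_apply, Matrix.zero_apply, Matrix.single_apply]
  split_ifs <;> simp

theorem eq_zero_of_centralizes_odd {β c : m → 𝕜} (hβ2 : ∀ i, β i * β i = 1)
    (hc : ∀ i, c i = 1 ∨ c i = -1) {a b : m} (ha : c a = 1) (hb : c b = -1) {Z : Matrix m m 𝕜}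
    (hZ𝔤 : Z ∈ skewFor (Matrix.diagonal β)) (hcZ : Matrix.diagonal c * Z = Z * Matrix.diagonal c)
    (hcomm : ∀ i j, c i = -c j → Z * (Matrix.single i j (1 : 𝕜) - Matrix.single j i (β i * β j)) -
      (Matrix.single i j (1 : 𝕜) - Matrix.single j i (β i * β j)) * Z = 0) : Z = 0 := by
  have hc2 : ∀ i, c i * c i = 1 := fun i => by rcases hc i with h | h <;> simp [h]
  have hdiag : ∀ i, Z i i = 0 := by
    intro i
    have h1 := congrFun (congrFun (mem_skewFor.1 hZ𝔤) i) i
    rw [Matrix.mul_diagonal, Matrix.neg_apply, Matrix.diagonal_mul, Matrix.transpose_apply] at h1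
    have h2 : (2 : 𝕜) * Z i i = 0 := by
      linear_combination β i * h1 - 2 * Z i i * hβ2 i
    exact (mul_eq_zero.1 h2).resolve_left two_ne_zero
  have hmix : ∀ i j, c i = -c j → Z i j = 0 := by
    intro i j hij
    have h1 := congrFun (congrFun hcZ i) j
    rw [Matrix.mul_diagonal, Matrix.diagonal_mul, hij] at h1
    have h2 : (2 : 𝕜) * Z i j = 0 := by
      linear_combination -c j * h1 - 2 * Z i j * hc2 j
    exact (mul_eq_zero.1 h2).resolve_left two_ne_zero
  have hother : ∀ k, ∃ l, c k = -c l := by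
    intro k
    rcases hc k with h | h
    · exact ⟨b, by rw [h, hb, neg_neg]⟩
    · exact ⟨a, by rw [h, ha]⟩
  ext i k
  obtain ⟨l, hl⟩ := hother k
  have hkl : k ≠ l := by
    rintro rfl
    rcases hc k with h | h <;> rw [h] at hl
    · exact absurd (show (2 : 𝕜) = 0 by linear_combination hl) two_ne_zero
    · exact absurd (show (2 : 𝕜) = 0 by linear_combination -hl) two_ne_zero
  have h1 := congrFun (congrFun (hcomm k l hl) i) l
  have e1 : (Z * Matrix.single k l (1 : 𝕜)) i l = Z i k := by simp
  have e2 : (Z * Matrix.single l k (β k * β l)) i l = 0 :=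
    Matrix.mul_single_apply_of_ne _ _ _ _ _ hkl.symm _
  have e3 : (Matrix.single k l (1 : 𝕜) * Z) i l = 0 := by
    by_cases hik : i = k
    · subst hik; simp [hdiag]
    · simp [hik]
  have e4 : (Matrix.single l k (β k * β l) * Z) i l = 0 := by
    by_cases hil : i = l
    · subst hil; simp [hmix k i hl]
    · simp [hil]
  rw [mul_sub, sub_mul, Matrix.sub_apply, Matrix.sub_apply, Matrix.sub_apply, e1, e2, e3, e4] at h1
  simpa using h1

/-- The subgroups of isometry groups of diagonal forms given by a grading are not symmetric. -/
theorem not_isSymmetricSubgroup_of_grading {β c : m → 𝕜} (hβ : ∀ i, β i = 1 ∨ β i = -1)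
    (hc : ∀ i, c i = 1 ∨ c i = -1)
    {G : Subgroup (GL m 𝕜)} (hG₁ : idComp (specialIsometry (Matrix.diagonal β)) ≤ G)
    (hG₂ : G ≤ bilinIsometry (Matrix.diagonal β)) (H : Subgroup G) (𝔥 : Submodule ℝ (Matrix m m 𝕜))
    (h𝔥 : ∀ X : Matrix m m 𝕜, (∀ t : ℝ, ∃ g ∈ H, ((g : GL m 𝕜) : Matrix m m 𝕜) = exp (t • X)) →
      X ∈ 𝔥)
    (heven : ∀ X ∈ 𝔥, Matrix.diagonal c * X = X * Matrix.diagonal c)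
    {a a' b : m} (haa : a ≠ a') (ha : c a = 1) (ha' : c a' = 1) (hb : c b = -1)
    (hnot : ∀ s s' : 𝕜, s ≠ 0 → Matrix.single a a' s + Matrix.single a' a s' ∉ 𝔥) :
    ¬ IsSymmetricSubgroup H := by
  let _ : NormedRing (Matrix m m 𝕜) := Matrix.linftyOpNormedRing
  let _ : NormedAlgebra ℝ (Matrix m m 𝕜) := Matrix.linftyOpNormedAlgebra
  have hcomplete : CompleteSpace (Matrix m m 𝕜) := inferInstance
  have hfin : FiniteDimensional ℝ (Matrix m m 𝕜) := by
    have : FiniteDimensional ℝ 𝕜 := inferInstance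
    exact Module.Finite.matrix
  have hβ2 : ∀ i, β i * β i = 1 := fun i => by rcases hβ i with h | h <;> simp [h]
  have hc2 : ∀ i, c i * c i = 1 := fun i => by rcases hc i with h | h <;> simp [h]
  have hβs : ∀ i, star (β i) = β i := fun i => by rcases hβ i with h | h <;> simp [h]
  have hcs : ∀ i, star (c i) = c i := fun i => by rcases hc i with h | h <;> simp [h]
  have hBB : Matrix.diagonal β * Matrix.diagonal β = 1 := by
    rw [Matrix.diagonal_mul_diagonal]; simp only [hβ2]; exact Matrix.diagonal_one
  have hcc : Matrix.diagonal c * Matrix.diagonal c = 1 := by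
    rw [Matrix.diagonal_mul_diagonal]; simp only [hc2]; exact Matrix.diagonal_one
  have hBt : (Matrix.diagonal β)ᴴ = Matrix.diagonal β := by
    rw [Matrix.diagonal_conjTranspose]; congr 1; funext i; exact hβs i
  have hct : (Matrix.diagonal c)ᴴ = Matrix.diagonal c := by
    rw [Matrix.diagonal_conjTranspose]; congr 1; funext i; exact hcs i
  have hodd : ∀ i j, c i = -c j → Matrix.diagonal c * (Matrix.single i j (1 : 𝕜) -
      Matrix.single j i (β i * β j)) = -((Matrix.single i j (1 : 𝕜) -
      Matrix.single j i (β i * β j)) * Matrix.diagonal c) := by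
    intro i j hij
    rw [mul_sub, sub_mul, diag_mul_single, diag_mul_single, single_mul_diag, single_mul_diag, hij]
    ext k l
    simp only [Matrix.sub_apply, Matrix.neg_apply, Matrix.single_apply]
    split_ifs <;> ring
  have hLie := isLieAlgebraOf_skewFor hBB hG₁ hG₂
  let τ : Matrix m m 𝕜 →ₗ[ℝ] ℝ :=
    RCLike.reLm.comp ((Matrix.traceLinearMap m 𝕜 𝕜).restrictScalars ℝ)
  have hτ : ∀ X : Matrix m m 𝕜, τ X = RCLike.re X.trace := fun X => rfl
  refine hLie.not_isSymmetricSubgroup H 𝔥 (Matrix.diagonal c) hcc (fun X _ => h𝔥 X) heven τ ?_ ?_ ?_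
  · intro X Y
    rw [hτ, hτ, Matrix.trace_mul_comm]
  · intro Z hZ hZ𝔤 hZτ
    have hcZ := heven Z hZ
    have hcomm : ∀ X ∈ skewFor (Matrix.diagonal β),
        Matrix.diagonal c * X = -(X * Matrix.diagonal c) → Z * X - X * Z = 0 := by
      intro X hX hcX
      have hW𝔤 := hLie.lie_mem ⟨Z, hZ𝔤⟩ ⟨X, hX⟩
      dsimp only at hW𝔤
      have hcW : Matrix.diagonal c * (Z * X - X * Z) = -((Z * X - X * Z) * Matrix.diagonal c) := by
        have a1 : Matrix.diagonal c * (Z * X) = -(Z * X * Matrix.diagonal c) := by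
          rw [← mul_assoc, hcZ, mul_assoc, hcX, mul_neg, mul_assoc]
        have a2 : Matrix.diagonal c * (X * Z) = -(X * Z * Matrix.diagonal c) := by
          rw [← mul_assoc, hcX, neg_mul, mul_assoc, hcZ, mul_assoc]
        rw [mul_sub, sub_mul, a1, a2]
        abel
      set W := Z * X - X * Z
      have hWh : Wᴴ ∈ skewFor (Matrix.diagonal β) := conjTranspose_mem_skewFor hBB hBt hW𝔤
      have hcWh : Matrix.diagonal c * Wᴴ = -(Wᴴ * Matrix.diagonal c) := by
        have h1 := congrArg Matrix.conjTranspose hcW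
        rw [Matrix.conjTranspose_mul, Matrix.conjTranspose_neg, Matrix.conjTranspose_mul, hct] at h1
        rw [h1, neg_neg]
      have h1 := hZτ X hX Wᴴ hWh hcX hcWh
      rw [hτ] at h1
      change RCLike.re (W * Wᴴ).trace = 0 at h1
      have h2 : RCLike.re (W * Wᴴ).trace = ∑ i, ∑ j, ‖W i j‖ ^ 2 := by
        simp only [Matrix.trace, Matrix.diag_apply, Matrix.mul_apply, Matrix.conjTranspose_apply,
          map_sum]
        refine Finset.sum_congr rfl fun i _ => Finset.sum_congr rfl fun j _ => ?_
        rw [RCLike.star_def, RCLike.mul_conj]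
        norm_cast
      rw [h2, Finset.sum_eq_zero_iff_of_nonneg (fun i _ => Finset.sum_nonneg fun j _ => sq_nonneg _)] at h1
      ext i j
      have h3 := h1 i (Finset.mem_univ i)
      rw [Finset.sum_eq_zero_iff_of_nonneg (fun j _ => sq_nonneg _)] at h3
      have h4 := h3 j (Finset.mem_univ j)
      simpa using h4
    exact eq_zero_of_centralizes_odd hβ2 hc ha hb hZ𝔤 hcZ fun i j hij =>
      hcomm _ (single_sub_mem_skewFor hβ2 i j) (hodd i j hij)
  · have hab : a ≠ b := by
      rintro rfl
      rw [ha] at hb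
      exact absurd (show (2 : 𝕜) = 0 by linear_combination hb) two_ne_zero
    have hab' : a' ≠ b := by
      rintro rfl
      rw [ha'] at hb
      exact absurd (show (2 : 𝕜) = 0 by linear_combination hb) two_ne_zero
    refine ⟨_, single_sub_mem_skewFor hβ2 a b, _, single_sub_mem_skewFor hβ2 a' b,
      hodd a b (by rw [ha, hb, neg_neg]), hodd a' b (by rw [ha', hb, neg_neg]), ?_⟩
    rw [single_bracket haa hab hab']
    refine hnot _ _ (neg_ne_zero.2 ?_)
    exact mul_ne_zero (left_ne_zero_of_mul_eq_one (hβ2 a')) (left_ne_zero_of_mul_eq_one (hβ2 b))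

end GradedNotSymmetric

section PlanarMatrices

variable {n r : ℕ} {m : Type} [Fintype m] [DecidableEq m] {R : Type} [CommRing R]

/-- The matrix that acts by `[[aⱼ, bⱼ], [cⱼ, dⱼ]]` in the `j`-th coordinate plane and by `f` on the
remaining coordinates. -/
def planar (e : Fin n ⊕ Fin n ⊕ Fin r ≃ m) (a b c d : Fin n → R) (f : Fin r → R) : Matrix m m R :=
  (Matrix.fromBlocks (Matrix.diagonal a) (Matrix.fromCols (Matrix.diagonal b) 0)
    (Matrix.fromRows (Matrix.diagonal c) 0)
    (Matrix.fromBlocks (Matrix.diagonal d) 0 0 (Matrix.diagonal f))).submatrix e.symm e.symm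

variable (e : Fin n ⊕ Fin n ⊕ Fin r ≃ m)

theorem planar_ext {A A' : Matrix m m R} (h : ∀ i j, A (e i) (e j) = A' (e i) (e j)) : A = A' := by
  ext x y
  rw [← e.apply_symm_apply x, ← e.apply_symm_apply y, h]

theorem planar_mul (a b c d a' b' c' d' : Fin n → R) (f f' : Fin r → R) :
    planar e a b c d f * planar e a' b' c' d' f' =
      planar e (a * a' + b * c') (a * b' + b * d') (c * a' + d * c') (c * b' + d * d') (f * f') := by
  rw [planar, planar, Matrix.submatrix_mul_equiv, planar]
  congr 1
  ext (i | i | i) (j | j | j) <;>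
    simp [Matrix.mul_apply, Matrix.diagonal_apply] <;> split_ifs <;> simp_all

theorem planar_one : planar e (1 : Fin n → R) 0 0 1 1 = 1 := by
  rw [planar, ← Matrix.submatrix_one_equiv e.symm]
  congr 1
  ext (i | i | i) (j | j | j) <;> simp [Matrix.one_apply]

theorem planar_apply_inl (b c : Fin n → R) (f : Fin r → R) (i₀ i) :
    planar e 0 b c 0 f (e (Sum.inl i₀)) (e i) = if i = Sum.inr (Sum.inl i₀) then b i₀ else 0 := by
  rw [planar, Matrix.submatrix_apply, Equiv.symm_apply_apply, Equiv.symm_apply_apply]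
  rcases i with i | i | i
  · simp
  · by_cases h : i = i₀
    · simp [h]
    · simp [h, Matrix.diagonal_apply_ne _ (Ne.symm h)]
  · simp

theorem planar_apply_inr_inl (b c : Fin n → R) (f : Fin r → R) (i₁ i) :
    planar e 0 b c 0 f (e i) (e (Sum.inr (Sum.inl i₁))) = if i = Sum.inl i₁ then b i₁ else 0 := by
  rw [planar, Matrix.submatrix_apply, Equiv.symm_apply_apply, Equiv.symm_apply_apply]
  rcases i with i | i | i
  · by_cases h : i = i₁ <;> simp [h]
  · simp
  · simp

theorem planar_transpose (a b c d : Fin n → R) (f : Fin r → R) :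
    (planar e a b c d f)ᵀ = planar e a c b d f := by
  rw [planar, planar, Matrix.transpose_submatrix]
  congr 1
  ext (i | i | i) (j | j | j) <;> simp [Matrix.diagonal_apply, eq_comm] <;>
    by_cases h : i = j <;> simp [h]

theorem planar_map {S : Type} [CommRing S] (φ : R →+* S) (a b c d : Fin n → R) (f : Fin r → R) :
    (planar e a b c d f).map φ =
      planar e (φ ∘ a) (φ ∘ b) (φ ∘ c) (φ ∘ d) (φ ∘ f) := by
  refine planar_ext e fun i j => ?_
  rcases i with i | i | i <;> rcases j with j | j | j <;>
    simp [planar, Matrix.diagonal_apply, apply_ite φ]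

theorem planar_smul (s : R) (a b c d : Fin n → R) (f : Fin r → R) :
    s • planar e a b c d f = planar e (s • a) (s • b) (s • c) (s • d) (s • f) := by
  refine planar_ext e fun i j => ?_
  rcases i with i | i | i <;> rcases j with j | j | j <;>
    simp [planar, Matrix.diagonal_apply]

theorem planar_neg (a b c d : Fin n → R) (f : Fin r → R) :
    -planar e a b c d f = planar e (-a) (-b) (-c) (-d) (-f) := by
  rw [← neg_one_smul R, planar_smul]
  simp

theorem planar_add (a b c d a' b' c' d' : Fin n → R) (f f' : Fin r → R) :
    planar e a b c d f + planar e a' b' c' d' f' =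
      planar e (a + a') (b + b') (c + c') (d + d') (f + f') := by
  refine planar_ext e fun i j => ?_
  rcases i with i | i | i <;> rcases j with j | j | j <;>
    simp [planar, Matrix.diagonal_apply] <;> split_ifs <;> simp

theorem planar_eq_diagonal (a d : Fin n → R) (f : Fin r → R) :
    planar e a 0 0 d f = Matrix.diagonal (Sum.elim a (Sum.elim d f) ∘ e.symm) := by
  rw [planar, ← Matrix.submatrix_diagonal_equiv]
  congr 1
  ext (i | i | i) (j | j | j) <;> simp [Matrix.diagonal_apply]

theorem planar_injective {a b c d a' b' c' d' : Fin n → R} {f f' : Fin r → R}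
    (h : planar e a b c d f = planar e a' b' c' d' f') :
    a = a' ∧ b = b' ∧ c = c' ∧ d = d' ∧ f = f' := by
  have h1 : ∀ i j, planar e a b c d f (e i) (e j) = planar e a' b' c' d' f' (e i) (e j) := by
    intro i j; rw [h]
  simp only [planar, Matrix.submatrix_apply, Equiv.symm_apply_apply] at h1
  refine ⟨?_, ?_, ?_, ?_, ?_⟩ <;> funext i
  · simpa using h1 (Sum.inl i) (Sum.inl i)
  · simpa using h1 (Sum.inl i) (Sum.inr (Sum.inl i))
  · simpa using h1 (Sum.inr (Sum.inl i)) (Sum.inl i)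
  · simpa using h1 (Sum.inr (Sum.inl i)) (Sum.inr (Sum.inl i))
  · simpa using h1 (Sum.inr (Sum.inr i)) (Sum.inr (Sum.inr i))

theorem det_planar_diagonal (a d : Fin n → R) (f : Fin r → R) :
    (planar e a 0 0 d f).det = (∏ i, a i) * (∏ i, d i) * ∏ i, f i := by
  rw [planar_eq_diagonal, Matrix.det_diagonal]
  simp only [Function.comp_apply]
  rw [Equiv.prod_comp e.symm (Sum.elim a (Sum.elim d f)), Fintype.prod_sum_type,
    Fintype.prod_sum_type]
  simp [mul_assoc]

theorem exp_planar {u v : ℂ} (huv : u * v = 1) (s : Fin n → ℂ) :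
    NormedSpace.exp (planar e 0 (fun j => u * s j) (fun j => v * s j) 0 0) =
      planar e (fun j => Complex.cosh (s j)) (fun j => u * Complex.sinh (s j))
        (fun j => v * Complex.sinh (s j)) (fun j => Complex.cosh (s j)) 1 := by
  set U : Matrix m m ℂ := planar e 1 1 (fun _ => v) (fun _ => -v) 1
  set V : Matrix m m ℂ := planar e (fun _ => 1 / 2) (fun _ => u / 2) (fun _ => 1 / 2)
    (fun _ => -(u / 2)) 1
  have hUV : U * V = 1 := by
    rw [planar_mul, ← planar_one e]
    congr 1 <;> funext i <;> simp <;>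
      first
      | ring1
      | linear_combination huv
  have hU : IsUnit U := IsUnit.of_mul_eq_one _ hUV
  have hinv : U⁻¹ = V := Matrix.inv_eq_right_inv hUV
  have h1 : planar e 0 (fun j => u * s j) (fun j => v * s j) 0 0 =
      U * planar e s 0 0 (-s) 0 * U⁻¹ := by
    rw [hinv, planar_mul, planar_mul]
    congr 1 <;> funext i <;> simp <;> ring1
  rw [h1, Matrix.exp_conj _ _ hU, planar_eq_diagonal, Matrix.exp_diagonal, hinv]
  have h2 : NormedSpace.exp (Sum.elim s (Sum.elim (-s) (0 : Fin r → ℂ)) ∘ e.symm) =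
      Sum.elim (Complex.exp ∘ s) (Sum.elim (Complex.exp ∘ (-s)) (1 : Fin r → ℂ)) ∘ e.symm := by
    funext i
    rw [Pi.coe_exp]
    simp only [Function.comp_apply]
    rcases e.symm i with j | j | j <;> simp [Complex.exp_eq_exp_ℂ]
  rw [h2, ← planar_eq_diagonal, planar_mul, planar_mul]
  congr 1 <;> funext i <;> simp [Complex.cosh, Complex.sinh] <;>
    first
    | ring1
    | linear_combination (Complex.exp (s i) / 2 + Complex.exp (-s i) / 2) * huv

end PlanarMatrices

section Frames

variable {n r : ℕ} {m : Type} [Fintype m] [DecidableEq m] {𝕜 : Type} [RCLike 𝕜]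

/-- `t ↦ K T(t) K'`, where `T(t)` acts by `[[0, u tⱼ], [v tⱼ, 0]]` in the `j`-th plane. -/
noncomputable def planarHom (e : Fin n ⊕ Fin n ⊕ Fin r ≃ m) (𝔤 : LieSubalgebra ℝ (Matrix m m 𝕜))
    (K K' : Matrix m m 𝕜) (u v : 𝕜)
    (hmem : ∀ t : Fin n → ℝ,
      K * planar e 0 (fun j => u * (t j : 𝕜)) (fun j => v * (t j : 𝕜)) 0 0 * K' ∈ 𝔤) :
    (Fin n → ℝ) →ₗ[ℝ] 𝔤 where
  toFun := fun t => ⟨_, hmem t⟩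
  map_add' := fun s t => by
    apply Subtype.ext
    change K * _ * K' = K * _ * K' + K * _ * K'
    rw [← add_mul, ← mul_add, planar_add]
    have h1 : ∀ x : 𝕜, (fun j => x * (((s + t) j : ℝ) : 𝕜)) =
        (fun j => x * (s j : 𝕜)) + fun j => x * (t j : 𝕜) := by
      intro x; funext j; simp [mul_add]
    rw [h1, h1, add_zero, add_zero]
  map_smul' := fun s t => by
    apply Subtype.ext
    change K * _ * K' = s • (K * _ * K')
    have h1 : ∀ x : 𝕜, (fun j => x * (((s • t) j : ℝ) : 𝕜)) =
        (s : 𝕜) • fun j => x * (t j : 𝕜) := by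
      intro x; funext j; simp [mul_left_comm]
    have h2 : ∀ M : Matrix m m 𝕜, s • M = (s : 𝕜) • M := by
      intro M; ext i j; simp [RCLike.real_smul_eq_coe_mul]
    rw [← Matrix.smul_mul, ← Matrix.mul_smul, h2, planar_smul, h1, h1, smul_zero, smul_zero]

theorem coe_planarHom (e : Fin n ⊕ Fin n ⊕ Fin r ≃ m) (𝔤 : LieSubalgebra ℝ (Matrix m m 𝕜))
    (K K' : Matrix m m 𝕜) (u v : 𝕜) (hmem) (t : Fin n → ℝ) :
    (planarHom e 𝔤 K K' u v hmem t : Matrix m m 𝕜) =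
      K * planar e 0 (fun j => u * (t j : 𝕜)) (fun j => v * (t j : 𝕜)) 0 0 * K' := rfl

theorem planarHom_lie (e : Fin n ⊕ Fin n ⊕ Fin r ≃ m) (𝔤 : LieSubalgebra ℝ (Matrix m m 𝕜))
    {K K' : Matrix m m 𝕜} (hK : K * K' = 1) (u v : 𝕜) (hmem) (s t : Fin n → ℝ) :
    ⁅planarHom e 𝔤 K K' u v hmem s, planarHom e 𝔤 K K' u v hmem t⁆ = 0 := by
  have hK' : K' * K = 1 := mul_eq_one_comm.1 hK
  apply Subtype.ext
  have h1 : ∀ s t : Fin n → ℝ,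
      (planarHom e 𝔤 K K' u v hmem s : Matrix m m 𝕜) * planarHom e 𝔤 K K' u v hmem t =
        K * planar e (fun j => u * v * (s j * t j : 𝕜)) 0 0 (fun j => u * v * (s j * t j : 𝕜)) 0 *
          K' := by
    intro s t
    rw [coe_planarHom, coe_planarHom, Matrix.mul_assoc, ← Matrix.mul_assoc K',
      ← Matrix.mul_assoc K', hK', Matrix.one_mul, ← Matrix.mul_assoc, Matrix.mul_assoc K,
      planar_mul]
    congr 3 <;> funext i <;> simp <;> ring
  change (planarHom e 𝔤 K K' u v hmem s : Matrix m m 𝕜) * planarHom e 𝔤 K K' u v hmem t -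
    (planarHom e 𝔤 K K' u v hmem t : Matrix m m 𝕜) * planarHom e 𝔤 K K' u v hmem s = 0
  rw [h1, h1, sub_eq_zero]
  simp only [mul_comm]

/-- An eigenframe from a conjugation of a space of planar matrices. -/
noncomputable def eigenFrameOfPlanar (e : Fin n ⊕ Fin n ⊕ Fin r ≃ m) (B : Matrix m m 𝕜)
    {𝔤 : LieSubalgebra ℝ (Matrix m m 𝕜)} {𝔞 : Submodule ℝ 𝔤} {K K' : Matrix m m 𝕜} (hK : K * K' = 1)
    {u v : 𝕜} (huv : u * v = 1) (hmem) (hrange : (planarHom e 𝔤 K K' u v hmem).range = 𝔞) :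
    EigenFrame B 𝔤 𝔞 n r where
  φ := planarHom e 𝔤 K K' u v hmem
  U := K * (planar e 1 1 (fun _ => v) (fun _ => -v) 1).submatrix id e
  V := (planar e (fun _ => 1 / 2) (fun _ => u / 2) (fun _ => 1 / 2) (fun _ => -(u / 2)) 1).submatrix e id * K'
  range_eq := hrange
  continuous_φ := by
    refine Continuous.matrix_mul (Continuous.matrix_mul continuous_const ?_) continuous_const
    refine Continuous.matrix_submatrix ?_ _ _
    have h1 : ∀ x : 𝕜, Continuous fun t : Fin n → ℝ => Matrix.diagonal (fun j => x * (t j : 𝕜)) := by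
      intro x
      refine Continuous.matrix_diagonal (continuous_pi fun j => ?_)
      exact continuous_const.mul (RCLike.continuous_ofReal.comp (continuous_apply j))
    refine Continuous.matrix_fromBlocks continuous_const ?_ ?_ continuous_const
    · refine continuous_matrix fun i j => ?_
      rcases j with j | j
      · exact (h1 u).matrix_elem i j
      · exact continuous_const
    · refine continuous_matrix fun i j => ?_
      rcases i with i | i
      · exact (h1 v).matrix_elem i j
      · exact continuous_const
  U_mul_V := by
    rw [Matrix.mul_assoc, ← Matrix.mul_assoc (Matrix.submatrix _ _ _), Matrix.submatrix_mul_equiv,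
      planar_mul]
    have : planar e (1 * (fun _ => (1 : 𝕜) / 2) + 1 * fun _ => 1 / 2)
        (1 * (fun _ => u / 2) + 1 * fun _ => -(u / 2))
        ((fun _ => v) * (fun _ => 1 / 2) + (fun _ => -v) * fun _ => 1 / 2)
        ((fun _ => v) * (fun _ => u / 2) + (fun _ => -v) * fun _ => -(u / 2)) (1 * 1) = 1 := by
      rw [← planar_one e]
      congr 1 <;> funext i <;> simp <;>
        first
        | ring1
        | linear_combination huv
    rw [this, Matrix.submatrix_id_id, Matrix.one_mul, hK]
  V_mul_U := by
    have hK' : K' * K = 1 := mul_eq_one_comm.1 hK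
    rw [Matrix.mul_assoc, ← Matrix.mul_assoc K', hK', Matrix.one_mul,
      ← Matrix.submatrix_mul _ _ _ id _ Function.bijective_id, planar_mul,
      ← Matrix.submatrix_one_equiv e, ← planar_one e]
    congr 1
    congr 1 <;> funext i <;> simp <;>
        first
        | ring1
        | linear_combination huv
        | linear_combination (1 / 2 : 𝕜) * huv
        | linear_combination -(1 / 2 : 𝕜) * huv
  eigen := by
    intro t
    have hK' : K' * K = 1 := mul_eq_one_comm.1 hK
    change K * _ * K' * (K * _) = K * _ * _
    have h1 : Matrix.diagonal (fun a => ((eigs r t a : ℝ) : 𝕜)) =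
        (planar e (fun j => (t j : 𝕜)) 0 0 (fun j => -(t j : 𝕜)) 0).submatrix e e := by
      rw [planar_eq_diagonal, Matrix.submatrix_diagonal_equiv]
      congr 1
      funext a
      rcases a with a | a | a <;> simp [eigs]
    rw [Matrix.mul_assoc, ← Matrix.mul_assoc K', hK', Matrix.one_mul, Matrix.mul_assoc,
      Matrix.mul_assoc, h1]
    congr 1
    rw [Matrix.submatrix_mul_equiv, planar_mul]
    conv_lhs => arg 1; rw [← Matrix.submatrix_id_id (planar e 0 _ _ 0 0)]
    rw [← Matrix.submatrix_mul _ _ _ id _ Function.bijective_id, planar_mul]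
    congr 1
    congr 1 <;> funext i <;> simp
    all_goals first
      | ring1
      | linear_combination (t i : 𝕜) * huv

theorem range_eq_of_maximal {𝔤 V : Type} [LieRing 𝔤] [LieAlgebra ℝ 𝔤] [AddCommGroup V]
    [Module ℝ V] {𝔭 𝔞 : Submodule ℝ 𝔤} (h : IsMaximalAbelianIn 𝔭 𝔞) (φ : V →ₗ[ℝ] 𝔤)
    (hφ : ∀ t, φ t ∈ 𝔭) (hlie : ∀ s t, ⁅φ s, φ t⁆ = 0) (hle : 𝔞 ≤ φ.range) : φ.range = 𝔞 := by
  refine (Maximal.eq_of_le h ⟨?_, ?_⟩ hle).symm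
  · rintro _ ⟨t, rfl⟩
    exact hφ t
  · rintro _ ⟨s, rfl⟩ _ ⟨t, rfl⟩
    exact hlie s t

end Frames

section NormalForms

open scoped InnerProductSpace

variable {m ι : Type} [Fintype m] [DecidableEq m] [Fintype ι] [DecidableEq ι]

theorem orthonormal_toLp {v : ι → m → ℝ} (hv : ∀ i j, v i ⬝ᵥ v j = if i = j then 1 else 0) :
    Orthonormal ℝ fun i => WithLp.toLp 2 (v i) := by
  rw [orthonormal_iff_ite]
  intro i j
  rw [EuclideanSpace.inner_toLp_toLp, star_trivial, hv]
  exact if_congr eq_comm rfl rfl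

theorem card_le_of_orthonormal {v : ι → m → ℝ}
    (hv : ∀ i j, v i ⬝ᵥ v j = if i = j then 1 else 0) : Fintype.card ι ≤ Fintype.card m := by
  simpa using (orthonormal_toLp hv).linearIndependent.fintype_card_le_finrank

/-- An orthonormal family is part of the columns of an orthogonal matrix. -/
theorem exists_orthogonal_extension (a : ι ↪ m) {v : ι → m → ℝ}
    (hv : ∀ i j, v i ⬝ᵥ v j = if i = j then 1 else 0) :
    ∃ k : Matrix m m ℝ, kᵀ * k = 1 ∧ ∀ i x, k x (a i) = v i x := by
  let V : m → EuclideanSpace ℝ m := Function.extend a (fun i => WithLp.toLp 2 (v i)) 0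
  have hV : ∀ i, V (a i) = WithLp.toLp 2 (v i) := fun i => a.injective.extend_apply _ _ _
  have h1 : Orthonormal ℝ ((Set.range a).domRestrict V) := by
    rw [orthonormal_iff_ite]
    rintro ⟨x, hx⟩ ⟨y, hy⟩
    obtain ⟨i, hi⟩ := hx
    obtain ⟨j, hj⟩ := hy
    have h2 : ⟪V x, V y⟫_ℝ = if i = j then 1 else 0 := by
      rw [← hi, ← hj, hV, hV, orthonormal_iff_ite.1 (orthonormal_toLp hv) i j]
    have h3 : i = j ↔ x = y := by rw [← hi, ← hj, a.injective.eq_iff]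
    exact h2.trans (if_congr (h3.trans Subtype.mk_eq_mk.symm) rfl rfl)
  obtain ⟨b, hb⟩ := h1.exists_orthonormalBasis_extension_of_card_eq (ι := m) (by simp)
  refine ⟨Matrix.of fun x y => b y x, ?_, ?_⟩
  · ext i j
    have := orthonormal_iff_ite.1 b.orthonormal i j
    rw [Matrix.one_apply, ← this, Matrix.mul_apply, PiLp.inner_apply]
    refine Finset.sum_congr rfl fun x _ => ?_
    simp [mul_comm]
  · intro i x
    rw [Matrix.of_apply, hb _ ⟨i, rfl⟩, hV]

theorem exists_pairs {D : Matrix m m ℝ} {𝒯 : Set (Matrix m m ℝ)} (hD : Dᵀ = D)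
    (hskew : ∀ T ∈ 𝒯, Tᵀ = -T) (hcomm : ∀ S ∈ 𝒯, ∀ T ∈ 𝒯, S * T = T * S)
    (hDT : ∀ T ∈ 𝒯, D * T = -(T * D)) :
    ∃ (n : ℕ) (v w : Fin n → m → ℝ), (∀ i j, v i ⬝ᵥ v j = if i = j then 1 else 0) ∧
      (∀ i j, w i ⬝ᵥ w j = if i = j then 1 else 0) ∧ (∀ i j, v i ⬝ᵥ w j = 0) ∧
      (∀ i, ∃ d : ℝ, D *ᵥ v i = d • v i ∧ D *ᵥ w i = -d • w i) ∧
      (∀ T ∈ 𝒯, ∃ t : Fin n → ℝ, ∀ j, T *ᵥ v j = t j • w j ∧ T *ᵥ w j = -t j • v j) ∧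
      ∀ u, (∀ i, v i ⬝ᵥ u = 0) → (∀ i, w i ⬝ᵥ u = 0) → ∀ T ∈ 𝒯, T *ᵥ u = 0 := by
  let L : Matrix m m ℝ → (EuclideanSpace ℝ m →ₗ[ℝ] EuclideanSpace ℝ m) := Matrix.toEuclideanLin
  have hL : ∀ T x, L T x = WithLp.toLp 2 (T *ᵥ x.ofLp) := fun T x => rfl
  have hinner : ∀ x y : EuclideanSpace ℝ m, ⟪x, y⟫_ℝ = x.ofLp ⬝ᵥ y.ofLp := by
    intro x y
    rw [EuclideanSpace.inner_eq_star_dotProduct, star_trivial, dotProduct_comm]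
  have hadj : ∀ (T : Matrix m m ℝ) x y, ⟪L T x, y⟫_ℝ = ⟪x, L Tᵀ y⟫_ℝ := by
    intro T x y
    rw [hinner, hinner, hL, hL, Matrix.mulVec_transpose, dotProduct_comm,
      Matrix.dotProduct_mulVec, dotProduct_comm]
  obtain ⟨n, v, w, h, hz⟩ := exists_pairFamily (D := L D) (𝒯 := L '' 𝒯)
    (fun x y => by rw [hadj, hD])
    (by
      rintro _ ⟨T, hT, rfl⟩ x y
      rw [hadj, hskew T hT, ← inner_neg_right]
      congr 1
      simp [hL, Matrix.neg_mulVec])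
    (by
      rintro _ ⟨S, hS, rfl⟩ _ ⟨T, hT, rfl⟩ x
      simp [hL, hcomm S hS T hT])
    (by
      rintro _ ⟨T, hT, rfl⟩ x
      simp [hL, hDT T hT, Matrix.neg_mulVec])
  refine ⟨n, fun i => (v i).ofLp, fun i => (w i).ofLp, ?_, ?_, ?_, ?_, ?_, ?_⟩
  · intro i j; rw [← hinner, h.vv]
  · intro i j; rw [← hinner, h.ww]
  · intro i j; rw [← hinner, h.vw]
  · intro i
    obtain ⟨d, h1, h2⟩ := h.eig i
    exact ⟨d, congrArg WithLp.ofLp h1, congrArg WithLp.ofLp h2⟩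
  · intro T hT
    obtain ⟨t, ht⟩ := h.rot _ ⟨T, hT, rfl⟩
    exact ⟨t, fun j => ⟨congrArg WithLp.ofLp (ht j).1, congrArg WithLp.ofLp (ht j).2⟩⟩
  · intro u hv hw T hT
    have := hz (WithLp.toLp 2 u) (fun i => by rw [hinner]; exact hv i)
      (fun i => by rw [hinner]; exact hw i) _ ⟨T, hT, rfl⟩
    exact congrArg WithLp.ofLp this

end NormalForms

section Columns

variable {n r : ℕ} {m : Type} [Fintype m] [DecidableEq m] {R : Type} [CommRing R]
variable (e : Fin n ⊕ Fin n ⊕ Fin r ≃ m) (k : Matrix m m R) (a b c d : Fin n → R) (f : Fin r → R)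

theorem mul_planar_apply (x y) : (k * planar e a b c d f) x y =
    ∑ i, k x (e i) * planar e a b c d f (e i) y := by
  rw [Matrix.mul_apply, ← e.sum_comp]

theorem mul_planar_apply₁ (x j) : (k * planar e a b c d f) x (e (Sum.inl j)) =
    k x (e (Sum.inl j)) * a j + k x (e (Sum.inr (Sum.inl j))) * c j := by
  rw [mul_planar_apply]
  simp [planar, Fintype.sum_sum_type, Matrix.diagonal_apply]

theorem mul_planar_apply₂ (x j) : (k * planar e a b c d f) x (e (Sum.inr (Sum.inl j))) =
    k x (e (Sum.inl j)) * b j + k x (e (Sum.inr (Sum.inl j))) * d j := by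
  rw [mul_planar_apply]
  simp [planar, Fintype.sum_sum_type, Matrix.diagonal_apply]

theorem mul_planar_apply₃ (x j) : (k * planar e a b c d f) x (e (Sum.inr (Sum.inr j))) =
    k x (e (Sum.inr (Sum.inr j))) * f j := by
  rw [mul_planar_apply]
  simp [planar, Fintype.sum_sum_type, Matrix.diagonal_apply]

end Columns

section RotationForms

variable {n r : ℕ} {m : Type} [Fintype m] [DecidableEq m]

theorem dotProduct_col_col {k : Matrix m m ℝ} (hk : kᵀ * k = 1) (x y : m) :
    (fun z => k z x) ⬝ᵥ (fun z => k z y) = if x = y then 1 else 0 := by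
  rw [← Matrix.one_apply, ← hk]
  rfl

/-- Commuting skew matrices have a common normal form. -/
theorem exists_rotation_form (hr : r ≤ 1) (e : Fin n ⊕ Fin n ⊕ Fin r ≃ m)
    {𝒯 : Set (Matrix m m ℝ)} (hskew : ∀ T ∈ 𝒯, Tᵀ = -T)
    (hcomm : ∀ S ∈ 𝒯, ∀ T ∈ 𝒯, S * T = T * S) :
    ∃ k : Matrix m m ℝ, kᵀ * k = 1 ∧
      ∀ T ∈ 𝒯, ∃ t : Fin n → ℝ, T * k = k * planar e 0 (-t) t 0 0 := by
  obtain ⟨n₀, v, w, hvv, hww, hvw, -, hrot, hz⟩ := exists_pairs (D := 0) (by simp) hskew hcomm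
    (by simp)
  have horth : ∀ i j : Fin n₀ ⊕ Fin n₀,
      Sum.elim v w i ⬝ᵥ Sum.elim v w j = if i = j then 1 else 0 := by
    rintro (i | i) (j | j)
    · simp [hvv]
    · simp [hvw]
    · simp [dotProduct_comm (w i), hvw]
    · simp [hww]
  have hn₀ : n₀ ≤ n := by
    have h1 := card_le_of_orthonormal horth
    rw [← Fintype.card_congr e] at h1
    simp only [Fintype.card_sum, Fintype.card_fin] at h1
    omega
  let a : Fin n₀ ⊕ Fin n₀ ↪ m :=
    ⟨fun i => e (Sum.elim (fun j => Sum.inl (Fin.castLE hn₀ j))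
      (fun j => Sum.inr (Sum.inl (Fin.castLE hn₀ j))) i), by
      rintro (i | i) (j | j) h <;> replace h := e.injective h <;> simp_all⟩
  obtain ⟨k, hk, hka⟩ := exists_orthogonal_extension a horth
  have hcol : ∀ i, (fun z => k z (a i)) = Sum.elim v w i := fun i => funext (hka i)
  have hkv : ∀ j : Fin n₀, (fun z => k z (e (Sum.inl (Fin.castLE hn₀ j)))) = v j :=
    fun j => hcol (Sum.inl j)
  have hkw : ∀ j : Fin n₀, (fun z => k z (e (Sum.inr (Sum.inl (Fin.castLE hn₀ j))))) = w j :=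
    fun j => hcol (Sum.inr j)
  have hrest : ∀ x, (∀ i, a i ≠ x) → ∀ T ∈ 𝒯, T *ᵥ (fun z => k z x) = 0 := by
    intro x hx
    refine hz _ (fun i => ?_) fun i => ?_
    · rw [← hkv, dotProduct_col_col hk]
      exact if_neg (hx (Sum.inl i))
    · rw [← hkw, dotProduct_col_col hk]
      exact if_neg (hx (Sum.inr i))
  refine ⟨k, hk, fun T hT => ?_⟩
  obtain ⟨t, ht⟩ := hrot T hT
  refine ⟨fun j => if h : j.1 < n₀ then t ⟨j, h⟩ else 0, ?_⟩
  have hmul : ∀ x y, (T * k) x y = (T *ᵥ fun z => k z y) x := fun _ _ => rfl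
  ext x y
  obtain ⟨y, rfl⟩ := e.surjective y
  rw [hmul]
  rcases y with j | j | j
  · rw [mul_planar_apply₁]
    by_cases hj : j.1 < n₀
    · have h1 := hkv ⟨j, hj⟩
      have h2 := congrFun (hkw ⟨j, hj⟩) x
      simp only [Fin.castLE_mk, Fin.eta] at h1 h2
      rw [h1, (ht _).1, h2]
      simp [hj, mul_comm]
    · rw [hrest _ _ T hT]
      · simp [hj]
      · rintro (i | i) h <;> replace h := e.injective h <;> simp at h
        rw [← h] at hj
        exact hj i.2
  · rw [mul_planar_apply₂]
    by_cases hj : j.1 < n₀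
    · have h1 := hkw ⟨j, hj⟩
      have h2 := congrFun (hkv ⟨j, hj⟩) x
      simp only [Fin.castLE_mk, Fin.eta] at h1 h2
      rw [h1, (ht _).2, h2]
      simp [hj, mul_comm]
    · rw [hrest _ _ T hT]
      · simp [hj]
      · rintro (i | i) h <;> replace h := e.injective h <;> simp at h
        rw [← h] at hj
        exact hj i.2
  · rw [mul_planar_apply₃, hrest _ _ T hT]
    · simp
    · rintro (i | i) h <;> replace h := e.injective h <;> simp at h

/-- The planes are spanned by the `j`-th positive and the `j`-th negative direction. -/
def planeEquiv (p q : ℕ) (h : p ≤ q) : Fin p ⊕ Fin p ⊕ Fin (q - p) ≃ Fin p ⊕ Fin q :=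
  Equiv.sumCongr (Equiv.refl _) (finSumFinEquiv.trans (finCongr (Nat.add_sub_of_le h)))

variable {p q : ℕ}

/-- Commuting symmetric matrices in `so(p,q)` have a common normal form. -/
theorem exists_hyperbolic_form (h : p ≤ q) {𝒯 : Set (Matrix (Fin p ⊕ Fin q) (Fin p ⊕ Fin q) ℝ)}
    (hsymm : ∀ X ∈ 𝒯, Xᵀ = X) (hcomm : ∀ X ∈ 𝒯, ∀ Y ∈ 𝒯, X * Y = Y * X)
    (hX : ∀ X ∈ 𝒯, ID p q ℝ * X = -(X * ID p q ℝ)) :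
    ∃ (V : Matrix (Fin p) (Fin p) ℝ) (W : Matrix (Fin q) (Fin q) ℝ), Vᵀ * V = 1 ∧ Wᵀ * W = 1 ∧
      ∀ X ∈ 𝒯, ∃ t : Fin p → ℝ, X * Matrix.fromBlocks V 0 0 W =
        Matrix.fromBlocks V 0 0 W * planar (planeEquiv p q h) 0 t t 0 0 := by
  have hI := ID_mul_self (p := p) (q := q) ℝ
  obtain ⟨n, v, w, hvv, hww, hvw, heig, hrot, hz⟩ := exists_pairs (D := ID p q ℝ)
    (𝒯 := (fun X => X * ID p q ℝ) '' 𝒯) (ID_transpose ℝ)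
    (by
      rintro _ ⟨X, hX', rfl⟩
      rw [Matrix.transpose_mul, ID_transpose, hsymm X hX', hX X hX'])
    (by
      have h1 : ∀ X ∈ 𝒯, ∀ Y ∈ 𝒯, X * ID p q ℝ * (Y * ID p q ℝ) = -(X * Y) := by
        intro X _ Y hY
        rw [Matrix.mul_assoc, ← Matrix.mul_assoc (ID p q ℝ), hX Y hY, Matrix.neg_mul,
          Matrix.mul_assoc, hI, Matrix.mul_one, Matrix.mul_neg]
      rintro _ ⟨X, hX', rfl⟩ _ ⟨Y, hY', rfl⟩
      simp only [h1 X hX' Y hY', h1 Y hY' X hX', hcomm X hX' Y hY'])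
    (by
      rintro _ ⟨X, hX', rfl⟩
      simp only
      rw [← Matrix.mul_assoc, hX X hX', Matrix.neg_mul])
  have hd : ∀ i, ∃ v' w' : Fin p ⊕ Fin q → ℝ, ID p q ℝ *ᵥ v' = v' ∧ ID p q ℝ *ᵥ w' = -w' ∧
      (v' = v i ∧ w' = w i ∨ v' = w i ∧ w' = v i) := by
    intro i
    obtain ⟨d, h1, h2⟩ := heig i
    have h3 : (d * d) • v i = v i := by
      have h4 : ID p q ℝ *ᵥ (ID p q ℝ *ᵥ v i) = ID p q ℝ *ᵥ (d • v i) := by rw [h1]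
      rw [Matrix.mulVec_mulVec, hI, Matrix.one_mulVec, Matrix.mulVec_smul, h1, smul_smul] at h4
      exact h4.symm
    have h5 : d * d = 1 := by
      have h6 := congrArg (fun x => v i ⬝ᵥ x) h3
      simpa [hvv] using h6
    rcases mul_self_eq_one_iff.1 h5 with rfl | rfl
    · exact ⟨v i, w i, by simpa using h1, by simpa using h2, Or.inl ⟨rfl, rfl⟩⟩
    · exact ⟨w i, v i, by simpa using h2, by simpa using h1, Or.inr ⟨rfl, rfl⟩⟩
  choose v' w' hv' hw' hvw' using hd
  have hv'2 : ∀ i y, v' i (Sum.inr y) = 0 := by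
    intro i y
    have := congrFun (hv' i) (Sum.inr y)
    rw [ID_eq_diagonal, Matrix.mulVec_diagonal] at this
    simp at this
    linarith
  have hw'1 : ∀ i x, w' i (Sum.inl x) = 0 := by
    intro i x
    have := congrFun (hw' i) (Sum.inl x)
    rw [ID_eq_diagonal, Matrix.mulVec_diagonal] at this
    simp at this
    linarith
  have hwv : ∀ i j, w i ⬝ᵥ v j = 0 := fun i j => by rw [dotProduct_comm, hvw]
  have hperp : ∀ i j, v' i ⬝ᵥ w' j = 0 := by
    intro i j
    simp [dotProduct, Fintype.sum_sum_type, hv'2, hw'1]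
  have hvv' : ∀ i j, v' i ⬝ᵥ v' j = if i = j then 1 else 0 := by
    intro i j
    by_cases hij : i = j
    · subst hij
      rcases hvw' i with ⟨h1, -⟩ | ⟨h1, -⟩ <;> simp [h1, hvv, hww]
    · rcases hvw' i with ⟨h1, -⟩ | ⟨h1, -⟩ <;> rcases hvw' j with ⟨h2, -⟩ | ⟨h2, -⟩ <;>
        simp [h1, h2, hvv, hww, hvw, hwv, hij]
  have hww' : ∀ i j, w' i ⬝ᵥ w' j = if i = j then 1 else 0 := by
    intro i j
    by_cases hij : i = j
    · subst hij
      rcases hvw' i with ⟨-, h1⟩ | ⟨-, h1⟩ <;> simp [h1, hvv, hww]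
    · rcases hvw' i with ⟨-, h1⟩ | ⟨-, h1⟩ <;> rcases hvw' j with ⟨-, h2⟩ | ⟨-, h2⟩ <;>
        simp [h1, h2, hvv, hww, hvw, hwv, hij]
  have hrot' : ∀ X ∈ 𝒯, ∃ t : Fin n → ℝ, ∀ j, X *ᵥ v' j = t j • w' j ∧ X *ᵥ w' j = t j • v' j := by
    intro X hX'
    obtain ⟨t, ht⟩ := hrot _ ⟨X, hX', rfl⟩
    have h1 : ∀ j, ∃ s : ℝ, X *ᵥ v' j = s • w' j ∧ X *ᵥ w' j = s • v' j := by
      intro j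
      have h2 : X *ᵥ v' j = (X * ID p q ℝ) *ᵥ v' j := by
        rw [← Matrix.mulVec_mulVec, hv']
      have h3 : X *ᵥ w' j = -((X * ID p q ℝ) *ᵥ w' j) := by
        rw [← Matrix.mulVec_mulVec, hw', Matrix.mulVec_neg, neg_neg]
      rcases hvw' j with ⟨h4, h5⟩ | ⟨h4, h5⟩
      · refine ⟨t j, ?_, ?_⟩
        · rw [h2, h4, h5, (ht j).1]
        · rw [h3, h4, h5, (ht j).2]; simp
      · refine ⟨-t j, ?_, ?_⟩
        · rw [h2, h4, h5, (ht j).2]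
        · rw [h3, h4, h5, (ht j).1]; simp
    choose s hs using h1
    exact ⟨s, hs⟩
  have hz' : ∀ u, (∀ i, v' i ⬝ᵥ u = 0) → (∀ i, w' i ⬝ᵥ u = 0) →
      (ID p q ℝ *ᵥ u = u ∨ ID p q ℝ *ᵥ u = -u) → ∀ X ∈ 𝒯, X *ᵥ u = 0 := by
    intro u h1 h2 h3 X hX'
    have h4 : (X * ID p q ℝ) *ᵥ u = 0 := by
      refine hz u (fun i => ?_) (fun i => ?_) _ ⟨X, hX', rfl⟩
      · rcases hvw' i with ⟨h5, h6⟩ | ⟨h5, h6⟩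
        · rw [← h5, h1]
        · rw [← h6, h2]
      · rcases hvw' i with ⟨h5, h6⟩ | ⟨h5, h6⟩
        · rw [← h6, h2]
        · rw [← h5, h1]
    rw [← Matrix.mulVec_mulVec] at h4
    rcases h3 with h3 | h3
    · rwa [h3] at h4
    · rwa [h3, Matrix.mulVec_neg, neg_eq_zero] at h4
  have hav : ∀ i j, (fun x => v' i (Sum.inl x)) ⬝ᵥ (fun x => v' j (Sum.inl x)) =
      if i = j then 1 else 0 := by
    intro i j
    rw [← hvv']
    simp [dotProduct, Fintype.sum_sum_type, hv'2]
  have hbw : ∀ i j, (fun x => w' i (Sum.inr x)) ⬝ᵥ (fun x => w' j (Sum.inr x)) =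
      if i = j then 1 else 0 := by
    intro i j
    rw [← hww']
    simp [dotProduct, Fintype.sum_sum_type, hw'1]
  have hn : n ≤ p := by simpa using card_le_of_orthonormal hav
  let b : Fin p ↪ Fin q := ⟨fun j => (finSumFinEquiv.trans (finCongr (Nat.add_sub_of_le h)))
    (Sum.inl j), fun i j hij => by simpa using hij⟩
  obtain ⟨V, hV, hVa⟩ := exists_orthogonal_extension (Fin.castLEEmb hn) hav
  obtain ⟨W, hW, hWb⟩ := exists_orthogonal_extension ((Fin.castLEEmb hn).trans b) hbw
  refine ⟨V, W, hV, hW, fun X hX' => ?_⟩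
  obtain ⟨t, ht⟩ := hrot' X hX'
  set k := Matrix.fromBlocks V 0 0 W with hkdef
  have hcol₁ : ∀ j : Fin n, (fun z => k z (Sum.inl (Fin.castLE hn j))) = v' j := by
    intro j
    funext z
    rcases z with z | z
    · exact hVa j z
    · simp [hkdef, hv'2]
  have hcol₂ : ∀ j : Fin n, (fun z => k z (Sum.inr (b (Fin.castLE hn j)))) = w' j := by
    intro j
    funext z
    rcases z with z | z
    · simp [hkdef, hw'1]
    · exact hWb j z
  have hk : kᵀ * k = 1 := by
    rw [hkdef, Matrix.fromBlocks_transpose, Matrix.fromBlocks_multiply]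
    simp [hV, hW]
  have hrest₁ : ∀ x, (∀ i : Fin n, Fin.castLE hn i ≠ x) → X *ᵥ (fun z => k z (Sum.inl x)) = 0 := by
    intro x hx
    refine hz' _ (fun i => ?_) (fun i => ?_) (Or.inl ?_) X hX'
    · rw [← hcol₁, dotProduct_col_col hk, if_neg (by simpa using hx i)]
    · rw [← hcol₂, dotProduct_col_col hk, if_neg (by simp)]
    · funext z
      rw [ID_eq_diagonal, Matrix.mulVec_diagonal]
      rcases z with z | z <;> simp [hkdef]
  have hrest₂ : ∀ x, (∀ i : Fin n, b (Fin.castLE hn i) ≠ x) →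
      X *ᵥ (fun z => k z (Sum.inr x)) = 0 := by
    intro x hx
    refine hz' _ (fun i => ?_) (fun i => ?_) (Or.inr ?_) X hX'
    · rw [← hcol₁, dotProduct_col_col hk, if_neg (by simp)]
    · rw [← hcol₂, dotProduct_col_col hk, if_neg (by simpa using hx i)]
    · funext z
      rw [ID_eq_diagonal, Matrix.mulVec_diagonal]
      rcases z with z | z <;> simp [hkdef]
  refine ⟨fun j => if h : j.1 < n then t ⟨j, h⟩ else 0, ?_⟩
  have hmul : ∀ x y, (X * k) x y = (X *ᵥ fun z => k z y) x := fun _ _ => rfl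
  ext x y
  obtain ⟨y, rfl⟩ := (planeEquiv p q h).surjective y
  rw [hmul]
  have he₁ : ∀ j, planeEquiv p q h (Sum.inl j) = Sum.inl j := fun _ => rfl
  have he₂ : ∀ j, planeEquiv p q h (Sum.inr (Sum.inl j)) = Sum.inr (b j) := fun _ => rfl
  rcases y with j | j | j
  · rw [mul_planar_apply₁, he₁, he₂]
    by_cases hj : j.1 < n
    · have h1 := hcol₁ ⟨j, hj⟩
      have h2 := congrFun (hcol₂ ⟨j, hj⟩) x
      simp only [Fin.castLE_mk, Fin.eta] at h1 h2
      rw [h1, (ht _).1, h2]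
      simp [hj, mul_comm]
    · rw [hrest₁]
      · simp [hj]
      · rintro i rfl
        exact hj i.2
  · rw [mul_planar_apply₂, he₁, he₂]
    by_cases hj : j.1 < n
    · have h1 := hcol₂ ⟨j, hj⟩
      have h2 := congrFun (hcol₁ ⟨j, hj⟩) x
      simp only [Fin.castLE_mk, Fin.eta] at h1 h2
      rw [h1, (ht _).2, h2]
      simp [hj, mul_comm]
    · rw [hrest₂]
      · simp [hj]
      · intro i hi
        rw [b.injective.eq_iff] at hi
        rw [← hi] at hj
        exact hj i.2
  · rw [mul_planar_apply₃]
    have he₃ : planeEquiv p q h (Sum.inr (Sum.inr j)) =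
      Sum.inr ((finSumFinEquiv.trans (finCongr (Nat.add_sub_of_le h))) (Sum.inr j)) := rfl
    rw [he₃, hrest₂]
    · simp
    · intro i hi
      simp [b, -finSumFinEquiv_apply_left, -finSumFinEquiv_apply_right] at hi

end RotationForms

section Frames

/-- A maximal abelian subspace of `i so(N,ℝ)` has an eigenframe. -/
theorem exists_frame_C {N n r : ℕ} (hr : r ≤ 1) (e : Fin n ⊕ Fin n ⊕ Fin r ≃ Fin N)
    {𝔞 : Submodule ℝ (soC N)} (h𝔞 : IsMaximalAbelianIn (pC N) 𝔞) :
    ∃ k : Matrix (Fin N) (Fin N) ℝ, kᵀ * k = 1 ∧ ∃ E : EigenFrame 1 (soC N) 𝔞 n r, ∀ t,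
      (E.φ t : Matrix (Fin N) (Fin N) ℂ) = cx k * planar e 0 (fun j => -Complex.I * (t j : ℂ))
        (fun j => Complex.I * (t j : ℂ)) 0 0 * cx kᵀ := by
  have hform : ∀ X ∈ 𝔞, ∃ T : Matrix (Fin N) (Fin N) ℝ, Tᵀ = -T ∧
      (X : Matrix (Fin N) (Fin N) ℂ) = Complex.I • cx T := by
    intro X hX
    have h1 : (X : Matrix (Fin N) (Fin N) ℂ).map (starRingEnd ℂ) = -X := h𝔞.1.1 hX
    have h2 : (X : Matrix (Fin N) (Fin N) ℂ)ᵀ = -X := (LieAlgebra.Orthogonal.mem_so _ _ _).1 X.2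
    refine ⟨(X : Matrix (Fin N) (Fin N) ℂ).map Complex.im, ?_, ?_⟩
    · ext i j
      have := congrArg Complex.im (congrFun (congrFun h2 i) j)
      simpa using this
    · ext i j
      have := congrArg Complex.re (congrFun (congrFun h1 i) j)
      simp at this
      apply Complex.ext
      · simp; linarith
      · simp
  have hcx : ∀ T S : Matrix (Fin N) (Fin N) ℝ, Complex.I • cx T * Complex.I • cx S = -cx (T * S) := by
    intro T S
    rw [Matrix.smul_mul, Matrix.mul_smul, smul_smul, Complex.I_mul_I, map_mul, neg_one_smul]
  obtain ⟨k, hk, hT⟩ := exists_rotation_form hr e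
    (𝒯 := {T | ∃ X ∈ 𝔞, (X : Matrix (Fin N) (Fin N) ℂ) = Complex.I • cx T ∧ Tᵀ = -T})
    (by rintro T ⟨-, -, -, h⟩; exact h)
    (by
      rintro S ⟨X, hX, hXS, -⟩ T ⟨Y, hY, hYT, -⟩
      have h1 := congrArg Subtype.val (h𝔞.1.2 X hX Y hY)
      change (X : Matrix (Fin N) (Fin N) ℂ) * Y - Y * X = 0 at h1
      rw [hXS, hYT, hcx, hcx] at h1
      exact cx_injective (neg_injective (sub_eq_zero.1 h1)))
  have hk' : k * kᵀ = 1 := mul_eq_one_comm.1 hk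
  have hplanar : ∀ t : Fin n → ℝ, cx k * planar e 0 (fun j => -Complex.I * (t j : ℂ))
        (fun j => Complex.I * (t j : ℂ)) 0 0 * cx kᵀ =
      Complex.I • cx (k * planar e 0 (-t) t 0 0 * kᵀ) := by
    intro t
    rw [map_mul, map_mul, ← Matrix.smul_mul, ← Matrix.mul_smul]
    congr 2
    change _ = Complex.I • (planar e 0 (-t) t 0 0).map Complex.ofRealHom
    rw [planar_map, planar_smul]
    congr 1 <;> funext i <;> simp
  have hskew : ∀ t : Fin n → ℝ, (k * planar e 0 (-t) t 0 0 * kᵀ)ᵀ =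
      -(k * planar e 0 (-t) t 0 0 * kᵀ) := by
    intro t
    rw [Matrix.transpose_mul, Matrix.transpose_mul, Matrix.transpose_transpose, planar_transpose,
      ← Matrix.neg_mul, ← Matrix.mul_neg, planar_neg, Matrix.mul_assoc]
    simp
  have hmem : ∀ t : Fin n → ℝ, cx k * planar e 0 (fun j => -Complex.I * ((t j : ℝ) : ℂ))
        (fun j => Complex.I * ((t j : ℝ) : ℂ)) 0 0 * cx kᵀ ∈ soC N := by
    intro t
    refine (LieAlgebra.Orthogonal.mem_so _ _ _).2 ?_
    rw [hplanar, Matrix.transpose_smul, ← cx_transpose, hskew, map_neg, smul_neg]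
  have hrange : (planarHom e (soC N) (cx k) (cx kᵀ) (-Complex.I) Complex.I hmem).range = 𝔞 := by
    have hKK : cx k * cx kᵀ = 1 := by rw [← map_mul, hk', map_one]
    refine range_eq_of_maximal h𝔞 _ (fun t => ?_) (fun s t => planarHom_lie e _ hKK _ _ _ s t) ?_
    · change Matrix.map _ _ = -_
      change Matrix.map (cx k * planar e 0 (fun j => -Complex.I * (t j : ℂ))
        (fun j => Complex.I * (t j : ℂ)) 0 0 * cx kᵀ) _ =
        -(cx k * planar e 0 (fun j => -Complex.I * (t j : ℂ))
        (fun j => Complex.I * (t j : ℂ)) 0 0 * cx kᵀ)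
      rw [hplanar]
      generalize k * planar e 0 (-t) t 0 0 * kᵀ = M
      ext i j
      simp
    · intro X hX
      obtain ⟨T, hTt, hXT⟩ := hform X hX
      obtain ⟨t, ht⟩ := hT T ⟨X, hX, hXT, hTt⟩
      refine ⟨t, Subtype.ext ?_⟩
      refine (hplanar t).trans ?_
      rw [hXT, ← ht, Matrix.mul_assoc, hk', Matrix.mul_one]
  exact ⟨k, hk, eigenFrameOfPlanar e 1 (by rw [← map_mul, hk', map_one]) (by simp) hmem hrange,
    fun t => rfl⟩

variable {p q : ℕ}

theorem mem_soR_iff (X : Matrix (Fin p ⊕ Fin q) (Fin p ⊕ Fin q) ℝ) :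
    X ∈ soR p q ↔ Xᵀ * ID p q ℝ = -(ID p q ℝ * X) := by
  rw [← Matrix.mul_neg]
  exact mem_skewAdjointMatricesSubmodule _ _

theorem planar_mul_ID (h : p ≤ q) (t : Fin p → ℝ) :
    planar (planeEquiv p q h) 0 t t 0 0 * ID p q ℝ =
      -(ID p q ℝ * planar (planeEquiv p q h) 0 t t 0 0) := by
  have : ID p q ℝ = planar (planeEquiv p q h) 1 0 0 (-1) (-1) := by
    rw [planar_eq_diagonal, ID_eq_diagonal]
    congr 1
    funext x
    obtain ⟨x, rfl⟩ := (planeEquiv p q h).surjective x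
    rcases x with x | x | x <;> simp [planeEquiv]
  rw [this, planar_mul, planar_mul, planar_neg]
  congr 1 <;> simp

/-- A maximal abelian subspace of `𝔭 ⊆ so(p,q)` has an eigenframe. -/
theorem exists_frame_R (h : p ≤ q) {𝔞 : Submodule ℝ (soR p q)}
    (h𝔞 : IsMaximalAbelianIn (pR p q) 𝔞) :
    ∃ (V : Matrix (Fin p) (Fin p) ℝ) (W : Matrix (Fin q) (Fin q) ℝ), Vᵀ * V = 1 ∧ Wᵀ * W = 1 ∧
      ∃ E : EigenFrame (ID p q ℝ) (soR p q) 𝔞 p (q - p), ∀ t,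
      (E.φ t : Matrix (Fin p ⊕ Fin q) (Fin p ⊕ Fin q) ℝ) = Matrix.fromBlocks V 0 0 W *
        planar (planeEquiv p q h) 0 t t 0 0 * (Matrix.fromBlocks V 0 0 W)ᵀ := by
  have hsymm : ∀ X ∈ 𝔞, (X : Matrix (Fin p ⊕ Fin q) (Fin p ⊕ Fin q) ℝ)ᵀ = X := fun X hX =>
    h𝔞.1.1 hX
  obtain ⟨V, W, hV, hW, hX⟩ := exists_hyperbolic_form h
    (𝒯 := (fun X : soR p q => (X : Matrix (Fin p ⊕ Fin q) (Fin p ⊕ Fin q) ℝ)) '' 𝔞)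
    (by rintro _ ⟨X, hX, rfl⟩; exact hsymm X hX)
    (by
      rintro _ ⟨X, hX, rfl⟩ _ ⟨Y, hY, rfl⟩
      exact sub_eq_zero.1 (congrArg Subtype.val (h𝔞.1.2 X hX Y hY)))
    (by
      rintro _ ⟨X, hX, rfl⟩
      have h1 := (mem_soR_iff _).1 X.2
      rw [hsymm X hX] at h1
      exact (neg_eq_iff_eq_neg.2 h1).symm)
  set k := Matrix.fromBlocks V 0 0 W with hkdef
  have hk : kᵀ * k = 1 := by
    rw [hkdef, Matrix.fromBlocks_transpose, Matrix.fromBlocks_multiply]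
    simp [hV, hW]
  have hk' : k * kᵀ = 1 := mul_eq_one_comm.1 hk
  have hkI : k * ID p q ℝ = ID p q ℝ * k := by
    rw [hkdef, ID_eq, Matrix.fromBlocks_multiply, Matrix.fromBlocks_multiply]
    simp
  have hkI' : kᵀ * ID p q ℝ = ID p q ℝ * kᵀ := by
    have := congrArg Matrix.transpose hkI
    rw [Matrix.transpose_mul, Matrix.transpose_mul, ID_transpose] at this
    exact this.symm
  have hone : ∀ t : Fin p → ℝ, (fun j => (1 : ℝ) * ((t j : ℝ) : ℝ)) = t := fun t => by
    funext j; simp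
  have hmem : ∀ t : Fin p → ℝ, k * planar (planeEquiv p q h) 0 (fun j => (1 : ℝ) * ((t j : ℝ) : ℝ))
        (fun j => (1 : ℝ) * ((t j : ℝ) : ℝ)) 0 0 * kᵀ ∈ soR p q := by
    intro t
    rw [mem_soR_iff, hone, Matrix.transpose_mul, Matrix.transpose_mul, Matrix.transpose_transpose,
      planar_transpose]
    calc k * (planar (planeEquiv p q h) 0 t t 0 0 * kᵀ) * ID p q ℝ
        = k * (planar (planeEquiv p q h) 0 t t 0 0 * ID p q ℝ) * kᵀ := by
          simp only [Matrix.mul_assoc, hkI']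
      _ = -((k * ID p q ℝ) * planar (planeEquiv p q h) 0 t t 0 0 * kᵀ) := by
          rw [planar_mul_ID]; simp only [Matrix.mul_assoc, Matrix.neg_mul, Matrix.mul_neg]
      _ = _ := by rw [hkI]; simp only [Matrix.mul_assoc]
  have hrange : (planarHom (planeEquiv p q h) (soR p q) k kᵀ (1 : ℝ) 1 hmem).range = 𝔞 := by
    refine range_eq_of_maximal h𝔞 _ (fun t => ?_) (fun s t => planarHom_lie _ _ hk' _ _ _ s t) ?_
    · change (k * planar (planeEquiv p q h) 0 (fun j => (1 : ℝ) * ((t j : ℝ) : ℝ))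
        (fun j => (1 : ℝ) * ((t j : ℝ) : ℝ)) 0 0 * kᵀ)ᵀ = k * planar (planeEquiv p q h) 0
          (fun j => (1 : ℝ) * ((t j : ℝ) : ℝ)) (fun j => (1 : ℝ) * ((t j : ℝ) : ℝ)) 0 0 * kᵀ
      rw [Matrix.transpose_mul, Matrix.transpose_mul, Matrix.transpose_transpose,
        planar_transpose, Matrix.mul_assoc]
    · intro X hXa
      obtain ⟨t, ht⟩ := hX _ ⟨X, hXa, rfl⟩
      refine ⟨t, Subtype.ext ?_⟩
      rw [coe_planarHom]
      change k * planar (planeEquiv p q h) 0 (fun j => (1 : ℝ) * ((t j : ℝ) : ℝ))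
        (fun j => (1 : ℝ) * ((t j : ℝ) : ℝ)) 0 0 * kᵀ = _
      rw [hone, ← ht, Matrix.mul_assoc, hk', Matrix.mul_one]
  refine ⟨V, W, hV, hW, eigenFrameOfPlanar (planeEquiv p q h) (ID p q ℝ) hk' (by simp) hmem hrange,
    fun t => ?_⟩
  change k * planar (planeEquiv p q h) 0 (fun j => (1 : ℝ) * ((t j : ℝ) : ℝ))
        (fun j => (1 : ℝ) * ((t j : ℝ) : ℝ)) 0 0 * kᵀ = _
  rw [hone]

end Frames

section Linearization

attribute [-instance] LieRing.ofAssociativeRing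

/-- A linear condition that holds along `exp(tX)` holds for `X`. -/
theorem apply_eq_zero_of_exp {m 𝕜 : Type} [Fintype m] [DecidableEq m] [RCLike 𝕜]
    {X : Matrix m m 𝕜} (L : Matrix m m 𝕜 →ₗ[ℝ] Matrix m m ℂ)
    (h : ∀ t : ℝ, L (NormedSpace.exp (t • X)) = 0) : L X = 0 := by
  let _ : NormedRing (Matrix m m 𝕜) := Matrix.linftyOpNormedRing
  let _ : NormedAlgebra ℝ (Matrix m m 𝕜) := Matrix.linftyOpNormedAlgebra
  let _ : NormedAddCommGroup (Matrix m m ℂ) := Matrix.linftyOpNormedAddCommGroup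
  let _ : NormedSpace ℝ (Matrix m m ℂ) := Matrix.linftyOpNormedSpace
  have hcomplete : CompleteSpace (Matrix m m 𝕜) := inferInstance
  have h1 := hasDerivAt_exp_smul_const (𝕂 := ℝ) X 0
  rw [zero_smul, NormedSpace.exp_zero, one_mul] at h1
  have h2 := (LinearMap.toContinuousLinearMap L).hasFDerivAt.comp_hasDerivAt (0 : ℝ) h1
  have h3 := h2.congr_of_eventuallyEq (f₁ := fun _ => 0) (Eventually.of_forall fun t => (h t).symm)
  exact h3.unique (hasDerivAt_const _ _)

end Linearization

section QuotExp

variable {N n r : ℕ}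

theorem quot_expIC {X : soC N} (hX : (X : Matrix (Fin N) (Fin N) ℂ).map (starRingEnd ℂ) = -X) :
    quot (expIC N X) = NormedSpace.exp (Complex.I • (X : Matrix (Fin N) (Fin N) ℂ)) *
      NormedSpace.exp (Complex.I • (X : Matrix (Fin N) (Fin N) ℂ)) := by
  have h1 : (((expIC N X).2 : GL (Fin N) ℂ) : Matrix (Fin N) (Fin N) ℂ) =
      NormedSpace.exp (-(Complex.I • (X : Matrix (Fin N) (Fin N) ℂ))) := by
    change NormedSpace.exp (Complex.I • (X : Matrix (Fin N) (Fin N) ℂ).map (starRingEnd ℂ)) = _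
    rw [hX, smul_neg]
  have h2 := SO_mul_inv (expIC N X).2
  have h3 : NormedSpace.exp (Complex.I • (X : Matrix (Fin N) (Fin N) ℂ)) *
      NormedSpace.exp (-(Complex.I • (X : Matrix (Fin N) (Fin N) ℂ))) = 1 := by
    rw [Matrix.exp_neg]
    exact Matrix.mul_nonsing_inv _ ((Matrix.isUnit_iff_isUnit_det _).1 (Matrix.isUnit_exp _))
  have h4 : ((((expIC N X).2⁻¹ : SO (Fin N) ℂ) : GL (Fin N) ℂ) : Matrix (Fin N) (Fin N) ℂ) =
      NormedSpace.exp (Complex.I • (X : Matrix (Fin N) (Fin N) ℂ)) := by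
    rw [h1] at h2
    calc _ = NormedSpace.exp (Complex.I • (X : Matrix (Fin N) (Fin N) ℂ)) *
        NormedSpace.exp (-(Complex.I • (X : Matrix (Fin N) (Fin N) ℂ))) * _ := by
          rw [h3, Matrix.one_mul]
      _ = _ := by rw [Matrix.mul_assoc, h2, Matrix.mul_one]
  rw [quot, h4]
  rfl

/-- The rotations by the angles `2 tⱼ`, in the frame given by `k`. -/
noncomputable def rotMat (e : Fin n ⊕ Fin n ⊕ Fin r ≃ Fin N) (k : Matrix (Fin N) (Fin N) ℝ)
    (t : Fin n → ℝ) : Matrix (Fin N) (Fin N) ℝ :=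
  k * planar e (fun j => Real.cos (2 * t j)) (fun j => Real.sin (2 * t j))
    (fun j => -Real.sin (2 * t j)) (fun j => Real.cos (2 * t j)) 1 * kᵀ

theorem quot_expIC_eq_rotMat (e : Fin n ⊕ Fin n ⊕ Fin r ≃ Fin N) {k : Matrix (Fin N) (Fin N) ℝ}
    (hk : kᵀ * k = 1) {X : soC N} (hX : X ∈ pC N) {t : Fin n → ℝ}
    (hXt : (X : Matrix (Fin N) (Fin N) ℂ) = cx k * planar e 0 (fun j => -Complex.I * (t j : ℂ))
        (fun j => Complex.I * (t j : ℂ)) 0 0 * cx kᵀ) :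
    quot (expIC N X) = cx (rotMat e k t) := by
  have hk' : cx k * cx kᵀ = 1 := by rw [← map_mul, mul_eq_one_comm.1 hk, map_one]
  have hk'' : cx kᵀ * cx k = 1 := by rw [← map_mul, hk, map_one]
  have hu : IsUnit (cx k) := IsUnit.of_mul_eq_one _ hk'
  have hinv : (cx k)⁻¹ = cx kᵀ := Matrix.inv_eq_right_inv hk'
  have h1 : Complex.I • (X : Matrix (Fin N) (Fin N) ℂ) =
      cx k * planar e 0 (fun j => -Complex.I * (Complex.I * (t j : ℂ)))
        (fun j => Complex.I * (Complex.I * (t j : ℂ))) 0 0 * (cx k)⁻¹ := by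
    rw [hXt, hinv, ← Matrix.smul_mul, ← Matrix.mul_smul, planar_smul]
    congr 3 <;> funext i <;> simp
  rw [quot_expIC hX, h1, Matrix.exp_conj _ _ hu, exp_planar e (by simp), hinv, rotMat, map_mul, map_mul,
    Matrix.mul_assoc, ← Matrix.mul_assoc (cx kᵀ), ← Matrix.mul_assoc (cx kᵀ), hk'', Matrix.one_mul,
    ← Matrix.mul_assoc, Matrix.mul_assoc (cx k), planar_mul]
  congr 2
  change _ = (planar e _ _ _ _ _).map Complex.ofRealHom
  rw [planar_map]
  have hc : ∀ x : ℝ, Complex.cosh (Complex.I * x) = Real.cos x := fun x => by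
    rw [mul_comm, Complex.cosh_mul_I, Complex.ofReal_cos]
  have hs : ∀ x : ℝ, Complex.sinh (Complex.I * x) = Real.sin x * Complex.I := fun x => by
    rw [mul_comm, Complex.sinh_mul_I, Complex.ofReal_sin]
  have hcs : ∀ x : ℝ, (Real.sin x : ℂ) ^ 2 + (Real.cos x : ℂ) ^ 2 = 1 := fun x => by
    exact_mod_cast Real.sin_sq_add_cos_sq x
  have hI2 : ∀ x : ℂ, Complex.I * (x * Complex.I) = -x := fun x => by
    linear_combination x * Complex.I_mul_I
  congr 1 <;> funext i <;> simp [hc, hs, hI2, Real.cos_two_mul, Real.sin_two_mul,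
    -Complex.ofReal_cos, -Complex.ofReal_sin]
  · linear_combination -hcs (t i)
  · ring
  · ring
  · linear_combination -hcs (t i)

theorem continuous_inclC (N : ℕ) : Continuous (inclC N) := by
  refine continuous_id.prodMk (Continuous.subtype_mk ?_ _)
  refine continuous_into_GL ?_
  exact continuous_cj.comp (continuous_GL_val.comp continuous_subtype_val)

theorem smul_mem_of_isConj (g : SO (Fin N) ℂ) {γ δ : SO (Fin N) ℂ × SO (Fin N) ℂ}
    {z w h : Matrix (Fin N) (Fin N) ℝ} (hγ : quot γ = cx z) (hδ : quot δ = cx w)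
    (hh : hᵀ * h = 1) (hdet : h.det = 1) (hz : z = h * w * hᵀ) :
    ∃ g' : SO (Fin N) ℂ, ((inclC N g * γ : _) : (SO (Fin N) ℂ × SO (Fin N) ℂ) ⧸ KCC N) =
      (inclC N g' * δ : SO (Fin N) ℂ × SO (Fin N) ℂ) := by
  obtain ⟨a, ha, haz⟩ := exists_mem_specialIsometry (B := 1) (g := cx h)
    (by rw [Matrix.mul_one, ← cx_transpose, ← map_mul, hh, map_one])
    (by rw [det_cx, hdet, Complex.ofReal_one])
  refine ⟨g * ⟨a, ha⟩, ?_⟩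
  have h1 : quot γ = quot (inclC N ⟨a, ha⟩ * δ) := by
    symm
    rw [quot_smul_eq_iff]
    change a.1 * _ = _ * cj a.1
    rw [haz, hδ, hγ, cj_cx, ← map_mul, ← map_mul, hz, Matrix.mul_assoc _ _ h, hh, Matrix.mul_one]
  rw [KCC_eq_iff, map_mul, mul_assoc, quot_smul, h1, quot_smul g]

/-- The orbits in the distinguished boundary, from representatives for the invariant. -/
theorem isOrbitDecomposition_boundaryC {e : Fin n ⊕ Fin n ⊕ Fin r ≃ Fin N}
    {𝔞 : Submodule ℝ (soC N)} (h𝔞 : IsMaximalAbelianIn (pC N) 𝔞)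
    {k : Matrix (Fin N) (Fin N) ℝ} (hk : kᵀ * k = 1) (E : EigenFrame 1 (soC N) 𝔞 n r)
    (hE : ∀ t, (E.φ t : Matrix (Fin N) (Fin N) ℂ) = cx k * planar e 0 (fun j => -Complex.I * (t j : ℂ))
        (fun j => Complex.I * (t j : ℂ)) 0 0 * cx kᵀ)
    {c : ℕ} (z : Fin c → Matrix (Fin N) (Fin N) ℝ) (hzt : ∀ j, (z j)ᵀ * z j = 1)
    (hzd : ∀ j, (z j).det = 1) (hz4 : ∀ j, z j * z j * (z j * z j) = 1)
    (hA : ∀ t ∈ (polytope n r (Real.pi / 2)).extremePoints ℝ, ∃ j, ∃ h : Matrix (Fin N) (Fin N) ℝ,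
      hᵀ * h = 1 ∧ h.det = 1 ∧ rotMat e k t = h * z j * hᵀ)
    (hB : ∀ j, ∃ t ∈ (polytope n r (Real.pi / 2)).extremePoints ℝ, ∃ h : Matrix (Fin N) (Fin N) ℝ,
      hᵀ * h = 1 ∧ h.det = 1 ∧ rotMat e k t = h * z j * hᵀ)
    (hdisj : ∀ i j, ∀ g : Matrix (Fin N) (Fin N) ℂ, gᵀ * g = 1 → g.det = 1 →
      g * cx (z i) = cx (z j) * cj g → i = j)
    (H : Fin c → Subgroup (SO (Fin N) ℂ))
    (hH : ∀ j (g : SO (Fin N) ℂ), g ∈ H j ↔ ((g : GL (Fin N) ℂ) : Matrix (Fin N) (Fin N) ℂ) * cx (z j) =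
      cx (z j) * cj ((g : GL (Fin N) ℂ) : Matrix (Fin N) (Fin N) ℂ)) :
    IsOrbitDecomposition (inclC N) (boundaryC N 𝔞) H := by
  have hx : ∀ j, ∃ x : SO (Fin N) ℂ × SO (Fin N) ℂ, quot x = cx (z j) := by
    intro j
    obtain ⟨a, ha, haz⟩ := exists_mem_specialIsometry (B := 1) (g := cx (z j))
      (by rw [Matrix.mul_one, ← cx_transpose, ← map_mul, hzt, map_one])
      (by rw [det_cx, hzd, Complex.ofReal_one])
    refine ⟨(⟨a, ha⟩, 1), ?_⟩
    rw [quot, inv_one]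
    exact (Matrix.mul_one _).trans haz
  choose x hxz using hx
  have hφ : ∀ t, E.φ t ∈ pC N := fun t => h𝔞.1.1 (E.mem t)
  have hquot : ∀ t, quot (expIC N (E.φ t)) = cx (rotMat e k t) := fun t =>
    quot_expIC_eq_rotMat e hk (hφ t) (hE t)
  have hext := fun t => E.mem_extremeOmega_iff (B := 1) (fun X => by
    rw [Matrix.mul_one, Matrix.one_mul]
    exact LieAlgebra.Orthogonal.mem_so _ _ _) (by simp) (by simp) t
  have hcj : ∀ g : SO (Fin N) ℂ, ∀ j, ((inclC N g * x j : _) : (SO (Fin N) ℂ × SO (Fin N) ℂ) ⧸ KCC N) = x j ↔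
      ((g : GL (Fin N) ℂ) : Matrix (Fin N) (Fin N) ℂ) * cx (z j) =
        cx (z j) * cj ((g : GL (Fin N) ℂ) : Matrix (Fin N) (Fin N) ℂ) := by
    intro g j
    rw [KCC_eq_iff, quot_smul_eq_iff, hxz]
  refine isOrbitDecomposition_of_points ?_ (hasLocalSections_C N) (fun g γ hγ => smul_mem_fourthC g hγ)
    ?_ x ?_ ?_ ?_ H ?_
  · exact continuous_inclC N
  · intro γ hγ k hk
    change _ = _ at hγ ⊢
    rw [quot_mul_KCC γ hk]
    exact hγ
  · intro j
    change quot (x j) * cj (quot (x j)) * (quot (x j) * cj (quot (x j))) = 1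
    rw [hxz, cj_cx, ← map_mul, ← map_mul, hz4, map_one]
  · intro y
    constructor
    · rintro ⟨g, Y, hY, rfl⟩
      obtain ⟨t, rfl⟩ := E.exists_of_mem Y
      obtain ⟨j, h, hh, hd, hr⟩ := hA t ((hext t).1 hY)
      obtain ⟨g', hg'⟩ := smul_mem_of_isConj g ((congrArg _ (congrArg _ (E.coe_equiv t))).trans (hquot t))
        (hxz j) hh hd hr
      exact ⟨j, g', hg'⟩
    · rintro ⟨j, g, rfl⟩
      obtain ⟨t, ht, h, hh, hd, hr⟩ := hB j
      have hh' : h * hᵀ = 1 := mul_eq_one_comm.1 hh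
      obtain ⟨g', hg'⟩ := smul_mem_of_isConj g (hxz j)
        ((congrArg _ (congrArg _ (E.coe_equiv t))).trans (hquot t)) (h := hᵀ)
        (by rw [Matrix.transpose_transpose, hh']) (by rw [Matrix.det_transpose, hd])
        (by
          rw [hr, Matrix.transpose_transpose]
          calc z j = (hᵀ * h) * z j * (hᵀ * h) := by rw [hh, Matrix.one_mul, Matrix.mul_one]
            _ = _ := by simp only [Matrix.mul_assoc])
      exact ⟨g', E.equiv t, (hext t).2 ht, hg'⟩
  · intro i j g h
    rw [KCC_eq_iff, quot_smul_eq_iff, hxz, hxz] at h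
    have hg := mem_SO_iff.1 g.2
    exact hdisj i j _ hg.1 hg.2 h
  · intro j g
    rw [hH, hcj]

end QuotExp

section RotationConjugacy

variable {m : Type} [Fintype m] [DecidableEq m]

/-- Conjugacy of real matrices under the special orthogonal group. -/
def RotConj (z w : Matrix m m ℝ) : Prop :=
  ∃ h : Matrix m m ℝ, hᵀ * h = 1 ∧ h.det = 1 ∧ z = h * w * hᵀ

theorem det_eq_of_orthogonal {k : Matrix m m ℝ} (hk : kᵀ * k = 1) : k.det = 1 ∨ k.det = -1 :=
  det_sq_of_isometry (B := 1) isUnit_one (by rwa [Matrix.mul_one])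

theorem orthogonal_mul {R : Type} [CommRing R] {k l : Matrix m m R} (hk : kᵀ * k = 1) (hl : lᵀ * l = 1) :
    (k * l)ᵀ * (k * l) = 1 := by
  rw [Matrix.transpose_mul, Matrix.mul_assoc, ← Matrix.mul_assoc kᵀ, hk, Matrix.one_mul, hl]

theorem conj_conj (k l w : Matrix m m ℝ) : k * (l * w * lᵀ) * kᵀ = k * l * w * (k * l)ᵀ := by
  rw [Matrix.transpose_mul]
  simp only [Matrix.mul_assoc]

theorem rotConj_of_orthogonal {k δ w : Matrix m m ℝ} (hk : kᵀ * k = 1) (hδ : δᵀ * δ = 1)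
    (hδd : δ.det = -1) (hw : δ * w * δᵀ = w) : RotConj (k * w * kᵀ) w := by
  rcases det_eq_of_orthogonal hk with h | h
  · exact ⟨k, hk, h, rfl⟩
  · refine ⟨k * δ, orthogonal_mul hk hδ, by rw [Matrix.det_mul, h, hδd]; norm_num, ?_⟩
    rw [← conj_conj, hw]

/-- `-1` at two places on the diagonal, `1` at the other places. -/
def twoSigns (x y : m) : Matrix m m ℝ := Matrix.diagonal fun i => if i = x ∨ i = y then -1 else 1

theorem twoSigns_conj {x y x' y' : m} (h : x ≠ y) (h' : x' ≠ y') :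
    ∃ Q : Matrix m m ℝ, Qᵀ * Q = 1 ∧ twoSigns x y = Q * twoSigns x' y' * Qᵀ := by
  obtain ⟨σ, hσ⟩ := Equiv.Perm.exists_extending_pair ![x, y] ![x', y']
    (by intro i j; fin_cases i <;> fin_cases j <;> simp [h, h.symm])
    (by intro i j; fin_cases i <;> fin_cases j <;> simp [h', h'.symm])
  have h0 : σ x = x' := hσ 0
  have h1 : σ y = y' := hσ 1
  refine ⟨(1 : Matrix m m ℝ).submatrix σ id, ?_, ?_⟩
  · rw [Matrix.transpose_submatrix, Matrix.transpose_one, Matrix.submatrix_mul_equiv _ _ id σ id]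
    simp
  · have h2 : (1 : Matrix m m ℝ).submatrix σ id * twoSigns x' y' =
        (twoSigns x' y').submatrix σ id := by
      have := Matrix.submatrix_mul_equiv (1 : Matrix m m ℝ) (twoSigns x' y') σ (Equiv.refl m) id
      rw [Matrix.one_mul] at this
      exact this
    rw [h2, Matrix.transpose_submatrix, Matrix.transpose_one]
    have h3 := Matrix.submatrix_mul_equiv (twoSigns x' y') (1 : Matrix m m ℝ) σ (Equiv.refl m) σ
    rw [Matrix.mul_one] at h3
    refine Eq.trans ?_ h3.symm
    rw [twoSigns, twoSigns, Matrix.submatrix_diagonal_equiv]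
    congr 1
    funext i
    simp [← h0, ← h1]

theorem twoSigns_mul_self (x y : m) : twoSigns x y * twoSigns x y = 1 := by
  rw [twoSigns, Matrix.diagonal_mul_diagonal, ← Matrix.diagonal_one]
  congr 1
  funext i
  split_ifs <;> simp

theorem twoSigns_transpose (x y : m) : (twoSigns x y)ᵀ = twoSigns x y := Matrix.diagonal_transpose _

theorem det_twoSigns {x y : m} (h : x ≠ y) : (twoSigns x y).det = 1 := by
  rw [twoSigns, Matrix.det_diagonal, Finset.prod_ite]
  have : (Finset.univ.filter fun i => i = x ∨ i = y) = {x, y} := by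
    ext i; simp
  rw [this, Finset.prod_const, Finset.card_pair h]
  simp

/-- `-1` at one place on the diagonal, `1` at the other places. -/
def oneSign (x : m) : Matrix m m ℝ := Matrix.diagonal fun i => if i = x then -1 else 1

theorem oneSign_mul_self (x : m) : oneSign x * oneSign x = 1 := by
  rw [oneSign, Matrix.diagonal_mul_diagonal, ← Matrix.diagonal_one]
  congr 1
  funext i
  split_ifs <;> simp

theorem oneSign_transpose (x : m) : (oneSign x)ᵀ = oneSign x := Matrix.diagonal_transpose _

theorem det_oneSign (x : m) : (oneSign x).det = -1 := by
  rw [oneSign, Matrix.det_diagonal, Finset.prod_ite_eq' Finset.univ x fun _ => (-1 : ℝ)]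
  simp

theorem rotConj_twoSigns {k : Matrix m m ℝ} (hk : kᵀ * k = 1) {x y x' y' : m} (h : x ≠ y)
    (h' : x' ≠ y') : RotConj (k * twoSigns x y * kᵀ) (twoSigns x' y') := by
  obtain ⟨Q, hQ, hxy⟩ := twoSigns_conj h h'
  rw [hxy, conj_conj]
  refine rotConj_of_orthogonal (δ := oneSign x') (orthogonal_mul hk hQ)
    (by rw [oneSign_transpose, oneSign_mul_self]) (det_oneSign _) ?_
  rw [oneSign_transpose]
  have : oneSign x' * twoSigns x' y' = twoSigns x' y' * oneSign x' := by
    rw [oneSign, twoSigns, Matrix.diagonal_mul_diagonal, Matrix.diagonal_mul_diagonal]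
    simp only [mul_comm]
  rw [this, Matrix.mul_assoc, oneSign_mul_self, Matrix.mul_one]

end RotationConjugacy

section RotMat

variable {N n r : ℕ} (e : Fin n ⊕ Fin n ⊕ Fin r ≃ Fin N) (k : Matrix (Fin N) (Fin N) ℝ)

/-- The standard complex structure on the planes. -/
def planeJ (e : Fin n ⊕ Fin n ⊕ Fin r ≃ Fin N) : Matrix (Fin N) (Fin N) ℝ := planar e 0 (-1) 1 0 1

theorem planeJ_transpose_mul : (planeJ e)ᵀ * planeJ e = 1 := by
  rw [planeJ, planar_transpose, planar_mul, ← planar_one e]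
  congr 1 <;> simp

theorem planeJ_mul_self : planeJ e * planeJ e = planar e (-1) 0 0 (-1) 1 := by
  rw [planeJ, planar_mul]
  congr 1 <;> simp

theorem planeJ_fourth : planeJ e * planeJ e * (planeJ e * planeJ e) = 1 := by
  rw [planeJ_mul_self, planar_mul, ← planar_one e]
  congr 1 <;> simp

theorem planeJ_mul_self_ne (hn : 0 < n) : planeJ e * planeJ e ≠ 1 := by
  rw [planeJ_mul_self, ← planar_one e]
  intro h
  have := congrFun (planar_injective e h).1 ⟨0, hn⟩
  norm_num at this

theorem det_planeJ : (planeJ e).det = 1 := by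
  set c : ℝ := Real.sqrt (1 / 2)
  have hc : c * c = 1 / 2 := Real.mul_self_sqrt (by norm_num)
  set w := planar e (fun _ => c) (fun _ => -c) (fun _ => c) (fun _ => c) 1
  have h1 : w * w = planeJ e := by
    rw [planar_mul, planeJ]
    congr 1 <;> funext i <;> simp <;> linarith
  have h2 : wᵀ * w = 1 := by
    rw [planar_transpose, planar_mul, ← planar_one e]
    congr 1 <;> funext i <;> simp <;> linarith
  rw [← h1, Matrix.det_mul]
  rcases det_eq_of_orthogonal h2 with h | h <;> rw [h] <;> norm_num

theorem rotMat_single (j : Fin n) {s : ℝ} (hs : |s| = Real.pi / 2) :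
    rotMat e k (Pi.single j s) =
      k * twoSigns (e (Sum.inl j)) (e (Sum.inr (Sum.inl j))) * kᵀ := by
  have h1 : ∀ i, Real.cos (2 * (Pi.single j s : Fin n → ℝ) i) = if i = j then -1 else 1 := by
    intro i
    by_cases hij : i = j
    · subst hij
      rw [Pi.single_eq_same, if_pos rfl, ← Real.cos_abs, abs_mul, hs]
      have : |(2 : ℝ)| * (Real.pi / 2) = Real.pi := by rw [abs_of_pos two_pos]; ring
      rw [this, Real.cos_pi]
    · simp [hij]
  have h2 : ∀ i, Real.sin (2 * (Pi.single j s : Fin n → ℝ) i) = 0 := by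
    intro i
    by_cases hij : i = j
    · subst hij
      rw [Pi.single_eq_same]
      rcases (abs_eq (by positivity)).1 hs with h | h
      · rw [h, show 2 * (Real.pi / 2) = Real.pi by ring, Real.sin_pi]
      · rw [h, show 2 * -(Real.pi / 2) = -Real.pi by ring, Real.sin_neg, Real.sin_pi, neg_zero]
    · simp [Pi.single_eq_of_ne hij]
  rw [rotMat]
  simp only [h1, h2, neg_zero]
  have h3 : (fun _ : Fin n => (0 : ℝ)) = 0 := rfl
  rw [h3, planar_eq_diagonal, twoSigns]
  congr 3
  funext x
  obtain ⟨x, rfl⟩ := e.surjective x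
  rcases x with x | x | x <;> simp

theorem rotMat_half {t : Fin n → ℝ} (ht : ∀ j, |t j| = Real.pi / 2 / 2) :
    ∃ k' : Matrix (Fin N) (Fin N) ℝ, k' = k * planar e 1 0 0 (fun j => -(SignType.sign (t j) : ℝ)) 1 ∧
      (kᵀ * k = 1 → k'ᵀ * k' = 1) ∧ rotMat e k t = k' * planeJ e * k'ᵀ := by
  have hpos : ∀ j, t j = (SignType.sign (t j) : ℝ) * (Real.pi / 4) := by
    intro j
    conv_lhs => rw [← sign_mul_abs (t j), ht j]
    ring
  have hsq : ∀ j, (SignType.sign (t j) : ℝ) * SignType.sign (t j) = 1 := by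
    intro j
    have h0 : t j ≠ 0 := by
      intro h0
      have := ht j
      rw [h0, abs_zero] at this
      linarith [Real.pi_pos]
    rcases lt_or_gt_of_ne h0 with h | h
    · simp [sign_neg h]
    · simp [sign_pos h]
  have h1 : ∀ j, Real.cos (2 * t j) = 0 := by
    intro j
    rw [← Real.cos_abs, abs_mul, ht j, abs_of_pos two_pos,
      show 2 * (Real.pi / 2 / 2) = Real.pi / 2 by ring, Real.cos_pi_div_two]
  have h2 : ∀ j, Real.sin (2 * t j) = SignType.sign (t j) := by
    intro j
    rcases mul_self_eq_one_iff.1 (hsq j) with h | h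
    · rw [hpos j, h]
      rw [show 2 * (1 * (Real.pi / 4)) = Real.pi / 2 by ring, Real.sin_pi_div_two]
      have : SignType.sign (1 * (Real.pi / 4)) = 1 := sign_pos (by positivity)
      rw [this]; simp
    · rw [hpos j, h]
      rw [show 2 * (-1 * (Real.pi / 4)) = -(Real.pi / 2) by ring, Real.sin_neg, Real.sin_pi_div_two]
      have : SignType.sign (-1 * (Real.pi / 4)) = -1 := sign_neg (by linarith [Real.pi_pos])
      rw [this]; simp
  refine ⟨_, rfl, fun hk => orthogonal_mul hk ?_, ?_⟩
  · rw [planar_transpose, planar_mul, ← planar_one e]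
    congr 1 <;> funext i <;> simp [hsq]
  · rw [← conj_conj, rotMat]
    congr 2
    rw [planeJ, planar_transpose, planar_mul, planar_mul]
    congr 1 <;> funext i <;> simp [h1, h2]

end RotMat

section Relations

variable {m : Type} [Fintype m] [DecidableEq m]

theorem relation_sq {g : Matrix m m ℂ} {z w : Matrix m m ℝ} (h : g * cx z = cx w * cj g) :
    g * cx (z * z) = cx (w * w) * g := by
  have h1 : cj g * cx z = cx w * g := by
    have := congrArg cj h
    rwa [map_mul, map_mul, cj_cx, cj_cx, cj_cj] at this
  rw [map_mul, map_mul, ← Matrix.mul_assoc, h, Matrix.mul_assoc, h1, Matrix.mul_assoc]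

theorem relation_sq_eq_one {g : Matrix m m ℂ} (hg : gᵀ * g = 1) {z w : Matrix m m ℝ}
    (h : g * cx z = cx w * cj g) : z * z = 1 ↔ w * w = 1 := by
  have h1 := relation_sq h
  have hg' : g * gᵀ = 1 := mul_eq_one_comm.1 hg
  constructor
  · intro h2
    rw [h2, map_one, Matrix.mul_one] at h1
    apply cx_injective
    calc cx (w * w) = cx (w * w) * g * gᵀ := by rw [Matrix.mul_assoc, hg', Matrix.mul_one]
      _ = cx 1 := by rw [← h1, hg', map_one]
  · intro h2
    rw [h2, map_one, Matrix.one_mul] at h1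
    apply cx_injective
    calc cx (z * z) = gᵀ * (g * cx (z * z)) := by rw [← Matrix.mul_assoc, hg, Matrix.one_mul]
      _ = cx 1 := by rw [h1, hg, map_one]

/-- The condition `gᴴ J g = J` for complex orthogonal matrices. -/
theorem relation_J_iff {g J : Matrix m m ℂ} (hg : gᵀ * g = 1) (hJ : cj J = J) :
    gᴴ * J * g = J ↔ g * J = J * cj g := by
  have hg' : g * gᵀ = 1 := mul_eq_one_comm.1 hg
  have h1 : gᴴ = cj gᵀ := by ext i j; rfl
  have h2 : cj gᵀ * cj g = 1 := by rw [← map_mul, hg, map_one]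
  have h3 : cj g * cj gᵀ = 1 := by rw [← map_mul, hg', map_one]
  constructor
  · intro h
    have h4 : J * g = cj g * J := by
      calc J * g = cj g * cj gᵀ * (J * g) := by rw [h3, Matrix.one_mul]
        _ = cj g * (gᴴ * J * g) := by rw [h1]; simp only [Matrix.mul_assoc]
        _ = _ := by rw [h]
    have := congrArg cj h4
    rw [map_mul, map_mul, hJ, cj_cj] at this
    exact this.symm
  · intro h
    have := congrArg cj h
    rw [map_mul, map_mul, hJ, cj_cj] at this
    rw [h1, Matrix.mul_assoc, ← this, ← Matrix.mul_assoc, h2, Matrix.one_mul]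

end Relations

section Coordinates

/-- The coordinates of `SO(2n,ℂ)` grouped into planes. -/
def evenEquiv (n : ℕ) : Fin n ⊕ Fin n ⊕ Fin 0 ≃ Fin (2 * n) :=
  (Equiv.sumAssoc _ _ _).symm.trans
    ((Equiv.sumEmpty _ _).trans (finSumFinEquiv.trans (finCongr (two_mul n).symm)))

/-- The coordinates of `SO(2n+1,ℂ)` grouped into planes and a line. -/
def oddEquiv (n : ℕ) : Fin n ⊕ Fin n ⊕ Fin 1 ≃ Fin (2 * n + 1) :=
  (Equiv.sumAssoc _ _ _).symm.trans
    ((Equiv.sumCongr (finSumFinEquiv.trans (finCongr (two_mul n).symm)) (Equiv.refl _)).trans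
      finSumFinEquiv)

theorem planeJ_evenEquiv (n : ℕ) : cx (planeJ (evenEquiv n)) =
    (Matrix.J (Fin n) ℂ).submatrix (finSumFinEquiv.trans (finCongr (two_mul n).symm)).symm
      (finSumFinEquiv.trans (finCongr (two_mul n).symm)).symm := by
  ext x y
  obtain ⟨x, rfl⟩ := (evenEquiv n).surjective x
  obtain ⟨y, rfl⟩ := (evenEquiv n).surjective y
  have h : ∀ z : Fin n ⊕ Fin n ⊕ Fin 0,
      (finSumFinEquiv.trans (finCongr (two_mul n).symm)).symm (evenEquiv n z) =
        (Equiv.sumEmpty _ (Fin 0)) ((Equiv.sumAssoc _ _ _).symm z) := by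
    intro z
    simp only [evenEquiv, Equiv.trans_apply]
    simp [finCongr]
  rw [Matrix.submatrix_apply, h, h, cx_apply, planeJ, planar, Matrix.submatrix_apply,
    Equiv.symm_apply_apply, Equiv.symm_apply_apply]
  rcases x with x | x | x
  · rcases y with y | y | y
    · simp [Matrix.J]
    · simp [Matrix.J, Matrix.diagonal_apply, Matrix.one_apply, apply_ite]
    · exact y.elim0
  · rcases y with y | y | y
    · simp [Matrix.J, Matrix.one_apply, apply_ite]
    · simp [Matrix.J]
    · exact y.elim0
  · exact x.elim0

/-- Complex orthogonal matrices commuting with the quaternionic structure have determinant one. -/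
theorem det_eq_one_of_relation {n : ℕ} {g : Matrix (Fin (2 * n)) (Fin (2 * n)) ℂ} (hg : gᵀ * g = 1)
    (h : g * cx (planeJ (evenEquiv n)) = cx (planeJ (evenEquiv n)) * cj g) : g.det = 1 := by
  have hJ := planeJ_evenEquiv n
  generalize finSumFinEquiv.trans (finCongr (two_mul n).symm) = f at hJ
  have h1 := (relation_J_iff hg (cj_cx _)).2 h
  rw [hJ] at h1
  have h2 : (g.submatrix f f)ᵀ * g.submatrix f f = 1 := by
    rw [Matrix.transpose_submatrix, Matrix.submatrix_mul_equiv, hg, Matrix.submatrix_one_equiv]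
  have h3 : (g.submatrix f f)ᴴ * Matrix.J (Fin n) ℂ * g.submatrix f f = Matrix.J (Fin n) ℂ := by
    have h4 := congrArg (fun M => Matrix.submatrix M f f) h1
    simp only [Matrix.submatrix_submatrix, Equiv.symm_comp_self, Matrix.submatrix_id_id] at h4
    rw [← Matrix.submatrix_mul_equiv _ _ f f f, ← Matrix.submatrix_mul_equiv _ _ f f f,
      Matrix.submatrix_submatrix] at h4
    simpa using h4
  have h5 := det_eq_one_of_star h2 h3
  rwa [Matrix.det_submatrix_equiv_self] at h5

end Coordinates

section ComplexDecompositions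

variable {N n r : ℕ}

theorem rotConj_single (e : Fin n ⊕ Fin n ⊕ Fin r ≃ Fin N) {k : Matrix (Fin N) (Fin N) ℝ}
    (hk : kᵀ * k = 1) (j : Fin n) {s : ℝ} (hs : |s| = Real.pi / 2) {x y : Fin N} (hxy : x ≠ y) :
    RotConj (rotMat e k (Pi.single j s)) (twoSigns x y) := by
  rw [rotMat_single e k j hs]
  exact rotConj_twoSigns hk (by simp) hxy

theorem isOrbitDecomposition_single {e : Fin n ⊕ Fin n ⊕ Fin r ≃ Fin N} (hr : r ≤ 1) (hn : n = 2)
    {𝔞 : Submodule ℝ (soC N)} (h𝔞 : IsMaximalAbelianIn (pC N) 𝔞) {x y : Fin N} (hxy : x ≠ y)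
    {H : Subgroup (SO (Fin N) ℂ)}
    (hH : ∀ g : SO (Fin N) ℂ, g ∈ H ↔ ((g : GL (Fin N) ℂ) : Matrix (Fin N) (Fin N) ℂ) *
      cx (twoSigns x y) = cx (twoSigns x y) * cj ((g : GL (Fin N) ℂ) : Matrix (Fin N) (Fin N) ℂ)) :
    IsOrbitDecomposition (inclC N) (boundaryC N 𝔞) ![H] := by
  obtain ⟨k, hk, E, hE⟩ := exists_frame_C hr e h𝔞
  have hpi : |Real.pi / 2| = Real.pi / 2 := abs_of_pos (by positivity)
  refine isOrbitDecomposition_boundaryC h𝔞 hk E hE ![twoSigns x y] ?_ ?_ ?_ ?_ ?_ ?_ _ ?_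
  · intro j; fin_cases j; simp [twoSigns_transpose, twoSigns_mul_self]
  · intro j; fin_cases j; simp [det_twoSigns hxy]
  · intro j; fin_cases j; simp [twoSigns_mul_self]
  · intro t ht
    rcases extremePoints_polytope (by omega) (by positivity) ht with ⟨j, s, hs, rfl⟩ | ⟨h, -⟩
    · exact ⟨0, rotConj_single e hk j hs hxy⟩
    · omega
  · intro j; fin_cases j
    exact ⟨_, extreme_single (by omega) (by positivity) (⟨0, by omega⟩ : Fin n) hpi,
      rotConj_single e hk _ hpi hxy⟩
  · intro i j g _ _ _
    exact Subsingleton.elim i j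
  · intro j g; fin_cases j
    exact hH g

theorem isOrbitDecomposition_odd {e : Fin n ⊕ Fin n ⊕ Fin 1 ≃ Fin N} (hn : 3 ≤ n)
    {𝔞 : Submodule ℝ (soC N)} (h𝔞 : IsMaximalAbelianIn (pC N) 𝔞) {x y : Fin N} (hxy : x ≠ y)
    {H₁ H₂ : Subgroup (SO (Fin N) ℂ)}
    (hH₁ : ∀ g : SO (Fin N) ℂ, g ∈ H₁ ↔ ((g : GL (Fin N) ℂ) : Matrix (Fin N) (Fin N) ℂ) *
      cx (twoSigns x y) = cx (twoSigns x y) * cj ((g : GL (Fin N) ℂ) : Matrix (Fin N) (Fin N) ℂ))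
    (hH₂ : ∀ g : SO (Fin N) ℂ, g ∈ H₂ ↔ ((g : GL (Fin N) ℂ) : Matrix (Fin N) (Fin N) ℂ) *
      cx (planeJ e) = cx (planeJ e) * cj ((g : GL (Fin N) ℂ) : Matrix (Fin N) (Fin N) ℂ)) :
    IsOrbitDecomposition (inclC N) (boundaryC N 𝔞) ![H₁, H₂] := by
  obtain ⟨k, hk, E, hE⟩ := exists_frame_C le_rfl e h𝔞
  have hpi : |Real.pi / 2| = Real.pi / 2 := abs_of_pos (by positivity)
  have hpi' : |Real.pi / 2 / 2| = Real.pi / 2 / 2 := abs_of_pos (by positivity)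
  have hhalf : ∀ t : Fin n → ℝ, (∀ j, |t j| = Real.pi / 2 / 2) →
      RotConj (rotMat e k t) (planeJ e) := by
    intro t ht
    obtain ⟨k', -, hk', h⟩ := rotMat_half e k ht
    rw [h]
    refine rotConj_of_orthogonal (δ := planar e 1 0 0 1 (-1)) (hk' hk) ?_ ?_ ?_
    · rw [planar_transpose, planar_mul, ← planar_one e]
      congr 1 <;> simp
    · rw [det_planar_diagonal]; simp
    · rw [planeJ, planar_transpose, planar_mul, planar_mul]
      congr 1 <;> simp
  have hsq : planeJ e * planeJ e ≠ 1 := planeJ_mul_self_ne e (by omega)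
  refine isOrbitDecomposition_boundaryC h𝔞 hk E hE ![twoSigns x y, planeJ e] ?_ ?_ ?_ ?_ ?_ ?_ _ ?_
  · intro j; fin_cases j
    · simp [twoSigns_transpose, twoSigns_mul_self]
    · exact planeJ_transpose_mul e
  · intro j; fin_cases j
    · simp [det_twoSigns hxy]
    · exact det_planeJ e
  · intro j; fin_cases j
    · simp [twoSigns_mul_self]
    · exact planeJ_fourth e
  · intro t ht
    rcases extremePoints_polytope (by omega) (by positivity) ht with ⟨j, s, hs, rfl⟩ | ⟨-, h⟩
    · exact ⟨0, rotConj_single e hk j hs hxy⟩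
    · exact ⟨1, hhalf t h⟩
  · intro j; fin_cases j
    · exact ⟨_, extreme_single (by omega) (by positivity) (⟨0, by omega⟩ : Fin n) hpi,
        rotConj_single e hk _ hpi hxy⟩
    · exact ⟨fun _ => Real.pi / 2 / 2, extreme_half hn fun _ => hpi', hhalf _ fun _ => hpi'⟩
  · intro i j g hg _ h
    have h1 := relation_sq_eq_one hg h
    fin_cases i <;> fin_cases j
    · rfl
    · exact absurd (h1.1 (twoSigns_mul_self x y)) hsq
    · exact absurd (h1.2 (twoSigns_mul_self x y)) hsq
    · rfl
  · intro j g; fin_cases j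
    · exact hH₁ g
    · exact hH₂ g

theorem isOrbitDecomposition_even (hn : 3 ≤ n)
    {𝔞 : Submodule ℝ (soC (2 * n))} (h𝔞 : IsMaximalAbelianIn (pC (2 * n)) 𝔞) {x y : Fin (2 * n)}
    (hxy : x ≠ y) {δ : Matrix (Fin (2 * n)) (Fin (2 * n)) ℝ} (hδt : δᵀ = δ) (hδ : δ * δ = 1)
    (hδd : δ.det = -1) {H₁ H₂ H₃ : Subgroup (SO (Fin (2 * n)) ℂ)}
    (hH₁ : ∀ g : SO (Fin (2 * n)) ℂ,
      g ∈ H₁ ↔ (g : GL (Fin (2 * n)) ℂ).1 * cx (twoSigns x y) =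
        cx (twoSigns x y) * cj (g : GL (Fin (2 * n)) ℂ).1)
    (hH₂ : ∀ g : SO (Fin (2 * n)) ℂ,
      g ∈ H₂ ↔ (g : GL (Fin (2 * n)) ℂ).1 * cx (planeJ (evenEquiv n)) =
        cx (planeJ (evenEquiv n)) * cj (g : GL (Fin (2 * n)) ℂ).1)
    (hH₃ : ∀ g : SO (Fin (2 * n)) ℂ,
      g ∈ H₃ ↔ (g : GL (Fin (2 * n)) ℂ).1 * cx (δ * planeJ (evenEquiv n) * δ) =
        cx (δ * planeJ (evenEquiv n) * δ) * cj (g : GL (Fin (2 * n)) ℂ).1) :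
    IsOrbitDecomposition (inclC (2 * n)) (boundaryC (2 * n) 𝔞) ![H₁, H₂, H₃] := by
  set e := evenEquiv n with he
  obtain ⟨k, hk, E, hE⟩ := exists_frame_C (by omega) e h𝔞
  have hpi : |Real.pi / 2| = Real.pi / 2 := abs_of_pos (by positivity)
  have hδ' : δᵀ * δ = 1 := by rw [hδt, hδ]
  have hhalf : ∀ k' : Matrix (Fin (2 * n)) (Fin (2 * n)) ℝ, k'ᵀ * k' = 1 →
      (k'.det = 1 → RotConj (k' * planeJ e * k'ᵀ) (planeJ e)) ∧
      (k'.det = -1 → RotConj (k' * planeJ e * k'ᵀ) (δ * planeJ e * δ)) := by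
    intro k' hk'
    refine ⟨fun h => ⟨k', hk', h, rfl⟩, fun h => ⟨k' * δ, orthogonal_mul hk' hδ', ?_, ?_⟩⟩
    · rw [Matrix.det_mul, h, hδd]; norm_num
    · have h1 : δ * (δ * planeJ e * δ) * δᵀ = planeJ e := by
        rw [hδt]
        calc δ * (δ * planeJ e * δ) * δ = (δ * δ) * planeJ e * (δ * δ) := by
              simp only [Matrix.mul_assoc]
          _ = _ := by rw [hδ, Matrix.one_mul, Matrix.mul_one]
      rw [← conj_conj, h1]
  have hreach : ∀ s : ℝ, (s = 1 ∨ s = -1) → ∃ t : Fin n → ℝ, (∀ j, |t j| = Real.pi / 2 / 2) ∧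
      ∃ k' : Matrix (Fin (2 * n)) (Fin (2 * n)) ℝ, k'ᵀ * k' = 1 ∧ k'.det = s ∧
        rotMat e k t = k' * planeJ e * k'ᵀ := by
    intro s hs
    obtain ⟨d, hd, hds⟩ : ∃ d : ℝ, (d = 1 ∨ d = -1) ∧ k.det * d = s := by
      rcases det_eq_of_orthogonal hk with h | h <;> rcases hs with hs | hs <;> rw [h, hs]
      · exact ⟨1, Or.inl rfl, by norm_num⟩
      · exact ⟨-1, Or.inr rfl, by norm_num⟩
      · exact ⟨-1, Or.inr rfl, by norm_num⟩
      · exact ⟨1, Or.inl rfl, by norm_num⟩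
    let j₀ : Fin n := ⟨0, by omega⟩
    let t : Fin n → ℝ := fun j => if j = j₀ then -d * (Real.pi / 2 / 2) else -(Real.pi / 2 / 2)
    have ht : ∀ j, |t j| = Real.pi / 2 / 2 := by
      intro j
      have hp : (0 : ℝ) < Real.pi / 2 / 2 := by positivity
      simp only [t]
      split_ifs
      · rcases hd with rfl | rfl
        · rw [neg_one_mul, abs_neg, abs_of_pos hp]
        · rw [neg_neg, one_mul, abs_of_pos hp]
      · rw [abs_neg, abs_of_pos hp]
    obtain ⟨k', hk'e, hk', h⟩ := rotMat_half e k ht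
    refine ⟨t, ht, k', hk' hk, ?_, h⟩
    have hsign : ∀ j, -(SignType.sign (t j) : ℝ) = if j = j₀ then d else 1 := by
      intro j
      have hp : (0 : ℝ) < Real.pi / 2 / 2 := by positivity
      simp only [t]
      split_ifs
      · rcases hd with rfl | rfl
        · have : SignType.sign (-1 * (Real.pi / 2 / 2)) = -1 := sign_neg (by linarith)
          rw [this]; simp
        · have : SignType.sign (- -1 * (Real.pi / 2 / 2)) = 1 := sign_pos (by linarith)
          rw [this]; simp
      · have : SignType.sign (-(Real.pi / 2 / 2)) = -1 := sign_neg (by linarith)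
        rw [this]; simp
    rw [hk'e, Matrix.det_mul, det_planar_diagonal]
    simp only [hsign, Finset.prod_ite_eq', Finset.mem_univ, if_true, Pi.one_apply,
      Finset.prod_const_one, one_mul, mul_one]
    exact hds
  have hsq : planeJ e * planeJ e ≠ 1 := planeJ_mul_self_ne e (by omega)
  have hδsq : δ * planeJ e * δ * (δ * planeJ e * δ) = δ * (planeJ e * planeJ e) * δ := by
    calc _ = δ * planeJ e * (δ * δ) * planeJ e * δ := by simp only [Matrix.mul_assoc]
      _ = _ := by rw [hδ, Matrix.mul_one]; simp only [Matrix.mul_assoc]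
  have hsq' : δ * planeJ e * δ * (δ * planeJ e * δ) ≠ 1 := by
    intro h
    apply hsq
    calc planeJ e * planeJ e = (δ * δ) * (planeJ e * planeJ e) * (δ * δ) := by
          rw [hδ, Matrix.one_mul, Matrix.mul_one]
      _ = δ * (δ * (planeJ e * planeJ e) * δ) * δ := by simp only [Matrix.mul_assoc]
      _ = 1 := by rw [← hδsq, h, Matrix.mul_one, hδ]
  have hcδ : cx δ * cx δ = 1 := by rw [← map_mul, hδ, map_one]
  have hcδd : (cx δ).det = -1 := by rw [det_cx, hδd]; simp
  refine isOrbitDecomposition_boundaryC h𝔞 hk E hE ![twoSigns x y, planeJ e, δ * planeJ e * δ]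
    ?_ ?_ ?_ ?_ ?_ ?_ _ ?_
  · intro j; fin_cases j
    · simp [twoSigns_transpose, twoSigns_mul_self]
    · exact planeJ_transpose_mul e
    · exact orthogonal_mul (orthogonal_mul hδ' (planeJ_transpose_mul e)) hδ'
  · intro j; fin_cases j
    · simp [det_twoSigns hxy]
    · exact det_planeJ e
    · change (δ * planeJ e * δ).det = 1
      rw [Matrix.det_mul, Matrix.det_mul, hδd, det_planeJ]; norm_num
  · intro j; fin_cases j
    · simp [twoSigns_mul_self]
    · exact planeJ_fourth e
    · change δ * planeJ e * δ * (δ * planeJ e * δ) * (δ * planeJ e * δ * (δ * planeJ e * δ)) = 1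
      rw [hδsq]
      calc _ = δ * (planeJ e * planeJ e) * (δ * δ) * (planeJ e * planeJ e) * δ := by
            simp only [Matrix.mul_assoc]
        _ = δ * (planeJ e * planeJ e * (planeJ e * planeJ e)) * δ := by
            rw [hδ, Matrix.mul_one]; simp only [Matrix.mul_assoc]
        _ = 1 := by rw [planeJ_fourth, Matrix.mul_one, hδ]
  · intro t ht
    rcases extremePoints_polytope (by omega) (by positivity) ht with ⟨j, s, hs, rfl⟩ | ⟨-, h⟩
    · exact ⟨0, rotConj_single e hk j hs hxy⟩
    · obtain ⟨k', -, hk', h'⟩ := rotMat_half e k h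
      rw [h']
      rcases det_eq_of_orthogonal (hk' hk) with hd | hd
      · exact ⟨1, (hhalf k' (hk' hk)).1 hd⟩
      · exact ⟨2, (hhalf k' (hk' hk)).2 hd⟩
  · intro j; fin_cases j
    · exact ⟨_, extreme_single (by omega) (by positivity) (⟨0, by omega⟩ : Fin n) hpi,
        rotConj_single e hk _ hpi hxy⟩
    · obtain ⟨t, ht, k', hk', hd, h⟩ := hreach 1 (Or.inl rfl)
      refine ⟨t, extreme_half hn ht, ?_⟩
      rw [h]
      exact (hhalf k' hk').1 hd
    · obtain ⟨t, ht, k', hk', hd, h⟩ := hreach (-1) (Or.inr rfl)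
      refine ⟨t, extreme_half hn ht, ?_⟩
      rw [h]
      exact (hhalf k' hk').2 hd
  · intro i j g hg hgd h
    have h1 := relation_sq_eq_one hg h
    have hcδt : (cx δ)ᵀ * cx δ = 1 := by rw [← cx_transpose, hδt, hcδ]
    fin_cases i <;> fin_cases j
    · rfl
    · exact absurd (h1.1 (twoSigns_mul_self x y)) hsq
    · exact absurd (h1.1 (twoSigns_mul_self x y)) hsq'
    · exact absurd (h1.2 (twoSigns_mul_self x y)) hsq
    · rfl
    · exfalso
      change g * cx (planeJ e) = cx (δ * planeJ e * δ) * cj g at h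
      have h2 : (cx δ * g).det = 1 := by
        refine det_eq_one_of_relation (orthogonal_mul hcδt hg) ?_
        rw [map_mul cj, cj_cx, Matrix.mul_assoc, h, map_mul, map_mul]
        calc cx δ * (cx δ * cx (planeJ e) * cx δ * cj g) =
            (cx δ * cx δ) * cx (planeJ e) * cx δ * cj g := by simp only [Matrix.mul_assoc]
          _ = _ := by rw [hcδ, Matrix.one_mul, Matrix.mul_assoc]
      rw [Matrix.det_mul, hcδd, hgd] at h2
      norm_num at h2
    · exact absurd (h1.2 (twoSigns_mul_self x y)) hsq'
    · exfalso
      change g * cx (δ * planeJ e * δ) = cx (planeJ e) * cj g at h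
      have h2 : (g * cx δ).det = 1 := by
        refine det_eq_one_of_relation (orthogonal_mul hg hcδt) ?_
        rw [map_mul cj, cj_cx, ← Matrix.mul_assoc (cx _) (cj g), ← h, map_mul, map_mul]
        calc g * cx δ * cx (planeJ e) = g * (cx δ * cx (planeJ e)) * (cx δ * cx δ) := by
              rw [hcδ, Matrix.mul_one, Matrix.mul_assoc]
          _ = _ := by simp only [Matrix.mul_assoc]
      rw [Matrix.det_mul, hcδd, hgd] at h2
      norm_num at h2
    · rfl
  · intro j g; fin_cases j
    · exact hH₁ g
    · exact hH₂ g
    · exact hH₃ g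

end ComplexDecompositions

section Stabilizers

variable {m n : Type} [Fintype m] [DecidableEq m] [Fintype n] [DecidableEq n]

theorem asSubgroup_subgroupOf {M : Type} [Group M] {L H : Subgroup M} (h : H ≤ L) :
    asSubgroup (H.subgroupOf L) = H := Subgroup.map_subgroupOf_eq_of_le h

theorem coe_reindexGL {R : Type} [CommRing R] (f : m ≃ n) (g : GL m R) :
    (reindexGL f g).1 = g.1.submatrix f.symm f.symm := rfl

theorem mem_map_reindexGL {R : Type} [CommRing R] (f : m ≃ n) {L : Subgroup (GL m R)} {g : GL n R} :
    g ∈ L.map (reindexGL f) ↔ reindexGL f.symm g ∈ L := by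
  have h1 : ∀ g : GL m R, reindexGL f.symm (reindexGL f g) = g := by
    intro g; apply Units.ext
    rw [coe_reindexGL, coe_reindexGL, Matrix.submatrix_submatrix]
    simp
  have h2 : ∀ g : GL n R, reindexGL f (reindexGL f.symm g) = g := by
    intro g; apply Units.ext
    rw [coe_reindexGL, coe_reindexGL, Matrix.submatrix_submatrix]
    simp
  constructor
  · rintro ⟨a, ha, rfl⟩
    rwa [h1]
  · intro h
    exact ⟨_, h, h2 g⟩

theorem submatrix_relation_iff (f : m ≃ n) {g : Matrix n n ℂ} {z : Matrix n n ℂ} :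
    g.submatrix f f * z.submatrix f f = z.submatrix f f * cj (g.submatrix f f) ↔
      g * z = z * cj g := by
  have h1 : cj (g.submatrix f f) = (cj g).submatrix f f := rfl
  rw [h1, Matrix.submatrix_mul_equiv, Matrix.submatrix_mul_equiv]
  constructor
  · intro h
    have := congrArg (fun M => Matrix.submatrix M f.symm f.symm) h
    simpa using this
  · intro h
    rw [h]

theorem mem_SO_submatrix_iff (f : m ≃ n) {g : GL n ℂ} : reindexGL f.symm g ∈ SO m ℂ ↔ g ∈ SO n ℂ := by
  rw [mem_SO_iff, mem_SO_iff, coe_reindexGL, Equiv.symm_symm, Matrix.transpose_submatrix,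
    Matrix.submatrix_mul_equiv, Matrix.det_submatrix_equiv_self]
  refine and_congr_left fun _ => ⟨fun h => ?_, fun h => by rw [h]; simp⟩
  have := congrArg (fun M => Matrix.submatrix M f.symm f.symm) h
  simpa using this

theorem coe_inv_eq {R : Type} [CommRing R] {g : GL m R} {g' : Matrix m m R} (h : g.1 * g' = 1) :
    (g⁻¹).1 = g' :=
  left_inv_eq_right_inv (Units.inv_mul g) h

theorem mem_conjBy_iff {G : Type} [Group G] {r g : G} {H : Subgroup G} :
    g ∈ conjBy r H ↔ r⁻¹ * g * r ∈ H := by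
  rw [conjBy, Subgroup.mem_map_equiv]
  rfl

theorem twoSigns_submatrix {s N : ℕ} (h : 2 + s = N) :
    (cx (twoSigns (⟨0, by omega⟩ : Fin N) ⟨1, by omega⟩)).submatrix
      (finSumFinEquiv.trans (finCongr h)) (finSumFinEquiv.trans (finCongr h)) = -ID 2 s ℂ := by
  have h₁ : ∀ x : Fin 2, (finSumFinEquiv.trans (finCongr h)) (Sum.inl x) = ⟨0, by omega⟩ ∨
      (finSumFinEquiv.trans (finCongr h)) (Sum.inl x) = ⟨1, by omega⟩ := by
    intro x
    fin_cases x
    · exact Or.inl rfl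
    · exact Or.inr rfl
  have h₂ : ∀ x : Fin s, ¬((finSumFinEquiv.trans (finCongr h)) (Sum.inr x) = ⟨0, by omega⟩ ∨
      (finSumFinEquiv.trans (finCongr h)) (Sum.inr x) = ⟨1, by omega⟩) := by
    rintro x (hx | hx) <;> replace hx := congrArg Fin.val hx <;>
      simp at hx <;> omega
  change ((Matrix.diagonal _).map Complex.ofRealHom).submatrix _ _ = _
  rw [Matrix.diagonal_map (map_zero _), Matrix.submatrix_diagonal_equiv, ID,
    LieAlgebra.Orthogonal.indefiniteDiagonal, Matrix.diagonal_neg]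
  congr 1
  funext x
  rcases x with x | x
  · simp only [Function.comp_apply, if_pos (h₁ x)]
    simp
  · simp only [Function.comp_apply, if_neg (h₂ x)]
    simp

theorem mem_SOpqInC_iff {s N : ℕ} (h : 2 + s = N) {g : GL (Fin N) ℂ} :
    g ∈ SOpqInC 2 s N h ↔ g ∈ SO (Fin N) ℂ ∧
      g.1 * cx (twoSigns (⟨0, by omega⟩ : Fin N) ⟨1, by omega⟩) =
        cx (twoSigns (⟨0, by omega⟩ : Fin N) ⟨1, by omega⟩) * cj g.1 := by
  rw [SOpqInC, mem_map_reindexGL, ← mem_SO_submatrix_iff (finSumFinEquiv.trans (finCongr h)),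
    ← submatrix_relation_iff (finSumFinEquiv.trans (finCongr h)), twoSigns_submatrix h]
  set g' := reindexGL (finSumFinEquiv.trans (finCongr h)).symm g
  have hg' : g.1.submatrix (finSumFinEquiv.trans (finCongr h)) (finSumFinEquiv.trans (finCongr h)) =
    g'.1 := rfl
  rw [hg', mem_conjBy_iff, Matrix.mul_neg, Matrix.neg_mul, neg_inj]
  set E : GL (Fin 2 ⊕ Fin s) ℂ :=
    diagGL (Sum.elim (fun _ => 1) fun _ => Units.mk0 Complex.I Complex.I_ne_zero)
  have hE : E.1 = Matrix.fromBlocks 1 0 0 (Complex.I • 1) := by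
    change Matrix.diagonal _ = _
    ext (x | x) (y | y) <;> simp [Matrix.diagonal_apply, Matrix.one_apply]
  set E' : Matrix (Fin 2 ⊕ Fin s) (Fin 2 ⊕ Fin s) ℂ := Matrix.fromBlocks 1 0 0 (-Complex.I • 1)
  have hEE' : E.1 * E' = 1 := by
    rw [hE, Matrix.fromBlocks_multiply]
    simp [smul_smul]
  have hE'E : E' * E.1 = 1 := mul_eq_one_comm.1 hEE'
  have hEinv : (E⁻¹).1 = E' := coe_inv_eq hEE'
  have hEE : E.1 * E.1 = ID 2 s ℂ := by
    rw [hE, Matrix.fromBlocks_multiply, ID_eq]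
    simp [smul_smul]
  have hEt : E.1ᵀ = E.1 := by
    rw [hE, Matrix.fromBlocks_transpose]
    simp
  have hE't : E'ᵀ = E' := by
    rw [Matrix.fromBlocks_transpose]
    simp [E']
  have hcE : cj E.1 = E' := by
    rw [hE]
    ext (x | x) (y | y) <;> simp [E', Matrix.one_apply] <;> split_ifs <;> simp
  have hcE' : cj E' = E.1 := by rw [← hcE, cj_cj]
  have hEI : E.1 * ID 2 s ℂ = ID 2 s ℂ * E.1 := by rw [← hEE, Matrix.mul_assoc]
  have hII := ID_mul_self (p := 2) (q := s) ℂ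
  have hE'I : E' = ID 2 s ℂ * E.1 := by
    calc E' = E' * (ID 2 s ℂ * ID 2 s ℂ) := by rw [hII, Matrix.mul_one]
      _ = E' * E.1 * E.1 * ID 2 s ℂ := by rw [← hEE]; simp only [Matrix.mul_assoc]
      _ = _ := by rw [hE'E, Matrix.one_mul, hEI]
  have hIE' : ID 2 s ℂ * E' = E.1 := by
    rw [hE'I, ← Matrix.mul_assoc, hII, Matrix.one_mul]
  have hE'I' : E' * ID 2 s ℂ = E.1 := by
    rw [hE'I, Matrix.mul_assoc, hEI, ← Matrix.mul_assoc, hII, Matrix.one_mul]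
  have hcoe : (E⁻¹ * g' * E).1 = E' * g'.1 * E.1 := by
    rw [Units.val_mul, Units.val_mul, hEinv]
  constructor
  · rintro ⟨a, ha, hae⟩
    have h1 : cx a.1 = E' * g'.1 * E.1 := by rw [← hcoe, ← hae]; rfl
    have h2 : g'.1 = E.1 * cx a.1 * E' := by
      rw [h1]
      calc g'.1 = (E.1 * E') * g'.1 * (E.1 * E') := by rw [hEE', Matrix.one_mul, Matrix.mul_one]
        _ = _ := by simp only [Matrix.mul_assoc]
    obtain ⟨ha1, ha2⟩ := mem_SOpq_iff.1 ha
    have ha3 : (cx a.1)ᵀ * ID 2 s ℂ * cx a.1 = ID 2 s ℂ := by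
      rw [← cx_ID, ← cx_transpose, ← map_mul, ← map_mul, ha1]
    refine ⟨mem_SO_iff.2 ⟨?_, ?_⟩, ?_⟩
    · rw [h2, Matrix.transpose_mul, Matrix.transpose_mul, hEt, hE't]
      calc E' * ((cx a.1)ᵀ * E.1) * (E.1 * cx a.1 * E') =
          E' * ((cx a.1)ᵀ * (E.1 * E.1) * cx a.1) * E' := by simp only [Matrix.mul_assoc]
        _ = 1 := by rw [hEE, ha3, hE'I', hEE']
    · rw [h2, Matrix.det_mul, Matrix.det_mul, det_cx, ha2, mul_right_comm, ← Matrix.det_mul, hEE',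
        Matrix.det_one]; simp
    · rw [h2, map_mul, map_mul, cj_cx, hcE, hcE']
      simp only [Matrix.mul_assoc]
      rw [hE'I', ← Matrix.mul_assoc (ID 2 s ℂ), hIE']
  · rintro ⟨h1, h2⟩
    obtain ⟨h3, h4⟩ := mem_SO_iff.1 h1
    have h5 : cj g'.1 = ID 2 s ℂ * g'.1 * ID 2 s ℂ := by
      rw [Matrix.mul_assoc, h2, ← Matrix.mul_assoc, hII, Matrix.one_mul]
    have h6 : cj (E' * g'.1 * E.1) = E' * g'.1 * E.1 := by
      rw [map_mul, map_mul, hcE, hcE', h5]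
      calc E.1 * (ID 2 s ℂ * g'.1 * ID 2 s ℂ) * E' = (E.1 * ID 2 s ℂ) * g'.1 * (ID 2 s ℂ * E') := by
            simp only [Matrix.mul_assoc]
        _ = _ := by rw [hIE', hEI, ← hE'I]
    obtain ⟨Y, hY⟩ := exists_cx_eq h6
    have h7 : Yᵀ * ID 2 s ℝ * Y = ID 2 s ℝ := by
      apply cx_injective
      rw [map_mul, map_mul, cx_transpose, cx_ID, hY, Matrix.transpose_mul, Matrix.transpose_mul, hEt, hE't]
      calc E.1 * (g'.1ᵀ * E') * ID 2 s ℂ * (E' * g'.1 * E.1) =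
          E.1 * (g'.1ᵀ * ((E' * ID 2 s ℂ) * E') * g'.1) * E.1 := by simp only [Matrix.mul_assoc]
        _ = _ := by rw [hE'I', hEE', Matrix.mul_one, h3, Matrix.mul_one, hEE]
    have h8 : Y.det = 1 := by
      have := congrArg Matrix.det hY
      rw [det_cx, Matrix.det_mul, Matrix.det_mul, h4, mul_one, ← Matrix.det_mul, hE'E,
        Matrix.det_one] at this
      exact_mod_cast this
    obtain ⟨a, ha, haY⟩ := exists_mem_specialIsometry h7 h8
    refine ⟨a, ha, Units.ext ?_⟩
    rw [hcoe, ← hY, ← haY]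
    rfl

theorem mem_SOstarEven_iff {n : ℕ} {g : GL (Fin (2 * n)) ℂ} :
    g ∈ SOstarEven n ↔ g ∈ SO (Fin (2 * n)) ℂ ∧
      g.1 * cx (planeJ (evenEquiv n)) = cx (planeJ (evenEquiv n)) * cj g.1 := by
  have hJ := planeJ_evenEquiv n
  rw [SOstarEven]
  generalize finSumFinEquiv.trans (finCongr (two_mul n).symm) = f at hJ ⊢
  rw [mem_map_reindexGL, ← mem_SO_submatrix_iff f, ← submatrix_relation_iff f, hJ,
    Matrix.submatrix_submatrix, Equiv.symm_comp_self, Matrix.submatrix_id_id, SOstar,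
    Subgroup.mem_inf]
  refine and_congr_right fun h => ?_
  have hJ' : cj (Matrix.J (Fin n) ℂ) = Matrix.J (Fin n) ℂ := by
    ext (i | i) (j | j) <;> simp [Matrix.J, Matrix.one_apply, apply_ite]
  exact relation_J_iff (mem_SO_iff.1 h).1 hJ'

theorem coe_lastReflection {N : ℕ} (hN : 0 < N) :
    (lastReflection N ℂ).1 = cx (oneSign (⟨N - 1, by omega⟩ : Fin N)) := by
  change Matrix.diagonal _ = (Matrix.diagonal _).map Complex.ofRealHom
  rw [Matrix.diagonal_map (map_zero _)]
  congr 1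
  funext i
  have h1 : i.val + 1 = N ↔ i = ⟨N - 1, by omega⟩ := by
    rw [Fin.ext_iff]
    change _ ↔ i.val = N - 1
    omega
  change (((if i.val + 1 = N then -1 else 1 : ℂˣ)) : ℂ) = _
  by_cases h2 : i.val + 1 = N
  · rw [if_pos h2, if_pos (h1.1 h2)]
    simp
  · rw [if_neg h2, if_neg (mt h1.2 h2)]
    simp

theorem conj_relation_iff {δ w : Matrix m m ℝ} (hδ : δ * δ = 1) {g : Matrix m m ℂ} :
    cx δ * g * cx δ * cx w = cx w * cj (cx δ * g * cx δ) ↔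
      g * cx (δ * w * δ) = cx (δ * w * δ) * cj g := by
  have h : cx δ * cx δ = 1 := by rw [← map_mul, hδ, map_one]
  simp only [map_mul, cj_cx]
  constructor
  · intro h1
    calc g * (cx δ * cx w * cx δ) = cx δ * (cx δ * g * cx δ * cx w) * cx δ := by
          rw [← Matrix.one_mul (g * _), ← h]; simp only [Matrix.mul_assoc]
      _ = cx δ * cx w * cx δ * cj g * (cx δ * cx δ) := by
          rw [h1]; simp only [Matrix.mul_assoc]
      _ = _ := by rw [h, Matrix.mul_one]
  · intro h1
    calc cx δ * g * cx δ * cx w = cx δ * (g * (cx δ * cx w * cx δ)) * cx δ := by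
          rw [← Matrix.mul_one (_ * cx w), ← h]; simp only [Matrix.mul_assoc]
      _ = cx δ * cx δ * cx w * (cx δ * cj g * cx δ) := by
          rw [h1]; simp only [Matrix.mul_assoc]
      _ = _ := by rw [h, Matrix.one_mul]

theorem mem_conjBy_SOstarEven_iff {n : ℕ} (hn : 0 < 2 * n) {g : SO (Fin (2 * n)) ℂ} :
    (g : GL (Fin (2 * n)) ℂ) ∈ conjBy (lastReflection (2 * n) ℂ) (SOstarEven n) ↔
      (g : GL (Fin (2 * n)) ℂ).1 * cx (oneSign (⟨2 * n - 1, by omega⟩ : Fin (2 * n)) *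
        planeJ (evenEquiv n) * oneSign (⟨2 * n - 1, by omega⟩ : Fin (2 * n))) =
      cx (oneSign (⟨2 * n - 1, by omega⟩ : Fin (2 * n)) * planeJ (evenEquiv n) *
        oneSign (⟨2 * n - 1, by omega⟩ : Fin (2 * n))) * cj (g : GL (Fin (2 * n)) ℂ).1 := by
  set δ := oneSign (⟨2 * n - 1, by omega⟩ : Fin (2 * n)) with hδdef
  have hδ : δ * δ = 1 := oneSign_mul_self _
  have hc : (lastReflection (2 * n) ℂ).1 = cx δ := coe_lastReflection hn
  have hinv : ((lastReflection (2 * n) ℂ)⁻¹).1 = cx δ :=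
    coe_inv_eq (by rw [hc, ← map_mul, hδ, map_one])
  have hcoe : ((lastReflection (2 * n) ℂ)⁻¹ * (g : GL (Fin (2 * n)) ℂ) * lastReflection (2 * n) ℂ).1 =
      cx δ * (g : GL (Fin (2 * n)) ℂ).1 * cx δ := by
    rw [Units.val_mul, Units.val_mul, hinv, hc]
  rw [mem_conjBy_iff, mem_SOstarEven_iff, hcoe, conj_relation_iff hδ, and_iff_right]
  obtain ⟨h1, h2⟩ := mem_SO_iff.1 g.2
  have hδt : (cx δ)ᵀ = cx δ := by rw [← cx_transpose, hδdef, oneSign_transpose]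
  have hδc : cx δ * cx δ = 1 := by rw [← map_mul, hδ, map_one]
  rw [mem_SO_iff, hcoe, Matrix.transpose_mul, Matrix.transpose_mul, hδt]
  constructor
  · calc _ = cx δ * ((g : GL (Fin (2 * n)) ℂ).1ᵀ * (cx δ * cx δ) * (g : GL (Fin (2 * n)) ℂ).1) * cx δ := by
          simp only [Matrix.mul_assoc]
      _ = 1 := by rw [hδc, Matrix.mul_one, h1, Matrix.mul_one, hδc]
  · rw [Matrix.det_mul, Matrix.det_mul, h2, mul_one, ← Matrix.det_mul, hδc, Matrix.det_one]

theorem conjBy_SOstarEven_le {n : ℕ} (hn : 0 < 2 * n) :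
    conjBy (lastReflection (2 * n) ℂ) (SOstarEven n) ≤ SO (Fin (2 * n)) ℂ := by
  rintro _ ⟨a, ha, rfl⟩
  obtain ⟨h1, h2⟩ := mem_SO_iff.1 (mem_SOstarEven_iff.1 ha).1
  set δ := oneSign (⟨2 * n - 1, by omega⟩ : Fin (2 * n)) with hδdef
  have hδ : δ * δ = 1 := oneSign_mul_self _
  have hc : (lastReflection (2 * n) ℂ).1 = cx δ := coe_lastReflection hn
  have hδc : cx δ * cx δ = 1 := by rw [← map_mul, hδ, map_one]
  have hinv : ((lastReflection (2 * n) ℂ)⁻¹).1 = cx δ :=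
    coe_inv_eq (by rw [hc, ← map_mul, hδ, map_one])
  have hδt : (cx δ)ᵀ = cx δ := by rw [← cx_transpose, hδdef, oneSign_transpose]
  have hcoe : ((MulAut.conj (lastReflection (2 * n) ℂ)).toMonoidHom a).1 = cx δ * a.1 * cx δ := by
    change (lastReflection (2 * n) ℂ * a * (lastReflection (2 * n) ℂ)⁻¹).1 = _
    rw [Units.val_mul, Units.val_mul, hinv, hc]
  rw [mem_SO_iff, hcoe, Matrix.transpose_mul, Matrix.transpose_mul, hδt]
  constructor
  · calc _ = cx δ * (a.1ᵀ * (cx δ * cx δ) * a.1) * cx δ := by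
          simp only [Matrix.mul_assoc]
      _ = 1 := by rw [hδc, Matrix.mul_one, h1, Matrix.mul_one, hδc]
  · rw [Matrix.det_mul, Matrix.det_mul, h2, mul_one, ← Matrix.det_mul, hδc, Matrix.det_one]

end Stabilizers

section OddStabilizer

theorem planeJ_evenEquiv_mul_self (n : ℕ) :
    planeJ (evenEquiv n) * planeJ (evenEquiv n) = -1 := by
  rw [planeJ_mul_self, ← planar_one (evenEquiv n), planar_neg]
  congr 1
  · simp
  · simp
  · exact Subsingleton.elim _ _

theorem planeJ_oddEquiv (n : ℕ) :
    (cx (planeJ (oddEquiv n))).submatrix (finSumFinEquiv : Fin (2 * n) ⊕ Fin 1 ≃ Fin (2 * n + 1))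
      (finSumFinEquiv : Fin (2 * n) ⊕ Fin 1 ≃ Fin (2 * n + 1)) =
      Matrix.fromBlocks (cx (planeJ (evenEquiv n))) 0 0 1 := by
  have h₁ : ∀ x : Fin n ⊕ Fin n,
      (finSumFinEquiv : Fin (2 * n) ⊕ Fin 1 ≃ Fin (2 * n + 1)) (Sum.inl (evenEquiv n
        ((Equiv.sumAssoc _ _ _) (Sum.inl x)))) = oddEquiv n ((Equiv.sumAssoc _ _ _) (Sum.inl x)) := by
    intro x
    simp only [evenEquiv, oddEquiv, Equiv.trans_apply, Equiv.symm_apply_apply,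
      Equiv.sumEmpty_apply_inl, Equiv.sumCongr_apply, Sum.map_inl]
  have h₂ : ∀ x : Fin 1, (finSumFinEquiv : Fin (2 * n) ⊕ Fin 1 ≃ Fin (2 * n + 1)) (Sum.inr x) =
      oddEquiv n (Sum.inr (Sum.inr x)) := fun x => rfl
  have hsurj : ∀ x : Fin (2 * n), ∃ y : Fin n ⊕ Fin n,
      evenEquiv n ((Equiv.sumAssoc _ _ _) (Sum.inl y)) = x := by
    intro x
    obtain ⟨y, rfl⟩ := (evenEquiv n).surjective x
    rcases y with y | y | y
    · exact ⟨Sum.inl y, rfl⟩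
    · exact ⟨Sum.inr y, rfl⟩
    · exact y.elim0
  ext x y
  rcases x with x | x <;> rcases y with y | y
  · obtain ⟨x, rfl⟩ := hsurj x
    obtain ⟨y, rfl⟩ := hsurj y
    rw [Matrix.submatrix_apply, h₁, h₁, Matrix.fromBlocks_apply₁₁, cx_apply, cx_apply, planeJ,
      planeJ, planar, planar]
    simp only [Matrix.submatrix_apply, Equiv.symm_apply_apply]
    rcases x with x | x <;> rcases y with y | y <;> rfl
  · obtain ⟨x, rfl⟩ := hsurj x
    rw [Matrix.submatrix_apply, h₁, h₂, Matrix.fromBlocks_apply₁₂, cx_apply, planeJ, planar]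
    simp only [Matrix.submatrix_apply, Equiv.symm_apply_apply]
    rcases x with x | x <;> simp
  · obtain ⟨y, rfl⟩ := hsurj y
    rw [Matrix.submatrix_apply, h₁, h₂, Matrix.fromBlocks_apply₂₁, cx_apply, planeJ, planar]
    simp only [Matrix.submatrix_apply, Equiv.symm_apply_apply]
    rcases y with y | y <;> simp
  · rw [Matrix.submatrix_apply, h₂, h₂, Matrix.fromBlocks_apply₂₂, cx_apply, planeJ, planar]
    simp only [Matrix.submatrix_apply, Equiv.symm_apply_apply]
    obtain rfl := Subsingleton.elim x y
    simp

theorem mem_SOstarOdd_iff {n : ℕ} {g : GL (Fin (2 * n + 1)) ℂ} :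
    g ∈ SOstarOdd n ↔ g ∈ SO (Fin (2 * n + 1)) ℂ ∧
      g.1 * cx (planeJ (oddEquiv n)) = cx (planeJ (oddEquiv n)) * cj g.1 := by
  rw [SOstarOdd, mem_map_reindexGL,
    ← mem_SO_submatrix_iff (finSumFinEquiv : Fin (2 * n) ⊕ Fin 1 ≃ Fin (2 * n + 1)),
    ← submatrix_relation_iff (finSumFinEquiv : Fin (2 * n) ⊕ Fin 1 ≃ Fin (2 * n + 1)),
    planeJ_oddEquiv]
  set g' := reindexGL (finSumFinEquiv : Fin (2 * n) ⊕ Fin 1 ≃ Fin (2 * n + 1)).symm g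
  have hg' : g.1.submatrix (finSumFinEquiv : Fin (2 * n) ⊕ Fin 1 ≃ Fin (2 * n + 1)) (finSumFinEquiv
      : Fin (2 * n) ⊕ Fin 1 ≃ Fin (2 * n + 1)) =
    g'.1 := rfl
  rw [hg']
  set J := cx (planeJ (evenEquiv n)) with hJdef
  have hJJ : J * J = -1 := by rw [hJdef, ← map_mul, planeJ_evenEquiv_mul_self, map_neg, map_one]
  have hcJ : cj J = J := cj_cx _
  have hcblock : ∀ (A : Matrix (Fin (2 * n)) (Fin (2 * n)) ℂ) (D : Matrix (Fin 1) (Fin 1) ℂ),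
      cj (Matrix.fromBlocks A 0 0 D) = Matrix.fromBlocks (cj A) 0 0 (cj D) := by
    intro A D
    ext (x | x) (y | y) <;> simp
  constructor
  · rintro ⟨⟨a, d⟩, ⟨ha, hd⟩, h⟩
    have hd1 : d = 1 := hd
    subst hd1
    have h1 : g'.1 = Matrix.fromBlocks a.1 0 0 1 := by rw [← h]; rfl
    obtain ⟨ha1, ha2⟩ := mem_SOstarEven_iff.1 ha
    obtain ⟨ha3, ha4⟩ := mem_SO_iff.1 ha1
    rw [mem_SO_iff, h1]
    refine ⟨⟨?_, ?_⟩, ?_⟩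
    · rw [Matrix.fromBlocks_transpose, Matrix.fromBlocks_multiply]
      simp [ha3]
    · rw [Matrix.det_fromBlocks_zero₂₁, ha4, Matrix.det_one, one_mul]
    · have ha5 : a.1 * J = J * cj a.1 := ha2
      rw [hcblock, Matrix.fromBlocks_multiply, Matrix.fromBlocks_multiply, ha5]
      simp
  · rintro ⟨h1, h2⟩
    obtain ⟨h3, h4⟩ := mem_SO_iff.1 h1
    have h5 : cj (Matrix.fromBlocks J 0 0 (1 : Matrix (Fin 1) (Fin 1) ℂ)) =
        Matrix.fromBlocks J 0 0 1 := by rw [hcblock, hcJ, map_one]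
    have h6 : cj g'.1 * Matrix.fromBlocks J 0 0 (1 : Matrix (Fin 1) (Fin 1) ℂ) =
        Matrix.fromBlocks J 0 0 1 * g'.1 := by
      have := congrArg cj h2
      rwa [map_mul, map_mul, h5, cj_cj] at this
    have h7 : g'.1 * Matrix.fromBlocks (-1) 0 0 (1 : Matrix (Fin 1) (Fin 1) ℂ) =
        Matrix.fromBlocks (-1) 0 0 1 * g'.1 := by
      have : Matrix.fromBlocks (-1) 0 0 (1 : Matrix (Fin 1) (Fin 1) ℂ) =
          Matrix.fromBlocks J 0 0 1 * Matrix.fromBlocks J 0 0 1 := by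
        rw [Matrix.fromBlocks_multiply]; simp [hJJ]
      rw [this, ← Matrix.mul_assoc, h2, Matrix.mul_assoc, h6, Matrix.mul_assoc]
    obtain ⟨A, B, C, D, hABCD⟩ : ∃ A B C D, g'.1 = Matrix.fromBlocks A B C D :=
      ⟨_, _, _, _, (Matrix.fromBlocks_toBlocks _).symm⟩
    rw [hABCD, Matrix.fromBlocks_multiply, Matrix.fromBlocks_multiply, Matrix.fromBlocks_inj] at h7
    simp only [Matrix.mul_neg, Matrix.mul_one, Matrix.mul_zero, add_zero, zero_add, Matrix.neg_mul,
      Matrix.one_mul, Matrix.zero_mul] at h7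
    have hB : B = 0 := eq_zero_of_eq_neg h7.2.1
    have hC : C = 0 := eq_zero_of_eq_neg h7.2.2.1.symm
    subst hB hC
    rw [hABCD, hcblock, Matrix.fromBlocks_multiply, Matrix.fromBlocks_multiply, Matrix.fromBlocks_inj] at h2
    simp only [Matrix.mul_one, Matrix.mul_zero, add_zero, zero_add, 
      Matrix.one_mul, Matrix.zero_mul] at h2
    rw [hABCD, Matrix.fromBlocks_transpose, Matrix.fromBlocks_multiply, ← Matrix.fromBlocks_one,
      Matrix.fromBlocks_inj] at h3
    simp only [Matrix.mul_zero, add_zero, zero_add, Matrix.zero_mul, Matrix.transpose_zero] at h3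
    have hA : A.det = 1 := det_eq_one_of_relation h3.1 h2.1
    rw [hABCD, Matrix.det_fromBlocks_zero₂₁, hA, one_mul, Matrix.det_unique] at h4
    have hD : D = 1 := by
      ext i j
      rw [Subsingleton.elim i default, Subsingleton.elim j default, h4, Matrix.one_apply_eq]
    obtain ⟨a, ha, haA⟩ := exists_mem_specialIsometry (B := 1) (g := A)
      (by rw [Matrix.mul_one]; exact h3.1) hA
    refine ⟨(a, 1), ⟨mem_SOstarEven_iff.2 ⟨ha, ?_⟩, rfl⟩, Units.ext ?_⟩
    · change a.1 * _ = _ * cj a.1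
      rw [haA]
      exact h2.1
    · rw [hABCD, hD, ← haA]
      rfl

theorem not_isSymmetricSubgroup_SOstarOdd {n : ℕ} (hn : 2 ≤ n)
    {H : Subgroup (SO (Fin (2 * n + 1)) ℂ)}
    (hH : ∀ g : SO (Fin (2 * n + 1)) ℂ, g ∈ H ↔
      (g : GL (Fin (2 * n + 1)) ℂ).1 * cx (planeJ (oddEquiv n)) =
        cx (planeJ (oddEquiv n)) * cj (g : GL (Fin (2 * n + 1)) ℂ).1) :
    ¬ IsSymmetricSubgroup H := by
  set e := oddEquiv n with he
  set z := cx (planeJ e) with hz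
  let L : Matrix (Fin (2 * n + 1)) (Fin (2 * n + 1)) ℂ →ₗ[ℝ]
      Matrix (Fin (2 * n + 1)) (Fin (2 * n + 1)) ℂ :=
    { toFun := fun X => X * z - z * cj X
      map_add' := fun X Y => by rw [map_add, Matrix.add_mul, Matrix.mul_add]; abel
      map_smul' := fun c X => by
        rw [cj_smul_real, Matrix.smul_mul, Matrix.mul_smul, smul_sub]; rfl }
  have hL : ∀ X, X ∈ LinearMap.ker L ↔ X * z = z * cj X := fun X =>
    LinearMap.mem_ker.trans sub_eq_zero
  have h1 : Matrix.diagonal (fun _ : Fin (2 * n + 1) => (1 : ℂ)) = 1 := Matrix.diagonal_one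
  have hzz : z * cj z = Matrix.diagonal (fun i =>
      -(Sum.elim (fun _ => 1) (Sum.elim (fun _ => 1) fun _ => -1) (e.symm i) : ℂ)) := by
    rw [hz, cj_cx, ← map_mul, planeJ_mul_self, planar_eq_diagonal]
    change (Matrix.diagonal _).map Complex.ofRealHom = _
    rw [Matrix.diagonal_map (map_zero _)]
    congr 1
    funext i
    change ((Sum.elim (-1) (Sum.elim (-1) 1) (e.symm i) : ℝ) : ℂ) = _
    rcases e.symm i with j | j | j <;> simp
  let i₀ : Fin n := ⟨0, by omega⟩
  let i₁ : Fin n := ⟨1, by omega⟩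
  refine not_isSymmetricSubgroup_of_grading (β := fun _ => 1)
    (c := fun i => Sum.elim (fun _ => 1) (Sum.elim (fun _ => 1) fun _ => -1) (e.symm i))
    (fun _ => Or.inl rfl) ?_ ?_ ?_ H (LinearMap.ker L) ?_ ?_ (a := e (Sum.inl i₀))
    (a' := e (Sum.inl i₁)) (b := e (Sum.inr (Sum.inr 0))) ?_ ?_ ?_ ?_ ?_
  · intro i
    rcases e.symm i with j | j | j <;> simp
  · rw [h1]
    exact idComp_le _
  · rw [h1]
    exact inf_le_left
  · intro X hX
    refine LinearMap.mem_ker.2 (apply_eq_zero_of_exp L fun t => ?_)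
    obtain ⟨g, hg, hgt⟩ := hX t
    rw [← hgt]
    exact sub_eq_zero.2 ((hH g).1 hg)
  · intro X hX
    have h2 := (hL X).1 hX
    have h3 : cj X * cj z = cj z * X := by
      have := congrArg cj h2
      rwa [map_mul, map_mul, cj_cj] at this
    have h4 : X * (z * cj z) = z * cj z * X := by
      rw [← Matrix.mul_assoc, h2, Matrix.mul_assoc, h3, Matrix.mul_assoc]
    rw [hzz, ← Matrix.diagonal_neg, Matrix.mul_neg, Matrix.neg_mul, neg_inj] at h4
    exact h4.symm
  · simp [i₀, i₁]
  · simp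
  · simp
  · simp
  · intro s s' hs hmem
    rw [hL] at hmem
    have h2 := congrFun (congrFun hmem (e (Sum.inl i₀))) (e (Sum.inr (Sum.inl i₁)))
    have hz1 : ∀ i, z (e (Sum.inl i₀)) (e i) = if i = Sum.inr (Sum.inl i₀) then -1 else 0 := by
      intro i
      rw [hz, cx_apply, planeJ, planar_apply_inl]
      split_ifs <;> simp
    have hz2 : ∀ i, z (e i) (e (Sum.inr (Sum.inl i₁))) = if i = Sum.inl i₁ then -1 else 0 := by
      intro i
      rw [hz, cx_apply, planeJ, planar_apply_inr_inl]
      split_ifs <;> simp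
    rw [Matrix.mul_apply, Matrix.mul_apply, ← e.sum_comp, ← e.sum_comp] at h2
    simp only [hz1, hz2, mul_ite, ite_mul, mul_zero, zero_mul, Finset.sum_ite_eq',
      Finset.mem_univ, if_true, cj_apply, Matrix.add_apply, Matrix.single_apply] at h2
    simp [i₀, i₁] at h2
    exact hs h2

end OddStabilizer

section ComplexCases

theorem soC_even (n : ℕ) (hn : 3 ≤ n) (h : 2 + (2 * n - 2) = 2 * n) (𝔞 : Submodule ℝ (soC (2 * n)))
    (h𝔞 : IsMaximalAbelianIn (pC (2 * n)) 𝔞) :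
      ∃ H₁ H₂ H₃ : Subgroup (SO (Fin (2 * n)) ℂ),
        asSubgroup H₁ = SOpqInC 2 (2 * n - 2) (2 * n) h ∧
        asSubgroup H₂ = SOstarEven n ∧
        asSubgroup H₃ = conjBy (lastReflection (2 * n) ℂ) (SOstarEven n) ∧
        IsOrbitDecomposition (inclC (2 * n)) (boundaryC (2 * n) 𝔞) ![H₁, H₂, H₃] ∧
        (Odd n → IsOrbitDecomposition (inclC (2 * n)) (boundaryC (2 * n) 𝔞) ![H₁, H₂, H₂]) := by
  have h2n : 0 < 2 * n := by omega
  have hle : conjBy (lastReflection (2 * n) ℂ) (SOstarEven n) ≤ SO (Fin (2 * n)) ℂ :=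
    conjBy_SOstarEven_le h2n
  have hH₁ : ∀ g : SO (Fin (2 * n)) ℂ, g ∈ (SOpqInC 2 (2 * n - 2) (2 * n) h).subgroupOf
      (SO (Fin (2 * n)) ℂ) ↔ _ := fun g =>
    (mem_SOpqInC_iff h).trans (and_iff_right g.2)
  have hH₂ : ∀ g : SO (Fin (2 * n)) ℂ, g ∈ (SOstarEven n).subgroupOf
      (SO (Fin (2 * n)) ℂ) ↔ _ := fun g => mem_SOstarEven_iff.trans (and_iff_right g.2)
  have hxy : (⟨0, by omega⟩ : Fin (2 * n)) ≠ ⟨1, by omega⟩ := by simp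
  refine ⟨(SOpqInC 2 (2 * n - 2) (2 * n) h).subgroupOf _, (SOstarEven n).subgroupOf _,
    (conjBy (lastReflection (2 * n) ℂ) (SOstarEven n)).subgroupOf _,
    asSubgroup_subgroupOf fun g hg => ((mem_SOpqInC_iff h).1 hg).1,
    asSubgroup_subgroupOf fun g hg => (mem_SOstarEven_iff.1 hg).1,
    asSubgroup_subgroupOf hle, ?_, ?_⟩
  · exact isOrbitDecomposition_even hn h𝔞 hxy (oneSign_transpose _) (oneSign_mul_self _)
      (det_oneSign _) hH₁ hH₂ fun g => mem_conjBy_SOstarEven_iff h2n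
  · intro hodd
    set δ := planar (evenEquiv n) (1 : Fin n → ℝ) 0 0 (-1) 1 with hδdef
    have hδJ : δ * planeJ (evenEquiv n) * δ = -planeJ (evenEquiv n) := by
      rw [hδdef, planeJ, planar_mul, planar_mul, planar_neg]
      congr 1
      · simp
      · simp
      · simp
      · simp
      · exact Subsingleton.elim _ _
    refine isOrbitDecomposition_even (δ := δ) hn h𝔞 hxy ?_ ?_ ?_ hH₁ hH₂ fun g => ?_
    · rw [hδdef, planar_transpose]
    · rw [hδdef, planar_mul, ← planar_one (evenEquiv n)]
      congr 1 <;> simp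
    · rw [hδdef, det_planar_diagonal]
      simp [hodd.neg_one_pow]
    · rw [hδJ, map_neg, Matrix.mul_neg, Matrix.neg_mul, neg_inj]
      exact hH₂ g

theorem soC_odd (n : ℕ) (hn : 3 ≤ n) (h : 2 + (2 * n - 1) = 2 * n + 1)
    (𝔞 : Submodule ℝ (soC (2 * n + 1)))
    (h𝔞 : IsMaximalAbelianIn (pC (2 * n + 1)) 𝔞) :
      ∃ H₁ H₂ : Subgroup (SO (Fin (2 * n + 1)) ℂ),
        asSubgroup H₁ = SOpqInC 2 (2 * n - 1) (2 * n + 1) h ∧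
        asSubgroup H₂ = SOstarOdd n ∧
        IsOrbitDecomposition (inclC (2 * n + 1)) (boundaryC (2 * n + 1) 𝔞) ![H₁, H₂] ∧
        ¬ IsSymmetricSubgroup H₂ := by
  have hxy : (⟨0, by omega⟩ : Fin (2 * n + 1)) ≠ ⟨1, by omega⟩ := by simp
  have hH₂ : ∀ g : SO (Fin (2 * n + 1)) ℂ, g ∈ (SOstarOdd n).subgroupOf
      (SO (Fin (2 * n + 1)) ℂ) ↔ _ := fun g => mem_SOstarOdd_iff.trans (and_iff_right g.2)
  exact ⟨(SOpqInC 2 (2 * n - 1) (2 * n + 1) h).subgroupOf _, (SOstarOdd n).subgroupOf _,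
    asSubgroup_subgroupOf fun g hg => ((mem_SOpqInC_iff h).1 hg).1,
    asSubgroup_subgroupOf fun g hg => (mem_SOstarOdd_iff.1 hg).1,
    isOrbitDecomposition_odd hn h𝔞 hxy
      (fun g => (mem_SOpqInC_iff h).trans (and_iff_right g.2)) hH₂,
    not_isSymmetricSubgroup_SOstarOdd (by omega) hH₂⟩

theorem soC_five (𝔞 : Submodule ℝ (soC 5)) (h𝔞 : IsMaximalAbelianIn (pC 5) 𝔞) :
      ∃ H : Subgroup (SO (Fin 5) ℂ),
        asSubgroup H = SOpqInC 2 3 5 (by norm_num) ∧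
        IsOrbitDecomposition (inclC 5) (boundaryC 5 𝔞) ![H] := by
  have hxy : (⟨0, by omega⟩ : Fin 5) ≠ ⟨1, by omega⟩ := by simp
  exact ⟨(SOpqInC 2 3 5 (by norm_num)).subgroupOf _,
    asSubgroup_subgroupOf fun g hg => ((mem_SOpqInC_iff (by omega)).1 hg).1,
    isOrbitDecomposition_single (e := oddEquiv 2) le_rfl rfl h𝔞 hxy
      (fun g => (mem_SOpqInC_iff (by omega)).trans (and_iff_right g.2))⟩

end ComplexCases

section BlockGroups

variable {m n : Type} [Fintype m] [DecidableEq m] [Fintype n] [DecidableEq n]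

theorem coe_blockDiag {R : Type} [CommRing R] (a : GL m R) (d : GL n R) :
    (blockDiag (a, d)).1 = Matrix.fromBlocks a.1 0 0 d.1 := rfl

theorem continuous_blockDiag {𝕜 : Type} [RCLike 𝕜] :
    Continuous (blockDiag : GL m 𝕜 × GL n 𝕜 →* GL (m ⊕ n) 𝕜) :=
  continuous_into_GL ((continuous_GL_val.comp continuous_fst).matrix_fromBlocks continuous_const
    continuous_const (continuous_GL_val.comp continuous_snd))

theorem continuous_reindexGL {𝕜 : Type} [RCLike 𝕜] (f : m ≃ n) :
    Continuous (reindexGL f : GL m 𝕜 →* GL n 𝕜) :=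
  continuous_into_GL (continuous_GL_val.matrix_submatrix _ _)

theorem fromBlocks_orthogonal {V : Matrix m m ℝ} {W : Matrix n n ℝ} (hV : Vᵀ * V = 1)
    (hW : Wᵀ * W = 1) : (Matrix.fromBlocks V 0 0 W)ᵀ * Matrix.fromBlocks V 0 0 W = 1 := by
  rw [Matrix.fromBlocks_transpose, Matrix.fromBlocks_multiply]
  simp [hV, hW]

end BlockGroups

section RealPoints

variable {p q : ℕ}

theorem blockDiag_mem_SOe {a : GL (Fin p) ℝ} {d : GL (Fin q) ℝ} (ha : a ∈ SO (Fin p) ℝ)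
    (hd : d ∈ SO (Fin q) ℝ) : blockDiag (a, d) ∈ SOe p q := by
  refine le_idComp (isPreconnected_subgroup_map (isPreconnected_subgroup_prod
    (isPreconnected_SO_real p) (isPreconnected_SO_real q)) _ continuous_blockDiag) ?_
    (Subgroup.mem_map_of_mem blockDiag (Subgroup.mem_prod.2 ⟨ha, hd⟩))
  rintro _ ⟨⟨a, d⟩, ⟨ha, hd⟩, rfl⟩
  obtain ⟨ha1, ha2⟩ := mem_SO_iff.1 ha
  obtain ⟨hd1, hd2⟩ := mem_SO_iff.1 hd
  refine mem_SOpq_iff.2 ?_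
  rw [coe_blockDiag, ID_eq, Matrix.fromBlocks_transpose, Matrix.fromBlocks_multiply,
    Matrix.fromBlocks_multiply, Matrix.det_fromBlocks_zero₂₁]
  exact ⟨by simp [ha1, hd1], by rw [ha2, hd2, one_mul]⟩

theorem exists_SOe_fromBlocks {V : Matrix (Fin p) (Fin p) ℝ} {W : Matrix (Fin q) (Fin q) ℝ}
    (hV : Vᵀ * V = 1) (hVd : V.det = 1) (hW : Wᵀ * W = 1) (hWd : W.det = 1) :
    ∃ g : SOe p q, matR g = Matrix.fromBlocks V 0 0 W ∧ inclR p q g ∈ KCR p q := by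
  obtain ⟨a, ha, rfl⟩ := exists_mem_specialIsometry (B := 1) (by rwa [Matrix.mul_one]) hVd
  obtain ⟨d, hd, rfl⟩ := exists_mem_specialIsometry (B := 1) (by rwa [Matrix.mul_one]) hWd
  refine ⟨⟨_, blockDiag_mem_SOe ha hd⟩, rfl, (mem_KCR_iff _).2 ?_⟩
  rw [mat_inclR, ← cx_ID, ← map_mul, ← map_mul]
  refine ⟨congrArg cx ?_, ?_⟩
  · change Matrix.fromBlocks a.1 0 0 d.1 * _ = _ * Matrix.fromBlocks a.1 0 0 d.1
    rw [ID_eq, Matrix.fromBlocks_multiply, Matrix.fromBlocks_multiply]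
    simp
  · change (cx a.1).det = 1
    rw [det_cx, hVd, Complex.ofReal_one]

/-- Conjugacy of complex matrices under `SO(p) × SO(q)`. -/
def BlockConj (P Z : Matrix (Fin p ⊕ Fin q) (Fin p ⊕ Fin q) ℂ) : Prop :=
  ∃ (V : Matrix (Fin p) (Fin p) ℝ) (W : Matrix (Fin q) (Fin q) ℝ), Vᵀ * V = 1 ∧ V.det = 1 ∧
    Wᵀ * W = 1 ∧ W.det = 1 ∧
    P = cx (Matrix.fromBlocks V 0 0 W) * Z * cx (Matrix.fromBlocks V 0 0 W)ᵀ

theorem continuous_inclR (p q : ℕ) : Continuous (inclR p q) :=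
  Continuous.subtype_mk (continuous_into_GL
    (continuous_cx.comp (continuous_GL_val.comp continuous_subtype_val))) _

theorem mat_injective : Function.Injective (mat : SOpq p q ℂ → _) := fun _ _ h =>
  Subtype.ext (Units.ext h)

theorem exists_conj_of_blockConj {γ : SOpq p q ℂ} {Z : Matrix (Fin p ⊕ Fin q) (Fin p ⊕ Fin q) ℂ}
    (h : BlockConj (mat γ) Z) : ∃ g : SOe p q, inclR p q g ∈ KCR p q ∧
      mat ((inclR p q g)⁻¹ * γ * inclR p q g) = Z := by
  obtain ⟨V, W, hV, hVd, hW, hWd, h⟩ := h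
  obtain ⟨g, hg, hgK⟩ := exists_SOe_fromBlocks hV hVd hW hWd
  have h1 := fromBlocks_orthogonal hV hW
  have h2 : mat (inclR p q g)⁻¹ = cx (Matrix.fromBlocks V 0 0 W)ᵀ := by
    refine coe_inv_eq ?_
    change cx (matR g) * _ = 1
    rw [hg, ← map_mul, mul_eq_one_comm.1 h1, map_one]
  have h3 : cx (Matrix.fromBlocks V 0 0 W)ᵀ * cx (Matrix.fromBlocks V 0 0 W) = 1 := by
    rw [← map_mul, h1, map_one]
  refine ⟨g, hgK, ?_⟩
  rw [mat_mul, mat_mul, h2, mat_inclR, hg, h]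
  calc _ = cx (Matrix.fromBlocks V 0 0 W)ᵀ * cx (Matrix.fromBlocks V 0 0 W) * Z *
        (cx (Matrix.fromBlocks V 0 0 W)ᵀ * cx (Matrix.fromBlocks V 0 0 W)) := by
        simp only [Matrix.mul_assoc]
    _ = Z := by rw [h3, Matrix.one_mul, Matrix.mul_one]

/-- The hyperbolic rotations by imaginary angles in the coordinate planes. -/
noncomputable def hypMat (h : p ≤ q) (t : Fin p → ℝ) : Matrix (Fin p ⊕ Fin q) (Fin p ⊕ Fin q) ℂ :=
  planar (planeEquiv p q h) (fun j => (Real.cos (t j) : ℂ)) (fun j => Real.sin (t j) * Complex.I)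
    (fun j => Real.sin (t j) * Complex.I) (fun j => (Real.cos (t j) : ℂ)) 1

theorem mat_expIR (h : p ≤ q) {k : Matrix (Fin p ⊕ Fin q) (Fin p ⊕ Fin q) ℝ} (hk : kᵀ * k = 1)
    {X : soR p q} {t : Fin p → ℝ} (hX : (X : Matrix (Fin p ⊕ Fin q) (Fin p ⊕ Fin q) ℝ) =
      k * planar (planeEquiv p q h) 0 t t 0 0 * kᵀ) :
    mat (expIR p q X) = cx k * hypMat h t * cx kᵀ := by
  have hk' : cx k * cx kᵀ = 1 := by rw [← map_mul, mul_eq_one_comm.1 hk, map_one]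
  have h1 : Complex.I • (X : Matrix (Fin p ⊕ Fin q) (Fin p ⊕ Fin q) ℝ).map Complex.ofReal =
      cx k * planar (planeEquiv p q h) 0 (fun j => 1 * (Complex.I * (t j : ℂ)))
        (fun j => 1 * (Complex.I * (t j : ℂ))) 0 0 * (cx k)⁻¹ := by
    change Complex.I • cx (X : Matrix (Fin p ⊕ Fin q) (Fin p ⊕ Fin q) ℝ) = _
    rw [hX, map_mul, map_mul, Matrix.inv_eq_right_inv hk', ← Matrix.smul_mul, ← Matrix.mul_smul]
    congr 2
    change Complex.I • (planar _ _ _ _ _ _).map Complex.ofRealHom = _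
    rw [planar_map, planar_smul]
    congr 1 <;> funext i <;> simp
  change NormedSpace.exp (Complex.I • (X : Matrix (Fin p ⊕ Fin q) (Fin p ⊕ Fin q) ℝ).map
    Complex.ofReal) = _
  rw [h1, Matrix.exp_conj _ _ (IsUnit.of_mul_eq_one _ hk'), exp_planar _ (one_mul 1),
    Matrix.inv_eq_right_inv hk', hypMat]
  congr 2
  have hc : ∀ x : ℝ, Complex.cosh (Complex.I * x) = Real.cos x := fun x => by
    rw [mul_comm, Complex.cosh_mul_I, Complex.ofReal_cos]
  have hs : ∀ x : ℝ, Complex.sinh (Complex.I * x) = Real.sin x * Complex.I := fun x => by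
    rw [mul_comm, Complex.sinh_mul_I, Complex.ofReal_sin]
  congr 1 <;> funext i <;> simp only [hc, hs, one_mul]

/-- The stabilizer in `SO_e(p,q)` of the coset of `x`. -/
noncomputable def stabR (x : SOpq p q ℂ) : Subgroup (SOe p q) := (conjBy x (KCR p q)).comap (inclR p q)

theorem mem_stabR_iff {x : SOpq p q ℂ} {g : SOe p q} :
    g ∈ stabR x ↔ ((inclR p q g * x : SOpq p q ℂ) : SOpq p q ℂ ⧸ KCR p q) = x := by
  rw [stabR, Subgroup.mem_comap, mem_conjBy_iff, eq_comm, QuotientGroup.eq, mul_assoc]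

theorem mem_stabR_iff' {x : SOpq p q ℂ} {g : SOe p q} : g ∈ stabR x ↔
    cx (matR g) * invol x = invol x * cx (matR g) ∧
      (mat (x⁻¹ * inclR p q g * x)).toBlocks₁₁.det = 1 := by
  rw [mem_stabR_iff, eq_comm, KCR_eq_iff, ← invol_eq_iff, invol_smul, ← mul_assoc, mat_inclR]
  refine and_congr_left' ⟨fun h => ?_, fun h => ?_⟩
  · conv_rhs => rw [h]
    rw [Matrix.mul_assoc _ _ (cx _), ← mat_inclR, mat_inv_mul, Matrix.mul_one]
  · rw [h, Matrix.mul_assoc, ← mat_inclR, mat_mul_inv, Matrix.mul_one]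

/-- The orbits in the distinguished boundary, from representatives. -/
theorem exists_orbit_points (h : p ≤ q) {𝔞 : Submodule ℝ (soR p q)}
    {V : Matrix (Fin p) (Fin p) ℝ} {W : Matrix (Fin q) (Fin q) ℝ} (hV : Vᵀ * V = 1) (hW : Wᵀ * W = 1)
    (E : EigenFrame (ID p q ℝ) (soR p q) 𝔞 p (q - p))
    (hE : ∀ t, (E.φ t : Matrix (Fin p ⊕ Fin q) (Fin p ⊕ Fin q) ℝ) = Matrix.fromBlocks V 0 0 W *
        planar (planeEquiv p q h) 0 t t 0 0 * (Matrix.fromBlocks V 0 0 W)ᵀ)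
    {c : ℕ} (Z : Fin c → Matrix (Fin p ⊕ Fin q) (Fin p ⊕ Fin q) ℂ)
    (hA : ∀ t ∈ (polytope p (q - p) (Real.pi / 2)).extremePoints ℝ, ∃ j,
      BlockConj (cx (Matrix.fromBlocks V 0 0 W) * hypMat h t * cx (Matrix.fromBlocks V 0 0 W)ᵀ) (Z j))
    (hB : ∀ j, ∃ t ∈ (polytope p (q - p) (Real.pi / 2)).extremePoints ℝ,
      BlockConj (cx (Matrix.fromBlocks V 0 0 W) * hypMat h t * cx (Matrix.fromBlocks V 0 0 W)ᵀ) (Z j)) :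
    ∃ x : Fin c → SOpq p q ℂ, (∀ j, mat (x j) = Z j) ∧ ((∀ j, x j ∈ fourthR p q) →
      (∀ i j (g : SOe p q), mat (inclR p q g) * invol (x i) = invol (x j) * mat (inclR p q g) → i = j) →
      ∀ H : Fin c → Subgroup (SOe p q), (∀ j, H j = stabR (x j)) →
      IsOrbitDecomposition (inclR p q) (boundaryR p q 𝔞) H) := by
  have hk := fromBlocks_orthogonal hV hW
  have hmat := fun t => mat_expIR h hk (hE t)
  have hext := fun t => E.mem_extremeOmega_iff (B := ID p q ℝ) mem_soR_iff (ID_transpose ℝ)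
    (isUnit_ID ℝ) t
  have hx : ∀ j, ∃ x, mat x = Z j := by
    intro j
    obtain ⟨t, -, ht⟩ := hB j
    rw [← hmat] at ht
    obtain ⟨g, -, hg⟩ := exists_conj_of_blockConj ht
    exact ⟨_, hg⟩
  choose x hxZ using hx
  have hmem : ∀ t j, BlockConj (cx (Matrix.fromBlocks V 0 0 W) * hypMat h t *
      cx (Matrix.fromBlocks V 0 0 W)ᵀ) (Z j) → ∃ g : SOe p q, inclR p q g ∈ KCR p q ∧
      (inclR p q g)⁻¹ * expIR p q (E.φ t) * inclR p q g = x j := by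
    intro t j ht
    rw [← hmat] at ht
    obtain ⟨g, hg, hg'⟩ := exists_conj_of_blockConj ht
    exact ⟨g, hg, mat_injective (hg'.trans (hxZ j).symm)⟩
  refine ⟨x, hxZ, fun hfourth hdisj H hH => ?_⟩
  refine isOrbitDecomposition_of_points (continuous_inclR p q) (hasLocalSections_R p q)
    (fun g γ hγ => smul_mem_fourthR g hγ) ?_ x hfourth ?_ ?_ H ?_
  · intro γ hγ k hk
    change _ = _ at hγ ⊢
    rw [invol_mul_KCR γ hk]
    exact hγ
  · intro y
    constructor
    · rintro ⟨g, Y, hY, rfl⟩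
      obtain ⟨t, rfl⟩ := E.exists_of_mem Y
      obtain ⟨j, hj⟩ := hA t ((hext t).1 hY)
      obtain ⟨g', hg', hx⟩ := hmem t j hj
      refine ⟨j, g * g', ?_⟩
      rw [E.coe_equiv, ← hx, QuotientGroup.eq, map_mul]
      convert hg' using 1
      group
    · rintro ⟨j, g, rfl⟩
      obtain ⟨t, ht, hj⟩ := hB j
      obtain ⟨g', hg', hx⟩ := hmem t j hj
      refine ⟨g * g'⁻¹, E.equiv t, (hext t).2 ht, ?_⟩
      rw [E.coe_equiv, ← hx, QuotientGroup.eq, map_mul, map_inv]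
      convert inv_mem hg' using 1
      group
  · intro i j g hg
    refine hdisj i j g ?_
    rw [eq_comm, KCR_eq_iff, ← invol_eq_iff] at hg
    rw [hg.1, invol_smul, Matrix.mul_assoc, mat_inv_mul, Matrix.mul_one]
  · intro j g
    rw [hH, mem_stabR_iff]

end RealPoints

section SwapMatrices

variable {m : Type} [Fintype m] [DecidableEq m]

/-- The unitary matrix `u₁ ↦ i u₂`, `u₂ ↦ i u₁` (for orthonormal `u₁`, `u₂`), the identity on the
orthogonal complement. -/
noncomputable def swapVec (u₁ u₂ : m → ℝ) : Matrix m m ℂ :=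
  cx (1 - Matrix.vecMulVec u₁ u₁ - Matrix.vecMulVec u₂ u₂) +
    Complex.I • cx (Matrix.vecMulVec u₁ u₂ + Matrix.vecMulVec u₂ u₁)

theorem conj_vecMulVec (k : Matrix m m ℝ) (u w : m → ℝ) :
    k * Matrix.vecMulVec u w * kᵀ = Matrix.vecMulVec (k *ᵥ u) (k *ᵥ w) := by
  rw [Matrix.mul_vecMulVec, Matrix.vecMulVec_mul, Matrix.vecMul_transpose]

theorem swapVec_conj {k : Matrix m m ℝ} (hk : kᵀ * k = 1) (u₁ u₂ : m → ℝ) :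
    cx k * swapVec u₁ u₂ * cx kᵀ = swapVec (k *ᵥ u₁) (k *ᵥ u₂) := by
  rw [swapVec, Matrix.mul_add, Matrix.add_mul, Matrix.mul_smul, Matrix.smul_mul, ← map_mul, ← map_mul,
    ← map_mul, ← map_mul, swapVec]
  simp only [mul_sub, sub_mul, mul_add, add_mul, conj_vecMulVec, mul_one, mul_eq_one_comm.1 hk]

theorem swapVec_neg (u₁ u₂ : m → ℝ) : swapVec (-u₁) (-u₂) = swapVec u₁ u₂ := by
  simp only [swapVec, Matrix.neg_vecMulVec, Matrix.vecMulVec_neg, neg_neg]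

theorem swapVec_smul {η : ℝ} (hη : η = 1 ∨ η = -1) (u₁ u₂ : m → ℝ) :
    swapVec (η • u₁) (η • u₂) = swapVec u₁ u₂ := by
  rcases hη with rfl | rfl
  · rw [one_smul, one_smul]
  · rw [neg_one_smul, neg_one_smul, swapVec_neg]

theorem exists_orthogonal_mulVec (a : m) {v : m → ℝ} (hv : v ⬝ᵥ v = 1) :
    ∃ V : Matrix m m ℝ, Vᵀ * V = 1 ∧ V *ᵥ Pi.single a 1 = v := by
  obtain ⟨V, hV, h⟩ := exists_orthogonal_extension (ι := Fin 1) ⟨fun _ => a, fun _ _ _ => Subsingleton.elim _ _⟩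
    (v := fun _ => v) (fun i j => by rw [if_pos (Subsingleton.elim i j), hv])
  refine ⟨V, hV, ?_⟩
  rw [Matrix.mulVec_single_one]
  funext x
  exact h 0 x

theorem oneSign_mulVec_of_ne {a b : m} (h : a ≠ b) :
    oneSign b *ᵥ Pi.single a 1 = Pi.single a 1 := by
  rw [oneSign, Matrix.mulVec_single_one]
  funext x
  by_cases hx : x = a <;> simp [Matrix.col_apply, hx, h]

theorem oneSign_mulVec_self (a : m) : oneSign a *ᵥ Pi.single a 1 = -Pi.single a 1 := by
  rw [oneSign, Matrix.mulVec_single_one]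
  funext x
  by_cases hx : x = a <;> simp [Matrix.col_apply, hx]

theorem mul_oneSign {V : Matrix m m ℝ} (hV : Vᵀ * V = 1) (hd : V.det = -1) (b : m) :
    (V * oneSign b)ᵀ * (V * oneSign b) = 1 ∧ (V * oneSign b).det = 1 :=
  ⟨orthogonal_mul hV (by rw [oneSign_transpose, oneSign_mul_self]),
    by rw [Matrix.det_mul, hd, det_oneSign]; norm_num⟩

theorem exists_rotation_mulVec {a b : m} (hab : a ≠ b) {v : m → ℝ} (hv : v ⬝ᵥ v = 1) :
    ∃ V : Matrix m m ℝ, Vᵀ * V = 1 ∧ V.det = 1 ∧ V *ᵥ Pi.single a 1 = v := by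
  obtain ⟨V, hV, h⟩ := exists_orthogonal_mulVec a hv
  rcases det_eq_of_orthogonal hV with hd | hd
  · exact ⟨V, hV, hd, h⟩
  · refine ⟨_, (mul_oneSign hV hd b).1, (mul_oneSign hV hd b).2, ?_⟩
    rw [← Matrix.mulVec_mulVec, oneSign_mulVec_of_ne hab, h]

theorem exists_rotation_mulVec_sign (a : m) {v : m → ℝ} (hv : v ⬝ᵥ v = 1) :
    ∃ η : ℝ, (η = 1 ∨ η = -1) ∧ ∃ V : Matrix m m ℝ, Vᵀ * V = 1 ∧ V.det = 1 ∧
      V *ᵥ Pi.single a 1 = η • v := by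
  obtain ⟨V, hV, h⟩ := exists_orthogonal_mulVec a hv
  rcases det_eq_of_orthogonal hV with hd | hd
  · exact ⟨1, Or.inl rfl, V, hV, hd, by rw [h, one_smul]⟩
  · refine ⟨-1, Or.inr rfl, _, (mul_oneSign hV hd a).1, (mul_oneSign hV hd a).2, ?_⟩
    rw [← Matrix.mulVec_mulVec, oneSign_mulVec_self, Matrix.mulVec_neg, h, neg_one_smul]

theorem col_dotProduct_self {V : Matrix m m ℝ} (hV : Vᵀ * V = 1) (j : m) :
    (V *ᵥ Pi.single j 1) ⬝ᵥ (V *ᵥ Pi.single j 1) = 1 := by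
  rw [Matrix.dotProduct_mulVec, Matrix.vecMul_mulVec, hV]
  simp

end SwapMatrices

section NormalForms

variable {p q : ℕ}

theorem planar_planeEquiv_diagonal (h : p ≤ q) (a d : Fin p → ℝ) (f : Fin (q - p) → ℝ) :
    planar (planeEquiv p q h) a 0 0 d f = Matrix.fromBlocks (Matrix.diagonal a) 0 0
      (Matrix.diagonal (Sum.elim d f ∘ (finSumFinEquiv.trans (finCongr (Nat.add_sub_of_le h))).symm)) := by
  rw [planar_eq_diagonal, Matrix.fromBlocks_diagonal]
  congr 1
  funext x
  rcases x with x | x <;> rfl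

theorem hypMat_single (h : p ≤ q) (j : Fin p) {s : ℝ} (hs : |s| = Real.pi / 2) :
    ∃ ε : ℝ, (ε = 1 ∨ ε = -1) ∧ hypMat h (Pi.single j s) =
      swapVec (Pi.single (Sum.inl j) 1)
        (ε • Pi.single (planeEquiv p q h (Sum.inr (Sum.inl j))) 1) := by
  obtain ⟨hc, hs'⟩ : Real.cos s = 0 ∧ (Real.sin s = 1 ∨ Real.sin s = -1) := by
    rcases (abs_eq (by positivity)).1 hs with rfl | rfl <;> simp
  refine ⟨Real.sin s, hs', planar_ext (planeEquiv p q h) fun x y => ?_⟩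
  have he : ∀ j, (Sum.inl j : Fin p ⊕ Fin q) = planeEquiv p q h (Sum.inl j) := fun _ => rfl
  have hss : Real.sin s * Real.sin s = 1 := by rcases hs' with h | h <;> rw [h] <;> norm_num
  have hcos : ∀ i, Real.cos ((Pi.single j s : Fin p → ℝ) i) = if i = j then 0 else 1 := by
    intro i
    by_cases hi : i = j
    · subst hi; simp [hc]
    · simp [hi]
  have hsin : ∀ i, Real.sin ((Pi.single j s : Fin p → ℝ) i) = if i = j then Real.sin s else 0 := by
    intro i
    by_cases hi : i = j
    · subst hi; simp
    · simp [hi]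
  rw [he, hypMat]
  simp only [hcos, hsin]
  simp only [planar, Matrix.submatrix_apply, Equiv.symm_apply_apply, swapVec,
    Matrix.add_apply, Matrix.smul_apply, cx_apply, Matrix.sub_apply, Matrix.vecMulVec_apply,
    Matrix.one_apply, Pi.smul_apply, Pi.single_apply, EmbeddingLike.apply_eq_iff_eq, smul_eq_mul]
  rcases x with x | x | x <;> rcases y with y | y | y <;>
    simp [Matrix.diagonal_apply, Matrix.one_apply] <;>
    (try split_ifs) <;> simp_all <;> exact mul_comm _ _

/-- The representative of the first orbit. -/
noncomputable def swapRep (a : Fin p) (b : Fin q) : Matrix (Fin p ⊕ Fin q) (Fin p ⊕ Fin q) ℂ :=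
  swapVec (Pi.single (Sum.inl a) 1) (Pi.single (Sum.inr b) 1)

theorem fromBlocks_mulVec_inl (V : Matrix (Fin p) (Fin p) ℝ) (W : Matrix (Fin q) (Fin q) ℝ) (j : Fin p) :
    Matrix.fromBlocks V 0 0 W *ᵥ Pi.single (Sum.inl j) 1 = Sum.elim (V *ᵥ Pi.single j 1) (0 : Fin q → ℝ) := by
  simp only [Matrix.mulVec_single_one]
  funext x
  rcases x with x | x <;> simp

theorem fromBlocks_mulVec_inr (V : Matrix (Fin p) (Fin p) ℝ) (W : Matrix (Fin q) (Fin q) ℝ) (j : Fin q) :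
    Matrix.fromBlocks V 0 0 W *ᵥ Pi.single (Sum.inr j) 1 = Sum.elim (0 : Fin p → ℝ) (W *ᵥ Pi.single j 1) := by
  simp only [Matrix.mulVec_single_one]
  funext x
  rcases x with x | x <;> simp

theorem blockConj_single (h : p ≤ q) {V : Matrix (Fin p) (Fin p) ℝ} {W : Matrix (Fin q) (Fin q) ℝ}
    (hV : Vᵀ * V = 1) (hW : Wᵀ * W = 1) (hq : 2 ≤ q) (j : Fin p) {s : ℝ} (hs : |s| = Real.pi / 2)
    (a : Fin p) (b : Fin q) :
    BlockConj (cx (Matrix.fromBlocks V 0 0 W) * hypMat h (Pi.single j s) *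
      cx (Matrix.fromBlocks V 0 0 W)ᵀ) (swapRep a b) := by
  obtain ⟨ε, hε, hs⟩ := hypMat_single h j hs
  obtain ⟨b', hb'⟩ : ∃ b', planeEquiv p q h (Sum.inr (Sum.inl j)) = Sum.inr b' := ⟨_, rfl⟩
  have hε2 : ε * ε = 1 := by rcases hε with rfl | rfl <;> norm_num
  obtain ⟨η, hη, V', hV', hVd, hVa⟩ := exists_rotation_mulVec_sign a (col_dotProduct_self hV j)
  have hη2 : η * η = 1 := by rcases hη with rfl | rfl <;> norm_num
  have : Nontrivial (Fin q) := Fin.nontrivial_iff_two_le.2 hq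
  obtain ⟨c, hc⟩ := exists_ne b
  obtain ⟨W', hW', hWd, hWb⟩ := exists_rotation_mulVec hc.symm
    (v := η • ε • (W *ᵥ Pi.single b' 1)) (by
      rw [smul_dotProduct, smul_dotProduct, dotProduct_smul, dotProduct_smul, col_dotProduct_self hW]
      simp only [smul_eq_mul]
      linear_combination ε * ε * hη2 + hε2)
  refine ⟨V', W', hV', hVd, hW', hWd, ?_⟩
  rw [hs, swapVec_conj (fromBlocks_orthogonal hV hW), swapRep,
    swapVec_conj (fromBlocks_orthogonal hV' hW'), hb', Matrix.mulVec_smul, fromBlocks_mulVec_inl,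
    fromBlocks_mulVec_inr, fromBlocks_mulVec_inl, fromBlocks_mulVec_inr, hVa, hWb, ← swapVec_smul hη]
  congr 1 <;> funext x <;> rcases x with x | x <;> simp

/-- The representative of the second orbit. -/
noncomputable def halfRep (h : p ≤ q) : Matrix (Fin p ⊕ Fin q) (Fin p ⊕ Fin q) ℂ :=
  hypMat h fun _ => Real.pi / 2 / 2

theorem hypMat_sign (h : p ≤ q) {ε t : Fin p → ℝ} (hε : ∀ j, ε j = 1 ∨ ε j = -1) :
    hypMat h (ε * t) = cx (Matrix.fromBlocks (Matrix.diagonal ε) 0 0 1) * hypMat h t *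
      cx (Matrix.fromBlocks (Matrix.diagonal ε) 0 0 1)ᵀ := by
  have h1 : Matrix.fromBlocks (Matrix.diagonal ε) 0 0 (1 : Matrix (Fin q) (Fin q) ℝ) =
      planar (planeEquiv p q h) ε 0 0 1 1 := by
    rw [planar_planeEquiv_diagonal]
    congr 1
    rw [Sum.elim_one_one]
    exact Matrix.diagonal_one.symm
  rw [h1, planar_transpose]
  change _ = (planar _ _ _ _ _ _).map Complex.ofRealHom * _ * (planar _ _ _ _ _ _).map Complex.ofRealHom
  rw [planar_map, hypMat, hypMat, planar_mul, planar_mul]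
  congr 1 <;> funext i
  iterate 4 · rcases hε i with hi | hi <;> simp [hi]
  · simp

theorem hypMat_diagonal (h : p ≤ q) {δ : Fin p → ℝ} {f : Fin (q - p) → ℝ}
    (hδ : ∀ j, δ j = 1 ∨ δ j = -1) (hf : ∀ j, f j = 1 ∨ f j = -1) (t : Fin p → ℝ) :
    cx (planar (planeEquiv p q h) δ 0 0 δ f) * hypMat h t *
      cx (planar (planeEquiv p q h) δ 0 0 δ f)ᵀ = hypMat h t := by
  rw [planar_transpose]
  change (planar _ _ _ _ _ _).map Complex.ofRealHom * _ * (planar _ _ _ _ _ _).map Complex.ofRealHom = _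
  rw [planar_map, hypMat, planar_mul, planar_mul]
  congr 1 <;> funext i
  iterate 4 · rcases hδ i with hi | hi <;> simp [hi]
  · rcases hf i with hi | hi <;> simp [hi]

theorem exists_half_form (h : p ≤ q) (V : Matrix (Fin p) (Fin p) ℝ) (W : Matrix (Fin q) (Fin q) ℝ)
    {ε : Fin p → ℝ} (hε : ∀ j, ε j = 1 ∨ ε j = -1) :
    cx (Matrix.fromBlocks V 0 0 W) * hypMat h (fun j => ε j * (Real.pi / 2 / 2)) *
      cx (Matrix.fromBlocks V 0 0 W)ᵀ =
    cx (Matrix.fromBlocks (V * Matrix.diagonal ε) 0 0 W) * halfRep h *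
      cx (Matrix.fromBlocks (V * Matrix.diagonal ε) 0 0 W)ᵀ := by
  have h1 : Matrix.fromBlocks (V * Matrix.diagonal ε) 0 0 W =
      Matrix.fromBlocks V 0 0 W * Matrix.fromBlocks (Matrix.diagonal ε) 0 0 1 := by
    rw [Matrix.fromBlocks_multiply]; simp
  have h2 := hypMat_sign h (t := fun _ => Real.pi / 2 / 2) hε
  change hypMat h (fun j => ε j * (Real.pi / 2 / 2)) = _ at h2
  rw [h1, h2, halfRep, Matrix.transpose_mul, map_mul, map_mul]
  simp only [Matrix.mul_assoc]

theorem exists_sign_form {n : ℕ} {t : Fin n → ℝ} {c : ℝ} (hc : 0 < c) (ht : ∀ j, |t j| = c) :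
    ∃ ε : Fin n → ℝ, (∀ j, ε j = 1 ∨ ε j = -1) ∧ t = fun j => ε j * c := by
  have h1 : ∀ j, ∃ ε : ℝ, (ε = 1 ∨ ε = -1) ∧ t j = ε * c := by
    intro j
    rcases (abs_eq hc.le).1 (ht j) with h | h
    · exact ⟨1, Or.inl rfl, by rw [h, one_mul]⟩
    · exact ⟨-1, Or.inr rfl, by rw [h, neg_one_mul]⟩
  choose ε hε h using h1
  exact ⟨ε, hε, funext h⟩

theorem signs_orthogonal {m : Type} [Fintype m] [DecidableEq m] {ε : m → ℝ}
    (hε : ∀ j, ε j = 1 ∨ ε j = -1) : (Matrix.diagonal ε)ᵀ * Matrix.diagonal ε = 1 := by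
  rw [Matrix.diagonal_transpose, Matrix.diagonal_mul_diagonal, ← Matrix.diagonal_one]
  congr 1
  funext i
  rcases hε i with h | h <;> simp [h]

/-- Orthogonal changes of the frame that fix `halfRep`. -/
theorem exists_frame_change (h : p ≤ q) (V : Matrix (Fin p) (Fin p) ℝ) (W : Matrix (Fin q) (Fin q) ℝ)
    (hV : Vᵀ * V = 1) (hW : Wᵀ * W = 1) {δ : Fin p → ℝ} {f : Fin (q - p) → ℝ}
    (hδ : ∀ j, δ j = 1 ∨ δ j = -1) (hf : ∀ j, f j = 1 ∨ f j = -1) :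
    ∃ (V' : Matrix (Fin p) (Fin p) ℝ) (W' : Matrix (Fin q) (Fin q) ℝ), V'ᵀ * V' = 1 ∧ W'ᵀ * W' = 1 ∧
      V'.det = V.det * ∏ j, δ j ∧ W'.det = W.det * ((∏ j, δ j) * ∏ j, f j) ∧
      cx (Matrix.fromBlocks V 0 0 W) * halfRep h * cx (Matrix.fromBlocks V 0 0 W)ᵀ =
      cx (Matrix.fromBlocks V' 0 0 W') * halfRep h * cx (Matrix.fromBlocks V' 0 0 W')ᵀ := by
  have hg : ∀ j, (Sum.elim δ f ∘ (finSumFinEquiv.trans (finCongr (Nat.add_sub_of_le h))).symm) j = 1 ∨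
      (Sum.elim δ f ∘ (finSumFinEquiv.trans (finCongr (Nat.add_sub_of_le h))).symm) j = -1 := by
    intro j
    rw [Function.comp_apply]
    rcases (finSumFinEquiv.trans (finCongr (Nat.add_sub_of_le h))).symm j with x | x
    · exact hδ x
    · exact hf x
  refine ⟨V * Matrix.diagonal δ, W * Matrix.diagonal (Sum.elim δ f ∘
    (finSumFinEquiv.trans (finCongr (Nat.add_sub_of_le h))).symm),
    orthogonal_mul hV (signs_orthogonal hδ), orthogonal_mul hW (signs_orthogonal hg), ?_, ?_, ?_⟩
  · rw [Matrix.det_mul, Matrix.det_diagonal]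
  · rw [Matrix.det_mul, Matrix.det_diagonal]
    simp only [Function.comp_apply]
    rw [Equiv.prod_comp _ (Sum.elim δ f), Fintype.prod_sum_type]
    simp
  · have h1 : Matrix.fromBlocks (V * Matrix.diagonal δ) 0 0 (W * Matrix.diagonal (Sum.elim δ f ∘
        (finSumFinEquiv.trans (finCongr (Nat.add_sub_of_le h))).symm)) =
        Matrix.fromBlocks V 0 0 W * planar (planeEquiv p q h) δ 0 0 δ f := by
      rw [planar_planeEquiv_diagonal, Matrix.fromBlocks_multiply]; simp
    conv_lhs => rw [halfRep, ← hypMat_diagonal h hδ hf]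
    rw [h1, halfRep, Matrix.transpose_mul, map_mul, map_mul]
    simp only [Matrix.mul_assoc]

/-- One sign change. -/
theorem exists_signs {n : ℕ} (hn : 0 < n) {s : ℝ} (hs : s = 1 ∨ s = -1) :
    ∃ ε : Fin n → ℝ, (∀ j, ε j = 1 ∨ ε j = -1) ∧ ∏ j, ε j = s := by
  refine ⟨fun j => if j = ⟨0, hn⟩ then s else 1, fun j => ?_, by simp⟩
  dsimp only
  split_ifs
  · exact hs
  · exact Or.inl rfl

theorem blockConj_half_lt (hp : 0 < p) (h : p < q) {V : Matrix (Fin p) (Fin p) ℝ}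
    {W : Matrix (Fin q) (Fin q) ℝ} (hV : Vᵀ * V = 1) (hW : Wᵀ * W = 1) :
    BlockConj (cx (Matrix.fromBlocks V 0 0 W) * halfRep h.le * cx (Matrix.fromBlocks V 0 0 W)ᵀ)
      (halfRep h.le) := by
  have hVd := det_eq_of_orthogonal hV
  have hWd := det_eq_of_orthogonal hW
  obtain ⟨δ, hδ, hδd⟩ := exists_signs hp hVd
  obtain ⟨f, hf, hfd⟩ := exists_signs (Nat.sub_pos_of_lt h) (s := V.det * W.det) (by
    rcases hVd with h1 | h1 <;> rcases hWd with h2 | h2 <;> rw [h1, h2] <;> norm_num)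
  obtain ⟨V', W', hV', hW', hVd', hWd', he⟩ := exists_frame_change h.le V W hV hW hδ hf
  refine ⟨V', W', hV', ?_, hW', ?_, he⟩
  · rw [hVd', hδd]
    rcases hVd with h1 | h1 <;> rw [h1] <;> norm_num
  · rw [hWd', hδd, hfd]
    rcases hVd with h1 | h1 <;> rcases hWd with h2 | h2 <;> rw [h1, h2] <;> norm_num

theorem blockConj_half_eq {n : ℕ} (hn : 0 < n) {V W : Matrix (Fin n) (Fin n) ℝ}
    (hV : Vᵀ * V = 1) (hW : Wᵀ * W = 1) {δ : Matrix (Fin n) (Fin n) ℝ} (hδt : δᵀ = δ)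
    (hδ : δ * δ = 1) (hd : (V * δ).det * W.det = 1) :
    BlockConj (cx (Matrix.fromBlocks V 0 0 W) * halfRep (le_refl n) * cx (Matrix.fromBlocks V 0 0 W)ᵀ)
      (cx (Matrix.fromBlocks δ 0 0 1) * halfRep (le_refl n) * cx (Matrix.fromBlocks δ 0 0 1)) := by
  have hWd := det_eq_of_orthogonal hW
  obtain ⟨e, he, hed⟩ := exists_signs hn hWd
  obtain ⟨V', W', hV', hW', hVd', hWd', hVW⟩ := exists_frame_change (le_refl n) V W hV hW he (f := 1)
    (fun _ => Or.inl rfl)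
  have hδ' : δᵀ * δ = 1 := by rw [hδt, hδ]
  refine ⟨V' * δ, W', orthogonal_mul hV' hδ', ?_, hW', ?_, ?_⟩
  · rw [Matrix.det_mul] at hd
    rw [Matrix.det_mul, hVd', hed]
    linear_combination hd
  · rw [hWd', hed]
    rcases hWd with h2 | h2 <;> rw [h2] <;> simp
  · have h1 : Matrix.fromBlocks (V' * δ) 0 0 W' * Matrix.fromBlocks δ 0 0 1 =
        Matrix.fromBlocks V' 0 0 W' := by
      rw [Matrix.fromBlocks_multiply]; simp [Matrix.mul_assoc, hδ]
    have h2 : Matrix.fromBlocks δ 0 0 1 * (Matrix.fromBlocks (V' * δ) 0 0 W')ᵀ =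
        (Matrix.fromBlocks V' 0 0 W')ᵀ := by
      rw [← h1, Matrix.transpose_mul, Matrix.fromBlocks_transpose (A := δ)]
      simp [hδt]
    rw [hVW, ← h1, Matrix.transpose_mul, Matrix.fromBlocks_transpose (A := δ), map_mul, map_mul]
    simp only [Matrix.mul_assoc, hδt, Matrix.transpose_zero, Matrix.transpose_one]

end NormalForms

section Involutions

variable {p q : ℕ}

theorem invol_eq_mul_transpose (x : SOpq p q ℂ) : invol x = mat x * (mat x)ᵀ * ID p q ℂ := by
  rw [invol, mat_inv_eq, dag, Matrix.mul_assoc, ← Matrix.mul_assoc (ID p q ℂ),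
    ← Matrix.mul_assoc (ID p q ℂ), ID_mul_self, Matrix.one_mul, Matrix.mul_assoc]

/-- The involution at the first representative. -/
noncomputable def swapInvol (a : Fin p) (b : Fin q) : Matrix (Fin p ⊕ Fin q) (Fin p ⊕ Fin q) ℝ :=
  twoSigns (Sum.inl a) (Sum.inr b) * ID p q ℝ

theorem swapRep_mul_transpose (a : Fin p) (b : Fin q) :
    swapRep a b * (swapRep a b)ᵀ = cx (twoSigns (Sum.inl a) (Sum.inr b)) := by
  obtain ⟨A, hA⟩ : ∃ A : Matrix (Fin p ⊕ Fin q) (Fin p ⊕ Fin q) ℝ,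
    A = Matrix.single (Sum.inl a) (Sum.inl a) 1 + Matrix.single (Sum.inr b) (Sum.inr b) 1 := ⟨_, rfl⟩
  obtain ⟨J, hJ⟩ : ∃ J : Matrix (Fin p ⊕ Fin q) (Fin p ⊕ Fin q) ℝ,
    J = Matrix.single (Sum.inl a) (Sum.inr b) 1 + Matrix.single (Sum.inr b) (Sum.inl a) 1 := ⟨_, rfl⟩
  have hAA : A * A = A := by simp [hA, add_mul, mul_add]
  have hAJ : A * J = J := by simp [hA, hJ, add_mul, mul_add]
  have hJA : J * A = J := by simp [hA, hJ, mul_add, add_mul]; abel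
  have hJJ : J * J = A := by simp [hA, hJ, mul_add, add_mul, add_comm]
  have hAt : Aᵀ = A := by simp [hA]
  have hJt : Jᵀ = J := by simp [hJ, add_comm]
  have hvec : ∀ x y : Fin p ⊕ Fin q, Matrix.vecMulVec (Pi.single x (1 : ℝ)) (Pi.single y 1) =
      Matrix.single x y 1 := fun x y => by rw [Matrix.single_eq_single_vecMulVec_single]
  have h1 : swapRep a b = cx (1 - A) + Complex.I • cx J := by
    rw [swapRep, swapVec, sub_sub, hA, hJ]
    simp only [hvec]
  have h2 : twoSigns (Sum.inl a) (Sum.inr b) = 1 - A - A := by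
    rw [twoSigns, hA, ← Matrix.diagonal_single, ← Matrix.diagonal_single, ← Matrix.diagonal_one,
      Matrix.diagonal_add, Matrix.diagonal_sub, Matrix.diagonal_sub]
    congr 1
    funext z
    rcases z with z | z
    · by_cases hz : z = a <;> simp [hz]
    · by_cases hz : z = b <;> simp [hz]
  have h3 : (swapRep a b)ᵀ = swapRep a b := by
    rw [h1, Matrix.transpose_add, Matrix.transpose_smul, ← cx_transpose, ← cx_transpose, hJt,
      Matrix.transpose_sub, hAt, Matrix.transpose_one]
  rw [h3, h1, h2, add_mul, mul_add, mul_add, Matrix.smul_mul, Matrix.smul_mul, Matrix.mul_smul,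
    Matrix.mul_smul, smul_smul, Complex.I_mul_I, ← map_mul, ← map_mul, ← map_mul, ← map_mul, hJJ]
  simp only [mul_sub, sub_mul, hAA, hAJ, hJA, mul_one, one_mul, sub_self, map_zero,
    smul_zero, add_zero, zero_add, sub_zero, neg_one_smul, ← map_neg, ← map_add]
  rw [sub_eq_add_neg (1 - A)]

theorem invol_swapRep {x : SOpq p q ℂ} {a : Fin p} {b : Fin q} (hx : mat x = swapRep a b) :
    invol x = cx (swapInvol a b) := by
  rw [invol_eq_mul_transpose, hx, swapRep_mul_transpose, swapInvol, map_mul, cx_ID]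

/-- The involution at the second representative. -/
noncomputable def halfInvol (h : p ≤ q) : Matrix (Fin p ⊕ Fin q) (Fin p ⊕ Fin q) ℂ :=
  planar (planeEquiv p q h) 0 (fun _ => -Complex.I) (fun _ => Complex.I) 0 (-1)

theorem ID_eq_planar (h : p ≤ q) : ID p q ℂ = planar (planeEquiv p q h) 1 0 0 (-1) (-1) := by
  rw [planar_eq_diagonal, ID_eq_diagonal]
  congr 1
  funext x
  obtain ⟨x, rfl⟩ := (planeEquiv p q h).surjective x
  rcases x with x | x | x <;> simp [planeEquiv]

theorem invol_halfRep (h : p ≤ q) {x : SOpq p q ℂ} (hx : mat x = halfRep h) :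
    invol x = halfInvol h := by
  have hcc : (Real.cos (Real.pi / 2 / 2) : ℂ) * Real.cos (Real.pi / 2 / 2) = 1 / 2 := by
    rw [show Real.pi / 2 / 2 = Real.pi / 4 by ring, ← Complex.ofReal_mul, Real.cos_pi_div_four,
      div_mul_div_comm, Real.mul_self_sqrt (by norm_num)]
    norm_num
  have hss : (Real.sin (Real.pi / 2 / 2) : ℂ) * Real.sin (Real.pi / 2 / 2) = 1 / 2 := by
    rw [show Real.pi / 2 / 2 = Real.pi / 4 by ring, ← Complex.ofReal_mul, Real.sin_pi_div_four,
      div_mul_div_comm, Real.mul_self_sqrt (by norm_num)]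
    norm_num
  have hcs : (Real.cos (Real.pi / 2 / 2) : ℂ) * Real.sin (Real.pi / 2 / 2) = 1 / 2 := by
    rw [show Real.pi / 2 / 2 = Real.pi / 4 by ring, ← Complex.ofReal_mul, Real.sin_pi_div_four,
      Real.cos_pi_div_four, div_mul_div_comm, Real.mul_self_sqrt (by norm_num)]
    norm_num
  rw [invol_eq_mul_transpose, hx, halfRep, hypMat, ID_eq_planar h, planar_transpose, planar_mul,
    planar_mul, halfInvol]
  generalize (Real.cos (Real.pi / 2 / 2) : ℂ) = c at *
  generalize (Real.sin (Real.pi / 2 / 2) : ℂ) = s at *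
  have hI := Complex.I_mul_I
  congr 1 <;> funext i <;> simp
  · linear_combination hcc + s * s * hI - hss
  · linear_combination (-2 * Complex.I) * hcs
  · linear_combination (2 * Complex.I) * hcs
  · linear_combination -hcc - s * s * hI + hss

theorem cj_halfInvol (h : p ≤ q) : cj (halfInvol h) =
    planar (planeEquiv p q h) 0 (fun _ => Complex.I) (fun _ => -Complex.I) 0 (-1) := by
  change (planar _ _ _ _ _ _).map (starRingEnd ℂ) = _
  rw [planar_map]
  congr 1 <;> funext i <;> simp

theorem halfInvol_mul_cj (h : p ≤ q) : halfInvol h * cj (halfInvol h) =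
    planar (planeEquiv p q h) (-1) 0 0 (-1) 1 := by
  rw [cj_halfInvol, halfInvol, planar_mul]
  congr 1 <;> funext i <;> simp

theorem cj_halfInvol_ne (hp : 0 < p) (h : p ≤ q) : cj (halfInvol h) ≠ halfInvol h := by
  rw [cj_halfInvol]
  intro h1
  have h2 := congrFun (planar_injective _ h1).2.1 ⟨0, hp⟩
  exact Complex.I_ne_zero (self_eq_neg.1 h2)

theorem mem_fourthR_of_halfRep (h : p ≤ q) {x : SOpq p q ℂ} (hx : invol x = halfInvol h) :
    x ∈ fourthR p q := by
  change _ = _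
  rw [hx, halfInvol_mul_cj, planar_mul, ← planar_one (planeEquiv p q h)]
  congr 1 <;> simp

theorem mem_fourthR_of_real {x : SOpq p q ℂ} (hx : cj (invol x) = invol x) : x ∈ fourthR p q := by
  change _ = _
  rw [hx, invol_mul_self, Matrix.one_mul]

theorem relation_real {g : SOe p q} {z w : Matrix (Fin p ⊕ Fin q) (Fin p ⊕ Fin q) ℂ}
    (h : mat (inclR p q g) * z = w * mat (inclR p q g)) : cj z = z ↔ cj w = w := by
  have h1 := congrArg cj h
  rw [map_mul, map_mul, cj_mat_inclR] at h1
  constructor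
  · intro hz
    rw [hz, h] at h1
    calc cj w = cj w * mat (inclR p q g) * mat (inclR p q g)⁻¹ := by
          rw [Matrix.mul_assoc, mat_mul_inv, Matrix.mul_one]
      _ = w := by rw [← h1, Matrix.mul_assoc, mat_mul_inv, Matrix.mul_one]
  · intro hw
    rw [hw, ← h] at h1
    calc cj z = mat (inclR p q g)⁻¹ * (mat (inclR p q g) * cj z) := by
          rw [← Matrix.mul_assoc, mat_inv_mul, Matrix.one_mul]
      _ = z := by rw [h1, ← Matrix.mul_assoc, mat_inv_mul, Matrix.one_mul]

/-- Real matrices that commute with the complex structure have nonnegative determinant. -/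
theorem det_nonneg_of_commute {n : ℕ} {G : Matrix (Fin n ⊕ Fin n) (Fin n ⊕ Fin n) ℝ}
    (h : cx G * halfInvol (le_refl n) = halfInvol (le_refl n) * cx G) : 0 ≤ G.det := by
  have hz : halfInvol (le_refl n) = Matrix.fromBlocks 0 (-Complex.I • 1) (Complex.I • 1) 0 := by
    have hcast : ∀ (h : n + (n - n) = n) (x : Fin n), Fin.cast h (Fin.castAdd (n - n) x) = x :=
      fun _ _ => rfl
    have hN : IsEmpty (Fin (n - n)) := by rw [Nat.sub_self]; infer_instance
    refine planar_ext (planeEquiv n n le_rfl) fun x y => ?_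
    rcases x with x | x | x <;> rcases y with y | y | y <;> try exact hN.elim ‹_›
    all_goals
      rw [halfInvol, planar, Matrix.submatrix_apply, Equiv.symm_apply_apply, Equiv.symm_apply_apply]
      simp [planeEquiv, Matrix.diagonal_apply, Matrix.one_apply,
        apply_ite (fun x : ℂ => -x), hcast]
  obtain ⟨a, b, c, d, rfl⟩ : ∃ a b c d, G = Matrix.fromBlocks a b c d :=
    ⟨_, _, _, _, (Matrix.fromBlocks_toBlocks G).symm⟩
  have hcx : cx (Matrix.fromBlocks a b c d) = Matrix.fromBlocks (cx a) (cx b) (cx c) (cx d) :=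
    Matrix.fromBlocks_map _ _ _ _ _
  rw [hz, hcx, Matrix.fromBlocks_multiply, Matrix.fromBlocks_multiply, Matrix.fromBlocks_inj] at h
  obtain ⟨h1, h2, -, -⟩ := h
  simp only [Matrix.mul_zero, Matrix.zero_mul, zero_add, add_zero, Matrix.mul_smul, Matrix.smul_mul,
    Matrix.mul_one, Matrix.one_mul, neg_smul, Matrix.mul_neg, Matrix.neg_mul, neg_inj] at h1 h2
  rw [← smul_neg] at h1
  have hb : cx b = -cx c := smul_right_injective _ Complex.I_ne_zero h1
  have hd : cx a = cx d := smul_right_injective _ Complex.I_ne_zero h2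
  have hL : (Matrix.fromBlocks 1 (Complex.I • 1) 0 1 : Matrix (Fin n ⊕ Fin n) (Fin n ⊕ Fin n) ℂ) *
      cx (Matrix.fromBlocks a b c d) * Matrix.fromBlocks 1 (-Complex.I • 1) 0 1 =
      Matrix.fromBlocks (cx a + Complex.I • cx c) 0 (cx c) (cx a - Complex.I • cx c) := by
    rw [hcx, hb, ← hd, Matrix.fromBlocks_multiply, Matrix.fromBlocks_multiply]
    congr 1 <;> simp [smul_smul] <;> abel
  have hdet := congrArg Matrix.det hL
  rw [Matrix.det_mul, Matrix.det_mul, Matrix.det_fromBlocks_zero₂₁, Matrix.det_fromBlocks_zero₂₁,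
    Matrix.det_fromBlocks_zero₁₂, det_cx] at hdet
  have hconj : cx a - Complex.I • cx c = cj (cx a + Complex.I • cx c) := by
    ext i j
    simp [sub_eq_add_neg]
  rw [hconj, show (cj (cx a + Complex.I • cx c)).det = starRingEnd ℂ (cx a + Complex.I • cx c).det from
    (RingHom.map_det _ _).symm, Complex.mul_conj] at hdet
  simp only [Matrix.det_one, one_mul, mul_one] at hdet
  rw [Complex.ofReal_injective hdet]
  exact Complex.normSq_nonneg _

end Involutions

section RealDecompositions

variable {p q : ℕ}

theorem abs_pi_half : |Real.pi / 2| = Real.pi / 2 := abs_of_pos (by positivity)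

theorem abs_pi_quarter : |Real.pi / 2 / 2| = Real.pi / 2 / 2 := abs_of_pos (by positivity)

theorem exists_orbit_small (hp1 : 1 ≤ p) (hp2 : p ≤ 2) (h : p < q) {𝔞 : Submodule ℝ (soR p q)}
    (h𝔞 : IsMaximalAbelianIn (pR p q) 𝔞) (a : Fin p) (b : Fin q) :
    ∃ x : SOpq p q ℂ, mat x = swapRep a b ∧
      IsOrbitDecomposition (inclR p q) (boundaryR p q 𝔞) ![stabR x] := by
  obtain ⟨V, W, hV, hW, E, hE⟩ := exists_frame_R h.le h𝔞
  have hext : ∀ t ∈ (polytope p (q - p) (Real.pi / 2)).extremePoints ℝ, ∃ j s, |s| = Real.pi / 2 ∧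
      t = Pi.single j s := by
    intro t ht
    rcases hp1.lt_or_eq with hp | rfl
    · rcases extremePoints_polytope hp (by positivity) ht with h | ⟨h, -⟩
      · exact h
      · omega
    · refine ⟨0, t 0, (extremePoints_polytope_one (by omega)).1 ht, ?_⟩
      funext i
      rw [Subsingleton.elim i 0, Pi.single_eq_same]
  have hreach : ∃ j s, |s| = Real.pi / 2 ∧
      (Pi.single j s : Fin p → ℝ) ∈ (polytope p (q - p) (Real.pi / 2)).extremePoints ℝ := by
    rcases hp1.lt_or_eq with hp | rfl
    · exact ⟨a, _, abs_pi_half, extreme_single hp (by positivity) a abs_pi_half⟩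
    · refine ⟨0, _, abs_pi_half, (extremePoints_polytope_one (by omega)).2 ?_⟩
      rw [Pi.single_eq_same, abs_pi_half]
  obtain ⟨x, hx, hdec⟩ := exists_orbit_points h.le hV hW E hE ![swapRep a b]
    (fun t ht => by
      obtain ⟨j, s, hs, rfl⟩ := hext t ht
      exact ⟨0, blockConj_single h.le hV hW (by omega) j hs a b⟩)
    (fun i => by
      obtain ⟨j, s, hs, hj⟩ := hreach
      fin_cases i
      exact ⟨_, hj, blockConj_single h.le hV hW (by omega) j hs a b⟩)
  refine ⟨x 0, hx 0, hdec (fun j => ?_) (fun i j _ _ => Subsingleton.elim i j) _ fun j => ?_⟩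
  · refine mem_fourthR_of_real ?_
    rw [Subsingleton.elim j 0, invol_swapRep (hx 0), cj_cx]
  · fin_cases j; rfl

theorem exists_orbit_lt (hp : 3 ≤ p) (h : p < q) {𝔞 : Submodule ℝ (soR p q)}
    (h𝔞 : IsMaximalAbelianIn (pR p q) 𝔞) (a : Fin p) (b : Fin q) :
    ∃ x₁ x₂ : SOpq p q ℂ, mat x₁ = swapRep a b ∧ mat x₂ = halfRep h.le ∧
      IsOrbitDecomposition (inclR p q) (boundaryR p q 𝔞) ![stabR x₁, stabR x₂] := by
  obtain ⟨V, W, hV, hW, E, hE⟩ := exists_frame_R h.le h𝔞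
  have hhalf : ∀ t : Fin p → ℝ, (∀ j, |t j| = Real.pi / 2 / 2) →
      BlockConj (cx (Matrix.fromBlocks V 0 0 W) * hypMat h.le t * cx (Matrix.fromBlocks V 0 0 W)ᵀ)
        (halfRep h.le) := by
    intro t ht
    obtain ⟨ε, hε, rfl⟩ := exists_sign_form (by positivity) ht
    rw [exists_half_form h.le V W hε]
    exact blockConj_half_lt (by omega) h (orthogonal_mul hV (signs_orthogonal hε)) hW
  obtain ⟨x, hx, hdec⟩ := exists_orbit_points h.le hV hW E hE ![swapRep a b, halfRep h.le]
    (fun t ht => by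
      rcases extremePoints_polytope (by omega) (by positivity) ht with ⟨j, s, hs, rfl⟩ | ⟨-, ht⟩
      · exact ⟨0, blockConj_single h.le hV hW (by omega) j hs a b⟩
      · exact ⟨1, hhalf t ht⟩)
    (fun i => by
      fin_cases i
      · exact ⟨_, extreme_single (by omega) (by positivity) a abs_pi_half,
          blockConj_single h.le hV hW (by omega) a abs_pi_half a b⟩
      · exact ⟨_, extreme_half hp fun _ => abs_pi_quarter, hhalf _ fun _ => abs_pi_quarter⟩)
  have h0 : cj (invol (x 0)) = invol (x 0) := by rw [invol_swapRep (hx 0), cj_cx]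
  have h1 := invol_halfRep h.le (hx 1)
  have hne : cj (invol (x 1)) ≠ invol (x 1) := by
    rw [h1]
    exact cj_halfInvol_ne (by omega) h.le
  refine ⟨x 0, x 1, hx 0, hx 1, hdec (fun j => ?_) (fun i j g hg => ?_) _ fun j => ?_⟩
  · fin_cases j
    · exact mem_fourthR_of_real h0
    · exact mem_fourthR_of_halfRep h.le h1
  · have hr := relation_real hg
    fin_cases i <;> fin_cases j
    · rfl
    · exact absurd (hr.1 h0) hne
    · exact absurd (hr.2 h0) hne
    · rfl
  · fin_cases j <;> rfl

theorem invol_conj {D : Matrix (Fin p ⊕ Fin q) (Fin p ⊕ Fin q) ℝ} (hDt : Dᵀ = D) (hD : D * D = 1)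
    (hDI : D * ID p q ℝ = ID p q ℝ * D) {x y : SOpq p q ℂ} (hxy : mat y = cx D * mat x * cx D) :
    invol y = cx D * invol x * cx D := by
  have h1 : (cx D)ᵀ = cx D := by rw [← cx_transpose, hDt]
  have h2 : cx D * cx D = 1 := by rw [← map_mul, hD, map_one]
  have h3 : cx D * ID p q ℂ = ID p q ℂ * cx D := by rw [← cx_ID, ← map_mul, hDI, map_mul]
  rw [invol_eq_mul_transpose, invol_eq_mul_transpose, hxy, Matrix.transpose_mul, Matrix.transpose_mul, h1]
  calc _ = cx D * mat x * (cx D * cx D) * (mat x)ᵀ * (cx D * ID p q ℂ) := by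
        simp only [Matrix.mul_assoc]
    _ = _ := by rw [h2, h3, Matrix.mul_one]; simp only [Matrix.mul_assoc]

theorem fromBlocks_reflection {n : ℕ} {δ : Matrix (Fin n) (Fin n) ℝ} (hδt : δᵀ = δ) (hδ : δ * δ = 1) :
    (Matrix.fromBlocks δ 0 0 (1 : Matrix (Fin n) (Fin n) ℝ))ᵀ = Matrix.fromBlocks δ 0 0 1 ∧
    Matrix.fromBlocks δ 0 0 (1 : Matrix (Fin n) (Fin n) ℝ) * Matrix.fromBlocks δ 0 0 1 = 1 ∧
    Matrix.fromBlocks δ 0 0 (1 : Matrix (Fin n) (Fin n) ℝ) * ID n n ℝ =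
      ID n n ℝ * Matrix.fromBlocks δ 0 0 1 ∧
    (Matrix.fromBlocks δ 0 0 (1 : Matrix (Fin n) (Fin n) ℝ)).det = δ.det := by
  refine ⟨?_, ?_, ?_, ?_⟩
  · rw [Matrix.fromBlocks_transpose]; simp [hδt]
  · rw [Matrix.fromBlocks_multiply]; simp [hδ]
  · rw [ID_eq, Matrix.fromBlocks_multiply, Matrix.fromBlocks_multiply]; simp
  · rw [Matrix.det_fromBlocks_zero₂₁, Matrix.det_one, mul_one]

theorem not_relation_half {n : ℕ} {D : Matrix (Fin n ⊕ Fin n) (Fin n ⊕ Fin n) ℝ} (hD : D * D = 1)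
    (hDd : D.det = -1) (g : SOe n n) : ¬ mat (inclR n n g) * halfInvol (le_refl n) =
      cx D * halfInvol (le_refl n) * cx D * mat (inclR n n g) := by
  intro h
  have h2 : cx D * cx D = 1 := by rw [← map_mul, hD, map_one]
  have h1 := det_nonneg_of_commute (G := D * matR g) (by
    rw [map_mul, Matrix.mul_assoc, ← mat_inclR, h]
    calc _ = (cx D * cx D) * halfInvol (le_refl n) * (cx D * mat (inclR n n g)) := by
          simp only [Matrix.mul_assoc]
      _ = _ := by rw [h2, Matrix.one_mul])
  have h3 := (mem_SOpq_iff.1 (SOe_le n n g.2)).2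
  rw [Matrix.det_mul, hDd, h3] at h1
  norm_num at h1

theorem exists_orbit_eq {n : ℕ} (hn : 3 ≤ n) {𝔞 : Submodule ℝ (soR n n)}
    (h𝔞 : IsMaximalAbelianIn (pR n n) 𝔞) (a b : Fin n) {δ : Matrix (Fin n) (Fin n) ℝ} (hδt : δᵀ = δ)
    (hδ : δ * δ = 1) (hδd : δ.det = -1) :
    ∃ x₁ x₂ x₃ : SOpq n n ℂ, mat x₁ = swapRep a b ∧ mat x₂ = halfRep le_rfl ∧
      mat x₃ = cx (Matrix.fromBlocks δ 0 0 1) * halfRep le_rfl * cx (Matrix.fromBlocks δ 0 0 1) ∧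
      ∀ H₁ H₂ H₃, H₁ = stabR x₁ → H₂ = stabR x₂ → H₃ = stabR x₃ →
      IsOrbitDecomposition (inclR n n) (boundaryR n n 𝔞) ![H₁, H₂, H₃] := by
  obtain ⟨V, W, hV, hW, E, hE⟩ := exists_frame_R le_rfl h𝔞
  obtain ⟨hDt, hD, hDI, hDd⟩ := fromBlocks_reflection hδt hδ
  rw [hδd] at hDd
  have hone : cx (Matrix.fromBlocks 1 0 0 1) * halfRep (le_refl n) * cx (Matrix.fromBlocks 1 0 0 1) =
      halfRep (le_refl n) := by
    rw [Matrix.fromBlocks_one, map_one, Matrix.one_mul, Matrix.mul_one]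
  have hhalf : ∀ V' : Matrix (Fin n) (Fin n) ℝ, V'ᵀ * V' = 1 →
      (V'.det * W.det = 1 → BlockConj (cx (Matrix.fromBlocks V' 0 0 W) * halfRep (le_refl n) *
        cx (Matrix.fromBlocks V' 0 0 W)ᵀ) (halfRep le_rfl)) ∧
      (V'.det * W.det = -1 → BlockConj (cx (Matrix.fromBlocks V' 0 0 W) * halfRep (le_refl n) *
        cx (Matrix.fromBlocks V' 0 0 W)ᵀ)
        (cx (Matrix.fromBlocks δ 0 0 1) * halfRep le_rfl * cx (Matrix.fromBlocks δ 0 0 1))) := by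
    intro V' hV'
    refine ⟨fun h => ?_, fun h => blockConj_half_eq (by omega) hV' hW hδt hδ ?_⟩
    · have := blockConj_half_eq (by omega) hV' hW Matrix.transpose_one (mul_one 1)
        (by rwa [Matrix.mul_one])
      rwa [hone] at this
    · rw [Matrix.det_mul, hδd]
      linear_combination -h
  have hVd := det_eq_of_orthogonal hV
  have hWd := det_eq_of_orthogonal hW
  have hreach : ∀ s : ℝ, (s = 1 ∨ s = -1) → ∃ ε : Fin n → ℝ, (∀ j, ε j = 1 ∨ ε j = -1) ∧
      (V * Matrix.diagonal ε).det * W.det = s := by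
    intro s hs
    obtain ⟨ε, hε, hd⟩ := exists_signs (by omega : 0 < n) (s := V.det * W.det * s) (by
      rcases hVd with h | h <;> rcases hWd with h' | h' <;> rcases hs with h'' | h'' <;>
        rw [h, h', h''] <;> norm_num)
    refine ⟨ε, hε, ?_⟩
    rw [Matrix.det_mul, Matrix.det_diagonal, hd]
    rcases hVd with h | h <;> rcases hWd with h' | h' <;> rw [h, h'] <;> ring
  have hquarter : ∀ ε : Fin n → ℝ, (∀ j, ε j = 1 ∨ ε j = -1) →
      ∀ j, |ε j * (Real.pi / 2 / 2)| = Real.pi / 2 / 2 := by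
    intro ε hε j
    rcases hε j with h | h <;> simp [h, abs_pi_quarter]
  obtain ⟨x, hx, hdec⟩ := exists_orbit_points le_rfl hV hW E hE
    ![swapRep a b, halfRep le_rfl,
      cx (Matrix.fromBlocks δ 0 0 1) * halfRep le_rfl * cx (Matrix.fromBlocks δ 0 0 1)]
    (fun t ht => by
      rcases extremePoints_polytope (by omega) (by positivity) ht with ⟨j, s, hs, rfl⟩ | ⟨-, ht⟩
      · exact ⟨0, blockConj_single le_rfl hV hW (by omega) j hs a b⟩
      · obtain ⟨ε, hε, rfl⟩ := exists_sign_form (by positivity) ht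
        have hVε := orthogonal_mul hV (signs_orthogonal hε)
        rw [exists_half_form le_rfl V W hε]
        rcases det_eq_of_orthogonal hVε with h | h <;> rcases hWd with h' | h'
        · exact ⟨1, (hhalf _ hVε).1 (by rw [h, h']; norm_num)⟩
        · exact ⟨2, (hhalf _ hVε).2 (by rw [h, h']; norm_num)⟩
        · exact ⟨2, (hhalf _ hVε).2 (by rw [h, h']; norm_num)⟩
        · exact ⟨1, (hhalf _ hVε).1 (by rw [h, h']; norm_num)⟩)
    (fun i => by
      fin_cases i
      · exact ⟨_, extreme_single (by omega) (by positivity) a abs_pi_half,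
          blockConj_single le_rfl hV hW (by omega) a abs_pi_half a b⟩
      · obtain ⟨ε, hε, hd⟩ := hreach 1 (Or.inl rfl)
        refine ⟨_, extreme_half hn (hquarter ε hε), ?_⟩
        rw [exists_half_form le_rfl V W hε]
        exact (hhalf _ (orthogonal_mul hV (signs_orthogonal hε))).1 hd
      · obtain ⟨ε, hε, hd⟩ := hreach (-1) (Or.inr rfl)
        refine ⟨_, extreme_half hn (hquarter ε hε), ?_⟩
        rw [exists_half_form le_rfl V W hε]
        exact (hhalf _ (orthogonal_mul hV (signs_orthogonal hε))).2 hd)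
  have h0 : cj (invol (x 0)) = invol (x 0) := by rw [invol_swapRep (hx 0), cj_cx]
  have h1 := invol_halfRep le_rfl (hx 1)
  have h2 := invol_conj hDt hD hDI (x := x 1) (y := x 2) (by rw [hx 1]; exact hx 2)
  rw [h1] at h2
  have hcD : ∀ X, cx (Matrix.fromBlocks δ 0 0 (1 : Matrix (Fin n) (Fin n) ℝ)) * (cx
      (Matrix.fromBlocks δ 0 0 1) * X) = X := by
    intro X
    rw [← Matrix.mul_assoc, ← map_mul, hD, map_one, Matrix.one_mul]
  have hcD' : cx (Matrix.fromBlocks δ 0 0 (1 : Matrix (Fin n) (Fin n) ℝ)) * cx (Matrix.fromBlocks δ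
      0 0 1) = 1 := by
    rw [← map_mul, hD, map_one]
  have hne : cj (invol (x 1)) ≠ invol (x 1) := by
    rw [h1]
    exact cj_halfInvol_ne (by omega) le_rfl
  have hne' : cj (invol (x 2)) ≠ invol (x 2) := by
    rw [h2]
    intro h
    apply hne
    rw [h1]
    rw [map_mul, map_mul, cj_cx] at h
    have h' := congrArg (fun X => cx (Matrix.fromBlocks δ 0 0 (1 : Matrix (Fin n) (Fin n) ℝ)) * X *
        cx (Matrix.fromBlocks δ 0 0 1)) h
    simpa only [Matrix.mul_assoc, hcD, hcD', Matrix.mul_one] using h'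
  refine ⟨x 0, x 1, x 2, hx 0, hx 1, hx 2, fun H₁ H₂ H₃ hH₁ hH₂ hH₃ =>
    hdec (fun j => ?_) (fun i j g hg => ?_) _ fun j => ?_⟩
  · fin_cases j
    · exact mem_fourthR_of_real h0
    · exact mem_fourthR_of_halfRep le_rfl h1
    · have h4 := mem_fourthR_of_halfRep le_rfl h1
      change _ = _ at h4 ⊢
      rw [h1] at h4
      change invol (x 2) * cj (invol (x 2)) * (invol (x 2) * cj (invol (x 2))) = 1
      rw [h2, map_mul, map_mul, cj_cx]
      generalize halfInvol (le_refl n) = z at *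
      have h5 := congrArg (fun X => cx (Matrix.fromBlocks δ 0 0 (1 : Matrix (Fin n) (Fin n) ℝ)) * X
          * cx (Matrix.fromBlocks δ 0 0 1)) h4
      simpa only [Matrix.mul_assoc, hcD, hcD', Matrix.mul_one, Matrix.one_mul] using h5
  · have hr := relation_real hg
    fin_cases i <;> fin_cases j
    · rfl
    · exact absurd (hr.1 h0) hne
    · exact absurd (hr.1 h0) hne'
    · exact absurd (hr.2 h0) hne
    · rfl
    · exfalso
      change _ * invol (x 1) = invol (x 2) * _ at hg
      rw [h1, h2] at hg
      exact not_relation_half hD hDd g hg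
    · exact absurd (hr.2 h0) hne'
    · exfalso
      change _ * invol (x 2) = invol (x 1) * _ at hg
      rw [h1, h2] at hg
      refine not_relation_half hD hDd g⁻¹ ?_
      have h3 := congrArg (fun X => mat (inclR n n g)⁻¹ * X * mat (inclR n n g)⁻¹) hg
      rw [map_inv]
      calc mat (inclR n n g)⁻¹ * halfInvol (le_refl n) =
          mat (inclR n n g)⁻¹ * (halfInvol (le_refl n) * mat (inclR n n g)) * mat (inclR n n g)⁻¹ := by
            rw [Matrix.mul_assoc, Matrix.mul_assoc (halfInvol _), mat_mul_inv, Matrix.mul_one]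
        _ = _ := by
            rw [← h3, ← Matrix.mul_assoc, mat_inv_mul, Matrix.one_mul]
    · rfl
  · fin_cases j
    · exact hH₁
    · exact hH₂
    · exact hH₃

end RealDecompositions

section IdentityComponents

theorem idComp_mono {G : Type} [Group G] [TopologicalSpace G] [IsTopologicalGroup G]
    {L L' : Subgroup G} (h : L ≤ L') : idComp L ≤ idComp L' :=
  le_idComp (isPreconnected_idComp L) ((idComp_le L).trans h)

theorem idComp_prod {G G' : Type} [Group G] [TopologicalSpace G] [IsTopologicalGroup G]
    [Group G'] [TopologicalSpace G'] [IsTopologicalGroup G'] (A : Subgroup G) (B : Subgroup G') :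
    idComp (A.prod B) = (idComp A).prod (idComp B) := by
  refine le_antisymm (Subgroup.le_prod_iff.2 ⟨?_, ?_⟩) (le_idComp (isPreconnected_subgroup_prod
    (isPreconnected_idComp A) (isPreconnected_idComp B)) (Subgroup.prod_mono (idComp_le A) (idComp_le B)))
  · exact map_idComp_le _ continuous_fst (Subgroup.le_prod_iff.1 le_rfl).1
  · exact map_idComp_le _ continuous_snd (Subgroup.le_prod_iff.1 le_rfl).2

/-- Embeddings of topological groups preserve identity components. -/
theorem idComp_map {G G' : Type} [Group G] [TopologicalSpace G] [IsTopologicalGroup G]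
    [Group G'] [TopologicalSpace G'] [IsTopologicalGroup G'] {φ : G →* G'} (hφ : IsEmbedding φ)
    (L : Subgroup G) : idComp (L.map φ) = (idComp L).map φ := by
  refine le_antisymm (fun g hg => ?_) (map_idComp_le φ hφ.continuous le_rfl)
  have h1 : φ '' (φ ⁻¹' (idComp (L.map φ) : Set G')) = idComp (L.map φ) := by
    refine Set.image_preimage_eq_of_subset fun x hx => ?_
    obtain ⟨y, -, rfl⟩ := idComp_le _ hx
    exact ⟨y, rfl⟩
  have h2 : IsPreconnected (φ ⁻¹' (idComp (L.map φ) : Set G')) := by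
    rw [← hφ.isInducing.isPreconnected_image, h1]
    exact isPreconnected_idComp _
  have h3 : φ ⁻¹' (idComp (L.map φ) : Set G') ⊆ idComp L := by
    refine subset_idComp h2 ?_ fun x hx => ?_
    · rw [Set.mem_preimage, map_one]
      exact Subgroup.one_mem _
    · obtain ⟨y, hy, hyx⟩ := idComp_le _ hx
      rwa [← hφ.injective hyx]
  obtain ⟨x, -, rfl⟩ := idComp_le _ hg
  exact ⟨x, h3 hg, rfl⟩

variable {m n : Type} [Fintype m] [DecidableEq m] [Fintype n] [DecidableEq n]

theorem isEmbedding_reindexGL (f : m ≃ n) : IsEmbedding (reindexGL f : GL m ℝ →* GL n ℝ) := by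
  refine IsEmbedding.of_comp (continuous_reindexGL f)
    (g := fun g : GL n ℝ => g.1.submatrix f f) (continuous_GL_val.matrix_submatrix _ _) ?_
  convert (isOpenEmbedding_GL_val (m := m) (𝕜 := ℝ)).isEmbedding using 1
  funext g
  change (g.1.submatrix f.symm f.symm).submatrix f f = g.1
  simp

theorem isEmbedding_blockDiag :
    IsEmbedding (blockDiag : GL m ℝ × GL n ℝ →* GL (m ⊕ n) ℝ) := by
  refine IsEmbedding.of_comp continuous_blockDiag
    (g := fun g : GL (m ⊕ n) ℝ => (g.1.toBlocks₁₁, g.1.toBlocks₂₂))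
    ((continuous_GL_val.matrix_submatrix _ _).prodMk (continuous_GL_val.matrix_submatrix _ _)) ?_
  exact isOpenEmbedding_GL_val.isEmbedding.prodMap isOpenEmbedding_GL_val.isEmbedding

theorem coe_realifyGL (g : GL m ℂ) : (realifyGL g).1 = Matrix.fromBlocks (g.1.map Complex.re)
    (-g.1.map Complex.im) (g.1.map Complex.im) (g.1.map Complex.re) := rfl

theorem continuous_realifyGL : Continuous (realifyGL : GL m ℂ →* GL (m ⊕ m) ℝ) := by
  have hre := continuous_GL_val (m := m) (𝕜 := ℂ) |>.matrix_map Complex.continuous_re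
  have him := continuous_GL_val (m := m) (𝕜 := ℂ) |>.matrix_map Complex.continuous_im
  exact continuous_into_GL (hre.matrix_fromBlocks him.neg him hre)

theorem isEmbedding_realifyGL : IsEmbedding (realifyGL : GL m ℂ →* GL (m ⊕ m) ℝ) := by
  refine IsEmbedding.of_comp continuous_realifyGL
    (g := fun g : GL (m ⊕ m) ℝ => cx g.1.toBlocks₁₁ + Complex.I • cx g.1.toBlocks₂₁)
    (Continuous.add (continuous_cx.comp (continuous_GL_val.matrix_submatrix _ _)) ?_) ?_
  · have h : Continuous fun g : GL (m ⊕ m) ℝ => cx g.1.toBlocks₂₁ :=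
      continuous_cx.comp (continuous_GL_val.matrix_submatrix _ _)
    exact h.const_smul Complex.I
  convert (isOpenEmbedding_GL_val (m := m) (𝕜 := ℂ)).isEmbedding using 1
  funext g
  change cx (realifyGL g).1.toBlocks₁₁ + Complex.I • cx (realifyGL g).1.toBlocks₂₁ = g.1
  rw [coe_realifyGL, Matrix.toBlocks_fromBlocks₁₁, Matrix.toBlocks_fromBlocks₂₁]
  ext i j
  simp [mul_comm Complex.I, Complex.re_add_im]

end IdentityComponents

section Stabilizers

variable {p q : ℕ}

/-- The real isometries that commute with a complex matrix. -/
def commSub (z : Matrix (Fin p ⊕ Fin q) (Fin p ⊕ Fin q) ℂ) : Subgroup (GL (Fin p ⊕ Fin q) ℝ) where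
  carrier := {g | g ∈ bilinIsometry (ID p q ℝ) ∧ cx g.1 * z = z * cx g.1}
  one_mem' := ⟨Subgroup.one_mem _, by rw [Units.val_one, map_one, Matrix.one_mul, Matrix.mul_one]⟩
  mul_mem' := fun {a b} ha hb => ⟨Subgroup.mul_mem _ ha.1 hb.1, by
    rw [Units.val_mul, map_mul, Matrix.mul_assoc, hb.2, ← Matrix.mul_assoc, ha.2, Matrix.mul_assoc]⟩
  inv_mem' := fun {a} ha => ⟨Subgroup.inv_mem _ ha.1, by
    have h1 : cx a⁻¹.1 * cx a.1 = 1 := by rw [← map_mul, Units.inv_mul, map_one]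
    have h2 : cx a.1 * cx a⁻¹.1 = 1 := by rw [← map_mul, Units.mul_inv, map_one]
    calc cx a⁻¹.1 * z = cx a⁻¹.1 * (z * cx a.1) * cx a⁻¹.1 := by
          rw [Matrix.mul_assoc, Matrix.mul_assoc z, h2, Matrix.mul_one]
      _ = _ := by rw [← ha.2, ← Matrix.mul_assoc, h1, Matrix.one_mul]⟩

theorem block_orthogonal {N : Matrix (Fin p ⊕ Fin q) (Fin p ⊕ Fin q) ℂ}
    (h : Nᵀ * ID p q ℂ * N = ID p q ℂ) (hc : N * ID p q ℂ = ID p q ℂ * N) :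
    N.toBlocks₁₁ᵀ * N.toBlocks₁₁ = 1 := by
  obtain ⟨a, b, c, d, rfl⟩ : ∃ a b c d, N = Matrix.fromBlocks a b c d :=
    ⟨_, _, _, _, (Matrix.fromBlocks_toBlocks N).symm⟩
  rw [ID_eq, Matrix.fromBlocks_multiply, Matrix.fromBlocks_multiply, Matrix.fromBlocks_inj] at hc
  have h0 : c = 0 := eq_zero_of_eq_neg (by simpa using hc.2.2.1)
  rw [ID_eq, Matrix.fromBlocks_transpose, Matrix.fromBlocks_multiply, Matrix.fromBlocks_multiply,
    Matrix.fromBlocks_inj] at h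
  simpa [h0] using h.1

theorem asSubgroup_idComp_stabR (x : SOpq p q ℂ) :
    asSubgroup (idComp (stabR x)) = idComp (commSub (invol x)) := by
  rw [asSubgroup_idComp]
  apply le_antisymm
  · refine idComp_mono ?_
    rintro _ ⟨g, hg, rfl⟩
    exact ⟨(SOe_le p q g.2).1, (mem_stabR_iff'.1 hg).1⟩
  refine le_idComp (isPreconnected_idComp _) fun g hg => ?_
  have hSOe : idComp (commSub (invol x)) ≤ SOe p q := by
    have h : commSub (invol x) ≤ bilinIsometry (ID p q ℝ) := fun g hg => hg.1
    exact (idComp_mono h).trans (idComp_bilinIsometry (isUnit_ID ℝ)).le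
  refine ⟨⟨g, hSOe hg⟩, mem_stabR_iff'.2 ⟨(idComp_le _ hg).2, ?_⟩, rfl⟩
  let f : GL (Fin p ⊕ Fin q) ℝ → Matrix (Fin p) (Fin p) ℂ := fun g =>
    (mat x⁻¹ * cx g.1 * mat x).toBlocks₁₁
  have hf : Continuous f := ((continuous_const.matrix_mul
    (continuous_cx.comp continuous_GL_val)).matrix_mul continuous_const).matrix_submatrix _ _
  refine det_eq_one_of_isPreconnected (B := 1) isUnit_one
    ((isPreconnected_idComp (commSub (invol x))).image f hf.continuousOn) ⟨1, Subgroup.one_mem _, ?_⟩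
    ?_ ⟨g, hg, rfl⟩
  · change (mat x⁻¹ * cx 1 * mat x).toBlocks₁₁ = 1
    rw [map_one, Matrix.mul_one, mat_inv_mul]
    ext i j
    simp [Matrix.toBlocks₁₁, Matrix.one_apply]
  · rintro _ ⟨g, hg, rfl⟩
    have hγ := (mem_SOpq_iff.1 (x⁻¹ * inclR p q ⟨g, hSOe hg⟩ * x).2).1
    have h1 : mat (x⁻¹ * inclR p q ⟨g, hSOe hg⟩ * x) * ID p q ℂ =
        ID p q ℂ * mat (x⁻¹ * inclR p q ⟨g, hSOe hg⟩ * x) := by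
      rw [mul_assoc, ← invol_eq_iff, invol_smul]
      have h2 : mat (inclR p q ⟨g, hSOe hg⟩) * invol x = invol x * mat (inclR p q ⟨g, hSOe hg⟩) :=
        (idComp_le _ hg).2
      rw [h2, Matrix.mul_assoc, mat_mul_inv, Matrix.mul_one]
    rw [Matrix.mul_one]
    exact block_orthogonal hγ h1

theorem mem_map_blockDiag_iff {m n : Type} [Fintype m] [DecidableEq m] [Fintype n] [DecidableEq n]
    {A : Subgroup (GL m ℝ)} {B : Subgroup (GL n ℝ)} {g : GL (m ⊕ n) ℝ} :
    g ∈ (A.prod B).map blockDiag ↔ ∃ a ∈ A, ∃ d ∈ B, g.1 = Matrix.fromBlocks a.1 0 0 d.1 := by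
  constructor
  · rintro ⟨⟨a, d⟩, ⟨ha, hd⟩, rfl⟩
    exact ⟨a, ha, d, hd, rfl⟩
  · rintro ⟨a, ha, d, hd, h⟩
    exact ⟨(a, d), ⟨ha, hd⟩, Units.ext h.symm⟩

theorem exists_mem_bilinIsometry {m : Type} [Fintype m] [DecidableEq m] {𝕜 : Type} [RCLike 𝕜]
    {B a : Matrix m m 𝕜} (hB : IsUnit B) (h : aᵀ * B * a = B) : ∃ a' ∈ bilinIsometry B, a'.1 = a :=
  ⟨(isUnit_of_isometry hB h).unit, h, rfl⟩

theorem submatrix_eq_iff {m n R : Type} (f : m ≃ n) {X Y : Matrix n n R} :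
    X.submatrix f f = Y.submatrix f f ↔ X = Y := by
  refine ⟨fun h => ?_, fun h => by rw [h]⟩
  have := congrArg (fun M => Matrix.submatrix M f.symm f.symm) h
  simpa using this

/-- The relations defining `commSub`, after renumbering the basis. -/
theorem mem_commSub_submatrix_iff {m : Type} [Fintype m] [DecidableEq m] (f : m ≃ Fin p ⊕ Fin q)
    {z : Matrix (Fin p ⊕ Fin q) (Fin p ⊕ Fin q) ℂ} {g : GL (Fin p ⊕ Fin q) ℝ} :
    g ∈ commSub z ↔ (g.1.submatrix f f)ᵀ * (ID p q ℝ).submatrix f f * g.1.submatrix f f =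
      (ID p q ℝ).submatrix f f ∧
      cx (g.1.submatrix f f) * z.submatrix f f = z.submatrix f f * cx (g.1.submatrix f f) := by
  have h1 : cx (g.1.submatrix f f) = (cx g.1).submatrix f f := rfl
  rw [h1, Matrix.transpose_submatrix, Matrix.submatrix_mul_equiv, Matrix.submatrix_mul_equiv,
    Matrix.submatrix_mul_equiv, Matrix.submatrix_mul_equiv, submatrix_eq_iff, submatrix_eq_iff]
  rfl

end Stabilizers

section FirstStabilizer

variable {p q : ℕ} (hp : 1 ≤ p) (hq : 1 ≤ q)

theorem splitEquiv_apply₁ (i : Fin 1) :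
    splitEquiv p q hp hq (Sum.inl (Sum.inl i)) = Sum.inl ⟨0, hp⟩ := by
  refine congrArg Sum.inl (Fin.ext ?_)
  change i.1 = 0
  omega

theorem splitEquiv_apply₂ (j : Fin (q - 1)) :
    splitEquiv p q hp hq (Sum.inl (Sum.inr j)) = Sum.inr ⟨j.1, by omega⟩ := rfl

theorem splitEquiv_apply₃ (i : Fin 1) :
    splitEquiv p q hp hq (Sum.inr (Sum.inl i)) = Sum.inr ⟨q - 1, by omega⟩ := by
  refine congrArg Sum.inr (Fin.ext ?_)
  change q - 1 + i.1 = q - 1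
  omega

theorem splitEquiv_apply₄ (j : Fin (p - 1)) :
    splitEquiv p q hp hq (Sum.inr (Sum.inr j)) = Sum.inl ⟨1 + j.1, by omega⟩ := rfl

theorem ID_submatrix_split : (ID p q ℝ).submatrix (splitEquiv p q hp hq) (splitEquiv p q hp hq) =
    Matrix.fromBlocks (ID 1 (q - 1) ℝ) 0 0 (-ID 1 (p - 1) ℝ) := by
  simp only [ID_eq_diagonal]
  rw [Matrix.submatrix_diagonal_equiv, Matrix.diagonal_neg, Matrix.fromBlocks_diagonal]
  congr 1
  funext x
  rw [Function.comp_apply]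
  rcases x with (x | x) | (x | x)
  · rw [splitEquiv_apply₁]; simp
  · rw [splitEquiv_apply₂]; simp
  · rw [splitEquiv_apply₃]; simp
  · rw [splitEquiv_apply₄]; simp

theorem swapInvol_submatrix_split :
    (swapInvol (⟨0, hp⟩ : Fin p) (⟨q - 1, by omega⟩ : Fin q)).submatrix (splitEquiv p q hp hq)
      (splitEquiv p q hp hq) = Matrix.fromBlocks (-1) 0 0 1 := by
  rw [swapInvol, ID_eq_diagonal, twoSigns, Matrix.diagonal_mul_diagonal,
    Matrix.submatrix_diagonal_equiv, ← Matrix.diagonal_one, ← Matrix.diagonal_one, Matrix.diagonal_neg,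
    Matrix.fromBlocks_diagonal]
  congr 1
  funext x
  rw [Function.comp_apply]
  rcases x with (x | x) | (x | x)
  · rw [splitEquiv_apply₁]; simp
  · have h1 : x.1 ≠ q - 1 := by omega
    rw [splitEquiv_apply₂]; simp [h1]
  · rw [splitEquiv_apply₃]; simp
  · rw [splitEquiv_apply₄]; simp

theorem commSub_swapInvol :
    commSub (cx (swapInvol (⟨0, hp⟩ : Fin p) (⟨q - 1, by omega⟩ : Fin q))) =
      (((bilinIsometry (ID 1 (q - 1) ℝ)).prod (bilinIsometry (ID 1 (p - 1) ℝ))).map blockDiag).map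
        (reindexGL (splitEquiv p q hp hq)) := by
  ext g
  have hcx : ∀ X : Matrix (Fin p ⊕ Fin q) (Fin p ⊕ Fin q) ℝ, (cx X).submatrix (splitEquiv p q hp hq)
      (splitEquiv p q hp hq) = cx (X.submatrix (splitEquiv p q hp hq) (splitEquiv p q hp hq)) :=
    fun _ => rfl
  rw [mem_commSub_submatrix_iff (splitEquiv p q hp hq), mem_map_reindexGL, mem_map_blockDiag_iff,
    coe_reindexGL, Equiv.symm_symm, ID_submatrix_split, hcx, swapInvol_submatrix_split, ← map_mul,
    ← map_mul, cx_injective.eq_iff]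
  generalize g.1.submatrix (splitEquiv p q hp hq) (splitEquiv p q hp hq) = M
  constructor
  · rintro ⟨h1, h2⟩
    obtain ⟨a, b, c, d, rfl⟩ : ∃ a b c d, M = Matrix.fromBlocks a b c d :=
      ⟨_, _, _, _, (Matrix.fromBlocks_toBlocks M).symm⟩
    rw [Matrix.fromBlocks_multiply, Matrix.fromBlocks_multiply, Matrix.fromBlocks_inj] at h2
    have hb : b = 0 := eq_zero_of_eq_neg (by simpa using h2.2.1)
    have hc : c = 0 := eq_zero_of_eq_neg (by simpa using h2.2.2.1.symm)
    subst hb hc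
    rw [Matrix.fromBlocks_transpose, Matrix.fromBlocks_multiply, Matrix.fromBlocks_multiply,
      Matrix.fromBlocks_inj] at h1
    obtain ⟨a', ha', rfl⟩ := exists_mem_bilinIsometry (isUnit_ID ℝ) (by simpa using h1.1)
    obtain ⟨d', hd', rfl⟩ := exists_mem_bilinIsometry (isUnit_ID ℝ) (by simpa using h1.2.2.2)
    exact ⟨a', ha', d', hd', rfl⟩
  · rintro ⟨a, ha, d, hd, rfl⟩
    have ha' : a.1ᵀ * ID 1 (q - 1) ℝ * a.1 = ID 1 (q - 1) ℝ := ha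
    have hd' : d.1ᵀ * ID 1 (p - 1) ℝ * d.1 = ID 1 (p - 1) ℝ := hd
    rw [Matrix.fromBlocks_transpose, Matrix.fromBlocks_multiply, Matrix.fromBlocks_multiply,
      Matrix.fromBlocks_multiply, Matrix.fromBlocks_multiply]
    simp [ha', hd']

theorem idComp_commSub_swapInvol :
    idComp (commSub (cx (swapInvol (⟨0, hp⟩ : Fin p) (⟨q - 1, by omega⟩ : Fin q)))) =
      prodInSOpq p q hp hq (SOe 1 (q - 1)) (SOe 1 (p - 1)) := by
  rw [commSub_swapInvol, idComp_map (isEmbedding_reindexGL _), idComp_map isEmbedding_blockDiag,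
    idComp_prod, idComp_bilinIsometry (isUnit_ID ℝ), idComp_bilinIsometry (isUnit_ID ℝ)]
  rfl

end FirstStabilizer

section SecondStabilizer

variable {p q : ℕ}

/-- The coordinates of `SO(p,q)` grouped as for `SO(p,ℂ) × SO(q-p)`. -/
def pairEquiv (p q : ℕ) (h : p ≤ q) : (Fin p ⊕ Fin p) ⊕ Fin (q - p) ≃ Fin p ⊕ Fin q :=
  (Equiv.sumAssoc _ _ _).trans (planeEquiv p q h)

theorem ID_submatrix_pair (h : p ≤ q) : (ID p q ℝ).submatrix (pairEquiv p q h) (pairEquiv p q h) =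
    Matrix.fromBlocks (ID p p ℝ) 0 0 (-1) := by
  rw [ID_eq_diagonal, ID_eq_diagonal,
    Matrix.submatrix_diagonal_equiv, ← Matrix.diagonal_one, Matrix.diagonal_neg,
    Matrix.fromBlocks_diagonal]
  congr 1
  funext x
  rcases x with (x | x) | x <;> rfl

/-- The complex structure on `ℝᵖ ⊕ iℝᵖ`. -/
def pairJ (p : ℕ) : Matrix (Fin p ⊕ Fin p) (Fin p ⊕ Fin p) ℝ := Matrix.fromBlocks 0 (-1) 1 0

theorem halfInvol_submatrix_pair (h : p ≤ q) :
    (halfInvol h).submatrix (pairEquiv p q h) (pairEquiv p q h) =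
      Matrix.fromBlocks (Complex.I • cx (pairJ p)) 0 0 (-1) := by
  ext x y
  have h1 : ∀ z, (planeEquiv p q h).symm (pairEquiv p q h z) = Equiv.sumAssoc _ _ _ z := fun z => by
    rw [pairEquiv, Equiv.trans_apply, Equiv.symm_apply_apply]
  rw [halfInvol, planar, Matrix.submatrix_apply, Matrix.submatrix_apply, h1, h1]
  rcases x with (x | x) | x <;> rcases y with (y | y) | y <;>
    simp [pairJ, Matrix.diagonal_apply, Matrix.one_apply, apply_ite (fun x : ℂ => -x)] <;>
    split_ifs <;> simp

theorem complex_orthogonal_iff (x y : Matrix (Fin p) (Fin p) ℝ) :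
    (cx x + Complex.I • cx y)ᵀ * (cx x + Complex.I • cx y) = 1 ↔
      xᵀ * x - yᵀ * y = 1 ∧ xᵀ * y + yᵀ * x = 0 := by
  have h1 : (cx x + Complex.I • cx y)ᵀ * (cx x + Complex.I • cx y) =
      cx (xᵀ * x - yᵀ * y) + Complex.I • cx (xᵀ * y + yᵀ * x) := by
    rw [Matrix.transpose_add, Matrix.transpose_smul, ← cx_transpose, ← cx_transpose, add_mul, mul_add,
      mul_add, Matrix.smul_mul, Matrix.smul_mul, Matrix.mul_smul, Matrix.mul_smul, smul_smul,
      Complex.I_mul_I, neg_one_smul, map_sub, map_add, map_mul, map_mul, map_mul, map_mul, smul_add]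
    abel
  rw [h1]
  constructor
  · intro h
    constructor <;> ext i j
    · have := congrArg Complex.re (congrFun (congrFun h i) j)
      rw [Matrix.add_apply, Matrix.smul_apply, cx_apply, cx_apply] at this
      simpa [Matrix.one_apply, apply_ite Complex.re] using this
    · have := congrArg Complex.im (congrFun (congrFun h i) j)
      rw [Matrix.add_apply, Matrix.smul_apply, cx_apply, cx_apply] at this
      simpa [Matrix.one_apply, apply_ite Complex.im] using this
  · rintro ⟨h2, h3⟩
    rw [h2, h3, map_one, map_zero, smul_zero, add_zero]

/-- Real matrices that commute with the complex structure come from complex ones. -/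
theorem exists_realify {A : Matrix (Fin p ⊕ Fin p) (Fin p ⊕ Fin p) ℝ}
    (hA : A * pairJ p = pairJ p * A) (hI : Aᵀ * ID p p ℝ * A = ID p p ℝ) :
    ∃ a ∈ bilinIsometry (1 : Matrix (Fin p) (Fin p) ℂ), (realifyGL a).1 = A := by
  obtain ⟨a, b, c, d, rfl⟩ : ∃ a b c d, A = Matrix.fromBlocks a b c d :=
    ⟨_, _, _, _, (Matrix.fromBlocks_toBlocks A).symm⟩
  rw [pairJ, Matrix.fromBlocks_multiply, Matrix.fromBlocks_multiply, Matrix.fromBlocks_inj] at hA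
  obtain ⟨h1, h2, -, -⟩ := hA
  simp at h1 h2
  subst h1 h2
  rw [Matrix.fromBlocks_transpose, ID_eq, Matrix.fromBlocks_multiply, Matrix.fromBlocks_multiply,
    Matrix.fromBlocks_inj] at hI
  obtain ⟨h3, -, h4, -⟩ := hI
  simp at h3 h4
  obtain ⟨g, hg, hgM⟩ := exists_mem_bilinIsometry (B := 1) (a := cx a + Complex.I • cx c) isUnit_one (by
    rw [Matrix.mul_one]
    refine (complex_orthogonal_iff a c).2 ⟨?_, ?_⟩
    · rw [← h3, sub_eq_add_neg]
    · rw [← neg_add, neg_eq_zero, add_comm] at h4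
      exact h4)
  refine ⟨g, hg, ?_⟩
  rw [coe_realifyGL, hgM]
  congr 1 <;> ext i j <;> simp

theorem realify_mem {a : GL (Fin p) ℂ} (ha : a ∈ bilinIsometry (1 : Matrix (Fin p) (Fin p) ℂ)) :
    (realifyGL a).1 * pairJ p = pairJ p * (realifyGL a).1 ∧
      (realifyGL a).1ᵀ * ID p p ℝ * (realifyGL a).1 = ID p p ℝ := by
  have h : a.1ᵀ * 1 * a.1 = 1 := ha
  rw [Matrix.mul_one] at h
  have h1 : a.1 = cx (a.1.map Complex.re) + Complex.I • cx (a.1.map Complex.im) := by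
    ext i j
    simp [mul_comm Complex.I, Complex.re_add_im]
  rw [coe_realifyGL, pairJ, ID_eq, Matrix.fromBlocks_transpose, Matrix.fromBlocks_multiply,
    Matrix.fromBlocks_multiply, Matrix.fromBlocks_multiply, Matrix.fromBlocks_multiply]
  generalize a.1.map Complex.re = x at *
  generalize a.1.map Complex.im = y at *
  rw [h1] at h
  obtain ⟨h2, h3⟩ := (complex_orthogonal_iff x y).1 h
  constructor
  · simp
  · simp
    refine ⟨by rw [← h2, sub_eq_add_neg], ?_, ?_, by rw [← h2]; abel⟩
    · rw [← neg_add, h3, neg_zero]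
    · rw [← neg_add, add_comm, h3, neg_zero]

theorem commSub_halfInvol (h : p ≤ q) : commSub (halfInvol h) =
    ((((bilinIsometry (1 : Matrix (Fin p) (Fin p) ℂ)).map realifyGL).prod
      (bilinIsometry (1 : Matrix (Fin (q - p)) (Fin (q - p)) ℝ))).map blockDiag).map
        (reindexGL (pairEquiv p q h)) := by
  ext g
  rw [mem_commSub_submatrix_iff (pairEquiv p q h), mem_map_reindexGL, mem_map_blockDiag_iff,
    coe_reindexGL, Equiv.symm_symm, ID_submatrix_pair, halfInvol_submatrix_pair]
  generalize g.1.submatrix (pairEquiv p q h) (pairEquiv p q h) = M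
  have hcx : ∀ (a : Matrix (Fin p ⊕ Fin p) (Fin p ⊕ Fin p) ℝ) b c
      (d : Matrix (Fin (q - p)) (Fin (q - p)) ℝ), cx (Matrix.fromBlocks a b c d) =
      Matrix.fromBlocks (cx a) (b.map Complex.ofRealHom) (c.map Complex.ofRealHom) (cx d) := by
    intro a b c d
    exact Matrix.fromBlocks_map _ _ _ _ _
  constructor
  · rintro ⟨h1, h2⟩
    obtain ⟨a, b, c, d, rfl⟩ : ∃ a b c d, M = Matrix.fromBlocks a b c d :=
      ⟨_, _, _, _, (Matrix.fromBlocks_toBlocks M).symm⟩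
    rw [hcx, Matrix.fromBlocks_multiply, Matrix.fromBlocks_multiply, Matrix.fromBlocks_inj] at h2
    obtain ⟨h3, h4, h5, -⟩ := h2
    have hb : b = 0 := by
      ext i j
      have := congrArg Complex.re (congrFun (congrFun h4 i) j)
      simpa [Matrix.mul_apply] using this
    have hc : c = 0 := by
      ext i j
      have := congrArg Complex.re (congrFun (congrFun h5 i) j)
      simpa [Matrix.mul_apply] using this
    subst hb hc
    have ha : a * pairJ p = pairJ p * a := by
      apply cx_injective
      rw [map_mul, map_mul]
      exact smul_right_injective _ Complex.I_ne_zero (by simpa using h3)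
    rw [Matrix.fromBlocks_transpose, Matrix.fromBlocks_multiply, Matrix.fromBlocks_multiply,
      Matrix.fromBlocks_inj] at h1
    obtain ⟨a', ha', rfl⟩ := exists_realify ha (by simpa using h1.1)
    obtain ⟨d', hd', rfl⟩ := exists_mem_bilinIsometry (B := (1 : Matrix (Fin (q - p)) (Fin (q - p)) ℝ))
      isUnit_one (by simpa using h1.2.2.2)
    exact ⟨_, ⟨a', ha', rfl⟩, d', hd', rfl⟩
  · rintro ⟨_, ⟨a, ha, rfl⟩, d, hd, rfl⟩
    obtain ⟨h1, h2⟩ := realify_mem ha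
    have hd' : d.1ᵀ * 1 * d.1 = 1 := hd
    rw [Matrix.mul_one] at hd'
    have h3 := congrArg cx h1
    rw [map_mul, map_mul] at h3
    rw [hcx, Matrix.fromBlocks_transpose, Matrix.fromBlocks_multiply, Matrix.fromBlocks_multiply,
      Matrix.fromBlocks_multiply, Matrix.fromBlocks_multiply]
    simp [h2, hd']
    exact h3

theorem idComp_bilinIsometry_one_complex (n : ℕ) :
    idComp (bilinIsometry (1 : Matrix (Fin n) (Fin n) ℂ)) = SO (Fin n) ℂ := by
  rw [idComp_bilinIsometry isUnit_one]
  exact le_antisymm (idComp_le _) (le_idComp (isPreconnected_SO_complex n) le_rfl)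

theorem idComp_bilinIsometry_one_real (n : ℕ) :
    idComp (bilinIsometry (1 : Matrix (Fin n) (Fin n) ℝ)) = SO (Fin n) ℝ := by
  rw [idComp_bilinIsometry isUnit_one]
  exact le_antisymm (idComp_le _) (le_idComp (isPreconnected_SO_real n) le_rfl)

theorem idComp_commSub_halfInvol (h : p ≤ q) : idComp (commSub (halfInvol h)) = SOCprodSO p q h := by
  rw [commSub_halfInvol, idComp_map (isEmbedding_reindexGL _), idComp_map isEmbedding_blockDiag,
    idComp_prod, idComp_map isEmbedding_realifyGL, idComp_bilinIsometry_one_complex,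
    idComp_bilinIsometry_one_real]
  rfl

theorem SOCprodSO_self (n : ℕ) : SOCprodSO n n le_rfl = (SO (Fin n) ℂ).map realifyGL := by
  have key : ∀ (a : GL (Fin n) ℂ) (d : GL (Fin (n - n)) ℝ),
      reindexGL (pairEquiv n n le_rfl) (blockDiag (realifyGL a, d)) = realifyGL a := by
    intro a d
    apply Units.ext
    ext x y
    have he : ∀ x, pairEquiv n n le_rfl (Sum.inl x) = x := by
      intro x
      rcases x with x | x <;> rfl
    have he' : ∀ x, (pairEquiv n n le_rfl).symm x = Sum.inl x := fun x => by
      rw [Equiv.symm_apply_eq, he]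
    rw [coe_reindexGL, coe_blockDiag, Matrix.submatrix_apply, he', he', Matrix.fromBlocks_apply₁₁]
  ext g
  constructor
  · rintro ⟨_, ⟨⟨_, d⟩, ⟨⟨a, ha, rfl⟩, -⟩, rfl⟩, rfl⟩
    exact ⟨a, ha, (key a d).symm⟩
  · rintro ⟨a, ha, rfl⟩
    exact ⟨_, ⟨(realifyGL a, 1), ⟨⟨a, ha, rfl⟩, Subgroup.one_mem _⟩, rfl⟩, key a 1⟩

end SecondStabilizer

section NotSymmetric

variable {p q : ℕ}

theorem not_isSymmetricSubgroup_stabR (hp : 2 ≤ p) (h : p < q) {x : SOpq p q ℂ}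
    (hx : invol x = halfInvol h.le) : ¬ IsSymmetricSubgroup (stabR x) := by
  set e := planeEquiv p q h.le with he
  set z := halfInvol h.le with hz
  let L : Matrix (Fin p ⊕ Fin q) (Fin p ⊕ Fin q) ℝ →ₗ[ℝ] Matrix (Fin p ⊕ Fin q) (Fin p ⊕ Fin q) ℂ :=
    { toFun := fun X => cx X * z - z * cx X
      map_add' := fun X Y => by rw [map_add, Matrix.add_mul, Matrix.mul_add]; abel
      map_smul' := fun c X => by
        have h1 : cx (c • X) = c • cx X := by
          ext i j
          rw [Matrix.smul_apply, cx_apply, cx_apply, Matrix.smul_apply, smul_eq_mul,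
            Complex.ofReal_mul, Complex.real_smul]
        rw [h1, Matrix.smul_mul, Matrix.mul_smul, smul_sub]; rfl }
  have hL : ∀ X, X ∈ LinearMap.ker L ↔ cx X * z = z * cx X := fun X =>
    LinearMap.mem_ker.trans sub_eq_zero
  have hzz : z * cj z = cx (Matrix.diagonal (fun i =>
      -(Sum.elim (fun _ => 1) (Sum.elim (fun _ => 1) fun _ => -1) (e.symm i) : ℝ))) := by
    rw [hz, halfInvol_mul_cj, planar_eq_diagonal]
    change _ = (Matrix.diagonal _).map Complex.ofRealHom
    rw [Matrix.diagonal_map (map_zero _)]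
    congr 1
    funext i
    rw [Function.comp_apply]
    rcases e.symm i with j | j | j <;> simp
  let i₀ : Fin p := ⟨0, by omega⟩
  let i₁ : Fin p := ⟨1, by omega⟩
  refine not_isSymmetricSubgroup_of_grading (β := Sum.elim (fun _ => 1) fun _ => -1)
    (c := fun i => Sum.elim (fun _ => 1) (Sum.elim (fun _ => 1) fun _ => -1) (e.symm i))
    ?_ ?_ le_rfl ((SOe_le p q).trans inf_le_left) (stabR x) (LinearMap.ker L) ?_ ?_ (a := e (Sum.inl i₀))
    (a' := e (Sum.inl i₁)) (b := e (Sum.inr (Sum.inr ⟨0, by omega⟩))) ?_ ?_ ?_ ?_ ?_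
  · rintro (i | i) <;> simp
  · intro i
    rcases e.symm i with j | j | j <;> simp
  · intro X hX
    refine LinearMap.mem_ker.2 (apply_eq_zero_of_exp L fun t => ?_)
    obtain ⟨g, hg, hgt⟩ := hX t
    rw [← hgt]
    have := (mem_stabR_iff'.1 hg).1
    rw [hx] at this
    exact sub_eq_zero.2 this
  · intro X hX
    have h2 := (hL X).1 hX
    have h3 : cx X * cj z = cj z * cx X := by
      have := congrArg cj h2
      rwa [map_mul, map_mul, cj_cx] at this
    have h4 : cx X * (z * cj z) = z * cj z * cx X := by
      rw [← Matrix.mul_assoc, h2, Matrix.mul_assoc, h3, Matrix.mul_assoc]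
    rw [hzz, ← map_mul, ← map_mul, cx_injective.eq_iff, ← Matrix.diagonal_neg, Matrix.mul_neg,
      Matrix.neg_mul, neg_inj] at h4
    exact h4.symm
  · simp [i₀, i₁]
  · simp
  · simp
  · simp
  · intro s s' hs hmem
    rw [hL] at hmem
    have h2 := congrFun (congrFun hmem (e (Sum.inl i₀))) (e (Sum.inr (Sum.inl i₁)))
    have hz1 : ∀ i, z (e (Sum.inl i₀)) (e i) =
        if i = Sum.inr (Sum.inl i₀) then -Complex.I else 0 :=
      fun i => planar_apply_inl e _ _ _ i₀ i
    have hz2 : ∀ i, z (e i) (e (Sum.inr (Sum.inl i₁))) =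
        if i = Sum.inl i₁ then -Complex.I else 0 :=
      fun i => planar_apply_inr_inl e _ _ _ i₁ i
    rw [Matrix.mul_apply, Matrix.mul_apply, ← e.sum_comp, ← e.sum_comp] at h2
    simp only [hz1, hz2, mul_ite, ite_mul, mul_zero, zero_mul, Finset.sum_ite_eq',
      Finset.mem_univ, if_true, cx_apply, Matrix.add_apply, Matrix.single_apply] at h2
    simp [i₀, i₁] at h2
    exact hs h2

end NotSymmetric

section ConjugateStabilizers

variable {n : ℕ}

theorem coe_lastReflection_real (hn : 0 < n) :
    (lastReflection n ℝ).1 = oneSign (⟨n - 1, by omega⟩ : Fin n) := by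
  change Matrix.diagonal _ = Matrix.diagonal _
  congr 1
  funext i
  have h : i.val + 1 = n ↔ i = ⟨n - 1, by omega⟩ := by
    rw [Fin.ext_iff]
    change _ ↔ i.val = n - 1
    omega
  change (((if i.val + 1 = n then -1 else 1 : ℝˣ)) : ℝ) = _
  by_cases h2 : i.val + 1 = n
  · rw [if_pos h2, if_pos (h.1 h2)]; simp
  · rw [if_neg h2, if_neg (mt h.2 h2)]; simp

theorem mem_stabR_iff_KCR {p q : ℕ} {x : SOpq p q ℂ} {g : SOe p q} :
    g ∈ stabR x ↔ x⁻¹ * inclR p q g * x ∈ KCR p q := by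
  rw [stabR, Subgroup.mem_comap, mem_conjBy_iff]

theorem conj_mem_SOe {r : GL (Fin n ⊕ Fin n) ℝ} (hr : r ∈ bilinIsometry (ID n n ℝ))
    {g : GL (Fin n ⊕ Fin n) ℝ} (hg : g ∈ SOe n n) : r⁻¹ * g * r ∈ SOe n n := by
  have h := map_idComp_le (L := SOpq n n ℝ) (L' := SOpq n n ℝ) (MulAut.conj r⁻¹).toMonoidHom
    (show Continuous fun g => r⁻¹ * g * r⁻¹⁻¹ by fun_prop) (by
      rintro _ ⟨g, hg, rfl⟩
      change r⁻¹ * g * r⁻¹⁻¹ ∈ _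
      exact ⟨Subgroup.mul_mem (bilinIsometry _) (Subgroup.mul_mem _ (Subgroup.inv_mem _ hr) hg.1)
        (Subgroup.inv_mem _ (Subgroup.inv_mem _ hr)),
        (MonoidHom.normal_ker _).conj_mem g hg.2 r⁻¹⟩)
    (Subgroup.mem_map_of_mem _ hg)
  change r⁻¹ * g * r⁻¹⁻¹ ∈ _ at h
  rwa [inv_inv] at h

theorem conj_mem_stabR {δ : Matrix (Fin n) (Fin n) ℝ} (hδt : δᵀ = δ) (hδ : δ * δ = 1)
    {r : GL (Fin n ⊕ Fin n) ℝ} (hr : r.1 = Matrix.fromBlocks δ 0 0 1) {x y : SOpq n n ℂ}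
    (hxy : mat y = cx (Matrix.fromBlocks δ 0 0 1) * mat x * cx (Matrix.fromBlocks δ 0 0 1))
    {g : GL (Fin n ⊕ Fin n) ℝ} (hg : g ∈ asSubgroup (stabR y)) :
    r⁻¹ * g * r ∈ asSubgroup (stabR x) := by
  obtain ⟨hDt, hD, hDI, -⟩ := fromBlocks_reflection hδt hδ
  obtain ⟨g, hg, rfl⟩ := hg
  have hrm : r ∈ bilinIsometry (ID n n ℝ) := by
    change r.1ᵀ * ID n n ℝ * r.1 = ID n n ℝ
    rw [hr, hDt, Matrix.mul_assoc, ← hDI, ← Matrix.mul_assoc, hD, Matrix.one_mul]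
  refine ⟨⟨_, conj_mem_SOe hrm g.2⟩, mem_stabR_iff_KCR.2 ?_, rfl⟩
  obtain ⟨D, hDdef⟩ : ∃ D, cx (Matrix.fromBlocks δ 0 0 (1 : Matrix (Fin n) (Fin n) ℝ)) = D := ⟨_, rfl⟩
  have hDD : D * D = 1 := by rw [← hDdef, ← map_mul, hD, map_one]
  have hDID : D * ID n n ℂ = ID n n ℂ * D := by rw [← hDdef, ← cx_ID, ← map_mul, hDI, map_mul]
  have hrinv : (r⁻¹).1 = Matrix.fromBlocks δ 0 0 1 := coe_inv_eq (by rw [hr, hD])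
  have hmat : mat (inclR n n ⟨_, conj_mem_SOe hrm g.2⟩) = D * mat (inclR n n g) * D := by
    rw [mat_inclR]
    change cx ((r⁻¹).1 * matR g * r.1) = _
    rw [hrinv, hr, map_mul, map_mul, hDdef, mat_inclR]
  rw [hDdef] at hxy
  have hyinv : mat y⁻¹ = D * mat x⁻¹ * D := by
    refine coe_inv_eq ?_
    change mat y * _ = 1
    rw [hxy]
    calc _ = D * mat x * (D * D) * mat x⁻¹ * D := by simp only [Matrix.mul_assoc]
      _ = 1 := by rw [hDD, Matrix.mul_one, Matrix.mul_assoc D, mat_mul_inv, Matrix.mul_one, hDD]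
  have hN : mat (x⁻¹ * inclR n n ⟨_, conj_mem_SOe hrm g.2⟩ * x) =
      D * mat (y⁻¹ * inclR n n g * y) * D := by
    rw [mat_mul, mat_mul, mat_mul, mat_mul, hmat, hyinv, hxy]
    calc _ = (D * D) * mat x⁻¹ * D * mat (inclR n n g) * D * mat x * (D * D) := by
          rw [hDD, Matrix.one_mul, Matrix.mul_one]; simp only [Matrix.mul_assoc]
      _ = _ := by simp only [Matrix.mul_assoc]
  obtain ⟨h1, h2⟩ := (mem_KCR_iff _).1 (mem_stabR_iff_KCR.1 hg)
  refine (mem_KCR_iff _).2 ?_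
  rw [hN]
  generalize mat (y⁻¹ * inclR n n g * y) = N at *
  refine ⟨?_, ?_⟩
  · rw [Matrix.mul_assoc, hDID, ← Matrix.mul_assoc, Matrix.mul_assoc D, h1, ← Matrix.mul_assoc, hDID]
    simp only [Matrix.mul_assoc]
  · have h3 : (D * N * D).toBlocks₁₁ = cx δ * N.toBlocks₁₁ * cx δ := by
      have h4 : D = Matrix.fromBlocks (cx δ) 0 0 1 := by
        rw [← hDdef]
        refine (Matrix.fromBlocks_map _ _ _ _ _).trans ?_
        congr 1 <;> ext i j <;> simp [Matrix.one_apply, apply_ite]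
      rw [h4]
      conv_lhs => rw [← Matrix.fromBlocks_toBlocks N, Matrix.fromBlocks_multiply, Matrix.fromBlocks_multiply]
      simp
    rw [h3, Matrix.det_mul, Matrix.det_mul, h2, mul_one, ← Matrix.det_mul, ← map_mul, hδ, map_one,
      Matrix.det_one]

theorem asSubgroup_stabR_conj {δ : Matrix (Fin n) (Fin n) ℝ} (hδt : δᵀ = δ) (hδ : δ * δ = 1)
    {r : GL (Fin n ⊕ Fin n) ℝ} (hr : r.1 = Matrix.fromBlocks δ 0 0 1) {x y : SOpq n n ℂ}
    (hxy : mat y = cx (Matrix.fromBlocks δ 0 0 1) * mat x * cx (Matrix.fromBlocks δ 0 0 1)) :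
    asSubgroup (stabR y) = conjBy r (asSubgroup (stabR x)) := by
  obtain ⟨-, hD, -, -⟩ := fromBlocks_reflection hδt hδ
  have hDD : cx (Matrix.fromBlocks δ 0 0 (1 : Matrix (Fin n) (Fin n) ℝ)) *
      cx (Matrix.fromBlocks δ 0 0 1) = 1 := by rw [← map_mul, hD, map_one]
  have hr2 : r * r = 1 := Units.ext (by rw [Units.val_mul, hr, hD, Units.val_one])
  have hxy' : mat x = cx (Matrix.fromBlocks δ 0 0 1) * mat y * cx (Matrix.fromBlocks δ 0 0 1) := by
    rw [hxy, ← Matrix.mul_assoc, ← Matrix.mul_assoc, hDD, Matrix.one_mul, Matrix.mul_assoc, hDD,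
      Matrix.mul_one]
  ext g
  rw [mem_conjBy_iff]
  refine ⟨conj_mem_stabR hδt hδ hr hxy, fun h => ?_⟩
  have h1 := conj_mem_stabR hδt hδ hr hxy' h
  have h2 : r⁻¹ * (r⁻¹ * g * r) * r = (r * r)⁻¹ * g * (r * r) := by group
  rwa [h2, hr2, inv_one, one_mul, mul_one] at h1

theorem stabR_le_of_cj {p q : ℕ} {x y : SOpq p q ℂ} (hxy : mat y = cj (mat x)) : stabR x ≤ stabR y := by
  intro g hg
  rw [mem_stabR_iff_KCR, mem_KCR_iff] at hg ⊢
  have hyinv : mat y⁻¹ = cj (mat x⁻¹) := by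
    refine coe_inv_eq ?_
    change mat y * _ = 1
    rw [hxy, ← map_mul, mat_mul_inv, map_one]
  have hN : mat (y⁻¹ * inclR p q g * y) = cj (mat (x⁻¹ * inclR p q g * x)) := by
    rw [mat_mul, mat_mul, mat_mul, mat_mul, map_mul, map_mul, hyinv, hxy, cj_mat_inclR]
  rw [hN]
  generalize mat (x⁻¹ * inclR p q g * x) = N at *
  refine ⟨?_, ?_⟩
  · rw [← cj_ID, ← map_mul, hg.1, map_mul]
  · change (cj N.toBlocks₁₁).det = 1
    rw [show (cj N.toBlocks₁₁).det = starRingEnd ℂ N.toBlocks₁₁.det from (RingHom.map_det _ _).symm,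
      hg.2, map_one]

theorem stabR_eq_of_cj {p q : ℕ} {x y : SOpq p q ℂ} (hxy : mat y = cj (mat x)) : stabR y = stabR x :=
  le_antisymm (stabR_le_of_cj (by rw [hxy, cj_cj])) (stabR_le_of_cj hxy)

theorem halfRep_conj_neg_one (n : ℕ) : cx (Matrix.fromBlocks (-1) 0 0 1) * halfRep (le_refl n) *
    cx (Matrix.fromBlocks (-1) 0 0 1) = cj (halfRep (le_refl n)) := by
  have h1 := hypMat_sign (le_refl n) (ε := fun _ => -1) (t := fun _ => Real.pi / 2 / 2)
    fun _ => Or.inr rfl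
  have h2 : (Matrix.diagonal fun _ => -1 : Matrix (Fin n) (Fin n) ℝ) = -1 := by
    rw [← Matrix.diagonal_one, Matrix.diagonal_neg]
  rw [h2, Matrix.fromBlocks_transpose] at h1
  simp only [Matrix.transpose_neg, Matrix.transpose_one, Matrix.transpose_zero] at h1
  rw [halfRep, ← h1, hypMat, hypMat]
  change _ = (planar _ _ _ _ _ _).map (starRingEnd ℂ)
  rw [planar_map]
  congr 1 <;> funext i <;> simp [← Complex.ofReal_cos, ← Complex.ofReal_sin, -Complex.ofReal_cos,
    -Complex.ofReal_sin]

end ConjugateStabilizers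

section RealCases

theorem asSubgroup_idComp_first {p q : ℕ} (hp : 1 ≤ p) (hq : 1 ≤ q) {x : SOpq p q ℂ}
    (hx : mat x = swapRep ⟨0, hp⟩ ⟨q - 1, by omega⟩) :
    asSubgroup (idComp (stabR x)) = prodInSOpq p q hp hq (SOe 1 (q - 1)) (SOe 1 (p - 1)) := by
  rw [asSubgroup_idComp_stabR, invol_swapRep hx, idComp_commSub_swapInvol]

theorem asSubgroup_idComp_second {p q : ℕ} (h : p ≤ q) {x : SOpq p q ℂ} (hx : mat x = halfRep h) :
    asSubgroup (idComp (stabR x)) = SOCprodSO p q h := by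
  rw [asSubgroup_idComp_stabR, invol_halfRep h hx, idComp_commSub_halfInvol]

theorem soR_eq (n : ℕ) (hn : 3 ≤ n) (𝔞 : Submodule ℝ (soR n n))
    (h𝔞 : IsMaximalAbelianIn (pR n n) 𝔞) :
    ∃ H₁ H₂ H₃ : Subgroup (SOe n n),
      asSubgroup (idComp H₁) =
        prodInSOpq n n (Nat.one_le_of_lt hn) (Nat.one_le_of_lt hn) (SOe 1 (n - 1)) (SOe 1 (n - 1)) ∧
      asSubgroup (idComp H₂) = (SO (Fin n) ℂ).map realifyGL ∧
      asSubgroup H₃ = conjBy (blockDiag (lastReflection n ℝ, 1)) (asSubgroup H₂) ∧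
      IsOrbitDecomposition (inclR n n) (boundaryR n n 𝔞) ![H₁, H₂, H₃] ∧
      (Odd n → IsOrbitDecomposition (inclR n n) (boundaryR n n 𝔞) ![H₁, H₂, H₂]) := by
  have hl := coe_lastReflection_real (by omega : 0 < n)
  obtain ⟨x₁, x₂, x₃, h1, h2, h3, hdec⟩ := exists_orbit_eq hn h𝔞 ⟨0, by omega⟩ ⟨n - 1, by omega⟩
    (oneSign_transpose ⟨n - 1, by omega⟩) (oneSign_mul_self _) (det_oneSign _)
  refine ⟨stabR x₁, stabR x₂, stabR x₃, asSubgroup_idComp_first _ _ h1, ?_, ?_,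
    hdec _ _ _ rfl rfl rfl, fun hodd => ?_⟩
  · rw [asSubgroup_idComp_second _ h2, SOCprodSO_self]
  · refine asSubgroup_stabR_conj (oneSign_transpose _) (oneSign_mul_self _) ?_ (by rw [h2]; exact h3)
    rw [coe_blockDiag, hl, Units.val_one]
  · obtain ⟨y₁, y₂, y₃, h1', h2', h3', hdec'⟩ := exists_orbit_eq hn h𝔞 ⟨0, by omega⟩
      ⟨n - 1, by omega⟩ (δ := -1) (by simp) (by simp) (by
        rw [Matrix.det_neg, Fintype.card_fin, hodd.neg_one_pow, Matrix.det_one, mul_one])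
    have e1 : y₁ = x₁ := mat_injective (h1'.trans h1.symm)
    have e2 : y₂ = x₂ := mat_injective (h2'.trans h2.symm)
    subst e1 e2
    exact hdec' _ _ _ rfl rfl (stabR_eq_of_cj (by rw [h2', h3', halfRep_conj_neg_one])).symm

theorem soR_one (q : ℕ) (hq : 1 < q) (𝔞 : Submodule ℝ (soR 1 q))
    (h𝔞 : IsMaximalAbelianIn (pR 1 q) 𝔞) :
    ∃ H : Subgroup (SOe 1 q),
      asSubgroup (idComp H) = prodInSOpq 1 q le_rfl hq.le (SOe 1 (q - 1)) ⊥ ∧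
      IsOrbitDecomposition (inclR 1 q) (boundaryR 1 q 𝔞) ![H] := by
  obtain ⟨x, hx, hdec⟩ := exists_orbit_small le_rfl (by norm_num) hq h𝔞 ⟨0, Nat.one_pos⟩ ⟨q - 1, by omega⟩
  refine ⟨stabR x, ?_, hdec⟩
  rw [asSubgroup_idComp_first le_rfl hq.le hx, show SOe 1 (1 - 1) = ⊥ from SOe_one_zero]

theorem soR_two (q : ℕ) (hq : 2 < q) (𝔞 : Submodule ℝ (soR 2 q))
    (h𝔞 : IsMaximalAbelianIn (pR 2 q) 𝔞) :
    ∃ H : Subgroup (SOe 2 q),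
      asSubgroup (idComp H) =
        prodInSOpq 2 q one_le_two (Nat.one_le_of_lt hq) (SOe 1 (q - 1)) boost.range ∧
      IsOrbitDecomposition (inclR 2 q) (boundaryR 2 q 𝔞) ![H] := by
  obtain ⟨x, hx, hdec⟩ := exists_orbit_small (by norm_num) le_rfl hq h𝔞 ⟨0, by norm_num⟩
    ⟨q - 1, by omega⟩
  refine ⟨stabR x, ?_, hdec⟩
  rw [asSubgroup_idComp_first (by norm_num) (by omega) hx, show SOe 1 (2 - 1) = boost.range from SOe_one_one]

theorem soR_lt (p q : ℕ) (hp : 3 ≤ p) (hpq : p < q) (𝔞 : Submodule ℝ (soR p q))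
    (h𝔞 : IsMaximalAbelianIn (pR p q) 𝔞) :
    ∃ H₁ H₂ : Subgroup (SOe p q),
      asSubgroup (idComp H₁) =
        prodInSOpq p q (Nat.one_le_of_lt hp) (Nat.one_le_of_lt hpq) (SOe 1 (q - 1)) (SOe 1 (p - 1)) ∧
      asSubgroup (idComp H₂) = SOCprodSO p q hpq.le ∧
      IsOrbitDecomposition (inclR p q) (boundaryR p q 𝔞) ![H₁, H₂] ∧
      ¬ IsSymmetricSubgroup H₂ := by
  obtain ⟨x₁, x₂, h1, h2, hdec⟩ := exists_orbit_lt hp hpq h𝔞 ⟨0, by omega⟩ ⟨q - 1, by omega⟩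
  exact ⟨stabR x₁, stabR x₂, asSubgroup_idComp_first _ _ h1, asSubgroup_idComp_second _ h2, hdec,
    not_isSymmetricSubgroup_stabR (by omega) hpq (invol_halfRep _ h2)⟩

end RealCases

end Crown

theorem mainTheorem8 :
    -- SO(2n,ℂ), n ≥ 3
    (∀ n : ℕ, ∀ hn : 3 ≤ n, ∀ 𝔞 : Submodule ℝ (soC (2 * n)), IsMaximalAbelianIn (pC (2 * n)) 𝔞 →
      ∃ H₁ H₂ H₃ : Subgroup (SO (Fin (2 * n)) ℂ),
        asSubgroup H₁ = SOpqInC 2 (2 * n - 2) (2 * n) (by omega) ∧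
        asSubgroup H₂ = SOstarEven n ∧
        asSubgroup H₃ = conjBy (lastReflection (2 * n) ℂ) (SOstarEven n) ∧
        IsOrbitDecomposition (inclC (2 * n)) (boundaryC (2 * n) 𝔞) ![H₁, H₂, H₃] ∧
        (Odd n → IsOrbitDecomposition (inclC (2 * n)) (boundaryC (2 * n) 𝔞) ![H₁, H₂, H₂])) ∧
    -- SO(2n+1,ℂ), n ≥ 3
    (∀ n : ℕ, ∀ hn : 3 ≤ n, ∀ 𝔞 : Submodule ℝ (soC (2 * n + 1)),
      IsMaximalAbelianIn (pC (2 * n + 1)) 𝔞 →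
      ∃ H₁ H₂ : Subgroup (SO (Fin (2 * n + 1)) ℂ),
        asSubgroup H₁ = SOpqInC 2 (2 * n - 1) (2 * n + 1) (by omega) ∧
        asSubgroup H₂ = SOstarOdd n ∧
        IsOrbitDecomposition (inclC (2 * n + 1)) (boundaryC (2 * n + 1) 𝔞) ![H₁, H₂] ∧
        ¬ IsSymmetricSubgroup H₂) ∧
    -- SO(5,ℂ)
    (∀ 𝔞 : Submodule ℝ (soC 5), IsMaximalAbelianIn (pC 5) 𝔞 →
      ∃ H : Subgroup (SO (Fin 5) ℂ),
        asSubgroup H = SOpqInC 2 3 5 (by norm_num) ∧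
        IsOrbitDecomposition (inclC 5) (boundaryC 5 𝔞) ![H]) ∧
    -- SO_e(n,n), n ≥ 3
    (∀ n : ℕ, ∀ hn : 3 ≤ n, ∀ 𝔞 : Submodule ℝ (soR n n), IsMaximalAbelianIn (pR n n) 𝔞 →
      ∃ H₁ H₂ H₃ : Subgroup (SOe n n),
        asSubgroup (idComp H₁) =
          prodInSOpq n n (by omega) (by omega) (SOe 1 (n - 1)) (SOe 1 (n - 1)) ∧
        asSubgroup (idComp H₂) = (SO (Fin n) ℂ).map realifyGL ∧
        asSubgroup H₃ = conjBy (blockDiag (lastReflection n ℝ, 1)) (asSubgroup H₂) ∧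
        IsOrbitDecomposition (inclR n n) (boundaryR n n 𝔞) ![H₁, H₂, H₃] ∧
        (Odd n → IsOrbitDecomposition (inclR n n) (boundaryR n n 𝔞) ![H₁, H₂, H₂])) ∧
    -- SO_e(1,q), q > 1
    (∀ q : ℕ, ∀ hq : 1 < q, ∀ 𝔞 : Submodule ℝ (soR 1 q), IsMaximalAbelianIn (pR 1 q) 𝔞 →
      ∃ H : Subgroup (SOe 1 q),
        asSubgroup (idComp H) = prodInSOpq 1 q le_rfl hq.le (SOe 1 (q - 1)) ⊥ ∧
        IsOrbitDecomposition (inclR 1 q) (boundaryR 1 q 𝔞) ![H]) ∧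
    -- SO_e(2,q), q > 2
    (∀ q : ℕ, ∀ hq : 2 < q, ∀ 𝔞 : Submodule ℝ (soR 2 q), IsMaximalAbelianIn (pR 2 q) 𝔞 →
      ∃ H : Subgroup (SOe 2 q),
        asSubgroup (idComp H) =
          prodInSOpq 2 q (by norm_num) (by omega) (SOe 1 (q - 1)) boost.range ∧
        IsOrbitDecomposition (inclR 2 q) (boundaryR 2 q 𝔞) ![H]) ∧
    -- SO_e(p,q), 3 ≤ p < q
    (∀ p q : ℕ, ∀ hp : 3 ≤ p, ∀ hpq : p < q, ∀ 𝔞 : Submodule ℝ (soR p q),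
      IsMaximalAbelianIn (pR p q) 𝔞 →
      ∃ H₁ H₂ : Subgroup (SOe p q),
        asSubgroup (idComp H₁) =
          prodInSOpq p q (by omega) (by omega) (SOe 1 (q - 1)) (SOe 1 (p - 1)) ∧
        asSubgroup (idComp H₂) = SOCprodSO p q hpq.le ∧
        IsOrbitDecomposition (inclR p q) (boundaryR p q 𝔞) ![H₁, H₂] ∧
        ¬ IsSymmetricSubgroup H₂) :=
  ⟨fun n hn => soC_even n hn _, fun n hn => soC_odd n hn _, soC_five, soR_eq, soR_one, soR_two, soR_lt⟩
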